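/- **Theorem 1.1.** Let $F,G\in C^5(\mathbb R)$, $u_0\in C^4(\mathbb R^2)$, and put $\phi=F'(u_0)$, $\psi=G'(u_0)$, $H=\partial_\xi\phi+\partial_\eta\psi$ (functions of $(\xi,\eta)\in\mathbb R^2$). Assume that $\phi(0,0)=\psi(0,0)=0$, that $H$ attains its minimum over $\mathbb R^2$ at $(0,0)$ and nowhere else, that $H(0,0)=-1$, that the Hessian of $H$ at $(0,0)$ is $6I$, and that $\partial_\eta\psi(0,0)\ge-\frac12\ge\partial_\xi\phi(0,0)$. Consider $$\partial_tu+\partial_xF(u)+\partial_yG(u)=0,\qquad u(0,x,y)=u_0(x,y).$$ Then there are constants $\rho,r,\delta_0,\varepsilon_0>0$ with $\delta_0\le r$ such that for all $0<\delta\le\delta_0$ and $0<\varepsilon\le\varepsilon_0$ there exist functions $T^*,x^*,\Xi^*,Y^*$ of $y\in(-\delta,\delta)$, a function $\varphi(t,y)$ on $P=\{T^*(y)\le t<T^*(y)+\varepsilon,\ |y|<\delta\}$ with $|\varphi|<r$, and a function $u$ on $D=\{0\le t<T^*(y)+\varepsilon,\ |x|<r,\ |y|<\delta\}$ with the following properties.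 Let $\Gamma=\{(T^*(y),x^*(y),y):|y|<\delta\}$ and $\Sigma=\{(t,\varphi(t,y),y):(t,y)\in P\}$; a star on $\phi,\psi$ and their derivatives denotes the value at $(\Xi^*(y),Y^*(y))$, and $A(y)=\phi^*+\psi^*\,\partial_\eta\phi^*/\partial_\xi\phi^*$. (1) *Blowup curve.* $T^*,x^*\in C^1$, $(T^*(0),x^*(0))=(1,0)$, $|\Xi^*|,|Y^*|<\rho$, $y=Y^*+T^*\psi^*$, $x^*=\Xi^*+T^*\phi^*$, $1+T^*H(\Xi^*,Y^*)=0$, and $T^*(y)$ is the least $t>0$ for which some $(\xi,\eta)$ with $|\xi|,|\eta|<\rho$ satisfies $\eta+t\psi(\xi,\eta)=y$ and $1+tH(\xi,\eta)=0$. $\Gamma$ is space-like: the conormal $(1,0,-\partial_yT^*)$ of the surface $t=T^*(y)$ containing $\Gamma$ satisfies $(1,0,-\partial_yT^*)\cdot(1,\phi^*,\psi^*)>0$. On $\Gamma$, $u=u_0(\Xi^*,Y^*)$, and $|\nabla_{t,x,y}u|\to\infty$ at every point of $\Gamma$, approached off $\Sigma$. *Shock surface.* $\varphi(T^*(y),y)=x^*(y)$,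 so that $\Sigma$ starts from $\Gamma$; $\partial_t\varphi(T^*(y)+,y)=A(y)$, so that $(1,A(y),0)$ is tangent to $\Sigma$ at $\Gamma$. At the points of $\Sigma$ with $t>T^*(y)$ the limits $u_-,u_+$ of $u$ from the left ($x<\varphi$) and from the right ($x>\varphi$) exist and, with $[w]=w_+-w_-$, $$\partial_t\varphi\,[u]-[F(u)]+\partial_y\varphi\,[G(u)]=0,$$ $$(1,F'(u_+),G'(u_+))\cdot(-\partial_t\varphi,1,-\partial_y\varphi)<0<(1,F'(u_-),G'(u_-))\cdot(-\partial_t\varphi,1,-\partial_y\varphi).$$ (2) $\varphi\in C^2(P)$ (up to $t=T^*(y)$) and $u\in C^1(D\setminus\Sigma)$; $u$ solves the equation in $D\setminus\Sigma$ for $t>0$, $u(0,x,y)=u_0(x,y)$, and every $(t,x,y)\in D\setminus\Sigma$ lies on a characteristic $x=\xi+t\phi(\xi,\eta)$, $y=\eta+t\psi(\xi,\eta)$ with $|\xi|,|\eta|<\rho$ and $u(t,x,y)=u_0(\xi,\eta)$. (3) There is a constant $C$ such that for all $(t,x,y)\in D\setminus\Sigma$ with $|t-1|<\varepsilon$, writing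 $$d=|t-T^*(y)|^{1/2}+|x-x^*(y)-A(y)(t-T^*(y))|^{1/3},$$ $$|u(t,x,y)-u(T^*(y),x^*(y),y)|\le C\,d,\qquad |\nabla_{t,x,y}u(t,x,y)|\le C\,d^{-2},\qquad |\partial_tu(t,x,y)+A(y)\,\partial_xu(t,x,y)|\le C\,d^{-1}.$$ -/

import Mathlib

open Set Filter Topology

noncomputable section

/-- First partial derivative of a function of two real variables. -/
def partialFst (h : ℝ × ℝ → ℝ) (p : ℝ × ℝ) : ℝ := fderiv ℝ h p (1, 0)

/-- Second partial derivative of a function of two real variables. -/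
def partialSnd (h : ℝ × ℝ → ℝ) (p : ℝ × ℝ) : ℝ := fderiv ℝ h p (0, 1)

/-- Initial characteristic speed `F'(u₀(ξ,η))`. The paper's `φ` is `speed F u₀` and its `ψ` is
`speed G u₀`. -/
def speed (F : ℝ → ℝ) (u₀ : ℝ × ℝ → ℝ) (p : ℝ × ℝ) : ℝ := deriv F (u₀ p)

/-- `H(ξ,η) = ∂_ξ (F'(u₀)) + ∂_η (G'(u₀))`. -/
def initDiv (F G : ℝ → ℝ) (u₀ : ℝ × ℝ → ℝ) (p : ℝ × ℝ) : ℝ :=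
  partialFst (speed F u₀) p + partialSnd (speed G u₀) p

/-- The generic nondegenerate condition in normalised form: `H` has its unique global minimum, with
value `-1`, at the origin (so that its gradient vanishes there), its Hessian there is `6 I`, the
speeds vanish there, and `∂_η ψ ≥ -1/2 ≥ ∂_ξ φ` there. -/
structure NormalizedGNC (F G : ℝ → ℝ) (u₀ : ℝ × ℝ → ℝ) : Prop where
  speed_fst : speed F u₀ (0, 0) = 0
  speed_snd : speed G u₀ (0, 0) = 0
  min_value : initDiv F G u₀ (0, 0) = -1
  unique_min : ∀ p : ℝ × ℝ, p ≠ (0, 0) → -1 < initDiv F G u₀ p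
  hess_fst_fst : partialFst (partialFst (initDiv F G u₀)) (0, 0) = 6
  hess_fst_snd : partialFst (partialSnd (initDiv F G u₀)) (0, 0) = 0
  hess_snd_snd : partialSnd (partialSnd (initDiv F G u₀)) (0, 0) = 6
  snd_ge : -(1 / 2) ≤ partialSnd (speed G u₀) (0, 0)
  fst_le : partialFst (speed F u₀) (0, 0) ≤ -(1 / 2)

/-- The times at which the Jacobian `1 + t H` of the characteristic map
`(ξ,η) ↦ (ξ + t φ, η + t ψ)` vanishes at a starting point `(ξ,η)` with `|ξ|, |η| < ρ` whose
characteristic is, at that time, in the slice with second coordinate `y`. -/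
def degenerateTimes (F G : ℝ → ℝ) (u₀ : ℝ × ℝ → ℝ) (ρ y : ℝ) : Set ℝ :=
  {t | 0 < t ∧ ∃ ξ η : ℝ, |ξ| < ρ ∧ |η| < ρ ∧ η + t * speed G u₀ (ξ, η) = y ∧
    1 + t * initDiv F G u₀ (ξ, η) = 0}

/-- `t = T y, x = X y, |y| < δ` is the blowup curve: `T y` is the first degenerate time on the
slice `y`, attained along the characteristic that starts from `(Ξ y, Y y)`, and `X y` is the
position of that characteristic at time `T y`.

The curve is space-like: it lies in the surface `t = T y`, whose conormal `(1, 0, -T' y)` is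
positive on the characteristic direction `(1, F'(u), G'(u))`. In particular the tangent
`(T' y, X' y, 1)` is never parallel to the characteristic direction. -/
structure IsBlowupCurve (F G : ℝ → ℝ) (u₀ : ℝ × ℝ → ℝ) (ρ δ : ℝ) (T X Ξ Y : ℝ → ℝ) : Prop where
  time_zero : T 0 = 1
  pos_zero : X 0 = 0
  contDiffOn_time : ContDiffOn ℝ 1 T (Ioo (-δ) δ)
  contDiffOn_pos : ContDiffOn ℝ 1 X (Ioo (-δ) δ)
  foot_fst : ∀ y, |y| < δ → |Ξ y| < ρ
  foot_snd : ∀ y, |y| < δ → |Y y| < ρ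
  degenerate : ∀ y, |y| < δ → 1 + T y * initDiv F G u₀ (Ξ y, Y y) = 0
  snd_eq : ∀ y, |y| < δ → y = Y y + T y * speed G u₀ (Ξ y, Y y)
  fst_eq : ∀ y, |y| < δ → X y = Ξ y + T y * speed F u₀ (Ξ y, Y y)
  first_time : ∀ y, |y| < δ → IsLeast (degenerateTimes F G u₀ ρ y) (T y)
  spacelike : ∀ y, |y| < δ →
    0 < 1 * 1 + 0 * speed F u₀ (Ξ y, Y y) + (-deriv T y) * speed G u₀ (Ξ y, Y y)

/-- The parameter domain `T y ≤ t < T y + ε, |y| < δ` of the shock surface (variables `(t,y)`). -/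
def shockParam (T : ℝ → ℝ) (ε δ : ℝ) : Set (ℝ × ℝ) :=
  {q | |q.2| < δ ∧ T q.2 ≤ q.1 ∧ q.1 < T q.2 + ε}

/-- The shock surface `x = φ(t,y)` in the variables `(t,x,y)`. It contains the blowup curve. -/
def shockSurface (T : ℝ → ℝ) (φ : ℝ × ℝ → ℝ) (ε δ : ℝ) : Set (ℝ × ℝ × ℝ) :=
  {p | (p.1, p.2.2) ∈ shockParam T ε δ ∧ p.2.1 = φ (p.1, p.2.2)}

/-- The domain `0 ≤ t < T y + ε, |x| < r, |y| < δ` of the solution, variables `(t,x,y)`. -/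
def solDomain (T : ℝ → ℝ) (ε δ r : ℝ) : Set (ℝ × ℝ × ℝ) :=
  {p | 0 ≤ p.1 ∧ p.1 < T p.2.2 + ε ∧ |p.2.1| < r ∧ |p.2.2| < δ}

/-- The part of the domain to the left of the shock surface. -/
def leftSide (T : ℝ → ℝ) (φ : ℝ × ℝ → ℝ) (ε δ r : ℝ) : Set (ℝ × ℝ × ℝ) :=
  {p | p ∈ solDomain T ε δ r ∧ (p.1, p.2.2) ∈ shockParam T ε δ ∧ p.2.1 < φ (p.1, p.2.2)}

/-- The part of the domain to the right of the shock surface. -/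
def rightSide (T : ℝ → ℝ) (φ : ℝ × ℝ → ℝ) (ε δ r : ℝ) : Set (ℝ × ℝ × ℝ) :=
  {p | p ∈ solDomain T ε δ r ∧ (p.1, p.2.2) ∈ shockParam T ε δ ∧ φ (p.1, p.2.2) < p.2.1}

def partialT (u : ℝ × ℝ × ℝ → ℝ) (p : ℝ × ℝ × ℝ) : ℝ := fderiv ℝ u p (1, 0, 0)

def partialX (u : ℝ × ℝ × ℝ → ℝ) (p : ℝ × ℝ × ℝ) : ℝ := fderiv ℝ u p (0, 1, 0)

def partialY (u : ℝ × ℝ × ℝ → ℝ) (p : ℝ × ℝ × ℝ) : ℝ := fderiv ℝ u p (0, 0, 1)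

/-- Euclidean length of the space-time gradient `∇_{t,x,y} u`. -/
def gradNorm (u : ℝ × ℝ × ℝ → ℝ) (p : ℝ × ℝ × ℝ) : ℝ :=
  Real.sqrt (partialT u p ^ 2 + partialX u p ^ 2 + partialY u p ^ 2)

/-- `u` is, off the shock surface, the classical solution of
`∂_t u + ∂_x F(u) + ∂_y G(u) = 0`, `u(0,·) = u₀`, with values carried by the characteristics
that start near the origin. -/
structure IsSolutionOff (F G : ℝ → ℝ) (u₀ : ℝ × ℝ → ℝ) (ρ ε δ r : ℝ) (T : ℝ → ℝ)
    (φ : ℝ × ℝ → ℝ) (u : ℝ × ℝ × ℝ → ℝ) : Prop where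
  contDiffOn : ContDiffOn ℝ 1 u (solDomain T ε δ r \ shockSurface T φ ε δ)
  pde : ∀ p ∈ solDomain T ε δ r \ shockSurface T φ ε δ, 0 < p.1 →
    partialT u p + partialX (fun q => F (u q)) p + partialY (fun q => G (u q)) p = 0
  initial : ∀ x y : ℝ, |x| < r → |y| < δ → u (0, x, y) = u₀ (x, y)
  characteristic : ∀ p ∈ solDomain T ε δ r \ shockSurface T φ ε δ,
    ∃ ξ η : ℝ, |ξ| < ρ ∧ |η| < ρ ∧ p.2.1 = ξ + p.1 * speed F u₀ (ξ, η) ∧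
      p.2.2 = η + p.1 * speed G u₀ (ξ, η) ∧ u p = u₀ (ξ, η)

/-- For `T y < t < T y + ε` the one-sided limits `u₋, u₊` of `u` at `(t, φ(t,y), y)` exist and
satisfy the Rankine–Hugoniot condition and the geometric entropy condition. -/
def ShockConditions (F G : ℝ → ℝ) (ε δ r : ℝ) (T : ℝ → ℝ)
    (φ : ℝ × ℝ → ℝ) (u : ℝ × ℝ × ℝ → ℝ) : Prop :=
  ∀ t y : ℝ, |y| < δ → T y < t → t < T y + ε →
    ∃ um up : ℝ,
      Tendsto u (𝓝[leftSide T φ ε δ r] (t, φ (t, y), y)) (𝓝 um) ∧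
      Tendsto u (𝓝[rightSide T φ ε δ r] (t, φ (t, y), y)) (𝓝 up) ∧
      partialFst φ (t, y) * (up - um) - (F up - F um) + partialSnd φ (t, y) * (G up - G um) = 0 ∧
      -partialFst φ (t, y) + deriv F up - partialSnd φ (t, y) * deriv G up < 0 ∧
      0 < -partialFst φ (t, y) + deriv F um - partialSnd φ (t, y) * deriv G um

/-- `φ + ψ ∂_ηφ / ∂_ξφ` at the starting point `p`. -/
def tangentSpeed (F G : ℝ → ℝ) (u₀ : ℝ × ℝ → ℝ) (p : ℝ × ℝ) : ℝ :=
  speed F u₀ p + speed G u₀ p * (partialSnd (speed F u₀) p / partialFst (speed F u₀) p)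

/-- `|t - T y|^{1/2} + |x - X y - A y (t - T y)|^{1/3}`. -/
def cuspDist (T X A : ℝ → ℝ) (p : ℝ × ℝ × ℝ) : ℝ :=
  |p.1 - T p.2.2| ^ (1 / 2 : ℝ) +
    |p.2.1 - X p.2.2 - A p.2.2 * (p.1 - T p.2.2)| ^ (1 / 3 : ℝ)

end

set_option linter.unusedSectionVars false

noncomputable section

/-- Averaged right-hand side of the singular system `(τ w)' = F`, `y' = G`, `y(0) = y₀`. -/
def singOp {E : Type*} [NormedAddCommGroup E] [NormedSpace ℝ E] {τ₁ : ℝ} (h : 0 ≤ τ₁)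
    (F : ℝ → E × ℝ → E) (G : ℝ → E × ℝ → ℝ) (hF : Continuous (Function.uncurry F))
    (hG : Continuous (Function.uncurry G)) (y₀ : ℝ) (z : C(Icc (0 : ℝ) τ₁, E × ℝ)) :
    C(Icc (0 : ℝ) τ₁, E × ℝ) where
  toFun τ := (∫ θ in (0 : ℝ)..1, F (τ * θ) (IccExtend h z (τ * θ)),
    y₀ + τ * ∫ θ in (0 : ℝ)..1, G (τ * θ) (IccExtend h z (τ * θ)))
  continuous_toFun := by
    have hz : Continuous (IccExtend h z) := z.continuous.Icc_extend'
    refine Continuous.prodMk ?_ (continuous_const.add (continuous_subtype_val.mul ?_))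
    · exact intervalIntegral.continuous_parametric_intervalIntegral_of_continuous'
        (f := fun (τ : Icc (0 : ℝ) τ₁) θ => F (τ * θ) (IccExtend h z (τ * θ)))
        (hF.comp (by fun_prop : Continuous fun p : Icc (0 : ℝ) τ₁ × ℝ =>
          ((p.1 : ℝ) * p.2, IccExtend h z (p.1 * p.2)))) 0 1
    · exact intervalIntegral.continuous_parametric_intervalIntegral_of_continuous'
        (f := fun (τ : Icc (0 : ℝ) τ₁) θ => G (τ * θ) (IccExtend h z (τ * θ)))
        (hG.comp (by fun_prop : Continuous fun p : Icc (0 : ℝ) τ₁ × ℝ =>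
          ((p.1 : ℝ) * p.2, IccExtend h z (p.1 * p.2)))) 0 1

section SingOp

variable {E : Type*} [NormedAddCommGroup E] [NormedSpace ℝ E] {τ₁ : ℝ} {h : 0 ≤ τ₁}
  {F : ℝ → E × ℝ → E} {G : ℝ → E × ℝ → ℝ} {hF : Continuous (Function.uncurry F)}
  {hG : Continuous (Function.uncurry G)}

lemma mul_mem_Icc_of_mem {τ θ : ℝ} (hτ : τ ∈ Icc 0 τ₁) (hθ : θ ∈ Icc (0 : ℝ) 1) :
    τ * θ ∈ Icc 0 τ₁ :=
  ⟨mul_nonneg hτ.1 hθ.1, (mul_le_of_le_one_right hτ.1 hθ.2).trans hτ.2⟩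

lemma singOp_apply (y₀ : ℝ) (z : C(Icc (0 : ℝ) τ₁, E × ℝ)) (τ : Icc (0 : ℝ) τ₁) :
    singOp h F G hF hG y₀ z τ = (∫ θ in (0 : ℝ)..1, F (τ * θ) (IccExtend h z (τ * θ)),
    y₀ + τ * ∫ θ in (0 : ℝ)..1, G (τ * θ) (IccExtend h z (τ * θ))) := rfl

lemma continuous_comp_IccExtend {E E' : Type*} [NormedAddCommGroup E] [TopologicalSpace E'] {F : ℝ → E × ℝ → E'}
    (hF : Continuous (Function.uncurry F)) (z : C(Icc (0 : ℝ) τ₁, E × ℝ)) :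
    Continuous fun σ => F σ (IccExtend h z σ) :=
  hF.comp (continuous_id.prodMk z.continuous.Icc_extend')

/-- Comparison of two averaged systems along two curves. -/
lemma dist_singOp_le {F₂ : ℝ → E × ℝ → E} {G₂ : ℝ → E × ℝ → ℝ}
    {hF₂ : Continuous (Function.uncurry F₂)} {hG₂ : Continuous (Function.uncurry G₂)}
    {y₀ y₁ r : ℝ} (z z₂ : C(Icc (0 : ℝ) τ₁, E × ℝ))
    (h1 : ∀ τ (hτ : τ ∈ Icc 0 τ₁), ‖F τ (z ⟨τ, hτ⟩) - F₂ τ (z₂ ⟨τ, hτ⟩)‖ ≤ r)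
    (h2 : ∀ τ (hτ : τ ∈ Icc 0 τ₁), τ₁ * ‖G τ (z ⟨τ, hτ⟩) - G₂ τ (z₂ ⟨τ, hτ⟩)‖ ≤ r) (hr : 0 ≤ r) :
    dist (singOp h F G hF hG y₀ z) (singOp h F₂ G₂ hF₂ hG₂ y₁ z₂) ≤ |y₀ - y₁| + r := by
  rw [ContinuousMap.dist_le (by positivity)]
  rintro ⟨τ, hτ⟩
  rw [singOp_apply, singOp_apply, Prod.dist_eq]
  have int1 := fun (F : ℝ → E × ℝ → E) (hF : Continuous (Function.uncurry F)) (z) =>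
    ((continuous_comp_IccExtend (h := h) hF z).comp
      (continuous_const_mul τ)).intervalIntegrable (μ := MeasureTheory.volume) 0 1
  have int2 := fun (F : ℝ → E × ℝ → ℝ) (hF : Continuous (Function.uncurry F)) (z) =>
    ((continuous_comp_IccExtend (h := h) hF z).comp
      (continuous_const_mul τ)).intervalIntegrable (μ := MeasureTheory.volume) 0 1
  simp only [Function.comp_def] at int1 int2
  refine max_le ?_ ?_
  · simp only
    rw [dist_eq_norm, ← intervalIntegral.integral_sub (int1 F hF z) (int1 F₂ hF₂ z₂)]
    have := intervalIntegral.norm_integral_le_of_norm_le_const (a := 0) (b := 1) (C := r)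
      (f := fun θ => F (τ * θ) (IccExtend h z (τ * θ)) - F₂ (τ * θ) (IccExtend h z₂ (τ * θ)))
      (fun θ hθ => by
        rw [uIoc_of_le zero_le_one] at hθ
        have hm := mul_mem_Icc_of_mem hτ ⟨hθ.1.le, hθ.2⟩
        rw [IccExtend_of_mem _ _ hm, IccExtend_of_mem _ _ hm]
        exact h1 _ hm)
    refine this.trans ?_
    simp
  · simp only
    rw [dist_eq_norm]
    have := intervalIntegral.norm_integral_le_of_norm_le_const (a := 0) (b := 1) (C := r)
      (f := fun θ => τ₁ * (G (τ * θ) (IccExtend h z (τ * θ)) - G₂ (τ * θ) (IccExtend h z₂ (τ * θ))))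
      (fun θ hθ => by
        rw [uIoc_of_le zero_le_one] at hθ
        have hm := mul_mem_Icc_of_mem hτ ⟨hθ.1.le, hθ.2⟩
        rw [IccExtend_of_mem _ _ hm, IccExtend_of_mem _ _ hm, norm_mul, Real.norm_of_nonneg h]
        exact h2 _ hm)
    rw [intervalIntegral.integral_const_mul,
      intervalIntegral.integral_sub (int2 G hG z) (int2 G₂ hG₂ z₂)] at this
    set J := ∫ θ in (0 : ℝ)..1, G (τ * θ) (IccExtend h z (τ * θ))
    set J₂ := ∫ θ in (0 : ℝ)..1, G₂ (τ * θ) (IccExtend h z₂ (τ * θ))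
    calc ‖y₀ + τ * J - (y₁ + τ * J₂)‖ = ‖(y₀ - y₁) + τ * (J - J₂)‖ := by ring_nf
      _ ≤ ‖y₀ - y₁‖ + ‖τ * (J - J₂)‖ := norm_add_le _ _
      _ ≤ |y₀ - y₁| + ‖τ₁ * (J - J₂)‖ := by
        rw [norm_mul, norm_mul, Real.norm_of_nonneg h, Real.norm_of_nonneg hτ.1]
        exact add_le_add le_rfl (mul_le_mul_of_nonneg_right hτ.2 (norm_nonneg _))
      _ ≤ _ := by simpa using this

variable {κ ℓ : ℝ}

lemma dist_singOp_self_le (hκ : 0 ≤ κ) (hFl : ∀ τ z z', ‖F τ z - F τ z'‖ ≤ κ * ‖z - z'‖)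
    (hGl : ∀ τ z z', ‖G τ z - G τ z'‖ ≤ ℓ * ‖z - z'‖) (hℓ : τ₁ * ℓ ≤ κ) (y₀ y₁ : ℝ)
    (z z₂ : C(Icc (0 : ℝ) τ₁, E × ℝ)) :
    dist (singOp h F G hF hG y₀ z) (singOp h F G hF hG y₁ z₂) ≤ |y₀ - y₁| + κ * dist z z₂ := by
  refine dist_singOp_le z z₂ (fun τ hτ => ?_) (fun τ hτ => ?_) (by positivity)
  · refine (hFl _ _ _).trans (mul_le_mul_of_nonneg_left ?_ hκ)
    rw [← dist_eq_norm]; exact ContinuousMap.dist_apply_le_dist _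
  · calc τ₁ * ‖G τ (z ⟨τ, hτ⟩) - G τ (z₂ ⟨τ, hτ⟩)‖ ≤ τ₁ * (ℓ * ‖z ⟨τ, hτ⟩ - z₂ ⟨τ, hτ⟩‖) :=
        mul_le_mul_of_nonneg_left (hGl _ _ _) h
      _ = (τ₁ * ℓ) * ‖z ⟨τ, hτ⟩ - z₂ ⟨τ, hτ⟩‖ := by ring
      _ ≤ κ * dist z z₂ := by
        refine mul_le_mul hℓ ?_ (norm_nonneg _) hκ
        rw [← dist_eq_norm]; exact ContinuousMap.dist_apply_le_dist _

lemma exists_singOp_fixed [CompleteSpace E] (hκ : 0 ≤ κ) (hκ1 : κ < 1)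
    (hFl : ∀ τ z z', ‖F τ z - F τ z'‖ ≤ κ * ‖z - z'‖)
    (hGl : ∀ τ z z', ‖G τ z - G τ z'‖ ≤ ℓ * ‖z - z'‖) (hℓ : τ₁ * ℓ ≤ κ) (y₀ : ℝ) :
    ∃ z : C(Icc (0 : ℝ) τ₁, E × ℝ), singOp h F G hF hG y₀ z = z := by
  have hc : ContractingWith ⟨κ, hκ⟩ (singOp h F G hF hG y₀) := by
    refine ⟨by exact_mod_cast hκ1, LipschitzWith.of_dist_le_mul fun z z₂ => ?_⟩
    have := dist_singOp_self_le (h := h) (hF := hF) (hG := hG) hκ hFl hGl hℓ y₀ y₀ z z₂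
    rwa [sub_self, abs_zero, zero_add] at this
  exact ⟨_, hc.fixedPoint_isFixedPt⟩

lemma dist_le_of_singOp_fixed (hκ : 0 ≤ κ) (hκ1 : κ < 1)
    (hFl : ∀ τ z z', ‖F τ z - F τ z'‖ ≤ κ * ‖z - z'‖)
    (hGl : ∀ τ z z', ‖G τ z - G τ z'‖ ≤ ℓ * ‖z - z'‖) (hℓ : τ₁ * ℓ ≤ κ) {y₀ r : ℝ}
    {z z₂ : C(Icc (0 : ℝ) τ₁, E × ℝ)} (hz : singOp h F G hF hG y₀ z = z)
    (hz₂ : dist z₂ (singOp h F G hF hG y₀ z₂) ≤ r) : dist z₂ z ≤ r / (1 - κ) := by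
  have h1 := dist_singOp_self_le (h := h) (hF := hF) (hG := hG) hκ hFl hGl hℓ y₀ y₀ z₂ z
  rw [hz, sub_self, abs_zero, zero_add] at h1
  rw [le_div_iff₀ (by linarith)]
  nlinarith [dist_triangle z₂ (singOp h F G hF hG y₀ z₂) z]

end SingOp

abbrev PlaneState : Type := (ℝ × ℝ) × ℝ

def clampAbs (m x : ℝ) : ℝ := max (-m) (min m x)

lemma abs_clampAbs_le {m : ℝ} (hm : 0 ≤ m) (x : ℝ) : |clampAbs m x| ≤ m := by
  unfold clampAbs; rw [abs_le]
  exact ⟨le_max_left _ _, max_le (by linarith) (min_le_left _ _)⟩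

lemma clampAbs_of_abs_le {m x : ℝ} (h : |x| ≤ m) : clampAbs m x = x := by
  unfold clampAbs; rw [abs_le] at h
  rw [min_eq_right h.2, max_eq_right h.1]

lemma abs_clampAbs_sub_le (m x y : ℝ) : |clampAbs m x - clampAbs m y| ≤ |x - y| := by
  unfold clampAbs
  have h1 := abs_max_sub_max_le_max (-m) (min m x) (-m) (min m y)
  have h2 := abs_min_sub_min_le_max m x m y
  simp only [sub_self, abs_zero, abs_nonneg, sup_of_le_right] at h1 h2
  exact h1.trans h2

/-- Time slice of the cone in which the solution of the singular system lives. -/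
def coneSlice (M R τ : ℝ) : Set PlaneState :=
  {z | |z.1.1| ≤ M * τ ∧ |z.1.2| ≤ M * τ ∧ |z.2| ≤ R}

def stateCone (τ₁ M R : ℝ) : Set (ℝ × PlaneState) := {p | p.1 ∈ Icc 0 τ₁ ∧ p.2 ∈ coneSlice M R p.1}

def toSlice (M R τ : ℝ) (z : PlaneState) : PlaneState :=
  ((clampAbs (M * τ) z.1.1, clampAbs (M * τ) z.1.2), clampAbs R z.2)

lemma toSlice_mem {M R τ : ℝ} (h : 0 ≤ M * τ) (hR : 0 ≤ R) (z : PlaneState) :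
    toSlice M R τ z ∈ coneSlice M R τ :=
  ⟨abs_clampAbs_le h _, abs_clampAbs_le h _, abs_clampAbs_le hR _⟩

lemma toSlice_of_mem {M R τ : ℝ} {z : PlaneState} (hz : z ∈ coneSlice M R τ) :
    toSlice M R τ z = z := by
  obtain ⟨h1, h2, h3⟩ := hz
  simp [toSlice, clampAbs_of_abs_le h1, clampAbs_of_abs_le h2, clampAbs_of_abs_le h3]

lemma norm_toSlice_sub_le (M R τ : ℝ) (z z' : PlaneState) :
    ‖toSlice M R τ z - toSlice M R τ z'‖ ≤ ‖z - z'‖ := by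
  simp only [toSlice, Prod.norm_def, Prod.fst_sub, Prod.snd_sub, Real.norm_eq_abs]
  exact max_le_max (max_le_max (abs_clampAbs_sub_le _ _ _) (abs_clampAbs_sub_le _ _ _))
    (abs_clampAbs_sub_le _ _ _)

lemma continuous_toSlice (M R : ℝ) :
    Continuous fun p : ℝ × PlaneState => toSlice M R p.1 p.2 := by
  unfold toSlice clampAbs; fun_prop

lemma convex_coneSlice (M R τ : ℝ) : Convex ℝ (coneSlice M R τ) := by
  have : coneSlice M R τ = (Icc (-(M * τ)) (M * τ) ×ˢ Icc (-(M * τ)) (M * τ)) ×ˢ Icc (-R) R := by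
    ext z; simp only [coneSlice, abs_le, mem_ofPred_eq, mem_prod, mem_Icc]; tauto
  rw [this]
  exact ((convex_Icc _ _).prod (convex_Icc _ _)).prod (convex_Icc _ _)

lemma isCompact_stateCone (τ₁ M R : ℝ) : IsCompact (stateCone τ₁ M R) := by
  have hc : IsClosed (stateCone τ₁ M R) := by
    have : stateCone τ₁ M R = {p | 0 ≤ p.1} ∩ {p | p.1 ≤ τ₁} ∩ {p | |p.2.1.1| ≤ M * p.1} ∩
        {p | |p.2.1.2| ≤ M * p.1} ∩ {p | |p.2.2| ≤ R} := by
      ext p; simp [stateCone, coneSlice, and_assoc]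
    rw [this]
    refine ((((isClosed_le ?_ ?_).inter (isClosed_le ?_ ?_)).inter (isClosed_le ?_ ?_)).inter
      (isClosed_le ?_ ?_)).inter (isClosed_le ?_ ?_) <;> fun_prop
  refine ((isCompact_Icc (a := (0 : ℝ)) (b := τ₁)).prod
    (((isCompact_Icc (a := -(|M| * τ₁)) (b := |M| * τ₁)).prod
      (isCompact_Icc (a := -(|M| * τ₁)) (b := |M| * τ₁))).prod
      (isCompact_Icc (a := -R) (b := R)))).of_isClosed_subset hc ?_
  rintro ⟨τ, ⟨w, o⟩, y⟩ ⟨⟨h0, h1⟩, h2, h3, h4⟩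
  simp only at h0 h1 h2 h3 h4
  have hM : M * τ ≤ |M| * τ₁ :=
    (mul_le_mul_of_nonneg_right (le_abs_self M) h0).trans
      (mul_le_mul_of_nonneg_left h1 (abs_nonneg M))
  simp only [mem_prod, mem_Icc]
  exact ⟨⟨h0, h1⟩, ⟨abs_le.1 (h2.trans hM), abs_le.1 (h3.trans hM)⟩, abs_le.1 h4⟩

/-- A singular system `(τ w)' = F(τ,w,y)`, `y' = G(τ,w,y)` on a cone, with the bounds that make it
uniquely solvable from `w(0) = 0`, `y(0) = y₀`, differentiably in `y₀`. -/
structure ConeSystem (F : ℝ × PlaneState → ℝ × ℝ) (G : ℝ × PlaneState → ℝ)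
    (F' : ℝ × PlaneState → PlaneState →L[ℝ] ℝ × ℝ) (G' : ℝ × PlaneState → PlaneState →L[ℝ] ℝ)
    (τ₁ M R κ ℓ B : ℝ) : Prop where
  τ₁_pos : 0 < τ₁
  M_nonneg : 0 ≤ M
  R_nonneg : 0 ≤ R
  κ_nonneg : 0 ≤ κ
  κ_lt : κ < 1
  ℓ_nonneg : 0 ≤ ℓ
  ℓ_le : τ₁ * ℓ ≤ κ
  ℓ_le' : τ₁ * ℓ ≤ (1 - κ) / 2
  contF : ContinuousOn F (stateCone τ₁ M R)
  contG : ContinuousOn G (stateCone τ₁ M R)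
  contF' : ContinuousOn F' (stateCone τ₁ M R)
  contG' : ContinuousOn G' (stateCone τ₁ M R)
  derivF : ∀ p ∈ stateCone τ₁ M R,
    HasFDerivWithinAt (fun z => F (p.1, z)) (F' p) (coneSlice M R p.1) p.2
  derivG : ∀ p ∈ stateCone τ₁ M R,
    HasFDerivWithinAt (fun z => G (p.1, z)) (G' p) (coneSlice M R p.1) p.2
  normF' : ∀ p ∈ stateCone τ₁ M R, ‖F' p‖ ≤ κ
  normG' : ∀ p ∈ stateCone τ₁ M R, ‖G' p‖ ≤ ℓ
  normF : ∀ p ∈ stateCone τ₁ M R, ‖F p‖ ≤ 2 * M * p.1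
  normG : ∀ p ∈ stateCone τ₁ M R, |G p| ≤ B

namespace ConeSystem

variable {F : ℝ × PlaneState → ℝ × ℝ} {G : ℝ × PlaneState → ℝ}
  {F' : ℝ × PlaneState → PlaneState →L[ℝ] ℝ × ℝ} {G' : ℝ × PlaneState → PlaneState →L[ℝ] ℝ}
  {τ₁ M R κ ℓ B : ℝ}

/-- Retraction of all states onto the cone. -/
def retr (τ₁ M R τ : ℝ) (z : PlaneState) : ℝ × PlaneState :=
  (max 0 (min τ₁ τ), toSlice M R (max 0 (min τ₁ τ)) z)

lemma continuous_retr (τ₁ M R : ℝ) :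
    Continuous (Function.uncurry (retr τ₁ M R)) := by
  have h : Continuous fun p : ℝ × PlaneState => max 0 (min τ₁ p.1) := by fun_prop
  exact h.prodMk ((continuous_toSlice M R).comp (h.prodMk continuous_snd))

lemma retr_of_mem {τ : ℝ} (hτ : τ ∈ Icc 0 τ₁) {z : PlaneState} (hz : z ∈ coneSlice M R τ) :
    retr τ₁ M R τ z = (τ, z) := by
  have : max 0 (min τ₁ τ) = τ := by rw [min_eq_right hτ.2, max_eq_right hτ.1]
  rw [retr, this, toSlice_of_mem hz]

section
variable (S : ConeSystem F G F' G' τ₁ M R κ ℓ B)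
include S

lemma retr_mem (τ : ℝ) (z : PlaneState) : retr τ₁ M R τ z ∈ stateCone τ₁ M R :=
  ⟨⟨le_max_left _ _, max_le S.τ₁_pos.le (min_le_left _ _)⟩,
    toSlice_mem (mul_nonneg S.M_nonneg (le_max_left _ _)) S.R_nonneg z⟩

lemma continuous_comp_retr {E' : Type*} [TopologicalSpace E'] {H : ℝ × PlaneState → E'}
    (hH : ContinuousOn H (stateCone τ₁ M R)) :
    Continuous (Function.uncurry fun τ z => H (retr τ₁ M R τ z)) :=
  hH.comp_continuous (continuous_retr τ₁ M R) fun p => S.retr_mem p.1 p.2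

lemma norm_sub_F_le (τ : ℝ) (z z' : PlaneState) :
    ‖F (retr τ₁ M R τ z) - F (retr τ₁ M R τ z')‖ ≤ κ * ‖z - z'‖ := by
  have h := (convex_coneSlice M R (max 0 (min τ₁ τ))).norm_image_sub_le_of_norm_hasFDerivWithin_le
    (f := fun z => F (max 0 (min τ₁ τ), z)) (f' := fun z => F' (max 0 (min τ₁ τ), z)) (C := κ)
    (fun x hx => S.derivF (_, x) ⟨(S.retr_mem τ z).1, hx⟩)
    (fun x hx => S.normF' (_, x) ⟨(S.retr_mem τ z).1, hx⟩) (S.retr_mem τ z').2 (S.retr_mem τ z).2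
  exact h.trans (mul_le_mul_of_nonneg_left (norm_toSlice_sub_le _ _ _ _ _) S.κ_nonneg)

lemma norm_sub_G_le (τ : ℝ) (z z' : PlaneState) :
    ‖G (retr τ₁ M R τ z) - G (retr τ₁ M R τ z')‖ ≤ ℓ * ‖z - z'‖ := by
  have h := (convex_coneSlice M R (max 0 (min τ₁ τ))).norm_image_sub_le_of_norm_hasFDerivWithin_le
    (f := fun z => G (max 0 (min τ₁ τ), z)) (f' := fun z => G' (max 0 (min τ₁ τ), z)) (C := ℓ)
    (fun x hx => S.derivG (_, x) ⟨(S.retr_mem τ z).1, hx⟩)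
    (fun x hx => S.normG' (_, x) ⟨(S.retr_mem τ z).1, hx⟩) (S.retr_mem τ z').2 (S.retr_mem τ z).2
  exact h.trans (mul_le_mul_of_nonneg_left (norm_toSlice_sub_le _ _ _ _ _) S.ℓ_nonneg)

/-- The orbit with `y(0) = y₀`. -/
def orbit (y₀ : ℝ) : C(Icc (0 : ℝ) τ₁, PlaneState) :=
  (exists_singOp_fixed (h := S.τ₁_pos.le) (hF := S.continuous_comp_retr S.contF)
    (hG := S.continuous_comp_retr S.contG) S.κ_nonneg S.κ_lt S.norm_sub_F_le S.norm_sub_G_le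
    S.ℓ_le y₀).choose

lemma orbit_fixed (y₀ : ℝ) : singOp S.τ₁_pos.le (fun τ z => F (retr τ₁ M R τ z))
    (fun τ z => G (retr τ₁ M R τ z)) (S.continuous_comp_retr S.contF)
    (S.continuous_comp_retr S.contG) y₀ (S.orbit y₀) = S.orbit y₀ :=
  (exists_singOp_fixed (h := S.τ₁_pos.le) (hF := S.continuous_comp_retr S.contF)
    (hG := S.continuous_comp_retr S.contG) S.κ_nonneg S.κ_lt S.norm_sub_F_le S.norm_sub_G_le
    S.ℓ_le y₀).choose_spec

lemma dist_orbit_le (y₀ y₁ : ℝ) : dist (S.orbit y₁) (S.orbit y₀) ≤ |y₁ - y₀| / (1 - κ) := by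
  refine dist_le_of_singOp_fixed S.κ_nonneg S.κ_lt S.norm_sub_F_le S.norm_sub_G_le S.ℓ_le
    (S.orbit_fixed y₀) ?_
  conv_lhs => rw [← S.orbit_fixed y₁, S.orbit_fixed y₁]
  have := dist_singOp_self_le (h := S.τ₁_pos.le) (hF := S.continuous_comp_retr S.contF)
    (hG := S.continuous_comp_retr S.contG) S.κ_nonneg S.norm_sub_F_le S.norm_sub_G_le S.ℓ_le y₁ y₀
    (S.orbit y₁) (S.orbit y₁)
  rw [S.orbit_fixed y₁] at this
  simpa using this

lemma continuous_orbit : Continuous S.orbit := by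
  have hκ := S.κ_lt
  refine (LipschitzWith.of_dist_le_mul (K := ⟨1 / (1 - κ), by
    have : 0 < 1 - κ := by linarith
    positivity⟩) fun y₁ y₀ => ?_).continuous
  refine (S.dist_orbit_le y₀ y₁).trans (le_of_eq ?_)
  show _ = 1 / (1 - κ) * dist y₁ y₀
  rw [Real.dist_eq]; ring

lemma orbit_mem {y₀ : ℝ} (hy : |y₀| + τ₁ * B ≤ R) (τ : Icc (0 : ℝ) τ₁) :
    S.orbit y₀ τ ∈ coneSlice M R τ ∧ |(S.orbit y₀ τ).2 - y₀| ≤ τ * B := by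
  obtain ⟨τ, hτ⟩ := τ
  have hfix := congrArg (fun z => z ⟨τ, hτ⟩) (S.orbit_fixed y₀)
  simp only [singOp_apply] at hfix
  set z := S.orbit y₀ with hz
  have hw : ‖(z ⟨τ, hτ⟩).1‖ ≤ M * τ := by
    rw [← hfix]
    have hm : ∀ θ ∈ Ioc (0 : ℝ) 1, ‖F (retr τ₁ M R (τ * θ) (IccExtend S.τ₁_pos.le z (τ * θ)))‖
        ≤ 2 * M * (τ * θ) := fun θ hθ => by
      have hm := mul_mem_Icc_of_mem hτ ⟨hθ.1.le, hθ.2⟩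
      have h1 : (retr τ₁ M R (τ * θ) (IccExtend S.τ₁_pos.le z (τ * θ))).1 = τ * θ := by
        show max 0 (min τ₁ (τ * θ)) = _
        rw [min_eq_right hm.2, max_eq_right hm.1]
      have := S.normF _ (S.retr_mem (τ * θ) (IccExtend S.τ₁_pos.le z (τ * θ)))
      rwa [h1] at this
    have h := intervalIntegral.norm_integral_le_of_norm_le (μ := MeasureTheory.volume) (a := (0 : ℝ)) (b := 1)
      (f := fun θ => F (retr τ₁ M R (τ * θ) (IccExtend S.τ₁_pos.le z (τ * θ))))
      (g := fun θ => 2 * M * (τ * θ)) zero_le_one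
      (MeasureTheory.ae_of_all _ fun θ hθ => hm θ hθ)
      ((by fun_prop : Continuous fun θ : ℝ => 2 * M * (τ * θ)).intervalIntegrable 0 1)
    refine h.trans (le_of_eq ?_)
    rw [intervalIntegral.integral_const_mul, intervalIntegral.integral_const_mul, integral_id]
    ring
  have hy' : |(z ⟨τ, hτ⟩).2 - y₀| ≤ τ * B := by
    rw [← hfix]
    simp only [add_sub_cancel_left]
    rw [abs_mul, abs_of_nonneg hτ.1]
    refine mul_le_mul_of_nonneg_left ?_ hτ.1
    have := intervalIntegral.norm_integral_le_of_norm_le_const (a := (0 : ℝ)) (b := 1) (C := B)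
      (f := fun θ => G (retr τ₁ M R (τ * θ) (IccExtend S.τ₁_pos.le z (τ * θ))))
      (fun θ _ => S.normG _ (S.retr_mem _ _))
    simpa using this
  have hB : 0 ≤ B := (abs_nonneg _).trans (S.normG _ (S.retr_mem 0 0))
  refine ⟨⟨(norm_fst_le _).trans hw, (norm_snd_le _).trans hw, ?_⟩, hy'⟩
  have h1 : |(z ⟨τ, hτ⟩).2| ≤ |(z ⟨τ, hτ⟩).2 - y₀| + |y₀| := by
    simpa using abs_add_le ((z ⟨τ, hτ⟩).2 - y₀) y₀
  have h2 : τ * B ≤ τ₁ * B := mul_le_mul_of_nonneg_right hτ.2 hB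
  show |(z ⟨τ, hτ⟩).2| ≤ R
  linarith

/-- Linearised right-hand side along a curve. -/
def lin {E : Type*} [NormedAddCommGroup E] [NormedSpace ℝ E]
    (H' : ℝ × PlaneState → PlaneState →L[ℝ] E) (z : C(Icc (0 : ℝ) τ₁, PlaneState))
    (τ : ℝ) (v : PlaneState) : E :=
  H' (retr τ₁ M R τ (IccExtend S.τ₁_pos.le z τ)) v

lemma continuous_lin {E : Type*} [NormedAddCommGroup E] [NormedSpace ℝ E]
    {H' : ℝ × PlaneState → PlaneState →L[ℝ] E} (hH : ContinuousOn H' (stateCone τ₁ M R))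
    (z : C(Icc (0 : ℝ) τ₁, PlaneState)) : Continuous (Function.uncurry (S.lin H' z)) := by
  have h1 : Continuous fun τ : ℝ => H' (retr τ₁ M R τ (IccExtend S.τ₁_pos.le z τ)) :=
    (S.continuous_comp_retr hH).comp (continuous_id.prodMk z.continuous.Icc_extend')
  exact (h1.comp continuous_fst).clm_apply continuous_snd

lemma norm_lin_F (z : C(Icc (0 : ℝ) τ₁, PlaneState)) (τ : ℝ) (v v' : PlaneState) :
    ‖S.lin F' z τ v - S.lin F' z τ v'‖ ≤ κ * ‖v - v'‖ := by
  rw [lin, lin, ← map_sub]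
  exact (ContinuousLinearMap.le_opNorm _ _).trans
    (mul_le_mul_of_nonneg_right (S.normF' _ (S.retr_mem _ _)) (norm_nonneg _))

lemma norm_lin_G (z : C(Icc (0 : ℝ) τ₁, PlaneState)) (τ : ℝ) (v v' : PlaneState) :
    ‖S.lin G' z τ v - S.lin G' z τ v'‖ ≤ ℓ * ‖v - v'‖ := by
  rw [lin, lin, ← map_sub]
  exact (ContinuousLinearMap.le_opNorm _ _).trans
    (mul_le_mul_of_nonneg_right (S.normG' _ (S.retr_mem _ _)) (norm_nonneg _))

/-- Solution of the linearised system with `δy(0) = 1`. -/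
def vari (y₀ : ℝ) : C(Icc (0 : ℝ) τ₁, PlaneState) :=
  (exists_singOp_fixed (h := S.τ₁_pos.le) (hF := S.continuous_lin S.contF' (S.orbit y₀))
    (hG := S.continuous_lin S.contG' (S.orbit y₀)) S.κ_nonneg S.κ_lt (S.norm_lin_F _)
    (S.norm_lin_G _) S.ℓ_le 1).choose

lemma vari_fixed (y₀ : ℝ) : singOp S.τ₁_pos.le (S.lin F' (S.orbit y₀)) (S.lin G' (S.orbit y₀))
    (S.continuous_lin S.contF' (S.orbit y₀)) (S.continuous_lin S.contG' (S.orbit y₀)) 1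
    (S.vari y₀) = S.vari y₀ :=
  (exists_singOp_fixed (h := S.τ₁_pos.le) (hF := S.continuous_lin S.contF' (S.orbit y₀))
    (hG := S.continuous_lin S.contG' (S.orbit y₀)) S.κ_nonneg S.κ_lt (S.norm_lin_F _)
    (S.norm_lin_G _) S.ℓ_le 1).choose_spec

lemma norm_vari_le (y₀ : ℝ) : ‖S.vari y₀‖ ≤ 1 / (1 - κ) := by
  rw [← dist_zero_left]
  refine dist_le_of_singOp_fixed S.κ_nonneg S.κ_lt (S.norm_lin_F _) (S.norm_lin_G _) S.ℓ_le
    (S.vari_fixed y₀) ?_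
  rw [dist_zero_left, ContinuousMap.norm_le _ zero_le_one]
  intro τ
  rw [singOp_apply]
  have h0 : ∀ σ, IccExtend S.τ₁_pos.le (⇑(0 : C(Icc (0 : ℝ) τ₁, PlaneState))) σ = 0 := fun σ => rfl
  simp only [lin, h0, map_zero]
  simp [Prod.norm_def]

omit S in
lemma ball_unif {E : Type*} [NormedAddCommGroup E] [NormedSpace ℝ E]
    {H' : ℝ × PlaneState → PlaneState →L[ℝ] E} (hH : ContinuousOn H' (stateCone τ₁ M R))
    {ω : ℝ} (hω : 0 < ω) : ∃ η > 0, ∀ τ : ℝ, ∀ z z' : PlaneState, (τ, z) ∈ stateCone τ₁ M R →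
      (τ, z') ∈ stateCone τ₁ M R → ‖z - z'‖ < η → ‖H' (τ, z) - H' (τ, z')‖ ≤ ω := by
  obtain ⟨η, hη, h⟩ := Metric.uniformContinuousOn_iff.1
    ((isCompact_stateCone τ₁ M R).uniformContinuousOn_of_continuous hH) ω hω
  refine ⟨η, hη, fun τ z z' hz hz' hd => ?_⟩
  rw [← dist_eq_norm]
  refine (h _ hz _ hz' ?_).le
  rw [Prod.dist_eq, dist_self, dist_eq_norm]
  exact max_lt hη hd

lemma continuous_vari : Continuous S.vari := by
  rw [continuous_iff_continuousAt]
  intro y₀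
  rw [ContinuousAt, Metric.tendsto_nhds]
  intro ε hε
  have hκ := S.κ_lt
  have hκ' : 0 < 1 - κ := by linarith
  set ω := ε * (1 - κ) ^ 2 / (2 * (1 + τ₁)) with hωdef
  have hτ := S.τ₁_pos
  have hω : 0 < ω := by positivity
  obtain ⟨η₁, hη₁, h₁⟩ := ball_unif S.contF' hω
  obtain ⟨η₂, hη₂, h₂⟩ := ball_unif S.contG' hω
  have hc := (S.continuous_orbit.tendsto y₀)
  rw [Metric.tendsto_nhds] at hc
  filter_upwards [hc _ (lt_min hη₁ hη₂)] with y₁ hy₁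
  have key : ∀ (τ : ℝ) (hτ : τ ∈ Icc 0 τ₁), ‖toSlice M R (max 0 (min τ₁ τ)) (S.orbit y₁ ⟨τ, hτ⟩) -
      toSlice M R (max 0 (min τ₁ τ)) (S.orbit y₀ ⟨τ, hτ⟩)‖ < min η₁ η₂ := fun τ hτ => by
    refine (norm_toSlice_sub_le _ _ _ _ _).trans_lt (lt_of_le_of_lt ?_ hy₁)
    rw [← dist_eq_norm]; exact ContinuousMap.dist_apply_le_dist _
  have hr : dist (S.vari y₁) (S.vari y₀) ≤ (ω * (1 + τ₁) / (1 - κ)) / (1 - κ) := by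
    refine dist_le_of_singOp_fixed S.κ_nonneg S.κ_lt (S.norm_lin_F _) (S.norm_lin_G _) S.ℓ_le
      (S.vari_fixed y₀) ?_
    have := dist_singOp_le (h := S.τ₁_pos.le) (hF := S.continuous_lin S.contF' (S.orbit y₁))
      (hG := S.continuous_lin S.contG' (S.orbit y₁)) (y₀ := 1) (y₁ := 1)
      (hF₂ := S.continuous_lin S.contF' (S.orbit y₀))
      (hG₂ := S.continuous_lin S.contG' (S.orbit y₀)) (r := ω * (1 + τ₁) / (1 - κ))
      (S.vari y₁) (S.vari y₁) ?_ ?_ (by positivity)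
    · rw [S.vari_fixed y₁] at this
      simpa using this
    · intro τ hτ'
      rw [lin, lin, IccExtend_of_mem _ _ hτ', IccExtend_of_mem _ _ hτ',
        ← sub_apply]
      refine (ContinuousLinearMap.le_opNorm _ _).trans ?_
      have h1 := h₁ _ _ _ (S.retr_mem τ _) (S.retr_mem τ _) ((key τ hτ').trans_le (min_le_left _ _))
      have h2 : ‖S.vari y₁ ⟨τ, hτ'⟩‖ ≤ 1 / (1 - κ) :=
        (ContinuousMap.norm_coe_le_norm _ _).trans (S.norm_vari_le _)
      refine (mul_le_mul h1 h2 (norm_nonneg _) hω.le).trans ?_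
      rw [mul_one_div]
      exact div_le_div_of_nonneg_right (by nlinarith) hκ'.le
    · intro τ hτ'
      rw [lin, lin, IccExtend_of_mem _ _ hτ', IccExtend_of_mem _ _ hτ',
        ← sub_apply]
      have h1 := h₂ _ _ _ (S.retr_mem τ _) (S.retr_mem τ _) ((key τ hτ').trans_le (min_le_right _ _))
      have h2 : ‖S.vari y₁ ⟨τ, hτ'⟩‖ ≤ 1 / (1 - κ) :=
        (ContinuousMap.norm_coe_le_norm _ _).trans (S.norm_vari_le _)
      refine (mul_le_mul_of_nonneg_left ((ContinuousLinearMap.le_opNorm _ _).trans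
        (mul_le_mul h1 h2 (norm_nonneg _) hω.le)) hτ.le).trans ?_
      rw [mul_one_div, ← mul_div_assoc]
      exact div_le_div_of_nonneg_right (by nlinarith) hκ'.le
  refine hr.trans_lt ?_
  have : (ω * (1 + τ₁) / (1 - κ)) / (1 - κ) = ε / 2 := by
    rw [hωdef]; field_simp
  linarith

/-- Difference quotients of orbits converge to the variation. -/
lemma hasDerivAt_orbit {y₀ : ℝ} (hy : |y₀| + τ₁ * B < R) : HasDerivAt S.orbit (S.vari y₀) y₀ := by
  rw [hasDerivAt_iff_tendsto_slope, Metric.tendsto_nhds]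
  intro ε hε
  have hκ := S.κ_lt
  have hκ' : 0 < 1 - κ := by linarith
  have hτ := S.τ₁_pos
  set ω := ε * (1 - κ) ^ 2 / (2 * (1 + τ₁)) with hωdef
  have hω : 0 < ω := by positivity
  obtain ⟨η₁, hη₁, h₁⟩ := ball_unif S.contF' hω
  obtain ⟨η₂, hη₂, h₂⟩ := ball_unif S.contG' hω
  have hc := (S.continuous_orbit.tendsto y₀)
  rw [Metric.tendsto_nhds] at hc
  have hR : ∀ᶠ y₁ in 𝓝 y₀, |y₁| + τ₁ * B < R :=
    (by fun_prop : Continuous fun y : ℝ => |y| + τ₁ * B).continuousAt.eventually_lt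
      continuousAt_const hy
  filter_upwards [nhdsWithin_le_nhds (hc _ (lt_min hη₁ hη₂)), nhdsWithin_le_nhds hR,
    self_mem_nhdsWithin] with y₁ hy₁ hR₁ hne
  have hne : y₁ - y₀ ≠ 0 := sub_ne_zero.2 hne
  set d := y₁ - y₀ with hd
  set Q : C(Icc (0 : ℝ) τ₁, PlaneState) := slope S.orbit y₀ y₁ with hQdef
  have hQ : ∀ τ, Q τ = d⁻¹ • (S.orbit y₁ τ - S.orbit y₀ τ) := fun τ => by
    rw [hQdef, slope_def_module]; rfl
  have hQn : ‖Q‖ ≤ 1 / (1 - κ) := by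
    rw [hQdef, slope_def_module, norm_smul, norm_inv, Real.norm_eq_abs, ← dist_eq_norm,
      inv_mul_le_iff₀ (abs_pos.2 hne)]
    refine (S.dist_orbit_le y₀ y₁).trans (le_of_eq ?_)
    ring
  set FQ : ℝ → PlaneState → ℝ × ℝ := fun τ _ =>
    d⁻¹ • (F (retr τ₁ M R τ (IccExtend hτ.le (S.orbit y₁) τ)) -
      F (retr τ₁ M R τ (IccExtend hτ.le (S.orbit y₀) τ))) with hFQ
  set GQ : ℝ → PlaneState → ℝ := fun τ _ =>
    d⁻¹ • (G (retr τ₁ M R τ (IccExtend hτ.le (S.orbit y₁) τ)) -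
      G (retr τ₁ M R τ (IccExtend hτ.le (S.orbit y₀) τ))) with hGQ
  have cF := fun y => continuous_comp_IccExtend (h := hτ.le) (S.continuous_comp_retr S.contF)
    (S.orbit y)
  have cG := fun y => continuous_comp_IccExtend (h := hτ.le) (S.continuous_comp_retr S.contG)
    (S.orbit y)
  have hFQc : Continuous (Function.uncurry FQ) :=
    (((cF y₁).sub (cF y₀)).const_smul d⁻¹).comp continuous_fst
  have hGQc : Continuous (Function.uncurry GQ) :=
    (((cG y₁).sub (cG y₀)).const_smul d⁻¹).comp continuous_fst
  have hQfix : singOp hτ.le FQ GQ hFQc hGQc 1 Q = Q := by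
    ext1 τ
    have e := fun y => congrArg (fun z => z τ) (S.orbit_fixed y)
    simp only [singOp_apply] at e
    rw [singOp_apply, hQ]
    conv_rhs => rw [← e y₁, ← e y₀]
    have i1 := fun y => ((cF y).comp (continuous_const_mul (τ : ℝ))).intervalIntegrable
      (μ := MeasureTheory.volume) 0 1
    have i2 := fun y => ((cG y).comp (continuous_const_mul (τ : ℝ))).intervalIntegrable
      (μ := MeasureTheory.volume) 0 1
    simp only [Function.comp_def] at i1 i2
    rw [Prod.mk_sub_mk, Prod.smul_mk, hFQ, hGQ]
    simp only
    rw [intervalIntegral.integral_smul, intervalIntegral.integral_smul,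
      intervalIntegral.integral_sub (i1 y₁) (i1 y₀), intervalIntegral.integral_sub (i2 y₁) (i2 y₀)]
    congr 1
    simp only [smul_eq_mul]
    field_simp
    rw [hd]; ring
  have hmem : ∀ y, |y| + τ₁ * B < R → ∀ (τ : ℝ) (h : τ ∈ Icc 0 τ₁),
      retr τ₁ M R τ (IccExtend hτ.le (S.orbit y) τ) = (τ, S.orbit y ⟨τ, h⟩) := fun y hy τ h => by
    rw [IccExtend_of_mem _ _ h, retr_of_mem h (S.orbit_mem hy.le ⟨τ, h⟩).1]
  have hdist : ∀ (τ : ℝ) (h : τ ∈ Icc 0 τ₁),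
      ‖S.orbit y₁ ⟨τ, h⟩ - S.orbit y₀ ⟨τ, h⟩‖ < min η₁ η₂ := fun τ h => by
    rw [← dist_eq_norm]; exact (ContinuousMap.dist_apply_le_dist _).trans_lt hy₁
  have mv : ∀ {E : Type} [NormedAddCommGroup E] [NormedSpace ℝ E] (H : ℝ × PlaneState → E)
      (H' : ℝ × PlaneState → PlaneState →L[ℝ] E)
      (_ : ∀ p ∈ stateCone τ₁ M R,
        HasFDerivWithinAt (fun z => H (p.1, z)) (H' p) (coneSlice M R p.1) p.2)
      (_ : ∀ τ : ℝ, ∀ z z' : PlaneState, (τ, z) ∈ stateCone τ₁ M R →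
      (τ, z') ∈ stateCone τ₁ M R → ‖z - z'‖ < min η₁ η₂ → ‖H' (τ, z) - H' (τ, z')‖ ≤ ω)
      (τ : ℝ) (h : τ ∈ Icc 0 τ₁),
      ‖d⁻¹ • (H (retr τ₁ M R τ (IccExtend hτ.le (S.orbit y₁) τ)) -
      H (retr τ₁ M R τ (IccExtend hτ.le (S.orbit y₀) τ))) - S.lin H' (S.orbit y₀) τ (Q ⟨τ, h⟩)‖
      ≤ ω * (1 / (1 - κ)) := by
    intro E _ _ H H' hH hω' τ h
    rw [lin, hmem y₁ hR₁ τ h, hmem y₀ hy τ h, hQ, map_smul, ← smul_sub]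
    set z := S.orbit y₀ ⟨τ, h⟩
    set z' := S.orbit y₁ ⟨τ, h⟩
    have hz : z ∈ coneSlice M R τ := (S.orbit_mem hy.le ⟨τ, h⟩).1
    have hz' : z' ∈ coneSlice M R τ := (S.orbit_mem hR₁.le ⟨τ, h⟩).1
    have hseg : segment ℝ z z' ⊆ coneSlice M R τ := (convex_coneSlice M R τ).segment_subset hz hz'
    have := (convex_segment z z').norm_image_sub_le_of_norm_hasFDerivWithin_le'
      (f := fun z => H (τ, z)) (f' := fun z => H' (τ, z)) (φ := H' (τ, z)) (C := ω)
      (fun x hx => (hH (τ, x) ⟨h, hseg hx⟩).mono hseg)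
      (fun x hx => hω' τ x z ⟨h, hseg hx⟩ ⟨h, hz⟩ (by
        refine lt_of_le_of_lt ?_ (hdist τ h)
        exact norm_sub_le_of_mem_segment hx))
      (left_mem_segment ℝ z z') (right_mem_segment ℝ z z')
    rw [norm_smul]
    refine (mul_le_mul_of_nonneg_left this (norm_nonneg _)).trans ?_
    have h2 : ‖d⁻¹‖ * ‖z' - z‖ ≤ 1 / (1 - κ) := by
      rw [← norm_smul, ← hQ]; exact (ContinuousMap.norm_coe_le_norm _ _).trans hQn
    calc ‖d⁻¹‖ * (ω * ‖z' - z‖) = ω * (‖d⁻¹‖ * ‖z' - z‖) := by ring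
      _ ≤ _ := mul_le_mul_of_nonneg_left h2 hω.le
  have hr : dist Q (S.vari y₀) ≤ (ω * (1 / (1 - κ)) * (1 + τ₁)) / (1 - κ) := by
    refine dist_le_of_singOp_fixed S.κ_nonneg S.κ_lt (S.norm_lin_F _) (S.norm_lin_G _) S.ℓ_le
      (S.vari_fixed y₀) ?_
    have := dist_singOp_le (h := S.τ₁_pos.le) (hF := hFQc) (hG := hGQc) (y₀ := 1) (y₁ := 1)
      (hF₂ := S.continuous_lin S.contF' (S.orbit y₀))
      (hG₂ := S.continuous_lin S.contG' (S.orbit y₀)) (r := ω * (1 / (1 - κ)) * (1 + τ₁))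
      Q Q ?_ ?_ (by positivity)
    · rw [hQfix] at this
      simpa using this
    · intro τ h
      refine (mv F F' S.derivF (fun τ z z' a b c => h₁ τ z z' a b (c.trans_le (min_le_left _ _)))
        τ h).trans (le_mul_of_one_le_right (by positivity) (by linarith))
    · intro τ h
      refine (mul_le_mul_of_nonneg_left (mv G G' S.derivG (fun τ z z' a b c =>
        h₂ τ z z' a b (c.trans_le (min_le_right _ _))) τ h) hτ.le).trans ?_
      rw [mul_comm τ₁]
      exact mul_le_mul_of_nonneg_left (by linarith) (by positivity)
  refine hr.trans_lt ?_
  have : (ω * (1 / (1 - κ)) * (1 + τ₁)) / (1 - κ) = ε / 2 := by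
    rw [hωdef]; field_simp
  linarith

end

end ConeSystem

section
variable {E : Type*} [NormedAddCommGroup E] [NormedSpace ℝ E] [CompleteSpace E] {τ₁ : ℝ}
  {h : 0 ≤ τ₁}
  {F : ℝ → E × ℝ → E} {G : ℝ → E × ℝ → ℝ} {hF : Continuous (Function.uncurry F)}
  {hG : Continuous (Function.uncurry G)}

lemma mul_integral_comp_eq {E : Type*} [NormedAddCommGroup E] [NormedSpace ℝ E] (f : ℝ → E)
    (τ : ℝ) : τ • ∫ θ in (0 : ℝ)..1, f (τ * θ) = ∫ σ in (0 : ℝ)..τ, f σ := by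
  rw [intervalIntegral.smul_integral_comp_mul_left]; simp

/-- Differential form of the averaged system. -/
lemma hasDerivAt_of_singOp_fixed {y₀ : ℝ} {z : C(Icc (0 : ℝ) τ₁, E × ℝ)}
    (hz : singOp h F G hF hG y₀ z = z) {τ : ℝ} (hτ : τ ∈ Ioo 0 τ₁) :
    HasDerivAt (fun σ => σ • (IccExtend h z σ).1) (F τ (IccExtend h z τ)) τ ∧
    HasDerivAt (fun σ => (IccExtend h z σ).2) (G τ (IccExtend h z τ)) τ := by
  have e : ∀ σ (hσ : σ ∈ Icc 0 τ₁), σ • (IccExtend h z σ).1 =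
      (∫ σ in (0 : ℝ)..σ, F σ (IccExtend h z σ)) ∧
      (IccExtend h z σ).2 = y₀ + ∫ σ in (0 : ℝ)..σ, G σ (IccExtend h z σ) := fun σ hσ => by
    have := congrArg (fun z => z ⟨σ, hσ⟩) hz
    simp only [singOp_apply] at this
    rw [IccExtend_of_mem _ _ hσ, ← this,
      ← mul_integral_comp_eq (fun σ => F σ (IccExtend h z σ)),
      ← mul_integral_comp_eq (fun σ => G σ (IccExtend h z σ))]
    exact ⟨rfl, rfl⟩
  have hnhds : Icc 0 τ₁ ∈ 𝓝 τ := Icc_mem_nhds hτ.1 hτ.2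
  constructor
  · refine (intervalIntegral.integral_hasDerivAt_right
      ((continuous_comp_IccExtend hF z).intervalIntegrable 0 τ)
      ((continuous_comp_IccExtend hF z).stronglyMeasurableAtFilter _ _)
      (continuous_comp_IccExtend hF z).continuousAt).congr_of_eventuallyEq ?_
    filter_upwards [hnhds] with σ hσ using (e σ hσ).1
  · refine ((intervalIntegral.integral_hasDerivAt_right
      ((continuous_comp_IccExtend hG z).intervalIntegrable 0 τ)
      ((continuous_comp_IccExtend hG z).stronglyMeasurableAtFilter _ _)
      (continuous_comp_IccExtend hG z).continuousAt).const_add y₀).congr_of_eventuallyEq ?_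
    filter_upwards [hnhds] with σ hσ using (e σ hσ).2

lemma hasDerivAt_of_smul {E : Type*} [NormedAddCommGroup E] [NormedSpace ℝ E] {f : ℝ → E} {f' : E} {τ : ℝ} (hτ : τ ≠ 0)
    (hf : HasDerivAt (fun σ => σ • f σ) f' τ) : HasDerivAt f (τ⁻¹ • (f' - f τ)) τ := by
  have h1 := (hasDerivAt_inv hτ).smul hf
  refine (h1.congr_of_eventuallyEq ?_).congr_deriv ?_
  · filter_upwards [isOpen_ne.mem_nhds hτ] with σ hσ
    show f σ = σ⁻¹ • (σ • f σ)
    rw [inv_smul_smul₀ hσ]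
  · rw [smul_smul, smul_sub, sub_eq_add_neg, ← neg_smul]
    congr 2
    field_simp

end

namespace ConeSystem

variable {F : ℝ × PlaneState → ℝ × ℝ} {G : ℝ × PlaneState → ℝ}
  {F' : ℝ × PlaneState → PlaneState →L[ℝ] ℝ × ℝ} {G' : ℝ × PlaneState → PlaneState →L[ℝ] ℝ}
  {τ₁ M R κ ℓ B : ℝ}

variable (S : ConeSystem F G F' G' τ₁ M R κ ℓ B)
include S

/-- The orbits as functions of time and label, constant outside `[0, τ₁]`. -/
def flow (p : ℝ × ℝ) : PlaneState := S.orbit p.2 (projIcc 0 τ₁ S.τ₁_pos.le p.1)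

def dflow (p : ℝ × ℝ) : PlaneState := S.vari p.2 (projIcc 0 τ₁ S.τ₁_pos.le p.1)

lemma continuous_flow : Continuous S.flow := by
  have h : Continuous fun p : ℝ × ℝ => projIcc 0 τ₁ S.τ₁_pos.le p.1 :=
    continuous_projIcc.comp continuous_fst
  have h2 := S.continuous_orbit.comp (continuous_snd : Continuous fun p : ℝ × ℝ => p.2)
  exact continuous_eval.comp (h2.prodMk h)

lemma continuous_dflow : Continuous S.dflow := by
  have h : Continuous fun p : ℝ × ℝ => projIcc 0 τ₁ S.τ₁_pos.le p.1 :=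
    continuous_projIcc.comp continuous_fst
  have h2 := S.continuous_vari.comp (continuous_snd : Continuous fun p : ℝ × ℝ => p.2)
  exact continuous_eval.comp (h2.prodMk h)

lemma flow_mem {τ y₀ : ℝ} (hτ : τ ∈ Icc 0 τ₁) (hy : |y₀| + τ₁ * B ≤ R) :
    S.flow (τ, y₀) ∈ coneSlice M R τ ∧ |(S.flow (τ, y₀)).2 - y₀| ≤ τ * B := by
  have := S.orbit_mem hy (projIcc 0 τ₁ S.τ₁_pos.le τ)
  have e : S.flow (τ, y₀) = S.orbit y₀ (projIcc 0 τ₁ S.τ₁_pos.le τ) := rfl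
  rw [projIcc_of_mem _ hτ] at this e
  rwa [e]

lemma retr_flow {τ y₀ : ℝ} (hτ : τ ∈ Icc 0 τ₁) (hy : |y₀| + τ₁ * B ≤ R) :
    retr τ₁ M R τ (S.flow (τ, y₀)) = (τ, S.flow (τ, y₀)) :=
  retr_of_mem hτ (S.flow_mem hτ hy).1

lemma hasDerivAt_flow_time {τ y₀ : ℝ} (hτ : τ ∈ Ioo 0 τ₁) (hy : |y₀| + τ₁ * B ≤ R) :
    HasDerivAt (fun σ => σ • (S.flow (σ, y₀)).1) (F (τ, S.flow (τ, y₀))) τ ∧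
    HasDerivAt (fun σ => (S.flow (σ, y₀)).2) (G (τ, S.flow (τ, y₀))) τ := by
  have := hasDerivAt_of_singOp_fixed (S.orbit_fixed y₀) hτ
  have e := S.retr_flow (Ioo_subset_Icc_self hτ) hy
  simp only [flow] at e ⊢
  simpa only [IccExtend, Function.comp_def, e] using this

lemma hasDerivAt_dflow_time {τ y₀ : ℝ} (hτ : τ ∈ Ioo 0 τ₁) (hy : |y₀| + τ₁ * B ≤ R) :
    HasDerivAt (fun σ => σ • (S.dflow (σ, y₀)).1) (F' (τ, S.flow (τ, y₀)) (S.dflow (τ, y₀))) τ ∧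
    HasDerivAt (fun σ => (S.dflow (σ, y₀)).2) (G' (τ, S.flow (τ, y₀)) (S.dflow (τ, y₀))) τ := by
  have := hasDerivAt_of_singOp_fixed (S.vari_fixed y₀) hτ
  have e := S.retr_flow (Ioo_subset_Icc_self hτ) hy
  simp only [flow, dflow] at e ⊢
  simpa only [IccExtend, Function.comp_def, lin, e] using this

lemma half_le_dflow (p : ℝ × ℝ) : 1 / 2 ≤ (S.dflow p).2 := by
  obtain ⟨τ, y₀⟩ := p
  rw [dflow]
  generalize projIcc 0 τ₁ S.τ₁_pos.le τ = σ
  have e := congrArg (fun z => (z σ).2) (S.vari_fixed y₀)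
  simp only [singOp_apply] at e
  have hκ : 0 < 1 - κ := by linarith [S.κ_lt]
  have := intervalIntegral.norm_integral_le_of_norm_le_const (a := (0 : ℝ)) (b := 1)
    (C := ℓ * (1 / (1 - κ)))
    (f := fun θ => S.lin G' (S.orbit y₀) (σ * θ) (IccExtend S.τ₁_pos.le (S.vari y₀) (σ * θ)))
    (fun θ _ => (ContinuousLinearMap.le_opNorm _ _).trans (mul_le_mul (S.normG' _ (S.retr_mem _ _))
      ((ContinuousMap.norm_coe_le_norm _ _).trans (S.norm_vari_le _)) (norm_nonneg _) S.ℓ_nonneg))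
  rw [sub_zero, abs_one, mul_one, Real.norm_eq_abs] at this
  set J := ∫ θ in (0 : ℝ)..1,
    S.lin G' (S.orbit y₀) (σ * θ) (IccExtend S.τ₁_pos.le (S.vari y₀) (σ * θ))
  have h2 : |(σ : ℝ) * J| ≤ 1 / 2 := by
    rw [abs_mul, abs_of_nonneg σ.2.1]
    calc (σ : ℝ) * |J| ≤ τ₁ * (ℓ * (1 / (1 - κ))) :=
          mul_le_mul σ.2.2 this (abs_nonneg _) S.τ₁_pos.le
      _ = (τ₁ * ℓ) * (1 / (1 - κ)) := by ring
      _ ≤ (1 - κ) / 2 * (1 / (1 - κ)) := mul_le_mul_of_nonneg_right S.ℓ_le' (by positivity)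
      _ = 1 / 2 := by field_simp
  show 1 / 2 ≤ ((S.vari y₀) σ).2
  rw [← e]
  linarith [neg_abs_le ((σ : ℝ) * J)]

lemma hasDerivAt_flow_label {τ y₀ : ℝ} (hy : |y₀| + τ₁ * B < R) :
    HasDerivAt (fun y => S.flow (τ, y)) (S.dflow (τ, y₀)) y₀ := by
  have := (ContinuousMap.evalCLM ℝ (projIcc 0 τ₁ S.τ₁_pos.le τ) :
    C(Icc (0 : ℝ) τ₁, PlaneState) →L[ℝ] PlaneState).hasFDerivAt.comp_hasDerivAt y₀ (S.hasDerivAt_orbit hy)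
  exact this

lemma flow_expand {a b τ : ℝ} (ha : |a| + τ₁ * B < R) (hb : |b| + τ₁ * B < R) (hab : a ≤ b) :
    (b - a) / 2 ≤ (S.flow (τ, b)).2 - (S.flow (τ, a)).2 := by
  have hm : ∀ x ∈ Icc a b, |x| + τ₁ * B < R := fun x hx => by
    have : |x| ≤ max |a| |b| := abs_le_max_abs_abs hx.1 hx.2
    rcases le_max_iff.1 this with h | h <;> linarith
  have hd : ∀ x ∈ Icc a b, HasDerivAt (fun y => (S.flow (τ, y)).2) (S.dflow (τ, x)).2 x :=
    fun x hx => (S.hasDerivAt_flow_label (hm x hx)).snd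
  have := (convex_Icc a b).mul_sub_le_image_sub_of_le_deriv (f := fun y => (S.flow (τ, y)).2)
    (C := 1 / 2) (fun x hx => (hd x hx).continuousAt.continuousWithinAt)
    (fun x hx => (hd x (interior_subset hx)).differentiableAt.differentiableWithinAt)
    (fun x hx => by rw [(hd x (interior_subset hx)).deriv]; exact S.half_le_dflow _)
    a (left_mem_Icc.2 hab) b (right_mem_Icc.2 hab) hab
  linarith

lemma abs_sub_le_flow {a b τ : ℝ} (ha : |a| + τ₁ * B < R) (hb : |b| + τ₁ * B < R) :
    |b - a| ≤ 2 * |(S.flow (τ, b)).2 - (S.flow (τ, a)).2| := by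
  rcases le_total a b with h | h
  · have := S.flow_expand (τ := τ) ha hb h
    rw [abs_of_nonneg (sub_nonneg.2 h), abs_of_nonneg] <;> linarith
  · have := S.flow_expand (τ := τ) hb ha h
    rw [abs_sub_comm, abs_of_nonneg (sub_nonneg.2 h), abs_sub_comm, abs_of_nonneg] <;> linarith

lemma B_nonneg : 0 ≤ B := (abs_nonneg _).trans (S.normG _ (S.retr_mem 0 0))

lemma exists_foot {τ y : ℝ} (hy : |y| + 2 * τ₁ * B < R) :
    ∃ y₀, |y₀| + τ₁ * B < R ∧ (S.flow (τ, y₀)).2 = y := by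
  have hB := S.B_nonneg
  have hτ := S.τ₁_pos
  have hB' : 0 ≤ τ₁ * B := by positivity
  obtain ⟨h1, h2⟩ := abs_le.1 (le_refl |y|)
  have hm : ∀ x ∈ Icc (y - τ₁ * B) (y + τ₁ * B), |x| + τ₁ * B < R := fun x hx => by
    have : |x| ≤ |y| + τ₁ * B := by rw [abs_le]; constructor <;> linarith [hx.1, hx.2]
    linarith
  set σ := projIcc 0 τ₁ S.τ₁_pos.le τ with hσ
  have hfl : ∀ y₀, S.flow (τ, y₀) = S.flow (σ, y₀) := fun y₀ => by
    simp [flow, hσ]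
  have hσB : (σ : ℝ) * B ≤ τ₁ * B := mul_le_mul_of_nonneg_right σ.2.2 hB
  have key : ∀ x ∈ Icc (y - τ₁ * B) (y + τ₁ * B), |(S.flow (τ, x)).2 - x| ≤ τ₁ * B := fun x hx => by
    rw [hfl]; exact ((S.flow_mem σ.2 (hm x hx).le).2).trans hσB
  have hc : ContinuousOn (fun x => (S.flow (τ, x)).2) (Icc (y - τ₁ * B) (y + τ₁ * B)) :=
    ((S.continuous_flow.comp (Continuous.prodMk_right τ)).snd).continuousOn
  have hle : y - τ₁ * B ≤ y + τ₁ * B := by linarith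
  obtain ⟨x, hx, hxy⟩ := intermediate_value_Icc hle hc (show y ∈ Icc _ _ from
    ⟨by have := abs_le.1 (key _ (left_mem_Icc.2 hle)); linarith [this.2],
     by have := abs_le.1 (key _ (right_mem_Icc.2 hle)); linarith [this.1]⟩)
  exact ⟨x, hm x hx, hxy⟩

open Classical in
/-- Label of the orbit through a given point. -/
def foot (p : ℝ × ℝ) : ℝ :=
  if h : |p.2| + 2 * τ₁ * B < R then (S.exists_foot (τ := p.1) h).choose else 0

lemma foot_spec {p : ℝ × ℝ} (h : |p.2| + 2 * τ₁ * B < R) :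
    |S.foot p| + τ₁ * B < R ∧ (S.flow (p.1, S.foot p)).2 = p.2 := by
  rw [foot, dif_pos h]; exact (S.exists_foot (τ := p.1) h).choose_spec

lemma foot_flow {τ y₀ : ℝ} (h : |y₀| + τ₁ * B < R)
    (h' : |(S.flow (τ, y₀)).2| + 2 * τ₁ * B < R) : S.foot (τ, (S.flow (τ, y₀)).2) = y₀ := by
  obtain ⟨h1, h2⟩ := S.foot_spec (p := (τ, (S.flow (τ, y₀)).2)) h'
  have := S.abs_sub_le_flow (τ := τ) h h1
  simp only at h2
  rw [h2, sub_self, abs_zero, mul_zero] at this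
  exact sub_eq_zero.1 (abs_nonpos_iff.1 this)

omit S in
lemma isOpen_band : IsOpen {p : ℝ × ℝ | |p.2| + 2 * τ₁ * B < R} :=
  isOpen_lt (by fun_prop) continuous_const

lemma continuousAt_foot {p : ℝ × ℝ} (h : |p.2| + 2 * τ₁ * B < R) : ContinuousAt S.foot p := by
  obtain ⟨h1, h2⟩ := S.foot_spec h
  have hc : Tendsto (fun q : ℝ × ℝ => 2 * |q.2 - (S.flow (q.1, S.foot p)).2|) (𝓝 p) (𝓝 0) := by
    have : Continuous fun q : ℝ × ℝ => 2 * |q.2 - (S.flow (q.1, S.foot p)).2| := by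
      have := S.continuous_flow; fun_prop
    have h3 := this.tendsto p
    simpa [h2] using h3
  rw [ContinuousAt, tendsto_iff_dist_tendsto_zero]
  refine squeeze_zero' (Eventually.of_forall fun _ => dist_nonneg) ?_ hc
  filter_upwards [isOpen_band.mem_nhds h] with q hq
  obtain ⟨h3, h4⟩ := S.foot_spec hq
  have := S.abs_sub_le_flow (τ := q.1) h1 h3
  rwa [h4] at this

/-- The solution of the singular system as a function of `(τ, y)`. -/
def field (p : ℝ × ℝ) : ℝ × ℝ := (S.flow (p.1, S.foot p)).1

/-- The `y`-derivative of `field`. -/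
def fieldY (p : ℝ × ℝ) : ℝ × ℝ :=
  ((S.dflow (p.1, S.foot p)).2)⁻¹ • (S.dflow (p.1, S.foot p)).1

lemma continuousAt_field {p : ℝ × ℝ} (h : |p.2| + 2 * τ₁ * B < R) : ContinuousAt S.field p :=
  (ContinuousAt.comp (f := fun p : ℝ × ℝ => (p.1, S.foot p)) S.continuous_flow.continuousAt
    (continuousAt_fst.prodMk (S.continuousAt_foot h))).fst

lemma continuousAt_fieldY {p : ℝ × ℝ} (h : |p.2| + 2 * τ₁ * B < R) : ContinuousAt S.fieldY p := by
  have := ContinuousAt.comp (f := fun p : ℝ × ℝ => (p.1, S.foot p)) S.continuous_dflow.continuousAt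
    (continuousAt_fst.prodMk (S.continuousAt_foot h))
  exact (this.snd.inv₀ (by have := S.half_le_dflow (p.1, S.foot p); simp; linarith)).smul this.fst

lemma flow_foot {p : ℝ × ℝ} (h : |p.2| + 2 * τ₁ * B < R) :
    S.flow (p.1, S.foot p) = (S.field p, p.2) := by
  rw [Prod.ext_iff]; exact ⟨rfl, (S.foot_spec h).2⟩

lemma field_mem {p : ℝ × ℝ} (hτ : p.1 ∈ Icc 0 τ₁) (h : |p.2| + 2 * τ₁ * B < R) :
    (S.field p, p.2) ∈ coneSlice M R p.1 := by
  rw [← S.flow_foot h]; exact (S.flow_mem hτ (S.foot_spec h).1.le).1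

lemma hasFDerivAt_flow {τ y₀ : ℝ} (hτ : τ ∈ Ioo 0 τ₁) (hy : |y₀| + τ₁ * B < R) :
    HasFDerivAt S.flow ((ContinuousLinearMap.fst ℝ ℝ ℝ).smulRight
      ((τ⁻¹ • (F (τ, S.flow (τ, y₀)) - (S.flow (τ, y₀)).1), G (τ, S.flow (τ, y₀))) : PlaneState) +
      (ContinuousLinearMap.snd ℝ ℝ ℝ).smulRight (S.dflow (τ, y₀))) (τ, y₀) := by
  have ht : HasDerivAt (fun σ => S.flow (σ, y₀))
      ((τ⁻¹ • (F (τ, S.flow (τ, y₀)) - (S.flow (τ, y₀)).1), G (τ, S.flow (τ, y₀))) : PlaneState) τ :=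
    by
      obtain ⟨h1, h2⟩ := S.hasDerivAt_flow_time hτ hy.le
      exact (hasDerivAt_of_smul hτ.1.ne' h1).prodMk h2
  have h1 : HasFDerivAt (fun p : ℝ × ℝ => S.flow (p.1, y₀))
      ((ContinuousLinearMap.fst ℝ ℝ ℝ).smulRight
      ((τ⁻¹ • (F (τ, S.flow (τ, y₀)) - (S.flow (τ, y₀)).1), G (τ, S.flow (τ, y₀))) : PlaneState))
      (τ, y₀) := by
    have := ht.hasFDerivAt.comp (τ, y₀) (hasFDerivAt_fst (𝕜 := ℝ) (p := (τ, y₀)))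
    refine this.congr_fderiv ?_
    ext <;> simp
  have h2 : HasFDerivAt (fun p : ℝ × ℝ => S.flow p - S.flow (p.1, y₀))
      ((ContinuousLinearMap.snd ℝ ℝ ℝ).smulRight (S.dflow (τ, y₀))) (τ, y₀) := by
    rw [hasFDerivAt_iff_isLittleO]
    have a1 : (fun p : ℝ × ℝ => S.flow p - S.flow (p.1, y₀) - (p.2 - y₀) • S.dflow (p.1, y₀))
        =o[𝓝 (τ, y₀)] fun p => p - (τ, y₀) := by
      have h3 := (hasDerivAt_iff_isLittleO.1 (S.hasDerivAt_orbit hy)).comp_tendsto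
        (continuous_snd.tendsto (τ, y₀))
      refine (Asymptotics.IsBigO.of_bound 1 (Eventually.of_forall fun p => ?_)).trans_isLittleO
        (h3.trans_isBigO (Asymptotics.IsBigO.of_bound 1 (Eventually.of_forall fun p => ?_)))
      · rw [one_mul]
        exact ContinuousMap.norm_coe_le_norm (S.orbit p.2 - S.orbit y₀ - (p.2 - y₀) • S.vari y₀)
          (projIcc 0 τ₁ S.τ₁_pos.le p.1)
      · rw [one_mul]; exact norm_snd_le (p - (τ, y₀))
    have a2 : (fun p : ℝ × ℝ => (p.2 - y₀) • (S.dflow (p.1, y₀) - S.dflow (τ, y₀)))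
        =o[𝓝 (τ, y₀)] fun p => p - (τ, y₀) := by
      have hc : Tendsto (fun p : ℝ × ℝ => S.dflow (p.1, y₀) - S.dflow (τ, y₀)) (𝓝 (τ, y₀))
          (𝓝 0) := by
        have : Continuous fun p : ℝ × ℝ => S.dflow (p.1, y₀) - S.dflow (τ, y₀) := by
          have := S.continuous_dflow; fun_prop
        simpa using this.tendsto (τ, y₀)
      have hb : (fun p : ℝ × ℝ => p.2 - y₀) =O[𝓝 (τ, y₀)] fun p => p - (τ, y₀) :=
        Asymptotics.IsBigO.of_bound 1 (Eventually.of_forall fun p => by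
          rw [one_mul]; exact norm_snd_le (p - (τ, y₀)))
      have h3 := hb.norm_right.smul_isLittleO ((Asymptotics.isLittleO_one_iff ℝ).2 hc)
      refine (h3.trans_isBigO (Asymptotics.IsBigO.of_bound 1 (Eventually.of_forall fun p => ?_)))
      simp
    refine (a1.add a2).congr_left fun p => ?_
    simp only [ContinuousLinearMap.smulRight_apply, ContinuousLinearMap.coe_snd', Prod.snd_sub]
    rw [smul_sub]; abel
  refine ((h1.add h2).congr_of_eventuallyEq (Eventually.of_forall fun p => ?_))
  simp

lemma hasFDerivAt_foot {p : ℝ × ℝ} (hτ : p.1 ∈ Ioo 0 τ₁) (h : |p.2| + 2 * τ₁ * B < R) :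
    HasFDerivAt S.foot (((S.dflow (p.1, S.foot p)).2)⁻¹ • (ContinuousLinearMap.snd ℝ ℝ ℝ -
      (G (p.1, S.field p, p.2)) • ContinuousLinearMap.fst ℝ ℝ ℝ)) p := by
  obtain ⟨h1, h2⟩ := S.foot_spec h
  set d := (S.dflow (p.1, S.foot p)).2 with hd
  have hd0 : d ≠ 0 := by have := S.half_le_dflow (p.1, S.foot p); rw [← hd] at this; linarith
  set g := G (p.1, S.field p, p.2) with hg
  let e : (ℝ × ℝ) ≃L[ℝ] (ℝ × ℝ) := ContinuousLinearEquiv.equivOfInverse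
    ((ContinuousLinearMap.fst ℝ ℝ ℝ).prod
      (g • ContinuousLinearMap.fst ℝ ℝ ℝ + d • ContinuousLinearMap.snd ℝ ℝ ℝ))
    ((ContinuousLinearMap.fst ℝ ℝ ℝ).prod
      (d⁻¹ • (ContinuousLinearMap.snd ℝ ℝ ℝ - g • ContinuousLinearMap.fst ℝ ℝ ℝ)))
    (fun x => by ext <;> simp; field_simp) (fun x => by ext <;> simp; field_simp; ring)
  have hΘ : HasFDerivAt (fun q : ℝ × ℝ => (q.1, (S.flow q).2)) (e : (ℝ × ℝ) →L[ℝ] (ℝ × ℝ))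
      (p.1, S.foot p) := by
    have := hasFDerivAt_fst (𝕜 := ℝ) (p := (p.1, S.foot p)) |>.prodMk (S.hasFDerivAt_flow hτ h1).snd
    refine this.congr_fderiv ?_
    rw [S.flow_foot h]
    ext <;> simp [e, hg, hd]
  have hinv := HasFDerivAt.of_local_left_inverse (f := fun q : ℝ × ℝ => (q.1, (S.flow q).2))
    (g := fun q : ℝ × ℝ => (q.1, S.foot q)) (a := p) (f' := e)
    (continuousAt_fst.prodMk (S.continuousAt_foot h)) hΘ ?_
  · have := hinv.snd
    refine this.congr_fderiv ?_
    ext <;> simp [e]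
  · filter_upwards [isOpen_band.mem_nhds h] with q hq
    rw [Prod.ext_iff]; exact ⟨rfl, (S.foot_spec hq).2⟩

/-- The field solves `τ w_τ + w + τ G w_y = F`. -/
lemma hasFDerivAt_field {p : ℝ × ℝ} (hτ : p.1 ∈ Ioo 0 τ₁) (h : |p.2| + 2 * τ₁ * B < R) :
    HasFDerivAt S.field ((ContinuousLinearMap.fst ℝ ℝ ℝ).smulRight
      ((p.1)⁻¹ • (F (p.1, S.field p, p.2) - S.field p) - G (p.1, S.field p, p.2) • S.fieldY p) +
      (ContinuousLinearMap.snd ℝ ℝ ℝ).smulRight (S.fieldY p)) p := by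
  obtain ⟨h1, h2⟩ := S.foot_spec h
  have hc := ((S.hasFDerivAt_flow hτ h1).fst).comp p
    (f := fun q : ℝ × ℝ => (q.1, S.foot q)) (hasFDerivAt_fst.prodMk (S.hasFDerivAt_foot hτ h))
  refine hc.congr_fderiv ?_
  rw [S.flow_foot h]
  refine ContinuousLinearMap.ext fun x => ?_
  simp only [fieldY, ContinuousLinearMap.comp_apply, ContinuousLinearMap.prod_apply,
    add_apply, ContinuousLinearMap.smulRight_apply,
    ContinuousLinearMap.coe_fst', ContinuousLinearMap.coe_snd', smul_apply,
    sub_apply, Prod.fst_add, Prod.smul_fst, smul_eq_mul]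
  ext <;> simp <;> ring

end ConeSystem

section Partials

variable {h : ℝ × ℝ × ℝ → ℝ} {p : ℝ × ℝ × ℝ}

lemma fderiv_apply_eq_partials (h : ℝ × ℝ × ℝ → ℝ) (p v : ℝ × ℝ × ℝ) :
    fderiv ℝ h p v = v.1 * partialT h p + v.2.1 * partialX h p + v.2.2 * partialY h p := by
  obtain ⟨a, b, c⟩ := v
  have : ((a, b, c) : ℝ × ℝ × ℝ) = a • (1, 0, 0) + b • (0, 1, 0) + c • (0, 0, 1) := by simp
  rw [this, map_add, map_add, map_smul, map_smul, map_smul]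
  simp [partialT, partialX, partialY]

lemma ContDiff.partialT {n m : WithTop ℕ∞} (hh : ContDiff ℝ n h) (hmn : m + 1 ≤ n) :
    ContDiff ℝ m (partialT h) :=
  (hh.fderiv_right hmn).clm_apply contDiff_const

lemma ContDiff.partialX {n m : WithTop ℕ∞} (hh : ContDiff ℝ n h) (hmn : m + 1 ≤ n) :
    ContDiff ℝ m (partialX h) :=
  (hh.fderiv_right hmn).clm_apply contDiff_const

lemma ContDiff.partialY {n m : WithTop ℕ∞} (hh : ContDiff ℝ n h) (hmn : m + 1 ≤ n) :
    ContDiff ℝ m (partialY h) :=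
  (hh.fderiv_right hmn).clm_apply contDiff_const

/-- Chain rule along a curve in the three variables. -/
lemma HasFDerivAt.comp_curve {t u y : ℝ → ℝ} {t' u' y' x : ℝ}
    (hh : DifferentiableAt ℝ h (t x, u x, y x)) (ht : HasDerivAt t t' x) (hu : HasDerivAt u u' x)
    (hy : HasDerivAt y y' x) : HasDerivAt (fun x => h (t x, u x, y x))
      (t' * _root_.partialT h (t x, u x, y x) + u' * _root_.partialX h (t x, u x, y x) +
        y' * _root_.partialY h (t x, u x, y x)) x := by
  have := hh.hasFDerivAt.comp_hasDerivAt x (f := fun x => (t x, u x, y x)) (ht.prodMk (hu.prodMk hy))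
  rwa [fderiv_apply_eq_partials] at this

lemma hasDerivAt_partialT (hh : Differentiable ℝ h) (t u y : ℝ) :
    HasDerivAt (fun t => h (t, u, y)) (partialT h (t, u, y)) t := by
  simpa using HasFDerivAt.comp_curve (hh _) (hasDerivAt_id t) (hasDerivAt_const t u)
    (hasDerivAt_const t y)

lemma hasDerivAt_partialX (hh : Differentiable ℝ h) (t u y : ℝ) :
    HasDerivAt (fun u => h (t, u, y)) (partialX h (t, u, y)) u := by
  simpa using HasFDerivAt.comp_curve (hh _) (hasDerivAt_const u t) (hasDerivAt_id u)
    (hasDerivAt_const u y)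

lemma hasDerivAt_partialY (hh : Differentiable ℝ h) (t u y : ℝ) :
    HasDerivAt (fun y => h (t, u, y)) (partialY h (t, u, y)) y := by
  simpa using HasFDerivAt.comp_curve (hh _) (hasDerivAt_const y t) (hasDerivAt_const y u)
    (hasDerivAt_id y)

lemma fderiv_fderiv_comm (hh : ContDiff ℝ 2 h) (v w : ℝ × ℝ × ℝ) :
    fderiv ℝ (fun q => fderiv ℝ h q v) p w = fderiv ℝ (fun q => fderiv ℝ h q w) p v := by
  have hd : DifferentiableAt ℝ (fderiv ℝ h) p :=
    ((hh.fderiv_right (m := 1) (by norm_num)).differentiable one_ne_zero) p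
  have hs := (hh.contDiffAt (x := p)).isSymmSndFDerivAt (by simp)
  have e : ∀ v w, fderiv ℝ (fun q => fderiv ℝ h q v) p w = fderiv ℝ (fderiv ℝ h) p w v := by
    intro v w
    rw [fderiv_clm_apply hd (differentiableAt_const _)]
    simp
  rw [e, e]; exact hs _ _

lemma partialX_partialT (hh : ContDiff ℝ 2 h) :
    partialX (partialT h) = partialT (partialX h) := funext fun _ => fderiv_fderiv_comm hh _ _

lemma partialY_partialT (hh : ContDiff ℝ 2 h) :
    partialY (partialT h) = partialT (partialY h) := funext fun _ => fderiv_fderiv_comm hh _ _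

lemma partialY_partialX (hh : ContDiff ℝ 2 h) :
    partialY (partialX h) = partialX (partialY h) := funext fun _ => fderiv_fderiv_comm hh _ _

end Partials

section Taylor

lemma exists_mem_uIoo_mean_value {f f' : ℝ → ℝ} (hf : ∀ x, HasDerivAt f (f' x) x) {a b : ℝ}
    (hab : a ≠ b) : ∃ c ∈ Set.uIoo a b, f b - f a = f' c * (b - a) := by
  wlog h : a < b generalizing a b with H
  · obtain ⟨c, hc, e⟩ := H hab.symm (lt_of_le_of_ne (not_lt.1 h) hab.symm)
    exact ⟨c, by rwa [uIoo_comm], by linarith⟩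
  · obtain ⟨c, hc, e⟩ := exists_hasDerivAt_eq_slope f f' h
      (fun x _ => (hf x).continuousAt.continuousWithinAt) (fun x _ => hf x)
    refine ⟨c, by rwa [uIoo_of_lt h], ?_⟩
    rw [e, div_mul_cancel₀ _ (sub_ne_zero.2 h.ne')]

lemma abs_sub_le_of_mem_uIoo {a b c : ℝ} (hc : c ∈ Set.uIoo a b) : |c - a| ≤ |b - a| := by
  rcases le_total a b with h | h
  · rw [uIoo_of_le h] at hc
    rw [abs_of_nonneg, abs_of_nonneg] <;> linarith [hc.1, hc.2]
  · rw [uIoo_of_ge h] at hc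
    rw [abs_of_nonpos, abs_of_nonpos] <;> linarith [hc.1, hc.2]

lemma exists_taylor_one {f f' : ℝ → ℝ} (hf : ∀ x, HasDerivAt f (f' x) x) (a b : ℝ) :
    ∃ c, |c - a| ≤ |b - a| ∧ f b = f a + f' c * (b - a) := by
  rcases eq_or_ne a b with rfl | hab
  · exact ⟨a, by simp, by simp⟩
  · obtain ⟨c, hc, e⟩ := exists_mem_uIoo_mean_value hf hab
    exact ⟨c, abs_sub_le_of_mem_uIoo hc, by linarith⟩

/-- If `g a = 0` and `g' c = k d * (c - a) ^ n` with `d` between, then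
`g b = k d * (b - a) ^ (n + 1) / (n + 1)` with `d` between. -/
lemma exists_taylor_succ {g g' k : ℝ → ℝ} {a : ℝ} {n : ℕ} (hg : ∀ x, HasDerivAt g (g' x) x)
    (h0 : g a = 0) (h : ∀ c, ∃ d, |d - a| ≤ |c - a| ∧ g' c = k d * (c - a) ^ n) (b : ℝ) :
    ∃ d, |d - a| ≤ |b - a| ∧ g b = k d * (b - a) ^ (n + 1) / (n + 1) := by
  rcases eq_or_ne a b with rfl | hab
  · exact ⟨a, le_rfl, by simp [h0]⟩
  have hba : b - a ≠ 0 := sub_ne_zero.2 hab.symm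
  obtain ⟨c, hc, e⟩ := exists_mem_uIoo_mean_value
    (f := fun x => g x * (b - a) ^ (n + 1) - g b * (x - a) ^ (n + 1))
    (fun x => ((hg x).mul_const _).sub ((((hasDerivAt_id x).sub_const a).pow (n + 1)).const_mul _))
    hab
  have hca : c - a ≠ 0 := sub_ne_zero.2 (by
    rintro rfl
    rw [uIoo, mem_Ioo, inf_lt_left, left_lt_sup] at hc
    exact (le_total c b).elim hc.1 hc.2)
  obtain ⟨d, hd, e'⟩ := h c
  refine ⟨d, hd.trans (abs_sub_le_of_mem_uIoo hc), ?_⟩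
  have h1 := mul_right_cancel₀ hba (e.symm.trans (by simp [h0] : _ = 0 * (b - a)))
  rw [eq_div_iff (by positivity)]
  refine mul_right_cancel₀ (pow_ne_zero n hca) ?_
  rw [e'] at h1
  push_cast at h1
  simp only [id] at h1
  linarith

lemma exists_taylor_two {f f' f'' : ℝ → ℝ} (hf : ∀ x, HasDerivAt f (f' x) x)
    (hf' : ∀ x, HasDerivAt f' (f'' x) x) (a b : ℝ) :
    ∃ c, |c - a| ≤ |b - a| ∧ f b = f a + f' a * (b - a) + f'' c * (b - a) ^ 2 / 2 := by
  obtain ⟨d, hd, e⟩ := exists_taylor_succ (a := a) (k := f'') (n := 1)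
    (fun x => ((hf x).sub_const (f a)).sub (((hasDerivAt_id x).sub_const a).const_mul (f' a)))
    (by simp) (fun c => by
      obtain ⟨d, hd, e⟩ := exists_taylor_one hf' a c
      exact ⟨d, hd, by rw [e]; ring⟩) b
  exact ⟨d, hd, by simp at e; norm_num at e; linarith⟩

lemma exists_taylor_three {f f' f'' f''' : ℝ → ℝ} (hf : ∀ x, HasDerivAt f (f' x) x)
    (hf' : ∀ x, HasDerivAt f' (f'' x) x) (hf'' : ∀ x, HasDerivAt f'' (f''' x) x) (a b : ℝ) :
    ∃ c, |c - a| ≤ |b - a| ∧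
      f b = f a + f' a * (b - a) + f'' a * (b - a) ^ 2 / 2 + f''' c * (b - a) ^ 3 / 6 := by
  have h1 := fun x : ℝ => (hasDerivAt_id x).sub_const a
  obtain ⟨d, hd, e⟩ := exists_taylor_succ (a := a) (k := fun x => f''' x / 2) (n := 2)
    (fun x => (((hf x).sub_const (f a)).sub ((h1 x).const_mul (f' a))).sub
      (((h1 x).pow 2).const_mul (f'' a / 2))) (by simp) (fun c => by
      obtain ⟨d, hd, e⟩ := exists_taylor_two hf' hf'' a c
      exact ⟨d, hd, by rw [e]; simp; ring⟩) b
  exact ⟨d, hd, by simp at e; norm_num at e; linarith⟩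

lemma exists_taylor_four {f f' f'' f''' f'''' : ℝ → ℝ} (hf : ∀ x, HasDerivAt f (f' x) x)
    (hf' : ∀ x, HasDerivAt f' (f'' x) x) (hf'' : ∀ x, HasDerivAt f'' (f''' x) x)
    (hf''' : ∀ x, HasDerivAt f''' (f'''' x) x) (a b : ℝ) :
    ∃ c, |c - a| ≤ |b - a| ∧ f b = f a + f' a * (b - a) + f'' a * (b - a) ^ 2 / 2 +
      f''' a * (b - a) ^ 3 / 6 + f'''' c * (b - a) ^ 4 / 24 := by
  have h1 := fun x : ℝ => (hasDerivAt_id x).sub_const a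
  obtain ⟨d, hd, e⟩ := exists_taylor_succ (a := a) (k := fun x => f'''' x / 6) (n := 3)
    (fun x => ((((hf x).sub_const (f a)).sub ((h1 x).const_mul (f' a))).sub
      (((h1 x).pow 2).const_mul (f'' a / 2))).sub (((h1 x).pow 3).const_mul (f''' a / 6)))
    (by simp) (fun c => by
      obtain ⟨d, hd, e⟩ := exists_taylor_three hf' hf'' hf''' a c
      exact ⟨d, hd, by rw [e]; simp; ring⟩) b
  exact ⟨d, hd, by simp at e; norm_num at e; linarith⟩

end Taylor

/-- A root `U p` of `X (t, u, y) = x`, `p = (t, x, y)`, selected uniquely by an open condition, is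
as smooth as the equation. -/
lemma exists_smooth_branch {X : ℝ × ℝ × ℝ → ℝ} (hX : ContDiff ℝ 1 X) {p₀ : ℝ × ℝ × ℝ}
    {U : ℝ × ℝ × ℝ → ℝ} {S : Set (ℝ × ℝ × ℝ)} {P : ℝ × ℝ × ℝ → ℝ → Prop}
    (hne : partialX X (p₀.1, U p₀, p₀.2.2) ≠ 0) (h0 : X (p₀.1, U p₀, p₀.2.2) = p₀.2.1)
    (hroot : ∀ᶠ p in 𝓝[S] p₀, ∀ u, P p u → X (p.1, u, p.2.2) = p.2.1 →
      P p (U p) ∧ X (p.1, U p, p.2.2) = p.2.1)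
    (huniq : ∀ᶠ p in 𝓝[S] p₀, ∀ u u', P p u → P p u' → X (p.1, u, p.2.2) = p.2.1 →
      X (p.1, u', p.2.2) = p.2.1 → u = u')
    (hopen : ∀ᶠ q in 𝓝 (p₀, U p₀), q.1 ∈ S → P q.1 q.2) :
    ∃ ψ : ℝ × ℝ × ℝ → ℝ, ContDiffAt ℝ 1 ψ p₀ ∧ ψ p₀ = U p₀ ∧ (∀ᶠ p in 𝓝[S] p₀, U p = ψ p) ∧
      ∀ v : ℝ × ℝ × ℝ, fderiv ℝ ψ p₀ v = -(partialX X (p₀.1, U p₀, p₀.2.2))⁻¹ *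
        (v.1 * partialT X (p₀.1, U p₀, p₀.2.2) - v.2.1 +
          v.2.2 * partialY X (p₀.1, U p₀, p₀.2.2)) := by
  set Φ : (ℝ × ℝ × ℝ) × ℝ → ℝ := fun q => X (q.1.1, q.2, q.1.2.2) - q.1.2.1 with hΦ
  have hX1 := hX.differentiable (by norm_num)
  have hΦ1 : ContDiff ℝ 1 Φ := by fun_prop
  have hlin : ∀ a b : ℝ, HasDerivAt (fun x : ℝ => a + x * b) b 0 := fun a b => by
    simpa using ((hasDerivAt_id (0 : ℝ)).mul_const b).const_add a
  have hΦu : fderiv ℝ Φ (p₀, U p₀) (0, 1) = partialX X (p₀.1, U p₀, p₀.2.2) := by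
    have h1 := HasFDerivAt.comp_hasDerivAt (f := fun u : ℝ => (p₀, u)) (U p₀)
      (hΦ1.differentiable (by norm_num) (p₀, U p₀)).hasFDerivAt
      ((hasDerivAt_const (U p₀) p₀).prodMk (hasDerivAt_id _))
    exact h1.unique ((hasDerivAt_partialX hX1 p₀.1 (U p₀) p₀.2.2).sub_const p₀.2.1)
  have hinv : (fderiv ℝ Φ (p₀, U p₀) ∘L ContinuousLinearMap.inr ℝ (ℝ × ℝ × ℝ) ℝ).IsInvertible := by
    refine ⟨ContinuousLinearEquiv.unitsEquivAut ℝ (Units.mk0 _ hne), ?_⟩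
    ext; simp [hΦu]
  have hΦ1' := hΦ1.contDiffAt (x := (p₀, U p₀))
  set ψ := hΦ1'.implicitFunction one_ne_zero hinv
  have hψc : ContDiffAt ℝ 1 ψ p₀ := hΦ1'.contDiffAt_implicitFunction one_ne_zero hinv
  have hψ0 : ψ p₀ = U p₀ := hΦ1'.implicitFunction_apply_self one_ne_zero hinv
  have hψr : ∀ᶠ p in 𝓝 p₀, X (p.1, ψ p, p.2.2) = p.2.1 := by
    simpa [hΦ, h0, sub_eq_zero] using hΦ1'.eventually_apply_implicitFunction one_ne_zero hinv
  refine ⟨ψ, hψc, hψ0, ?_, fun v => ?_⟩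
  · have ht : Tendsto (fun x => (x, ψ x)) (𝓝 p₀) (𝓝 (p₀, U p₀)) := by
      rw [← hψ0]; exact (continuousAt_id.prodMk hψc.continuousAt)
    filter_upwards [nhdsWithin_le_nhds hψr, hroot, huniq, nhdsWithin_le_nhds (ht.eventually hopen),
      self_mem_nhdsWithin] with p h1 h2 h3 h4 h5
    obtain ⟨h6, h7⟩ := h2 _ (h4 h5) h1
    exact h3 _ _ h6 (h4 h5) h7 h1
  · have hline : HasDerivAt (fun x : ℝ => p₀ + x • v) v 0 := by
      simpa using ((hasDerivAt_id (0 : ℝ)).smul_const v).const_add p₀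
    have hψv : HasDerivAt (fun x : ℝ => ψ (p₀ + x • v)) (fderiv ℝ ψ p₀ v) 0 :=
      HasFDerivAt.comp_hasDerivAt (0 : ℝ) (by
        rw [zero_smul, add_zero]
        exact (hψc.differentiableAt one_ne_zero).hasFDerivAt) hline
    have h1 := HasFDerivAt.comp_curve (h := X) (x := 0) (hX1 _) (hlin p₀.1 v.1) hψv
      (hlin p₀.2.2 v.2.2)
    have hev : ∀ᶠ x : ℝ in 𝓝 0, X ((p₀ + x • v).1, ψ (p₀ + x • v), (p₀ + x • v).2.2) =
        (p₀ + x • v).2.1 := (hline.continuousAt.tendsto.eventually (by simpa using hψr))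
    have h2 := h1.unique ((hlin p₀.2.1 v.2.1).congr_of_eventuallyEq hev)
    simp only [zero_smul, zero_mul, add_zero, hψ0] at h2
    field_simp
    linarith

/-- A family of functions `u ↦ D(τ,u,y)` with a cusp at `τ = 0`, `u = s y`, for all `y`, together
with the coefficients `Fh`, `Gh` of a transport equation `k_τ + Gh k_y = Fh` for the shock. -/
structure FlatCusp (D : ℝ × ℝ × ℝ → ℝ) (s A : ℝ → ℝ) (Fh Gh : ℝ × ℝ × ℝ → ℝ) (α β e : ℝ) :
    Prop where
  D3 : ContDiff ℝ 3 D
  Du3 : ContDiff ℝ 3 (partialX D)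
  s1 : ContDiff ℝ 1 s
  A2 : ContDiff ℝ 2 A
  Fh2 : ContDiff ℝ 2 Fh
  Gh2 : ContDiff ℝ 2 Gh
  Fsymm : ∀ a b y, Fh (a, b, y) = Fh (b, a, y)
  zero : ∀ y, D (0, s y, y) = 0
  zeroX : ∀ y, partialX D (0, s y, y) = 0
  zeroXX : ∀ y, partialX (partialX D) (0, s y, y) = 0
  slope : ∀ y, partialT D (0, s y, y) = A y
  Fdiag : ∀ y, Fh (s y, s y, y) = A y
  Fdiag' : ∀ y, partialT Fh (s y, s y, y) + partialX Fh (s y, s y, y) =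
    partialT (partialX D) (0, s y, y)
  α_pos : 0 < α
  β_pos : 0 < β
  e_pos : 0 < e
  boundTX : ∀ τ u y, |τ| ≤ e → |u - s y| ≤ e → |partialT (partialX D) (τ, u, y) - α| ≤ α / 100
  boundXXX : ∀ τ u y, |τ| ≤ e → |u - s y| ≤ e →
    |partialX (partialX (partialX D)) (τ, u, y) + β| ≤ β / 100

/-- `u` lies beyond the fold at `(τ, y)`, on the side `σ = ±1` of `s y`. -/
def IsOuter (s : ℝ → ℝ) (γ e σ τ y u : ℝ) : Prop :=
  0 < σ * (u - s y) ∧ |u - s y| < e ∧ 4 * γ * τ < (u - s y) ^ 2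

open Classical in
/-- The outer root of `D(τ,u,y) = k` on the side `σ`, at `p = (τ,k,y)`. -/
def outerRoot (D : ℝ × ℝ × ℝ → ℝ) (s : ℝ → ℝ) (γ e σ : ℝ) (p : ℝ × ℝ × ℝ) : ℝ :=
  if h : 0 < p.1 ∧ ∃ u, IsOuter s γ e σ p.1 p.2.2 u ∧ D (p.1, u, p.2.2) = p.2.1 then h.2.choose
  else s p.2.2

lemma isOuter_between {s : ℝ → ℝ} {γ e σ τ y u u' c : ℝ} (h : IsOuter s γ e σ τ y u)
    (h' : IsOuter s γ e σ τ y u') (hc : c ∈ uIcc u u') : IsOuter s γ e σ τ y c := by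
  wlog hle : u ≤ u' generalizing u u' with H
  · exact H h' h (by rwa [uIcc_comm]) (le_of_not_ge hle)
  rw [uIcc_of_le hle] at hc
  obtain ⟨h1, h2, h3⟩ := h
  obtain ⟨h1', h2', h3'⟩ := h'
  have hs : 0 < σ * (c - s y) := by
    rcases lt_trichotomy σ 0 with hσ | hσ | hσ
    · have : u' - s y < 0 := by nlinarith
      nlinarith [hc.2]
    · simp [hσ] at h1
    · have : 0 < u - s y := by
        by_contra hcon
        nlinarith
      nlinarith [hc.1]
  refine ⟨hs, ?_, ?_⟩
  · rw [abs_lt] at *; constructor <;> linarith [hc.1, hc.2]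
  · rcases lt_trichotomy σ 0 with hσ | hσ | hσ
    · have h4 : u' - s y < 0 := by nlinarith
      nlinarith [hc.2]
    · simp [hσ] at h1
    · have h4 : 0 < u - s y := by
        by_contra hcon
        nlinarith
      nlinarith [hc.1]

lemma isOpen_isOuter {s : ℝ → ℝ} (hs : Continuous s) (γ e σ : ℝ) :
    IsOpen {q : ℝ × ℝ × ℝ | IsOuter s γ e σ q.1 q.2.1 q.2.2} := by
  have : {q : ℝ × ℝ × ℝ | IsOuter s γ e σ q.1 q.2.1 q.2.2} =
      {q | 0 < σ * (q.2.2 - s q.2.1)} ∩ ({q | |q.2.2 - s q.2.1| < e} ∩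
        {q | 4 * γ * q.1 < (q.2.2 - s q.2.1) ^ 2}) := rfl
  rw [this]
  refine (isOpen_lt ?_ ?_).inter ((isOpen_lt ?_ ?_).inter (isOpen_lt ?_ ?_)) <;> fun_prop

namespace FlatCusp

variable {D : ℝ × ℝ × ℝ → ℝ} {s A : ℝ → ℝ} {Fh Gh : ℝ × ℝ × ℝ → ℝ} {α β e : ℝ}
  (C : FlatCusp D s A Fh Gh α β e)
include C

lemma contTX : ContDiff ℝ 2 (partialT (partialX D)) := C.Du3.partialT (by norm_num)
lemma contXX : ContDiff ℝ 2 (partialX (partialX D)) := C.Du3.partialX (by norm_num)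
lemma contXXX : ContDiff ℝ 1 (partialX (partialX (partialX D))) := C.contXX.partialX (by norm_num)
lemma contT : ContDiff ℝ 2 (partialT D) := C.D3.partialT (by norm_num)
lemma contY : ContDiff ℝ 2 (partialY D) := C.D3.partialY (by norm_num)
lemma contTT : ContDiff ℝ 1 (partialT (partialT D)) := C.contT.partialT (by norm_num)
lemma diffD : Differentiable ℝ D := C.D3.differentiable (by norm_num)
lemma diffX : Differentiable ℝ (partialX D) := C.Du3.differentiable (by norm_num)
lemma diffXX : Differentiable ℝ (partialX (partialX D)) := C.contXX.differentiable (by norm_num)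
lemma diffT : Differentiable ℝ (partialT D) := C.contT.differentiable (by norm_num)
lemma diffY : Differentiable ℝ (partialY D) := C.contY.differentiable (by norm_num)
lemma diffs : Differentiable ℝ s := C.s1.differentiable (by norm_num)

lemma partialX_partialT : partialX (partialT D) = partialT (partialX D) :=
  _root_.partialX_partialT (C.D3.of_le (by norm_num))

lemma taylorX (τ u y : ℝ) : ∃ τ₁ u₂, |τ₁| ≤ |τ| ∧ |u₂ - s y| ≤ |u - s y| ∧
    partialX D (τ, u, y) = τ * partialT (partialX D) (τ₁, u, y) +
      partialX (partialX (partialX D)) (0, u₂, y) * (u - s y) ^ 2 / 2 := by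
  obtain ⟨τ₁, h1, e1⟩ := exists_taylor_one (fun t => hasDerivAt_partialT C.diffX t u y) 0 τ
  obtain ⟨u₂, h2, e2⟩ := exists_taylor_two (fun u => hasDerivAt_partialX C.diffX 0 u y)
    (fun u => hasDerivAt_partialX C.diffXX 0 u y) (s y) u
  refine ⟨τ₁, u₂, by simpa using h1, h2, ?_⟩
  rw [e1, e2, C.zeroX, C.zeroXX]; ring

lemma taylorD (τ u y : ℝ) : ∃ τ₁ u₂ u₃, |τ₁| ≤ |τ| ∧ |u₂ - s y| ≤ |u - s y| ∧
    |u₃ - s y| ≤ |u - s y| ∧ D (τ, u, y) = A y * τ + partialT (partialT D) (τ₁, u, y) * τ ^ 2 / 2 +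
      τ * (u - s y) * partialT (partialX D) (0, u₂, y) +
      partialX (partialX (partialX D)) (0, u₃, y) * (u - s y) ^ 3 / 6 := by
  obtain ⟨τ₁, h1, e1⟩ := exists_taylor_two (fun t => hasDerivAt_partialT C.diffD t u y)
    (fun t => hasDerivAt_partialT C.diffT t u y) 0 τ
  obtain ⟨u₂, h2, e2⟩ := exists_taylor_one (fun u => hasDerivAt_partialX C.diffT 0 u y) (s y) u
  obtain ⟨u₃, h3, e3⟩ := exists_taylor_three (fun u => hasDerivAt_partialX C.diffD 0 u y)
    (fun u => hasDerivAt_partialX C.diffX 0 u y) (fun u => hasDerivAt_partialX C.diffXX 0 u y)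
    (s y) u
  refine ⟨τ₁, u₂, u₃, by simpa using h1, h2, h3, ?_⟩
  rw [e1, e2, e3, C.zero, C.zeroX, C.zeroXX, C.slope, C.partialX_partialT]; ring

lemma le_TX {τ u y : ℝ} (hτ : |τ| ≤ e) (hu : |u - s y| ≤ e) :
    99 / 100 * α ≤ partialT (partialX D) (τ, u, y) ∧
      partialT (partialX D) (τ, u, y) ≤ 101 / 100 * α := by
  have := abs_le.1 (C.boundTX τ u y hτ hu)
  constructor <;> linarith [this.1, this.2]

lemma le_XXX {τ u y : ℝ} (hτ : |τ| ≤ e) (hu : |u - s y| ≤ e) :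
    99 / 100 * β ≤ -partialX (partialX (partialX D)) (τ, u, y) ∧
      -partialX (partialX (partialX D)) (τ, u, y) ≤ 101 / 100 * β := by
  have := abs_le.1 (C.boundXXX τ u y hτ hu)
  constructor <;> linarith [this.1, this.2]

lemma X_le {τ u y : ℝ} (hτ : |τ| ≤ e) (hu : |u - s y| ≤ e)
    (h : 4 * (α / β) * τ ≤ (u - s y) ^ 2) :
    partialX D (τ, u, y) ≤ -(α / 2 * |τ| + β / 10 * (u - s y) ^ 2) := by
  obtain ⟨τ₁, u₂, h1, h2, e1⟩ := C.taylorX τ u y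
  have hα := C.α_pos
  have hβ := C.β_pos
  obtain ⟨a1, a2⟩ := C.le_TX (h1.trans hτ) hu
  obtain ⟨b1, b2⟩ := C.le_XXX (τ := 0) (by simpa using C.e_pos.le) (h2.trans hu)
  have h' : 4 * (α * τ) ≤ β * (u - s y) ^ 2 := by
    have := mul_le_mul_of_nonneg_left h hβ.le
    calc 4 * (α * τ) = β * (4 * (α / β) * τ) := by field_simp
      _ ≤ _ := this
  rw [e1]
  have hb := mul_le_mul_of_nonneg_right b1 (sq_nonneg (u - s y))
  rcases le_total 0 τ with ht | ht
  · rw [abs_of_nonneg ht]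
    have := mul_le_mul_of_nonneg_left a2 ht
    nlinarith
  · rw [abs_of_nonpos ht]
    have := mul_le_mul_of_nonpos_left a1 ht
    nlinarith [mul_nonneg hα.le (neg_nonneg.2 ht), mul_nonneg hβ.le (sq_nonneg (u - s y))]

lemma X_neg {τ u y : ℝ} (hτ : |τ| ≤ e) (hu : |u - s y| ≤ e)
    (h : 4 * (α / β) * τ ≤ (u - s y) ^ 2) (hne : τ ≠ 0 ∨ u ≠ s y) : partialX D (τ, u, y) < 0 := by
  have := C.X_le hτ hu h
  have hα := C.α_pos
  have hβ := C.β_pos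
  have : 0 < α / 2 * |τ| + β / 10 * (u - s y) ^ 2 := by
    rcases hne with h | h
    · positivity
    · have := sub_ne_zero.2 h; positivity
  linarith

lemma outer_ne {σ τ y u : ℝ} (h : IsOuter s (α / β) e σ τ y u) : u ≠ s y := by
  rintro rfl
  simpa using h.1

lemma outer_X_neg {σ τ y u : ℝ} (hτ : |τ| ≤ e) (h : IsOuter s (α / β) e σ τ y u) :
    partialX D (τ, u, y) < 0 := C.X_neg hτ h.2.1.le h.2.2.le (Or.inr (C.outer_ne h))

lemma outer_unique {σ τ y u u' : ℝ} (hτ : |τ| ≤ e) (h : IsOuter s (α / β) e σ τ y u)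
    (h' : IsOuter s (α / β) e σ τ y u') (heq : D (τ, u, y) = D (τ, u', y)) : u = u' := by
  by_contra hne
  obtain ⟨c, hc, e1⟩ := exists_mem_uIoo_mean_value
    (fun u => hasDerivAt_partialX C.diffD τ u y) hne
  have := C.outer_X_neg hτ (isOuter_between h h' (uIoo_subset_uIcc_self hc))
  rw [heq, sub_self] at e1
  rcases mul_eq_zero.1 e1.symm with h0 | h0
  · exact this.ne h0
  · exact hne (sub_eq_zero.1 h0).symm

lemma outerRoot_eq {σ τ k y u : ℝ} (hτ0 : 0 < τ) (hτ : τ ≤ e)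
    (h : IsOuter s (α / β) e σ τ y u) (hk : D (τ, u, y) = k) :
    outerRoot D s (α / β) e σ (τ, k, y) = u := by
  have hex : 0 < τ ∧ ∃ u, IsOuter s (α / β) e σ τ y u ∧ D (τ, u, y) = k := ⟨hτ0, u, h, hk⟩
  have e1 : outerRoot D s (α / β) e σ (τ, k, y) = hex.2.choose := dif_pos hex
  have hspec := hex.2.choose_spec
  rw [e1]
  exact C.outer_unique (by rwa [abs_of_pos hτ0]) hspec.1 h (hspec.2.trans hk.symm)

lemma exists_bound {h : ℝ × ℝ × ℝ → ℝ} (hh : Continuous h) (R : ℝ) :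
    ∃ K, 0 ≤ K ∧ ∀ τ u y, |τ| ≤ e → |u - s y| ≤ e → |y| ≤ R → |h (τ, u, y)| ≤ K := by
  have hs := C.s1.continuous
  have hc : Continuous fun q : ℝ × ℝ × ℝ => h (q.1, s q.2.2 + q.2.1, q.2.2) := by fun_prop
  obtain ⟨K, hK⟩ := ((isCompact_Icc (a := -e) (b := e)).prod ((isCompact_Icc (a := -e)
    (b := e)).prod (isCompact_Icc (a := -R) (b := R)))).exists_bound_of_continuousOn hc.continuousOn
  refine ⟨max K 0, le_max_right _ _, fun τ u y h1 h2 h3 => ?_⟩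
  have := hK (τ, u - s y, y) ⟨abs_le.1 h1, abs_le.1 h2, abs_le.1 h3⟩
  simp only [add_sub_cancel] at this
  exact this.trans (le_max_left _ _)

set_option maxHeartbeats 1000000 in
/-- For small `τ > 0` and `k = τ (A y + w)`, `w = O(τ)`, the outer roots exist, and they are at
distance `√τ` from `s y`. -/
lemma exists_outer_roots (R M : ℝ) (hM : 0 ≤ M) : ∃ τ₀, 0 < τ₀ ∧ τ₀ ≤ e ∧
    ∀ σ, (σ = 1 ∨ σ = -1) → ∀ τ w y, 0 < τ → τ ≤ τ₀ → |y| ≤ R → |w| ≤ M * τ →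
      (∃ u, IsOuter s (α / β) e σ τ y u ∧ D (τ, u, y) = τ * (A y + w)) ∧
      ∀ u, IsOuter s (α / β) e σ τ y u → D (τ, u, y) = τ * (A y + w) →
        (u - s y) ^ 2 ≤ 9 * (α / β) * τ := by
  have hα := C.α_pos
  have hβ := C.β_pos
  have he := C.e_pos
  obtain ⟨K, hK0, hK⟩ := C.exists_bound C.contTT.continuous R
  set q₀ := min (e / 4) (α ^ 2 / (3 * β * (K + M + 1))) with hq₀
  have hq₀pos : 0 < q₀ := by positivity
  refine ⟨min e (q₀ ^ 2 * β / α), by positivity, min_le_left _ _, ?_⟩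
  intro σ hσ τ w y hτ hττ hy hw
  have hσ2 : σ * σ = 1 := by rcases hσ with rfl | rfl <;> norm_num
  have hσa : |σ| = 1 := by rcases hσ with rfl | rfl <;> simp
  have hτe : |τ| ≤ e := by rw [abs_of_pos hτ]; exact hττ.trans (min_le_left _ _)
  set q := Real.sqrt (α / β * τ) with hq
  have hqpos : 0 < q := Real.sqrt_pos.2 (by positivity)
  have hqsq : q ^ 2 = α / β * τ := Real.sq_sqrt (by positivity)
  have hqτ : β * q ^ 2 = α * τ := by rw [hqsq]; field_simp
  have hqq : q ≤ q₀ := by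
    have h1 := hττ.trans (min_le_right _ _)
    rw [le_div_iff₀ hα] at h1
    have : q ^ 2 ≤ q₀ ^ 2 := by
      have : β * q ^ 2 ≤ β * q₀ ^ 2 := by rw [hqτ]; linarith
      exact le_of_mul_le_mul_left this hβ
    exact (pow_le_pow_iff_left₀ hqpos.le hq₀pos.le two_ne_zero).1 this
  have hqe : q ≤ e / 4 := hqq.trans (min_le_left _ _)
  have hqK : (K + M) * τ ^ 2 ≤ β * q ^ 3 / 3 := by
    have h1 : q ≤ α ^ 2 / (3 * β * (K + M + 1)) := hqq.trans (min_le_right _ _)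
    rw [le_div_iff₀ (by positivity)] at h1
    have h2 : α ^ 2 * τ ^ 2 = β ^ 2 * q ^ 4 := by
      have : (α * τ) ^ 2 = (β * q ^ 2) ^ 2 := by rw [hqτ]
      nlinarith
    have h3 : α ^ 2 * ((K + M) * τ ^ 2) ≤ α ^ 2 * (β * q ^ 3 / 3) := by
      calc α ^ 2 * ((K + M) * τ ^ 2) = (K + M) * (β ^ 2 * q ^ 4) := by rw [← h2]; ring
        _ ≤ (K + M + 1) * (β ^ 2 * q ^ 4) := by
          have : 0 ≤ β ^ 2 * q ^ 4 := by positivity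
          nlinarith
        _ = (q * (3 * β * (K + M + 1))) * (β * q ^ 3 / 3) := by ring
        _ ≤ α ^ 2 * (β * q ^ 3 / 3) := mul_le_mul_of_nonneg_right h1 (by positivity)
    exact le_of_mul_le_mul_left h3 (by positivity)
  have key : ∀ r, 0 < r → r ≤ e → ∃ a b err : ℝ, 99 / 100 * α ≤ a ∧ a ≤ 101 / 100 * α ∧
      99 / 100 * β ≤ b ∧ b ≤ 101 / 100 * β ∧ |err| ≤ β * q ^ 3 / 3 ∧
      σ * (D (τ, s y + σ * r, y) - τ * (A y + w)) = r * (a * τ - b * r ^ 2 / 6) + err := by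
    intro r hr hre
    have hab : |s y + σ * r - s y| = r := by
      rw [add_sub_cancel_left, abs_mul, hσa, one_mul, abs_of_pos hr]
    obtain ⟨τ₁, u₂, u₃, h1, h2, h3, eq⟩ := C.taylorD τ (s y + σ * r) y
    rw [hab] at h2 h3
    obtain ⟨a1, a2⟩ := C.le_TX (τ := 0) (by simpa using he.le) (h2.trans hre)
    obtain ⟨b1, b2⟩ := C.le_XXX (τ := 0) (by simpa using he.le) (h3.trans hre)
    have hKb := hK τ₁ (s y + σ * r) y (h1.trans hτe) (by rwa [hab]) hy
    refine ⟨_, _, σ * (partialT (partialT D) (τ₁, s y + σ * r, y) * τ ^ 2 / 2 - τ * w),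
      a1, a2, b1, b2, ?_, ?_⟩
    · rw [abs_mul, hσa, one_mul]
      refine (abs_sub _ _).trans (le_trans ?_ hqK)
      rw [abs_div, abs_mul, abs_mul, abs_of_pos hτ, abs_pow, abs_of_pos hτ]
      have e1 := mul_le_mul_of_nonneg_right hKb (sq_nonneg τ)
      have e2 := mul_le_mul_of_nonneg_left hw hτ.le
      simp only [abs_two]
      nlinarith [sq_nonneg τ, mul_nonneg hK0 (sq_nonneg τ)]
    · rw [eq, add_sub_cancel_left]
      have h3 : σ ^ 3 = σ := by rw [pow_succ, pow_two, hσ2, one_mul]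
      have h4 : σ ^ 4 = 1 := by rw [pow_succ, h3, hσ2]
      ring_nf
      rw [h4, show σ ^ 2 = 1 by rw [pow_two, hσ2]]
      ring
  have hq3 : 0 < β * q ^ 3 := by positivity
  have neg : ∀ r, 3 * q ≤ r → r ≤ e → σ * (D (τ, s y + σ * r, y) - τ * (A y + w)) < 0 := by
    intro r hr hre
    have hr0 : 0 < r := by linarith
    obtain ⟨a, b, err, -, h2, h3, -, h5, eq⟩ := key r hr0 hre
    rw [eq]
    have h6 : a * τ ≤ 101 / 100 * (β * q ^ 2) := by
      rw [hqτ, ← mul_assoc]; exact mul_le_mul_of_nonneg_right h2 hτ.le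
    have h7 := mul_le_mul_of_nonneg_right h3 (sq_nonneg r)
    have h8 : a * τ - b * r ^ 2 / 6 ≤ -(47 / 100 * (β * q ^ 2)) := by
      have : 0 ≤ β * q ^ 2 := by positivity
      have := mul_le_mul_of_nonneg_left (pow_le_pow_left₀ (by positivity) hr 2) hβ.le
      linarith
    have h9 := mul_le_mul_of_nonneg_left h8 hr0.le
    have h10 := (abs_le.1 h5).2
    have h11 := mul_le_mul_of_nonneg_right hr (show 0 ≤ 47 / 100 * (β * q ^ 2) by positivity)
    linarith
  constructor
  · have hcont : ContinuousOn (fun r => σ * (D (τ, s y + σ * r, y) - τ * (A y + w)))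
        (Icc (11 / 5 * q) (3 * q)) := by
      have := C.D3.continuous
      fun_prop
    have hlow : 0 < σ * (D (τ, s y + σ * (11 / 5 * q), y) - τ * (A y + w)) := by
      obtain ⟨a, b, err, h1, h2, h3, h4, h5, eq⟩ := key (11 / 5 * q) (by positivity) (by linarith)
      rw [eq]
      have h6 : 99 / 100 * (β * q ^ 2) ≤ a * τ := by
        rw [hqτ, ← mul_assoc]; exact mul_le_mul_of_nonneg_right h1 hτ.le
      have h7 : b * (11 / 5 * q) ^ 2 / 6 ≤ 101 / 100 * β * (11 / 5 * q) ^ 2 / 6 := by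
        have := mul_le_mul_of_nonneg_right h4 (sq_nonneg (11 / 5 * q)); linarith
      have h8 : 17 / 100 * (β * q ^ 2) ≤ a * τ - b * (11 / 5 * q) ^ 2 / 6 := by
        have : 0 ≤ β * q ^ 2 := by positivity
        linarith
      have h9 := mul_le_mul_of_nonneg_left h8 (show (0 : ℝ) ≤ 11 / 5 * q by positivity)
      have h10 := (abs_le.1 h5).1
      linarith
    obtain ⟨r, hr, hr0⟩ := intermediate_value_Icc' (by linarith) hcont (show (0 : ℝ) ∈ Icc _ _ from
      ⟨(neg _ le_rfl (by linarith)).le, hlow.le⟩)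
    have hrpos : 0 < r := by linarith [hr.1]
    have hD : D (τ, s y + σ * r, y) = τ * (A y + w) := by
      have := congrArg (fun x => σ * x) hr0
      simp only [← mul_assoc, hσ2, mul_zero, one_mul] at this
      linarith
    refine ⟨s y + σ * r, ⟨?_, ?_, ?_⟩, hD⟩
    · rw [add_sub_cancel_left, ← mul_assoc, hσ2, one_mul]; exact hrpos
    · rw [add_sub_cancel_left, abs_mul, hσa, one_mul, abs_of_pos hrpos]; linarith [hr.2]
    · rw [add_sub_cancel_left, mul_pow, pow_two σ, hσ2, one_mul]
      have h1 : (11 / 5 * q) ^ 2 ≤ r ^ 2 := pow_le_pow_left₀ (by positivity) hr.1 2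
      have h2 : 0 < q ^ 2 := by positivity
      nlinarith
  · intro u hu hD
    by_contra hcon
    push Not at hcon
    set r := σ * (u - s y) with hr
    have hur : u = s y + σ * r := by rw [hr, ← mul_assoc, hσ2]; ring
    have hrpos : 0 < r := hu.1
    have hre : r ≤ e := by
      have h1 : |r| = |u - s y| := by rw [hr, abs_mul, hσa, one_mul]
      have := hu.2.1.le
      rwa [← h1, abs_of_pos hrpos] at this
    have hr2 : (u - s y) ^ 2 = r ^ 2 := by rw [hr, mul_pow, pow_two σ, hσ2, one_mul]
    have h1 := neg r ((pow_le_pow_iff_left₀ (by positivity) hrpos.le two_ne_zero).1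
      (by rw [mul_pow, hqsq, ← hr2]; linarith)) hre
    rw [← hur, hD, sub_self, mul_zero] at h1
    exact h1.false

/-- Outer roots depend smoothly on `(τ,k,y)`. -/
lemma outerRoot_smooth {σ τ k y u : ℝ} (hτ0 : 0 < τ) (hτ : τ < e)
    (h : IsOuter s (α / β) e σ τ y u) (hk : D (τ, u, y) = k) :
    ContDiffAt ℝ 1 (outerRoot D s (α / β) e σ) (τ, k, y) ∧
    HasFDerivAt (outerRoot D s (α / β) e σ)
      ((partialX D (τ, u, y))⁻¹ • ((ContinuousLinearMap.fst ℝ ℝ ℝ).comp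
        (ContinuousLinearMap.snd ℝ ℝ (ℝ × ℝ)) -
        partialT D (τ, u, y) • ContinuousLinearMap.fst ℝ ℝ (ℝ × ℝ) -
        partialY D (τ, u, y) • (ContinuousLinearMap.snd ℝ ℝ ℝ).comp
        (ContinuousLinearMap.snd ℝ ℝ (ℝ × ℝ)))) (τ, k, y) := by
  have hroot := C.outerRoot_eq hτ0 hτ.le h hk
  have hX := C.outer_X_neg (by rw [abs_of_pos hτ0]; exact hτ.le) h
  have hsc := C.s1.continuous
  obtain ⟨ψ, h1, h2, h3, h4⟩ := exists_smooth_branch (C.D3.of_le (by norm_num))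
    (U := outerRoot D s (α / β) e σ) (p₀ := (τ, k, y)) (S := univ)
    (P := fun p u => (0 < p.1 ∧ p.1 < e) ∧ IsOuter s (α / β) e σ p.1 p.2.2 u)
    (by rw [hroot]; exact hX.ne) (by rw [hroot]; exact hk)
    (Eventually.of_forall fun p u hu hp => by
      rw [C.outerRoot_eq hu.1.1 hu.1.2.le hu.2 hp]
      exact ⟨hu, hp⟩)
    (Eventually.of_forall fun p u u' hu hu' h1 h2 =>
      C.outer_unique (by rw [abs_of_pos hu.1.1]; exact hu.1.2.le) hu.2 hu'.2 (h1.trans h2.symm))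
    (by
      rw [hroot]
      have ho : IsOpen {q : (ℝ × ℝ × ℝ) × ℝ | (0 < q.1.1 ∧ q.1.1 < e) ∧
          IsOuter s (α / β) e σ q.1.1 q.1.2.2 q.2} :=
        (isOpen_Ioo.preimage (f := fun q : (ℝ × ℝ × ℝ) × ℝ => q.1.1) (by fun_prop)).inter
          ((isOpen_isOuter hsc (α / β) e σ).preimage
          (f := fun q : (ℝ × ℝ × ℝ) × ℝ => ((q.1.1, q.1.2.2, q.2) : ℝ × ℝ × ℝ)) (by fun_prop))
      filter_upwards [ho.mem_nhds (show ((τ, k, y), u) ∈ _ from ⟨⟨hτ0, hτ⟩, h⟩)] with q hq _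
      exact hq)
  rw [nhdsWithin_univ] at h3
  refine ⟨h1.congr_of_eventuallyEq h3, ((h1.differentiableAt one_ne_zero).hasFDerivAt
    |>.congr_of_eventuallyEq h3).congr_fderiv (ContinuousLinearMap.ext fun v => ?_)⟩
  rw [h4, hroot]
  simp only [smul_apply, ContinuousLinearMap.comp_apply, sub_apply, smul_eq_mul,
    ContinuousLinearMap.coe_fst', ContinuousLinearMap.coe_snd']
  ring

end FlatCusp

/-- A family of outer roots approaching the cusp at `ybar`. -/
structure RootFamily {ι : Type*} (D : ℝ × ℝ × ℝ → ℝ) (s A : ℝ → ℝ) (γ e M : ℝ) (l : Filter ι)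
    (ybar σ : ℝ) (τ w y u : ι → ℝ) : Prop where
  τ_lim : Tendsto τ l (𝓝[>] 0)
  y_lim : Tendsto y l (𝓝 ybar)
  w_le : ∀ᶠ i in l, |w i| ≤ M * τ i
  side : σ = 1 ∨ σ = -1
  outer : ∀ᶠ i in l, IsOuter s γ e σ (τ i) (y i) (u i)
  eq : ∀ᶠ i in l, D (τ i, u i, y i) = τ i * (A (y i) + w i)
  upper : ∀ᶠ i in l, (u i - s (y i)) ^ 2 ≤ 9 * γ * τ i

/-- The limit of `(u - s)² / τ` along outer roots. -/
def rootCoeff (D : ℝ × ℝ × ℝ → ℝ) (s : ℝ → ℝ) (y : ℝ) : ℝ :=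
  6 * partialT (partialX D) (0, s y, y) / -partialX (partialX (partialX D)) (0, s y, y)

namespace FlatCusp

variable {D : ℝ × ℝ × ℝ → ℝ} {s A : ℝ → ℝ} {Fh Gh : ℝ × ℝ × ℝ → ℝ} {α β e M : ℝ}
  (C : FlatCusp D s A Fh Gh α β e)
include C

lemma slopeX_pos (y : ℝ) : 0 < partialT (partialX D) (0, s y, y) := by
  have := (C.le_TX (τ := 0) (u := s y) (y := y) (by simpa using C.e_pos.le)
    (by simpa using C.e_pos.le)).1
  have := C.α_pos
  linarith

lemma XXX_neg (y : ℝ) : partialX (partialX (partialX D)) (0, s y, y) < 0 := by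
  have := (C.le_XXX (τ := 0) (u := s y) (y := y) (by simpa using C.e_pos.le)
    (by simpa using C.e_pos.le)).1
  have := C.β_pos
  linarith

lemma rootCoeff_pos (y : ℝ) : 0 < rootCoeff D s y := by
  have := C.slopeX_pos y
  have := C.XXX_neg y
  exact div_pos (by linarith) (by linarith)

lemma XXX_mul_rootCoeff (y : ℝ) : partialX (partialX (partialX D)) (0, s y, y) * rootCoeff D s y =
    -6 * partialT (partialX D) (0, s y, y) := by
  have := (C.XXX_neg y).ne
  rw [rootCoeff]; field_simp

lemma diffXXX : Differentiable ℝ (partialX (partialX (partialX D))) :=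
  C.contXXX.differentiable (by norm_num)

lemma γ_pos : 0 < α / β := div_pos C.α_pos C.β_pos

variable {ι : Type*} {l : Filter ι} {ybar σ : ℝ} {τ w y u : ι → ℝ}
  (R : RootFamily D s A (α / β) e M l ybar σ τ w y u)
include R

lemma τ_pos : ∀ᶠ i in l, 0 < τ i := (tendsto_nhdsWithin_iff.1 R.τ_lim).2

lemma τ_lim : Tendsto τ l (𝓝 0) := (tendsto_nhdsWithin_iff.1 R.τ_lim).1

lemma sqrt_lim : Tendsto (fun i => Real.sqrt (τ i)) l (𝓝 0) := by
  have := (Real.continuous_sqrt.tendsto 0).comp (C.τ_lim R)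
  rwa [Real.sqrt_zero] at this

lemma s_lim : Tendsto (fun i => s (y i)) l (𝓝 (s ybar)) :=
  (C.s1.continuous.tendsto _).comp R.y_lim

lemma ratio_bdd : ∀ᶠ i in l, |(u i - s (y i)) / Real.sqrt (τ i)| ≤ Real.sqrt (9 * (α / β)) := by
  filter_upwards [C.τ_pos R, R.upper] with i h0 h
  refine Real.abs_le_sqrt ?_
  rw [div_pow, Real.sq_sqrt h0.le, div_le_iff₀ h0]
  exact h

lemma v_lim : Tendsto (fun i => u i - s (y i)) l (𝓝 0) := by
  have h1 : Tendsto (fun i => Real.sqrt (9 * (α / β)) * Real.sqrt (τ i)) l (𝓝 0) := by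
    simpa using (C.sqrt_lim R).const_mul _
  refine squeeze_zero_norm' ?_ h1
  filter_upwards [C.τ_pos R, C.ratio_bdd R] with i h0 h
  have : 0 < Real.sqrt (τ i) := Real.sqrt_pos.2 h0
  rw [abs_div, abs_of_pos this, div_le_iff₀ this] at h
  exact h

lemma u_lim : Tendsto u l (𝓝 (s ybar)) := by
  have := (C.v_lim R).add (C.s_lim R)
  simpa using this

/-- Values at intermediate points converge to the value on the cusp. -/
lemma tendsto_mid {h : ℝ × ℝ × ℝ → ℝ} (hh : Continuous h) {τ₁ u₁ : ι → ℝ}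
    (h1 : ∀ i, |τ₁ i| ≤ |τ i|) (h2 : ∀ i, |u₁ i - s (y i)| ≤ |u i - s (y i)|) :
    Tendsto (fun i => h (τ₁ i, u₁ i, y i)) l (𝓝 (h (0, s ybar, ybar))) := by
  have a1 : Tendsto τ₁ l (𝓝 0) :=
    squeeze_zero_norm h1 (by simpa using (C.τ_lim R).abs)
  have a2 : Tendsto (fun i => u₁ i - s (y i)) l (𝓝 0) :=
    squeeze_zero_norm h2 (by simpa using (C.v_lim R).abs)
  have a3 : Tendsto u₁ l (𝓝 (s ybar)) := by simpa using a2.add (C.s_lim R)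
  exact (hh.tendsto _).comp (a1.prodMk_nhds (a3.prodMk_nhds R.y_lim))

lemma tendsto_midT {h : ℝ × ℝ × ℝ → ℝ} (hh : Continuous h) {τ₁ : ι → ℝ}
    (h1 : ∀ i, |τ₁ i| ≤ |τ i|) :
    Tendsto (fun i => h (τ₁ i, s (y i), y i)) l (𝓝 (h (0, s ybar, ybar))) :=
  C.tendsto_mid R hh h1 (u₁ := fun i => s (y i)) fun i => by simp

lemma tendsto_midX {h : ℝ × ℝ × ℝ → ℝ} (hh : Continuous h) {u₁ : ι → ℝ}
    (h1 : ∀ i, |u₁ i - s (y i)| ≤ |u i - s (y i)|) :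
    Tendsto (fun i => h (0, u₁ i, y i)) l (𝓝 (h (0, s ybar, ybar))) :=
  C.tendsto_mid R hh (τ₁ := fun _ => 0) (fun i => by simp) h1

lemma tendsto_end {h : ℝ × ℝ × ℝ → ℝ} (hh : Continuous h) :
    Tendsto (fun i => h (τ i, u i, y i)) l (𝓝 (h (0, s ybar, ybar))) :=
  C.tendsto_mid R hh (fun _ => le_rfl) (fun _ => le_rfl)

lemma τ_div_v_lim : Tendsto (fun i => τ i / (u i - s (y i))) l (𝓝 0) := by
  have hγ := C.γ_pos
  have h1 : Tendsto (fun i => (2 * Real.sqrt (α / β))⁻¹ * Real.sqrt (τ i)) l (𝓝 0) := by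
    simpa using (C.sqrt_lim R).const_mul _
  refine squeeze_zero_norm' ?_ h1
  filter_upwards [C.τ_pos R, R.outer] with i h0 h
  have h2 : 2 * Real.sqrt (α / β) * Real.sqrt (τ i) ≤ |u i - s (y i)| := by
    refine Real.abs_le_sqrt (h.2.2.le.trans' (le_of_eq ?_)) |>.trans' (le_abs_self _) |>.trans ?_
    · rw [mul_pow, mul_pow, Real.sq_sqrt hγ.le, Real.sq_sqrt h0.le]; ring
    · rw [Real.sqrt_sq_eq_abs]
  have h5 : 0 < |u i - s (y i)| := lt_of_lt_of_le (by positivity) h2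
  rw [Real.norm_eq_abs, abs_div, abs_of_pos h0, div_le_iff₀ h5]
  calc τ i = (2 * Real.sqrt (α / β))⁻¹ * Real.sqrt (τ i) *
      (2 * Real.sqrt (α / β) * Real.sqrt (τ i)) := by
        field_simp; rw [Real.sq_sqrt h0.le]
    _ ≤ _ := mul_le_mul_of_nonneg_left h2 (by positivity)

lemma w_div_v_lim : Tendsto (fun i => w i / (u i - s (y i))) l (𝓝 0) := by
  have h1 : Tendsto (fun i => M * |τ i / (u i - s (y i))|) l (𝓝 0) := by
    simpa using (C.τ_div_v_lim R).abs.const_mul M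
  refine squeeze_zero_norm' ?_ h1
  filter_upwards [C.τ_pos R, R.w_le] with i h0 h
  rw [Real.norm_eq_abs, abs_div, abs_div, abs_of_pos h0, ← mul_div_assoc]
  exact div_le_div_of_nonneg_right h (abs_nonneg _)

lemma sq_div_lim : Tendsto (fun i => (u i - s (y i)) ^ 2 / τ i) l (𝓝 (rootCoeff D s ybar)) := by
  choose t1 u2 u3 h1 h2 h3 eq using fun i => C.taylorD (τ i) (u i) (y i)
  have l1 := C.tendsto_mid R C.contTT.continuous h1 (fun _ => le_rfl)
  have l2 := C.tendsto_midX R C.contTX.continuous h2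
  have l3 := C.tendsto_midX R C.contXXX.continuous h3
  have hb := (C.XXX_neg ybar).ne
  have l4 := ((((C.w_div_v_lim R).sub ((l1.mul (C.τ_div_v_lim R)).div_const 2)).sub l2).const_mul
    6).div l3 hb
  have e0 : 6 * (0 - partialT (partialT D) (0, s ybar, ybar) * 0 / 2 -
      partialT (partialX D) (0, s ybar, ybar)) / partialX (partialX (partialX D)) (0, s ybar, ybar)
      = rootCoeff D s ybar := by
    rw [rootCoeff]; field_simp; ring
  rw [e0] at l4
  refine l4.congr' ?_
  filter_upwards [C.τ_pos R, R.outer, R.eq, l3.eventually_ne hb] with i h0 ho he hb'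
  have hv : u i - s (y i) ≠ 0 := sub_ne_zero.2 (C.outer_ne ho)
  have hτ := h0.ne'
  have e1 := eq i
  rw [he] at e1
  simp only [Pi.div_apply]
  rw [div_eq_div_iff hb' hτ]
  field_simp
  linear_combination 12 * e1

lemma ratio_lim : Tendsto (fun i => (u i - s (y i)) / Real.sqrt (τ i)) l
    (𝓝 (σ * Real.sqrt (rootCoeff D s ybar))) := by
  have h := ((Real.continuous_sqrt.tendsto _).comp (C.sq_div_lim R)).const_mul σ
  refine h.congr' ?_
  filter_upwards [C.τ_pos R, R.outer] with i h0 ho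
  simp only [Function.comp]
  rw [Real.sqrt_div (sq_nonneg _), Real.sqrt_sq_eq_abs, ← mul_div_assoc]
  congr 1
  have h1 := ho.1
  rcases R.side with rfl | rfl
  · rw [one_mul] at h1 ⊢; exact abs_of_pos h1
  · rw [abs_of_neg (by linarith)]; ring

lemma X_div_lim : Tendsto (fun i => partialX D (τ i, u i, y i) / τ i) l
    (𝓝 (-2 * partialT (partialX D) (0, s ybar, ybar))) := by
  choose t1 u2 h1 h2 eq using fun i => C.taylorX (τ i) (u i) (y i)
  have l1 := C.tendsto_mid R C.contTX.continuous h1 (fun _ => le_rfl)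
  have l2 := C.tendsto_midX R C.contXXX.continuous h2
  have l3 := l1.add ((l2.mul (C.sq_div_lim R)).div_const 2)
  rw [C.XXX_mul_rootCoeff] at l3
  have e0 : partialT (partialX D) (0, s ybar, ybar) +
      -6 * partialT (partialX D) (0, s ybar, ybar) / 2 =
      -2 * partialT (partialX D) (0, s ybar, ybar) := by ring
  rw [e0] at l3
  refine l3.congr' ?_
  filter_upwards [C.τ_pos R] with i h0
  rw [eq]; field_simp

end FlatCusp

namespace FlatCusp

variable {D : ℝ × ℝ × ℝ → ℝ} {s A : ℝ → ℝ} {Fh Gh : ℝ × ℝ × ℝ → ℝ} {α β e M : ℝ}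
  (C : FlatCusp D s A Fh Gh α β e)
include C

lemma partialX_partialY : partialX (partialY D) = partialY (partialX D) :=
  (partialY_partialX (C.D3.of_le (by norm_num))).symm

lemma partialX_partialX_partialY : partialX (partialX (partialY D)) =
    partialY (partialX (partialX D)) := by
  rw [C.partialX_partialY]
  exact (partialY_partialX (C.Du3.of_le (by norm_num))).symm

lemma hasDerivAt_along {h : ℝ × ℝ × ℝ → ℝ} (hh : Differentiable ℝ h) (y : ℝ) :
    HasDerivAt (fun y => h (0, s y, y))
      (deriv s y * partialX h (0, s y, y) + partialY h (0, s y, y)) y := by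
  simpa using HasFDerivAt.comp_curve (hh _) (hasDerivAt_const y (0 : ℝ))
    (C.diffs y).hasDerivAt (hasDerivAt_id y)

lemma along_const {h : ℝ × ℝ × ℝ → ℝ} (hh : Differentiable ℝ h) {a : ℝ → ℝ}
    (e : ∀ y, h (0, s y, y) = a y) (y : ℝ) :
    deriv s y * partialX h (0, s y, y) + partialY h (0, s y, y) = deriv a y := by
  have h1 := C.hasDerivAt_along hh y
  have h2 : (fun y => h (0, s y, y)) = a := funext e
  rw [h2] at h1
  exact h1.deriv.symm

lemma zeroY (y : ℝ) : partialY D (0, s y, y) = 0 := by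
  have := C.along_const C.diffD (a := fun _ => 0) C.zero y
  simpa [C.zeroX] using this

lemma zeroYX (y : ℝ) : partialY (partialX D) (0, s y, y) = 0 := by
  have := C.along_const C.diffX (a := fun _ => 0) C.zeroX y
  simpa [C.zeroXX] using this

lemma zeroYY (y : ℝ) : partialY (partialY D) (0, s y, y) = 0 := by
  have := C.along_const C.diffY (a := fun _ => 0) C.zeroY y
  simpa [C.partialX_partialY, C.zeroYX] using this

lemma valueYXX (y : ℝ) : partialY (partialX (partialX D)) (0, s y, y) =
    -(deriv s y * partialX (partialX (partialX D)) (0, s y, y)) := by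
  have := C.along_const C.diffXX (a := fun _ => 0) C.zeroXX y
  simp only [deriv_const] at this
  linarith

lemma diffA : Differentiable ℝ A := C.A2.differentiable (by norm_num)

lemma valueTY (y : ℝ) : partialT (partialY D) (0, s y, y) =
    deriv A y - deriv s y * partialT (partialX D) (0, s y, y) := by
  have := C.along_const C.diffT C.slope y
  rw [C.partialX_partialT, partialY_partialT (C.D3.of_le (by norm_num))] at this
  linarith

lemma contA' : Continuous (deriv A) := C.A2.continuous_deriv (by norm_num)

lemma conts' : Continuous (deriv s) := C.s1.continuous_deriv le_rfl

variable {ι : Type*} {l : Filter ι} {ybar σ : ℝ} {τ w y u : ι → ℝ}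
  (R : RootFamily D s A (α / β) e M l ybar σ τ w y u)
include R

lemma Y_div_lim : Tendsto (fun i => partialY D (τ i, u i, y i) / τ i) l
    (𝓝 (deriv A ybar + 2 * deriv s ybar * partialT (partialX D) (0, s ybar, ybar))) := by
  have hYX : ContDiff ℝ 1 (partialX (partialY D)) := C.contY.partialX (by norm_num)
  have hYXd := hYX.differentiable one_ne_zero
  have hYXX : Continuous (partialX (partialX (partialY D))) :=
    (hYX.partialX (m := 0) (by norm_num)).continuous
  have hYT : Continuous (partialT (partialY D)) :=
    (C.contY.partialT (m := 1) (by norm_num)).continuous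
  choose t1 h1 e1 using fun i => exists_taylor_one
    (fun t => hasDerivAt_partialT C.diffY t (u i) (y i)) 0 (τ i)
  choose u2 h2 e2 using fun i => exists_taylor_two (fun u => hasDerivAt_partialX C.diffY 0 u (y i))
    (fun u => hasDerivAt_partialX hYXd 0 u (y i)) (s (y i)) (u i)
  have l1 := C.tendsto_mid R hYT (τ₁ := t1) (fun i => by simpa using h1 i) (fun _ => le_rfl)
  have l2 := C.tendsto_midX R hYXX h2
  have l3 := l1.add ((l2.mul (C.sq_div_lim R)).div_const 2)
  have e0 : partialT (partialY D) (0, s ybar, ybar) +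
      partialX (partialX (partialY D)) (0, s ybar, ybar) * rootCoeff D s ybar / 2 =
      deriv A ybar + 2 * deriv s ybar * partialT (partialX D) (0, s ybar, ybar) := by
    rw [C.partialX_partialX_partialY, C.valueYXX, C.valueTY]
    have := C.XXX_mul_rootCoeff ybar
    linear_combination (-deriv s ybar / 2) * this
  rw [e0] at l3
  refine l3.congr' ?_
  filter_upwards [C.τ_pos R] with i h0
  rw [e1, e2, C.zeroY, C.partialX_partialY, C.zeroYX]; field_simp; ring

lemma τ_div_X_lim : Tendsto (fun i => τ i / partialX D (τ i, u i, y i)) l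
    (𝓝 (-(2 * partialT (partialX D) (0, s ybar, ybar))⁻¹)) := by
  have h0 := (C.slopeX_pos ybar).ne'
  have := (C.X_div_lim R).inv₀ (by simpa using h0)
  rw [show (-2 * partialT (partialX D) (0, s ybar, ybar))⁻¹ =
    -(2 * partialT (partialX D) (0, s ybar, ybar))⁻¹ by rw [neg_mul, inv_neg]] at this
  simpa using this

lemma rootY_lim {Ω : ι → ℝ} {a : ℝ} (hΩ : Tendsto (fun i => Ω i / τ i) l (𝓝 a)) :
    Tendsto (fun i => (Ω i - partialY D (τ i, u i, y i)) / partialX D (τ i, u i, y i)) l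
      (𝓝 ((deriv A ybar - a) / (2 * partialT (partialX D) (0, s ybar, ybar)) +
        deriv s ybar)) := by
  have h0 := (C.slopeX_pos ybar).ne'
  have h1 := (hΩ.sub (C.Y_div_lim R)).div (C.X_div_lim R) (by simpa using h0)
  have e0 : (a - (deriv A ybar + 2 * deriv s ybar * partialT (partialX D) (0, s ybar, ybar))) /
      (-2 * partialT (partialX D) (0, s ybar, ybar)) =
      (deriv A ybar - a) / (2 * partialT (partialX D) (0, s ybar, ybar)) + deriv s ybar := by
    field_simp; ring
  rw [e0] at h1
  refine h1.congr' ?_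
  filter_upwards [C.τ_pos R] with i hi
  simp only [Pi.div_apply]
  rw [← sub_div, div_div_div_cancel_right₀ hi.ne']

end FlatCusp

/-- `q` is `C¹` in the state variables, uniformly up to the tip of the cone. -/
structure ConeDiff {E : Type*} [NormedAddCommGroup E] [NormedSpace ℝ E] (τ₁ M R : ℝ)
    (q : ℝ × PlaneState → E) (q' : ℝ × PlaneState → PlaneState →L[ℝ] E) : Prop where
  cont : ContinuousOn q (stateCone τ₁ M R)
  cont' : ContinuousOn q' (stateCone τ₁ M R)
  deriv : ∀ p ∈ stateCone τ₁ M R,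
    HasFDerivWithinAt (fun z => q (p.1, z)) (q' p) (coneSlice M R p.1) p.2

namespace ConeDiff

variable {E E' : Type*} [NormedAddCommGroup E] [NormedSpace ℝ E] [NormedAddCommGroup E']
  [NormedSpace ℝ E'] {τ₁ M R : ℝ} {q : ℝ × PlaneState → E} {q' : ℝ × PlaneState → PlaneState →L[ℝ] E}
  {r : ℝ × PlaneState → E'} {r' : ℝ × PlaneState → PlaneState →L[ℝ] E'}

lemma comp (hq : ConeDiff τ₁ M R q q') {h : E → E'} (hh : ContDiff ℝ 1 h) :
    ConeDiff τ₁ M R (fun p => h (q p)) (fun p => (fderiv ℝ h (q p)).comp (q' p)) where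
  cont := hh.continuous.comp_continuousOn hq.cont
  cont' := ((hh.continuous_fderiv one_ne_zero).comp_continuousOn hq.cont).clm_comp hq.cont'
  deriv p hp := ((hh.differentiable one_ne_zero _).hasFDerivAt).comp_hasFDerivWithinAt p.2
    (hq.deriv p hp)

lemma prodMk (hq : ConeDiff τ₁ M R q q') (hr : ConeDiff τ₁ M R r r') :
    ConeDiff τ₁ M R (fun p => (q p, r p)) (fun p => (q' p).prod (r' p)) where
  cont := hq.cont.prodMk hr.cont
  cont' := by
    have h : Continuous fun a : (PlaneState →L[ℝ] E) × (PlaneState →L[ℝ] E') => a.1.prod a.2 :=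
      (ContinuousLinearMap.prodₗᵢ ℝ).continuous
    exact h.comp_continuousOn (hq.cont'.prodMk hr.cont')
  deriv p hp := (hq.deriv p hp).prodMk (hr.deriv p hp)

lemma time : ConeDiff τ₁ M R (fun p => p.1) (fun _ => 0) where
  cont := continuousOn_fst
  cont' := continuousOn_const
  deriv _ _ := hasFDerivWithinAt_const _ _ _

lemma state : ConeDiff τ₁ M R (fun p => p.2) (fun _ => ContinuousLinearMap.id ℝ PlaneState) where
  cont := continuousOn_snd
  cont' := continuousOn_const
  deriv _ _ := hasFDerivWithinAt_id _ _

end ConeDiff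

/-- Coordinate functionals on states. -/
def stateW : PlaneState →L[ℝ] ℝ :=
  (ContinuousLinearMap.fst ℝ ℝ ℝ).comp (ContinuousLinearMap.fst ℝ (ℝ × ℝ) ℝ)
def stateΩ : PlaneState →L[ℝ] ℝ :=
  (ContinuousLinearMap.snd ℝ ℝ ℝ).comp (ContinuousLinearMap.fst ℝ (ℝ × ℝ) ℝ)
def stateY : PlaneState →L[ℝ] ℝ := ContinuousLinearMap.snd ℝ (ℝ × ℝ) ℝ

@[simp] lemma stateW_apply (z : PlaneState) : stateW z = z.1.1 := rfl
@[simp] lemma stateΩ_apply (z : PlaneState) : stateΩ z = z.1.2 := rfl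
@[simp] lemma stateY_apply (z : PlaneState) : stateY z = z.2 := rfl

/-- A criterion for `ConeDiff`: the data are given away from the tip, with limits at the tip. -/
lemma ConeDiff.of_limits {E : Type*} [NormedAddCommGroup E] [NormedSpace ℝ E] {τ₁ M R : ℝ}
    {q : ℝ × PlaneState → E} {q' : ℝ × PlaneState → PlaneState →L[ℝ] E}
    (hc : ∀ p ∈ stateCone τ₁ M R, 0 < p.1 → ContinuousAt q p ∧ ContinuousAt q' p ∧
      HasFDerivAt (fun z => q (p.1, z)) (q' p) p.2)
    (hl : ∀ y, |y| ≤ R →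
      Tendsto q (𝓝[stateCone τ₁ M R ∩ {p | 0 < p.1}] (0, (0, 0), y)) (𝓝 (q (0, (0, 0), y))) ∧
      Tendsto q' (𝓝[stateCone τ₁ M R ∩ {p | 0 < p.1}] (0, (0, 0), y)) (𝓝 (q' (0, (0, 0), y))))
    (h0 : ∀ y, |y| ≤ R →
      Tendsto q' (𝓝[stateCone τ₁ M R ∩ {p | p.1 = 0}] (0, (0, 0), y)) (𝓝 (q' (0, (0, 0), y))) ∧
      HasFDerivWithinAt (fun z => q (0, z)) (q' (0, (0, 0), y)) (coneSlice M R 0) ((0, 0), y)) :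
    ConeDiff τ₁ M R q q' := by
  have hbase : ∀ p ∈ stateCone τ₁ M R, p.1 = 0 → ∃ y, |y| ≤ R ∧ p = (0, (0, 0), y) := by
    rintro ⟨t, ⟨a, b⟩, y⟩ hp ht
    simp only at ht
    subst ht
    obtain ⟨-, h1, h2, h3⟩ := hp
    simp only [mul_zero] at h1 h2
    exact ⟨y, h3, by rw [abs_nonpos_iff.1 h1, abs_nonpos_iff.1 h2]⟩
  have hsplit : ∀ y, 𝓝[stateCone τ₁ M R] ((0, (0, 0), y) : ℝ × PlaneState) ≤
      𝓝[stateCone τ₁ M R ∩ {p | 0 < p.1}] (0, (0, 0), y) ⊔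
      𝓝[stateCone τ₁ M R ∩ {p | p.1 = 0}] (0, (0, 0), y) := by
    intro y
    rw [← nhdsWithin_union]
    refine nhdsWithin_mono _ fun p hp => ?_
    rcases hp.1.1.lt_or_eq with h | h
    · exact Or.inl ⟨hp, h⟩
    · exact Or.inr ⟨hp, h.symm⟩
  refine ⟨fun p hp => ?_, fun p hp => ?_, fun p hp => ?_⟩
  · rcases hp.1.1.lt_or_eq with h | h
    · exact (hc p hp h).1.continuousWithinAt
    · obtain ⟨y, hy, rfl⟩ := hbase p hp h.symm
      refine Tendsto.mono_left (Tendsto.sup (hl y hy).1 ?_) (hsplit y)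
      have h1 := (h0 y hy).2.continuousWithinAt
      have h2 : Tendsto (fun p : ℝ × PlaneState => p.2)
          (𝓝[stateCone τ₁ M R ∩ {p | p.1 = 0}] (0, (0, 0), y))
          (𝓝[coneSlice M R 0] ((0, 0), y)) := by
        refine tendsto_nhdsWithin_iff.2 ⟨(continuous_snd.tendsto _).mono_left
          nhdsWithin_le_nhds, ?_⟩
        filter_upwards [self_mem_nhdsWithin] with p hp
        have := hp.1.2
        rwa [show p.1 = 0 from hp.2] at this
      refine (Tendsto.comp h1 h2).congr' ?_
      filter_upwards [self_mem_nhdsWithin] with p hp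
      have : p.1 = 0 := hp.2
      simp only [Function.comp, ← this]
  · rcases hp.1.1.lt_or_eq with h | h
    · exact (hc p hp h).2.1.continuousWithinAt
    · obtain ⟨y, hy, rfl⟩ := hbase p hp h.symm
      exact Tendsto.mono_left (Tendsto.sup (hl y hy).2 (h0 y hy).1) (hsplit y)
  · rcases hp.1.1.lt_or_eq with h | h
    · exact (hc p hp h).2.2.hasFDerivWithinAt
    · obtain ⟨y, hy, rfl⟩ := hbase p hp h.symm
      exact (h0 y hy).2

/-- The outer root `U` of `D(τ,U,y) = τ (A y + w)` as a function of the state. -/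
def stateRoot (D : ℝ × ℝ × ℝ → ℝ) (s A : ℝ → ℝ) (γ e σ : ℝ) (p : ℝ × PlaneState) : ℝ :=
  outerRoot D s γ e σ (p.1, p.1 * (A p.2.2 + p.2.1.1), p.2.2)

/-- Derivative of `stateRoot` in the state variables. -/
def stateRoot' (D : ℝ × ℝ × ℝ → ℝ) (s A : ℝ → ℝ) (γ e σ : ℝ) (p : ℝ × PlaneState) :
    PlaneState →L[ℝ] ℝ :=
  let q : ℝ × ℝ × ℝ := (p.1, stateRoot D s A γ e σ p, p.2.2)
  if 0 < p.1 then (p.1 / partialX D q) • stateW +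
    ((p.1 * deriv A p.2.2 - partialY D q) / partialX D q) • stateY
  else (-(2 * partialT (partialX D) (0, s p.2.2, p.2.2))⁻¹) • stateW + deriv s p.2.2 • stateY

/-- `τ` times the `y`-derivative of the outer root, when `k_y = Ω`. -/
def stateRate (D : ℝ × ℝ × ℝ → ℝ) (s A : ℝ → ℝ) (γ e σ : ℝ) (p : ℝ × PlaneState) : ℝ :=
  let q : ℝ × ℝ × ℝ := (p.1, stateRoot D s A γ e σ p, p.2.2)
  p.1 * (p.2.1.2 - partialY D q) / partialX D q

/-- Derivative of `stateRate` in the state variables. -/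
def stateRate' (D : ℝ × ℝ × ℝ → ℝ) (s A : ℝ → ℝ) (γ e σ : ℝ) (p : ℝ × PlaneState) :
    PlaneState →L[ℝ] ℝ :=
  let q : ℝ × ℝ × ℝ := (p.1, stateRoot D s A γ e σ p, p.2.2)
  if 0 < p.1 then (p.1 / partialX D q) • stateΩ -
    (p.1 / partialX D q * partialY (partialX D) q +
      p.1 / partialX D q * ((p.2.1.2 - partialY D q) / partialX D q) *
      partialX (partialX D) q) • stateRoot' D s A γ e σ p -
    (p.1 / partialX D q * partialY (partialY D) q +
      p.1 / partialX D q * ((p.2.1.2 - partialY D q) / partialX D q) *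
      partialY (partialX D) q) • stateY
  else (-(2 * partialT (partialX D) (0, s p.2.2, p.2.2))⁻¹) • stateΩ

namespace FlatCusp

variable {D : ℝ × ℝ × ℝ → ℝ} {s A : ℝ → ℝ} {Fh Gh : ℝ × ℝ × ℝ → ℝ} {α β e M R τ₁ : ℝ}
  (C : FlatCusp D s A Fh Gh α β e)

/-- All states of the cone have outer roots. -/
def ConeRoots (D : ℝ × ℝ × ℝ → ℝ) (s A : ℝ → ℝ) (γ e M R τ₁ : ℝ) : Prop :=
  τ₁ < e ∧ ∀ σ, (σ = 1 ∨ σ = -1) → ∀ τ w y, 0 < τ → τ ≤ τ₁ → |y| ≤ R → |w| ≤ M * τ →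
      (∃ u, IsOuter s γ e σ τ y u ∧ D (τ, u, y) = τ * (A y + w)) ∧
      ∀ u, IsOuter s γ e σ τ y u → D (τ, u, y) = τ * (A y + w) →
        (u - s y) ^ 2 ≤ 9 * γ * τ

include C

lemma stateRoot_spec (H : ConeRoots D s A (α / β) e M R τ₁) {σ : ℝ} (hσ : σ = 1 ∨ σ = -1)
    {p : ℝ × PlaneState} (hp : p ∈ stateCone τ₁ M R) (h0 : 0 < p.1) :
    IsOuter s (α / β) e σ p.1 p.2.2 (stateRoot D s A (α / β) e σ p) ∧
    D (p.1, stateRoot D s A (α / β) e σ p, p.2.2) = p.1 * (A p.2.2 + p.2.1.1) ∧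
    (stateRoot D s A (α / β) e σ p - s p.2.2) ^ 2 ≤ 9 * (α / β) * p.1 := by
  obtain ⟨⟨u, hu, hD⟩, hup⟩ := H.2 σ hσ p.1 p.2.1.1 p.2.2 h0 hp.1.2 hp.2.2.2 hp.2.1
  have : stateRoot D s A (α / β) e σ p = u :=
    C.outerRoot_eq h0 (hp.1.2.trans H.1.le) hu hD
  rw [this]
  exact ⟨hu, hD, hup u hu hD⟩

lemma stateRoot_family (H : ConeRoots D s A (α / β) e M R τ₁) {σ : ℝ} (hσ : σ = 1 ∨ σ = -1)
    (y : ℝ) : RootFamily D s A (α / β) e M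
      (𝓝[stateCone τ₁ M R ∩ {p | 0 < p.1}] ((0, (0, 0), y) : ℝ × PlaneState)) y σ
      (fun p => p.1) (fun p => p.2.1.1) (fun p => p.2.2) (stateRoot D s A (α / β) e σ) where
  τ_lim := tendsto_nhdsWithin_iff.2 ⟨(continuous_fst.tendsto' _ _ rfl).mono_left
    nhdsWithin_le_nhds, by filter_upwards [self_mem_nhdsWithin] with p hp using hp.2⟩
  y_lim := ((continuous_snd.comp continuous_snd).tendsto' _ _ rfl).mono_left nhdsWithin_le_nhds
  w_le := by filter_upwards [self_mem_nhdsWithin] with p hp using hp.1.2.1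
  side := hσ
  outer := by
    filter_upwards [self_mem_nhdsWithin] with p hp using (C.stateRoot_spec H hσ hp.1 hp.2).1
  eq := by
    filter_upwards [self_mem_nhdsWithin] with p hp using (C.stateRoot_spec H hσ hp.1 hp.2).2.1
  upper := by
    filter_upwards [self_mem_nhdsWithin] with p hp using (C.stateRoot_spec H hσ hp.1 hp.2).2.2

lemma stateRoot_of_nonpos {σ : ℝ} {p : ℝ × PlaneState} (hp : p.1 ≤ 0) :
    stateRoot D s A (α / β) e σ p = s p.2.2 := dif_neg fun h => hp.not_gt h.1

lemma continuousAt_stateRoot (H : ConeRoots D s A (α / β) e M R τ₁) {σ : ℝ}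
    (hσ : σ = 1 ∨ σ = -1) {p : ℝ × PlaneState} (hp : p ∈ stateCone τ₁ M R) (h0 : 0 < p.1) :
    ContinuousAt (stateRoot D s A (α / β) e σ) p ∧
    HasFDerivAt (fun z => stateRoot D s A (α / β) e σ (p.1, z)) (stateRoot' D s A (α / β) e σ p)
      p.2 := by
  obtain ⟨h1, h2, -⟩ := C.stateRoot_spec H hσ hp h0
  obtain ⟨h3, h4⟩ := C.outerRoot_smooth h0 (hp.1.2.trans_lt H.1) h1 h2
  have hA := C.A2.continuous
  constructor
  · exact ContinuousAt.comp (f := fun p : ℝ × PlaneState => (p.1, p.1 * (A p.2.2 + p.2.1.1), p.2.2))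
      h3.continuousAt (by fun_prop)
  · have hy : HasFDerivAt (fun z : PlaneState => z.2) stateY p.2 := stateY.hasFDerivAt
    have hw : HasFDerivAt (fun z : PlaneState => z.1.1) stateW p.2 := stateW.hasFDerivAt
    have hAd := ((C.diffA p.2.2).hasDerivAt).comp_hasFDerivAt p.2 hy
    have hk := (hAd.add hw).const_mul p.1
    have := HasFDerivAt.comp p.2 (f := fun z : PlaneState =>
      ((p.1, p.1 * (A z.2 + z.1.1), z.2) : ℝ × ℝ × ℝ)) h4
      ((hasFDerivAt_const p.1 p.2).prodMk (hk.prodMk hy))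
    refine this.congr_fderiv ?_
    refine ContinuousLinearMap.ext fun v => ?_
    simp only [stateRoot', if_pos h0]
    simp
    ring

lemma outer_X_ne (H : ConeRoots D s A (α / β) e M R τ₁) {σ : ℝ}
    (hσ : σ = 1 ∨ σ = -1) {p : ℝ × PlaneState} (hp : p ∈ stateCone τ₁ M R) (h0 : 0 < p.1) :
    partialX D (p.1, stateRoot D s A (α / β) e σ p, p.2.2) ≠ 0 :=
  (C.outer_X_neg (by rw [abs_of_pos h0]; exact (hp.1.2.trans_lt H.1).le)
    (C.stateRoot_spec H hσ hp h0).1).ne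

lemma continuousAt_comp_root (H : ConeRoots D s A (α / β) e M R τ₁) {σ : ℝ}
    (hσ : σ = 1 ∨ σ = -1) {p : ℝ × PlaneState} (hp : p ∈ stateCone τ₁ M R) (h0 : 0 < p.1)
    {h : ℝ × ℝ × ℝ → ℝ} (hh : Continuous h) :
    ContinuousAt (fun p => h (p.1, stateRoot D s A (α / β) e σ p, p.2.2)) p := by
  have := (C.continuousAt_stateRoot H hσ hp h0).1
  exact ContinuousAt.comp (f := fun p : ℝ × PlaneState =>
    ((p.1, stateRoot D s A (α / β) e σ p, p.2.2) : ℝ × ℝ × ℝ)) (g := h) hh.continuousAt (by fun_prop)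

lemma continuousAt_stateRoot' (H : ConeRoots D s A (α / β) e M R τ₁) {σ : ℝ}
    (hσ : σ = 1 ∨ σ = -1) {p : ℝ × PlaneState} (hp : p ∈ stateCone τ₁ M R) (h0 : 0 < p.1) :
    ContinuousAt (stateRoot' D s A (α / β) e σ) p := by
  have hA' := C.contA'
  have hX := C.continuousAt_comp_root H hσ hp h0 C.Du3.continuous
  have hY := C.continuousAt_comp_root H hσ hp h0 C.contY.continuous
  have hne := C.outer_X_ne H hσ hp h0
  have hmain := ((continuousAt_fst.div hX hne).smul
    (continuousAt_const (y := stateW))).add ((((continuousAt_fst (p := p)).mul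
    (hA'.continuousAt.comp (f := fun p : ℝ × PlaneState => p.2.2) (by fun_prop))).sub
    hY).div hX hne |>.smul (continuousAt_const (y := stateY)))
  refine hmain.congr ?_
  filter_upwards [continuousAt_fst.eventually (lt_mem_nhds h0)] with p' hp'
  simp only [stateRoot', if_pos hp']
  rfl

lemma coneDiff_stateRoot (H : ConeRoots D s A (α / β) e M R τ₁) {σ : ℝ} (hσ : σ = 1 ∨ σ = -1) :
    ConeDiff τ₁ M R (stateRoot D s A (α / β) e σ) (stateRoot' D s A (α / β) e σ) := by
  have hs := C.s1.continuous
  have hs' := C.conts'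
  have hA' := C.contA'
  have hTX := C.contTX.continuous
  refine ConeDiff.of_limits (fun p hp h0 => ?_) (fun y hy => ?_) (fun y hy => ?_)
  · obtain ⟨h1, h2⟩ := C.continuousAt_stateRoot H hσ hp h0
    exact ⟨h1, C.continuousAt_stateRoot' H hσ hp h0, h2⟩
  · have hR := C.stateRoot_family H hσ y
    constructor
    · rw [C.stateRoot_of_nonpos le_rfl]
      exact C.u_lim hR
    · have h1 := (C.τ_div_X_lim hR).smul_const stateW
      have h2 := (C.rootY_lim hR (Ω := fun p => p.1 * deriv A p.2.2) (a := deriv A y) (by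
        refine ((hA'.tendsto _).comp hR.y_lim).congr' ?_
        filter_upwards [C.τ_pos hR] with p hp
        simp only [Function.comp]
        rw [mul_div_cancel_left₀ _ hp.ne'])).smul_const stateY
      rw [sub_self, zero_div, zero_add] at h2
      have h3 : stateRoot' D s A (α / β) e σ (0, (0, 0), y) =
        (-(2 * partialT (partialX D) (0, s y, y))⁻¹) • stateW + deriv s y • stateY := by
        simp only [stateRoot', lt_irrefl, if_false]
      rw [h3]
      refine (h1.add h2).congr' ?_
      filter_upwards [C.τ_pos hR] with p hp
      simp only [stateRoot', if_pos hp]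
  · have h3 : ∀ p : ℝ × PlaneState, p.1 = 0 → stateRoot' D s A (α / β) e σ p =
        (-(2 * partialT (partialX D) (0, s p.2.2, p.2.2))⁻¹) • stateW + deriv s p.2.2 • stateY := by
      intro p hp
      simp only [stateRoot', hp, lt_irrefl, if_false]
    constructor
    · rw [h3 _ rfl]
      have hc : Continuous fun p : ℝ × PlaneState =>
        (-(2 * partialT (partialX D) (0, s p.2.2, p.2.2))⁻¹) • stateW + deriv s p.2.2 • stateY := by
        have : ∀ p : ℝ × PlaneState, 2 * partialT (partialX D) (0, s p.2.2, p.2.2) ≠ 0 :=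
          fun p => by have := (C.slopeX_pos p.2.2).ne'; positivity
        fun_prop (disch := assumption)
      refine ((hc.tendsto _).mono_left nhdsWithin_le_nhds).congr' ?_
      filter_upwards [self_mem_nhdsWithin] with p hp
      exact (h3 p hp.2).symm
    · rw [h3 _ rfl]
      have h4 := (stateW.hasFDerivAt (x := ((0, 0), y))).const_smul
        (-(2 * partialT (partialX D) (0, s y, y))⁻¹)
      have h5 := (C.diffs y).hasDerivAt.comp_hasFDerivAt ((0, 0), y)
        (stateY.hasFDerivAt (x := (((0 : ℝ), (0 : ℝ)), y)))
      refine ((h4.add h5).hasFDerivWithinAt).congr' (fun z hz => ?_) ?_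
      · have : z.1.1 = 0 := abs_nonpos_iff.1 (by simpa using hz.1)
        rw [C.stateRoot_of_nonpos le_rfl]
        simp [this]
      · exact ⟨by simp, by simp, hy⟩

lemma stateRate_zero {σ : ℝ} {p : ℝ × PlaneState} (hp : p.1 = 0) :
    stateRate D s A (α / β) e σ p = 0 := by simp [stateRate, hp]

lemma rate_mul_lim (H : ConeRoots D s A (α / β) e M R τ₁) {σ : ℝ} (hσ : σ = 1 ∨ σ = -1)
    (y : ℝ) {Z : ℝ × PlaneState → ℝ}
    (hZ : Tendsto Z (𝓝[stateCone τ₁ M R ∩ {p | 0 < p.1}] (0, (0, 0), y)) (𝓝 0)) :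
    Tendsto (fun p => (p.2.1.2 - partialY D (p.1, stateRoot D s A (α / β) e σ p, p.2.2)) /
      partialX D (p.1, stateRoot D s A (α / β) e σ p, p.2.2) * Z p)
      (𝓝[stateCone τ₁ M R ∩ {p | 0 < p.1}] (0, (0, 0), y)) (𝓝 0) := by
  have hR := C.stateRoot_family H hσ y
  have h1 : Tendsto (fun p : ℝ × PlaneState => p.2.1.2 / p.1 * Z p)
      (𝓝[stateCone τ₁ M R ∩ {p | 0 < p.1}] (0, (0, 0), y)) (𝓝 0) := by
    refine squeeze_zero_norm' ?_ (by simpa using hZ.abs.const_mul M)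
    filter_upwards [self_mem_nhdsWithin] with p hp
    have hp2 : 0 < p.1 := hp.2
    rw [Real.norm_eq_abs, abs_mul, abs_div, abs_of_pos hp2]
    refine mul_le_mul_of_nonneg_right ?_ (abs_nonneg _)
    rw [div_le_iff₀ hp2]
    exact hp.1.2.2.1
  have h2 := (C.τ_div_X_lim hR).mul h1
  have h3 := (C.rootY_lim hR (Ω := fun _ => 0) (a := 0)
    (by simpa only [zero_div] using tendsto_const_nhds)).mul hZ
  have h4 := h2.add h3
  simp only [mul_zero, add_zero] at h4
  refine h4.congr' ?_
  filter_upwards [C.τ_pos hR, self_mem_nhdsWithin] with p hp hp'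
  have hne := C.outer_X_ne H hσ hp'.1 hp
  field_simp
  ring

lemma coneDiff_stateRate (hτ₁ : 0 ≤ τ₁) (H : ConeRoots D s A (α / β) e M R τ₁) {σ : ℝ} (hσ : σ = 1 ∨ σ = -1) :
    ConeDiff τ₁ M R (stateRate D s A (α / β) e σ) (stateRate' D s A (α / β) e σ) := by
  have hs := C.s1.continuous
  have hTX := C.contTX.continuous
  have hYX : ContDiff ℝ 2 (partialY (partialX D)) := C.Du3.partialY (by norm_num)
  have hYY : ContDiff ℝ 1 (partialY (partialY D)) := C.contY.partialY (by norm_num)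
  have hU := C.coneDiff_stateRoot H hσ
  refine ConeDiff.of_limits (fun p hp h0 => ?_) (fun y hy => ?_) (fun y hy => ?_)
  · obtain ⟨h1, h2⟩ := C.continuousAt_stateRoot H hσ hp h0
    have hcomp := fun {h} => C.continuousAt_comp_root H hσ hp h0 (h := h)
    have hX := hcomp C.Du3.continuous
    have hY := hcomp C.contY.continuous
    have hXX := hcomp C.contXX.continuous
    have hYX' := hcomp hYX.continuous
    have hYY' := hcomp hYY.continuous
    have hne := C.outer_X_ne H hσ hp h0
    have hΩ : ContinuousAt (fun p : ℝ × PlaneState => p.2.1.2) p := by fun_prop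
    have hU' : ContinuousAt (stateRoot' D s A (α / β) e σ) p :=
      C.continuousAt_stateRoot' H hσ hp h0
    refine ⟨(continuousAt_fst.mul (hΩ.sub hY)).div hX hne, ?_, ?_⟩
    · have hr := (continuousAt_fst (p := p)).div hX hne
      have hn := ((hΩ.sub hY).div hX hne)
      have hmain := ((hr.smul (continuousAt_const (y := stateΩ))).sub
        (((hr.mul hYX').add ((hr.mul hn).mul hXX)).smul hU')).sub
        (((hr.mul hYY').add ((hr.mul hn).mul hYX')).smul (continuousAt_const (y := stateY)))
      refine hmain.congr ?_
      filter_upwards [continuousAt_fst.eventually (lt_mem_nhds h0)] with p' hp'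
      simp only [stateRate', if_pos hp']
      rfl
    · have hy : HasFDerivAt (fun z : PlaneState => z.2) stateY p.2 := stateY.hasFDerivAt
      have hω : HasFDerivAt (fun z : PlaneState => z.1.2) stateΩ p.2 := stateΩ.hasFDerivAt
      have hin := (hasFDerivAt_const p.1 p.2).prodMk (h2.prodMk hy)
      have hYd := HasFDerivAt.comp p.2 (f := fun z : PlaneState =>
        ((p.1, stateRoot D s A (α / β) e σ (p.1, z), z.2) : ℝ × ℝ × ℝ))
        (C.diffY _).hasFDerivAt hin
      have hXd := HasFDerivAt.comp p.2 (f := fun z : PlaneState =>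
        ((p.1, stateRoot D s A (α / β) e σ (p.1, z), z.2) : ℝ × ℝ × ℝ))
        (C.diffX _).hasFDerivAt hin
      have := ((hω.sub hYd).const_mul p.1).mul
        ((hasDerivAt_inv (x := partialX D (p.1, stateRoot D s A (α / β) e σ p, p.2.2))
          hne).comp_hasFDerivAt p.2 hXd)
      refine (this.congr_fderiv ?_).congr_of_eventuallyEq (Eventually.of_forall fun z => ?_)
      · refine ContinuousLinearMap.ext fun v => ?_
        simp only [stateRate', if_pos h0]
        simp [fderiv_apply_eq_partials, C.partialX_partialY]
        field_simp
        ring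
      · simp [stateRate, div_eq_mul_inv]
  · have hR := C.stateRoot_family H hσ y
    have hXX := C.tendsto_end hR C.contXX.continuous
    have hYX' := C.tendsto_end hR hYX.continuous
    have hYY' := C.tendsto_end hR hYY.continuous
    rw [C.zeroXX] at hXX
    rw [C.zeroYX] at hYX'
    rw [C.zeroYY] at hYY'
    have hr := C.τ_div_X_lim hR
    constructor
    · rw [C.stateRate_zero rfl]
      have h0 : Tendsto (fun p : ℝ × PlaneState => p.1)
        (𝓝[stateCone τ₁ M R ∩ {p | 0 < p.1}] (0, (0, 0), y)) (𝓝 0) := C.τ_lim hR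
      refine (C.rate_mul_lim H hσ y h0).congr fun p => ?_
      simp only [stateRate]; ring
    · have h3 : stateRate' D s A (α / β) e σ (0, (0, 0), y) =
          (-(2 * partialT (partialX D) (0, s y, y))⁻¹) • stateΩ := by
        simp only [stateRate', lt_irrefl, if_false]
      rw [h3]
      have hU' : Tendsto (stateRoot' D s A (α / β) e σ)
          (𝓝[stateCone τ₁ M R ∩ {p | 0 < p.1}] (0, (0, 0), y)) (𝓝 _) :=
        (hU.cont' (0, (0, 0), y) ⟨⟨le_rfl, hτ₁⟩, by simp, by simp, hy⟩).mono_left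
          (nhdsWithin_mono _ inter_subset_left)
      have m1 := (hr.mul hYX').add (hr.mul (C.rate_mul_lim H hσ y hXX))
      have m2 := (hr.mul hYY').add (hr.mul (C.rate_mul_lim H hσ y hYX'))
      simp only [mul_zero, add_zero] at m1 m2
      have := ((hr.smul_const stateΩ).sub (m1.smul hU')).sub (m2.smul_const stateY)
      simp only [zero_smul, sub_zero] at this
      refine this.congr' ?_
      filter_upwards [C.τ_pos hR] with p hp
      simp only [stateRate', if_pos hp, mul_assoc]
  · have h3 : ∀ p : ℝ × PlaneState, p.1 = 0 → stateRate' D s A (α / β) e σ p =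
        (-(2 * partialT (partialX D) (0, s p.2.2, p.2.2))⁻¹) • stateΩ := by
      intro p hp
      simp only [stateRate', hp, lt_irrefl, if_false]
    constructor
    · rw [h3 _ rfl]
      have hc : Continuous fun p : ℝ × PlaneState =>
        (-(2 * partialT (partialX D) (0, s p.2.2, p.2.2))⁻¹) • stateΩ := by
        have : ∀ p : ℝ × PlaneState, 2 * partialT (partialX D) (0, s p.2.2, p.2.2) ≠ 0 :=
          fun p => by have := (C.slopeX_pos p.2.2).ne'; positivity
        fun_prop (disch := assumption)
      refine ((hc.tendsto _).mono_left nhdsWithin_le_nhds).congr' ?_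
      filter_upwards [self_mem_nhdsWithin] with p hp
      exact (h3 p hp.2).symm
    · rw [h3 _ rfl]
      have h4 := (stateΩ.hasFDerivAt (x := ((0, 0), y))).const_smul
        (-(2 * partialT (partialX D) (0, s y, y))⁻¹)
      refine (h4.hasFDerivWithinAt).congr' (fun z hz => ?_) ?_
      · have : z.1.2 = 0 := abs_nonpos_iff.1 (by simpa using hz.2.1)
        rw [C.stateRate_zero rfl]
        simp [this]
      · exact ⟨by simp, by simp, hy⟩

end FlatCusp

/-- Elimination for two roots `r a`, `r b` of the same quartic. -/
lemma root_pair_identity {r a b A c e₁ e₂ e₃ E E' w : ℝ} (hr : r ≠ 0) (hab : a ≠ b)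
    (h1 : A * r ^ 2 + c * r ^ 4 / 2 + r ^ 2 * e₁ * (a * r) + r ^ 2 * e₂ * (a * r) ^ 2 / 2 +
      e₃ * (a * r) ^ 3 / 6 + E * (a * r) ^ 4 / 24 = r ^ 2 * (A + w))
    (h2 : A * r ^ 2 + c * r ^ 4 / 2 + r ^ 2 * e₁ * (b * r) + r ^ 2 * e₂ * (b * r) ^ 2 / 2 +
      e₃ * (b * r) ^ 3 / 6 + E' * (b * r) ^ 4 / 24 = r ^ 2 * (A + w)) :
    2 * ((a + b) / r) * (e₁ + e₃ * (a + b) ^ 2 / 6) + 2 * (w / r ^ 2) =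
      c - e₂ * (a + b) ^ 2 - e₂ * (a * b) - 3 * (a + b) *
        ((E * a ^ 4 - E' * b ^ 4) / (24 * (a - b))) + (E * a ^ 4 + E' * b ^ 4) / 24 := by
  have hab' : a - b ≠ 0 := sub_ne_zero.2 hab
  set ρ := (E * a ^ 4 - E' * b ^ 4) / (24 * (a - b)) with hρ
  have hρ' : ρ * (24 * (a - b)) = E * a ^ 4 - E' * b ^ 4 := div_mul_cancel₀ _ (by simpa using hab')
  have h1' : c * r ^ 2 / 2 + r * e₁ * a + r ^ 2 * e₂ * a ^ 2 / 2 + r * e₃ * a ^ 3 / 6 +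
      r ^ 2 * E * a ^ 4 / 24 = w :=
    mul_left_cancel₀ (pow_ne_zero 2 hr) (by linear_combination h1)
  have h2' : c * r ^ 2 / 2 + r * e₁ * b + r ^ 2 * e₂ * b ^ 2 / 2 + r * e₃ * b ^ 3 / 6 +
      r ^ 2 * E' * b ^ 4 / 24 = w :=
    mul_left_cancel₀ (pow_ne_zero 2 hr) (by linear_combination h2)
  have h3 : e₁ + r * e₂ * (a + b) / 2 + e₃ * (a ^ 2 + a * b + b ^ 2) / 6 + r * ρ = 0 := by
    refine mul_left_cancel₀ (mul_ne_zero hr hab') ?_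
    linear_combination h1' - h2' + r ^ 2 / 24 * hρ'
  clear_value ρ
  refine mul_left_cancel₀ (pow_ne_zero 2 hr) ?_
  have e : r ^ 2 * (2 * ((a + b) / r) * (e₁ + e₃ * (a + b) ^ 2 / 6) + 2 * (w / r ^ 2)) =
      2 * r * (a + b) * (e₁ + e₃ * (a + b) ^ 2 / 6) + 2 * w := by field_simp
  rw [e]
  linear_combination -(h1' + h2') + 3 * r * (a + b) * h3

lemma tendsto_bdd_mul {ι : Type*} {l : Filter ι} {f g : ι → ℝ} {K : ℝ}
    (hf : ∀ᶠ i in l, |f i| ≤ K) (hg : Tendsto g l (𝓝 0)) :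
    Tendsto (fun i => f i * g i) l (𝓝 0) := by
  refine squeeze_zero_norm' ?_ (by simpa using hg.abs.const_mul K)
  filter_upwards [hf] with i hi
  rw [Real.norm_eq_abs, abs_mul]
  exact mul_le_mul_of_nonneg_right hi (abs_nonneg _)

namespace FlatCusp

variable {D : ℝ × ℝ × ℝ → ℝ} {s A : ℝ → ℝ} {Fh Gh : ℝ × ℝ × ℝ → ℝ} {α β e M : ℝ}
  (C : FlatCusp D s A Fh Gh α β e)
include C

lemma contXXXX : Continuous (partialX (partialX (partialX (partialX D)))) :=
  (C.contXXX.partialX (m := 0) (by norm_num)).continuous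

lemma taylorU4 (τ u y : ℝ) : ∃ ζ, |ζ - s y| ≤ |u - s y| ∧ D (τ, u, y) = D (τ, s y, y) +
    partialX D (τ, s y, y) * (u - s y) + partialX (partialX D) (τ, s y, y) * (u - s y) ^ 2 / 2 +
    partialX (partialX (partialX D)) (τ, s y, y) * (u - s y) ^ 3 / 6 +
    partialX (partialX (partialX (partialX D))) (τ, ζ, y) * (u - s y) ^ 4 / 24 :=
  exists_taylor_four (fun u => hasDerivAt_partialX C.diffD τ u y)
    (fun u => hasDerivAt_partialX C.diffX τ u y) (fun u => hasDerivAt_partialX C.diffXX τ u y)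
    (fun u => hasDerivAt_partialX C.diffXXX τ u y) (s y) u

lemma taylorX3 (τ u y : ℝ) : ∃ ζ, |ζ - s y| ≤ |u - s y| ∧ partialX D (τ, u, y) =
    partialX D (τ, s y, y) + partialX (partialX D) (τ, s y, y) * (u - s y) +
    partialX (partialX (partialX D)) (τ, s y, y) * (u - s y) ^ 2 / 2 +
    partialX (partialX (partialX (partialX D))) (τ, ζ, y) * (u - s y) ^ 3 / 6 :=
  exists_taylor_three (fun u => hasDerivAt_partialX C.diffX τ u y)
    (fun u => hasDerivAt_partialX C.diffXX τ u y)
    (fun u => hasDerivAt_partialX C.diffXXX τ u y) (s y) u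

lemma center_D (τ y : ℝ) : ∃ t, |t| ≤ |τ| ∧
    D (τ, s y, y) = A y * τ + partialT (partialT D) (t, s y, y) * τ ^ 2 / 2 := by
  obtain ⟨t, h1, e1⟩ := exists_taylor_two (fun t => hasDerivAt_partialT C.diffD t (s y) y)
    (fun t => hasDerivAt_partialT C.diffT t (s y) y) 0 τ
  refine ⟨t, by simpa using h1, ?_⟩
  rw [e1, C.zero, C.slope]; ring

lemma center_X (τ y : ℝ) : ∃ t, |t| ≤ |τ| ∧
    partialX D (τ, s y, y) = τ * partialT (partialX D) (t, s y, y) := by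
  obtain ⟨t, h1, e1⟩ := exists_taylor_one (fun t => hasDerivAt_partialT C.diffX t (s y) y) 0 τ
  refine ⟨t, by simpa using h1, ?_⟩
  rw [e1, C.zeroX]; ring

lemma center_XX (τ y : ℝ) : ∃ t, |t| ≤ |τ| ∧
    partialX (partialX D) (τ, s y, y) = τ * partialT (partialX (partialX D)) (t, s y, y) := by
  obtain ⟨t, h1, e1⟩ := exists_taylor_one (fun t => hasDerivAt_partialT C.diffXX t (s y) y) 0 τ
  refine ⟨t, by simpa using h1, ?_⟩
  rw [e1, C.zeroXX]; ring

lemma contTXX : Continuous (partialT (partialX (partialX D))) :=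
  (C.contXX.partialT (m := 1) (by norm_num)).continuous

end FlatCusp

/-- The limit of `(D_{τu} (u₊ + u₋ - 2 s) + w) / τ` along pairs of outer roots. -/
def pairCoeff (D : ℝ × ℝ × ℝ → ℝ) (s : ℝ → ℝ) (y : ℝ) : ℝ :=
  (partialT (partialT D) (0, s y, y) +
    partialT (partialX (partialX D)) (0, s y, y) * rootCoeff D s y +
    partialX (partialX (partialX (partialX D))) (0, s y, y) * rootCoeff D s y ^ 2 / 12) / 2

namespace FlatCusp

variable {D : ℝ × ℝ × ℝ → ℝ} {s A : ℝ → ℝ} {Fh Gh : ℝ × ℝ × ℝ → ℝ} {α β e M : ℝ}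
  (C : FlatCusp D s A Fh Gh α β e)
  {ι : Type*} {l : Filter ι} {ybar : ℝ} {τ w y u v : ι → ℝ}
  (R : RootFamily D s A (α / β) e M l ybar 1 τ w y u)
  (R' : RootFamily D s A (α / β) e M l ybar (-1) τ w y v)
include C R R'

lemma ratio_lim_one : Tendsto (fun i => (u i - s (y i)) / Real.sqrt (τ i)) l
    (𝓝 (Real.sqrt (rootCoeff D s ybar))) := by
  simpa using C.ratio_lim R

lemma ratio_lim_neg_one : Tendsto (fun i => (v i - s (y i)) / Real.sqrt (τ i)) l
    (𝓝 (-Real.sqrt (rootCoeff D s ybar))) := by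
  simpa using C.ratio_lim R'

lemma pair_lim : Tendsto (fun i => (partialT (partialX D) (0, s ybar, ybar) *
    ((u i - s (y i)) + (v i - s (y i))) + w i) / τ i) l (𝓝 (pairCoeff D s ybar)) := by
  have la := C.ratio_lim_one R R'
  have lb := C.ratio_lim_neg_one R R'
  have hm2 : Real.sqrt (rootCoeff D s ybar) ^ 2 = rootCoeff D s ybar :=
    Real.sq_sqrt (C.rootCoeff_pos _).le
  have hm : 0 < Real.sqrt (rootCoeff D s ybar) := Real.sqrt_pos.2 (C.rootCoeff_pos _)
  set m := Real.sqrt (rootCoeff D s ybar) with hmdef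
  choose t0 h0 q0 using fun i => C.center_D (τ i) (y i)
  choose t1 h1 q1 using fun i => C.center_X (τ i) (y i)
  choose t2 h2 q2 using fun i => C.center_XX (τ i) (y i)
  choose z hz qz using fun i => C.taylorU4 (τ i) (u i) (y i)
  choose z' hz' qz' using fun i => C.taylorU4 (τ i) (v i) (y i)
  have l0 := C.tendsto_midT R C.contTT.continuous h0
  have l1 := C.tendsto_midT R C.contTX.continuous h1
  have l2 := C.tendsto_midT R C.contTXX h2
  have l3 := C.tendsto_midT R C.contXXX.continuous (τ₁ := τ) (fun _ => le_rfl)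
  have l4 := C.tendsto_mid R C.contXXXX (fun _ => le_rfl) hz
  have l4' := C.tendsto_mid R' C.contXXXX (fun _ => le_rfl) hz'
  have hp := C.slopeX_pos ybar
  set a := fun i => (u i - s (y i)) / Real.sqrt (τ i) with ha
  set b := fun i => (v i - s (y i)) / Real.sqrt (τ i) with hb
  have lS : Tendsto (fun i => a i + b i) l (𝓝 0) := by simpa using la.add lb
  have lab : Tendsto (fun i => a i - b i) l (𝓝 (2 * m)) := by
    have := la.sub lb
    rwa [show m - -m = 2 * m by ring] at this
  have lρ := ((l4.mul (la.pow 4)).sub (l4'.mul (lb.pow 4))).div (lab.const_mul 24)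
    (by positivity)
  have lrhs := ((((l0.sub (l2.mul (lS.pow 2))).sub (l2.mul (la.mul lb))).sub
    ((lS.const_mul 3).mul lρ)).add (((l4.mul (la.pow 4)).add (l4'.mul (lb.pow 4))).div_const
    24)).div_const 2
  have lK := l1.add ((l3.mul (lS.pow 2)).div_const 6)
  have e0 : partialT (partialX D) (0, s ybar, ybar) +
      partialX (partialX (partialX D)) (0, s ybar, ybar) * 0 ^ 2 / 6 =
      partialT (partialX D) (0, s ybar, ybar) := by ring
  rw [e0] at lK
  have lq := (tendsto_const_nhds (x := partialT (partialX D) (0, s ybar, ybar))).div lK hp.ne'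
  rw [div_self hp.ne'] at lq
  have hw : ∀ᶠ i in l, |w i / τ i| ≤ M := by
    filter_upwards [C.τ_pos R, R.w_le] with i hi hwi
    rw [abs_div, abs_of_pos hi, div_le_iff₀ hi]; exact hwi
  have lz := tendsto_bdd_mul hw (g := fun i => 1 - _) (by simpa using lq.const_sub 1)
  have lmain := (lrhs.mul lq).add lz
  have hm4 : m ^ 4 = rootCoeff D s ybar ^ 2 := by
    rw [show (4 : ℕ) = 2 * 2 from rfl, pow_mul, hm2]
  have hm4' : (-m) ^ 4 = rootCoeff D s ybar ^ 2 := by rw [Even.neg_pow (by decide), hm4]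
  rw [hm4, hm4', sub_self, zero_div, show m * -m = -rootCoeff D s ybar by rw [← hm2]; ring] at lmain
  have lmain' := lmain.congr' (f₂ := fun i => (partialT (partialX D) (0, s ybar, ybar) *
      ((u i - s (y i)) + (v i - s (y i))) + w i) / τ i) (by
    filter_upwards [C.τ_pos R, R.eq, R'.eq, lab.eventually_ne (by positivity : 2 * m ≠ 0),
      lK.eventually_ne hp.ne'] with i hi hu hv hab hK
    have hr : Real.sqrt (τ i) ≠ 0 := (Real.sqrt_pos.2 hi).ne'
    have hrτ : Real.sqrt (τ i) ^ 2 = τ i := Real.sq_sqrt hi.le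
    have hrτ4 : Real.sqrt (τ i) ^ 4 = τ i ^ 2 := by
      rw [show (4 : ℕ) = 2 * 2 from rfl, pow_mul, hrτ]
    have hua : a i * Real.sqrt (τ i) = u i - s (y i) := div_mul_cancel₀ _ hr
    have hvb : b i * Real.sqrt (τ i) = v i - s (y i) := div_mul_cancel₀ _ hr
    have key := root_pair_identity (A := A (y i)) (c := partialT (partialT D) (t0 i, s (y i), y i))
      (e₁ := partialT (partialX D) (t1 i, s (y i), y i))
      (e₂ := partialT (partialX (partialX D)) (t2 i, s (y i), y i))
      (e₃ := partialX (partialX (partialX D)) (τ i, s (y i), y i))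
      (E := partialX (partialX (partialX (partialX D))) (τ i, z i, y i))
      (E' := partialX (partialX (partialX (partialX D))) (τ i, z' i, y i)) (w := w i)
      hr (sub_ne_zero.1 hab)
      (by rw [hua, hrτ4, hrτ, ← hu, qz i, q0 i, q1 i, q2 i])
      (by rw [hvb, hrτ4, hrτ, ← hv, qz' i, q0 i, q1 i, q2 i])
    have hSτ : ((u i - s (y i)) + (v i - s (y i))) / τ i = (a i + b i) / Real.sqrt (τ i) := by
      rw [← hua, ← hvb]
      nth_rewrite 3 [← hrτ]
      field_simp
    rw [hrτ, ← hSτ] at key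
    simp only [Pi.div_apply]
    have hsplit : (partialT (partialX D) (0, s ybar, ybar) * ((u i - s (y i)) + (v i - s (y i))) +
        w i) / τ i = partialT (partialX D) (0, s ybar, ybar) *
        (((u i - s (y i)) + (v i - s (y i))) / τ i) + w i / τ i := by ring
    rw [hsplit, ← key]
    generalize partialT (partialX D) (t1 i, s (y i), y i) + partialX (partialX (partialX D))
      (τ i, s (y i), y i) * (a i + b i) ^ 2 / 6 = K at hK ⊢
    generalize (u i - s (y i) + (v i - s (y i))) / τ i = X
    generalize w i / τ i = W
    field_simp
    ring)
  convert lmain' using 2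
  rw [pairCoeff]
  ring

end FlatCusp

lemma hasDerivAt_line {h : ℝ × ℝ × ℝ → ℝ} (hh : Differentiable ℝ h) (c a b y θ : ℝ) :
    HasDerivAt (fun θ => h (c + θ * a, c + θ * b, y))
      (a * partialT h (c + θ * a, c + θ * b, y) + b * partialX h (c + θ * a, c + θ * b, y)) θ := by
  have h1 : ∀ a, HasDerivAt (fun θ => c + θ * a) a θ := fun a => by
    simpa using ((hasDerivAt_id θ).mul_const a).const_add c
  simpa using HasFDerivAt.comp_curve (hh _) (h1 a) (h1 b) (hasDerivAt_const θ y)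

lemma partialT_swap {h : ℝ × ℝ × ℝ → ℝ} (hh : Differentiable ℝ h)
    (hs : ∀ a b y, h (a, b, y) = h (b, a, y)) (a b y : ℝ) :
    partialT h (a, b, y) = partialX h (b, a, y) := by
  have h1 := hasDerivAt_partialT hh a b y
  simp only [hs _ b y] at h1
  exact h1.unique (hasDerivAt_partialX hh b a y)

namespace FlatCusp

variable {D : ℝ × ℝ × ℝ → ℝ} {s A : ℝ → ℝ} {Fh Gh : ℝ × ℝ × ℝ → ℝ} {α β e M : ℝ}
  (C : FlatCusp D s A Fh Gh α β e)
include C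

lemma diffF : Differentiable ℝ Fh := C.Fh2.differentiable (by norm_num)

lemma Fdiag_T (y : ℝ) :
    partialT Fh (s y, s y, y) = partialT (partialX D) (0, s y, y) / 2 := by
  have h1 := C.Fdiag' y
  rw [← partialT_swap C.diffF C.Fsymm] at h1
  linarith

lemma Fdiag_X (y : ℝ) :
    partialX Fh (s y, s y, y) = partialT (partialX D) (0, s y, y) / 2 := by
  rw [← partialT_swap C.diffF C.Fsymm, C.Fdiag_T]

lemma Fdiag_Y (y : ℝ) : partialY Fh (s y, s y, y) =
    deriv A y - deriv s y * partialT (partialX D) (0, s y, y) := by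
  have h1 := HasFDerivAt.comp_curve (C.diffF _) (C.diffs y).hasDerivAt
    (C.diffs y).hasDerivAt (hasDerivAt_id y)
  have h2 : (fun x => Fh (s x, s x, id x)) = A := funext C.Fdiag
  rw [h2] at h1
  have h3 := h1.deriv
  simp only [id] at h3
  rw [C.Fdiag_T, C.Fdiag_X] at h3
  linarith

lemma T_expansion (τ u y : ℝ) : ∃ t ζ, |t| ≤ |τ| ∧ |ζ - s y| ≤ |u - s y| ∧
    partialT D (τ, u, y) = A y + τ * partialT (partialT D) (t, u, y) +
      partialT (partialX D) (0, s y, y) * (u - s y) +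
      partialX (partialT (partialX D)) (0, ζ, y) * (u - s y) ^ 2 / 2 := by
  obtain ⟨t, h1, e1⟩ := exists_taylor_one (fun t => hasDerivAt_partialT C.diffT t u y) 0 τ
  have hTXd : Differentiable ℝ (partialT (partialX D)) := C.contTX.differentiable (by norm_num)
  obtain ⟨ζ, h2, e2⟩ := exists_taylor_two (fun u => hasDerivAt_partialX C.diffT 0 u y)
    (fun u => by rw [C.partialX_partialT]; exact hasDerivAt_partialX hTXd 0 u y) (s y) u
  refine ⟨t, ζ, by simpa using h1, h2, ?_⟩
  rw [e1, e2, C.slope, C.partialX_partialT]; ring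

lemma contXTX : Continuous (partialX (partialT (partialX D))) :=
  (C.contTX.partialX (m := 1) (by norm_num)).continuous

variable {ι : Type*} {l : Filter ι} {ybar : ℝ} {τ w y u v : ι → ℝ}
  (R : RootFamily D s A (α / β) e M l ybar 1 τ w y u)
  (R' : RootFamily D s A (α / β) e M l ybar (-1) τ w y v)
include R R'

lemma tendsto_line {h : ℝ × ℝ × ℝ → ℝ} (hh : Continuous h) {θ : ι → ℝ} (hθ : ∀ i, |θ i| ≤ 1) :
    Tendsto (fun i => h (s (y i) + θ i * (u i - s (y i)), s (y i) + θ i * (v i - s (y i)), y i)) l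
      (𝓝 (h (s ybar, s ybar, ybar))) := by
  have h1 : ∀ᶠ i in l, |θ i| ≤ 1 := Eventually.of_forall hθ
  have h2 := (C.s_lim R).add (tendsto_bdd_mul h1 (C.v_lim R))
  have h3 := (C.s_lim R).add (tendsto_bdd_mul h1 (C.v_lim R'))
  rw [add_zero] at h2 h3
  exact (hh.tendsto _).comp (h2.prodMk_nhds (h3.prodMk_nhds R.y_lim))

lemma tendsto_pair {h : ℝ × ℝ × ℝ → ℝ} (hh : Continuous h) :
    Tendsto (fun i => h (u i, v i, y i)) l (𝓝 (h (s ybar, s ybar, ybar))) :=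
  (hh.tendsto _).comp ((C.u_lim R).prodMk_nhds ((C.u_lim R').prodMk_nhds R.y_lim))

lemma sqrt_mul_ratio : ∀ᶠ i in l, 0 < Real.sqrt (τ i) ∧ Real.sqrt (τ i) ^ 2 = τ i ∧
    (u i - s (y i)) / Real.sqrt (τ i) * Real.sqrt (τ i) = u i - s (y i) ∧
    (v i - s (y i)) / Real.sqrt (τ i) * Real.sqrt (τ i) = v i - s (y i) := by
  filter_upwards [C.τ_pos R] with i hi
  have h := Real.sqrt_pos.2 hi
  exact ⟨h, Real.sq_sqrt hi.le, div_mul_cancel₀ _ h.ne', div_mul_cancel₀ _ h.ne'⟩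

/-- First order expansion of the right-hand side of the equation for `w`. -/
lemma exists_speed_lim : ∃ c, Tendsto (fun i => (Fh (u i, v i, y i) - A (y i) -
    τ i * deriv A (y i) * Gh (u i, v i, y i) + w i / 2) / τ i) l (𝓝 c) := by
  have hT : ContDiff ℝ 1 (partialT Fh) := C.Fh2.partialT (by norm_num)
  have hX : ContDiff ℝ 1 (partialX Fh) := C.Fh2.partialX (by norm_num)
  have hTd := hT.differentiable one_ne_zero
  have hXd := hX.differentiable one_ne_zero
  have la := C.ratio_lim_one R R'
  have lb := C.ratio_lim_neg_one R R'
  choose θ hθ eq using fun i => exists_taylor_two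
    (fun θ => hasDerivAt_line C.diffF (s (y i)) (u i - s (y i)) (v i - s (y i)) (y i) θ)
    (fun θ => ((hasDerivAt_line hTd (s (y i)) (u i - s (y i)) (v i - s (y i)) (y i) θ).const_mul
      (u i - s (y i))).add ((hasDerivAt_line hXd (s (y i)) (u i - s (y i)) (v i - s (y i))
      (y i) θ).const_mul (v i - s (y i)))) 0 1
  have hθ' : ∀ i, |θ i| ≤ 1 := fun i => by simpa using hθ i
  have lTT := C.tendsto_line R R' (hT.partialT (m := 0) (by norm_num)).continuous hθ'
  have lTX := C.tendsto_line R R' (hT.partialX (m := 0) (by norm_num)).continuous hθ'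
  have lXT := C.tendsto_line R R' (hX.partialT (m := 0) (by norm_num)).continuous hθ'
  have lXX := C.tendsto_line R R' (hX.partialX (m := 0) (by norm_num)).continuous hθ'
  have lA : Tendsto (fun i => deriv A (y i)) l (𝓝 (deriv A ybar)) :=
    (C.contA'.tendsto _).comp R.y_lim
  have lG := C.tendsto_pair R R' C.Gh2.continuous
  have la0 : Tendsto (fun i => partialT (partialX D) (0, s (y i), y i)) l
      (𝓝 (partialT (partialX D) (0, s ybar, ybar))) :=
    C.tendsto_midT R C.contTX.continuous (τ₁ := fun _ => 0) (fun _ => by simp)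
  have hp := C.slopeX_pos ybar
  have hw : ∀ᶠ i in l, |w i / τ i| ≤ M := by
    filter_upwards [C.τ_pos R, R.w_le] with i hi hwi
    rw [abs_div, abs_of_pos hi, div_le_iff₀ hi]; exact hwi
  have lq := la0.div_const (partialT (partialX D) (0, s ybar, ybar))
  rw [div_self hp.ne'] at lq
  have lz := tendsto_bdd_mul hw (g := fun i => 1 - _) (by simpa using lq.const_sub 1)
  have lP := C.pair_lim R R'
  have lmain := ((((lP.mul lq).add lz).div_const 2).add ((((la.mul ((la.mul lTT).add
    (lb.mul lTX))).add (lb.mul ((la.mul lXT).add (lb.mul lXX)))).div_const 2))).sub (lA.mul lG)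
  refine ⟨_, lmain.congr' ?_⟩
  filter_upwards [C.τ_pos R, C.sqrt_mul_ratio R R'] with i hi ⟨hr, hrτ, hua, hvb⟩
  have e1 := eq i
  simp only [zero_mul, add_zero, sub_zero, mul_one, one_pow, one_mul, add_sub_cancel, C.Fdiag,
    C.Fdiag_T, C.Fdiag_X] at e1
  rw [e1]
  have e2 : ∀ p q : ℝ, (u i - s (y i)) / Real.sqrt (τ i) * ((u i - s (y i)) / Real.sqrt (τ i) * p +
      (v i - s (y i)) / Real.sqrt (τ i) * q) = (u i - s (y i)) * ((u i - s (y i)) * p +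
      (v i - s (y i)) * q) / τ i := by
    intro p q; nth_rewrite 4 [← hrτ]; field_simp
  have e3 : ∀ p q : ℝ, (v i - s (y i)) / Real.sqrt (τ i) * ((u i - s (y i)) / Real.sqrt (τ i) * p +
      (v i - s (y i)) / Real.sqrt (τ i) * q) = (v i - s (y i)) * ((u i - s (y i)) * p +
      (v i - s (y i)) * q) / τ i := by
    intro p q; nth_rewrite 4 [← hrτ]; field_simp
  rw [e2, e3]
  field_simp
  ring

lemma exists_Fdiff_lim : ∃ c, Tendsto (fun i => (partialT Fh (u i, v i, y i) -
    partialX Fh (u i, v i, y i)) / Real.sqrt (τ i)) l (𝓝 c) := by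
  have hT : ContDiff ℝ 1 (partialT Fh) := C.Fh2.partialT (by norm_num)
  have hX : ContDiff ℝ 1 (partialX Fh) := C.Fh2.partialX (by norm_num)
  have hTd := hT.differentiable one_ne_zero
  have hXd := hX.differentiable one_ne_zero
  have la := C.ratio_lim_one R R'
  have lb := C.ratio_lim_neg_one R R'
  choose θ hθ eq using fun i => exists_taylor_one (fun θ =>
    (hasDerivAt_line hTd (s (y i)) (u i - s (y i)) (v i - s (y i)) (y i) θ).sub
    (hasDerivAt_line hXd (s (y i)) (u i - s (y i)) (v i - s (y i)) (y i) θ)) 0 1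
  have hθ' : ∀ i, |θ i| ≤ 1 := fun i => by simpa using hθ i
  have lTT := C.tendsto_line R R' (hT.partialT (m := 0) (by norm_num)).continuous hθ'
  have lTX := C.tendsto_line R R' (hT.partialX (m := 0) (by norm_num)).continuous hθ'
  have lXT := C.tendsto_line R R' (hX.partialT (m := 0) (by norm_num)).continuous hθ'
  have lXX := C.tendsto_line R R' (hX.partialX (m := 0) (by norm_num)).continuous hθ'
  refine ⟨_, (((la.mul lTT).add (lb.mul lTX)).sub ((la.mul lXT).add (lb.mul lXX))).congr' ?_⟩
  filter_upwards [C.sqrt_mul_ratio R R'] with i ⟨hr, hrτ, hua, hvb⟩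
  have e1 := eq i
  simp only [Pi.sub_apply, zero_mul, add_zero, sub_zero, mul_one, one_mul, add_sub_cancel,
    C.Fdiag_T, C.Fdiag_X, sub_self, zero_add] at e1
  rw [e1]
  field_simp

/-- `u_τ = (k_τ - D_τ) / D_u` along the two roots: the leading terms and the sum. -/
lemma exists_rate_lims {K : ι → ℝ} {ω κ₁ : ℝ} (hω : Tendsto (fun i => w i / τ i) l (𝓝 ω))
    (hK : Tendsto (fun i => (K i - A (y i)) / τ i) l (𝓝 κ₁)) :
    (∃ c, Tendsto (fun i => (K i - partialT D (τ i, u i, y i)) / partialX D (τ i, u i, y i) *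
      Real.sqrt (τ i)) l (𝓝 c)) ∧
    (∃ c, Tendsto (fun i => (K i - partialT D (τ i, v i, y i)) / partialX D (τ i, v i, y i) *
      Real.sqrt (τ i)) l (𝓝 c)) ∧
    ∃ c, Tendsto (fun i => (K i - partialT D (τ i, u i, y i)) / partialX D (τ i, u i, y i) +
      (K i - partialT D (τ i, v i, y i)) / partialX D (τ i, v i, y i)) l (𝓝 c) := by
  have la := C.ratio_lim_one R R'
  have lb := C.ratio_lim_neg_one R R'
  have lr := C.sqrt_lim R
  have hp := C.slopeX_pos ybar
  choose t z ht hz et using fun i => C.T_expansion (τ i) (u i) (y i)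
  choose t' z' ht' hz' et' using fun i => C.T_expansion (τ i) (v i) (y i)
  choose x hx ex using fun i => C.taylorX3 (τ i) (u i) (y i)
  choose x' hx' ex' using fun i => C.taylorX3 (τ i) (v i) (y i)
  choose t2 h2 q2 using fun i => C.center_XX (τ i) (y i)
  have lTT := C.tendsto_mid R C.contTT.continuous ht (fun _ => le_rfl)
  have lTT' := C.tendsto_mid R' C.contTT.continuous ht' (fun _ => le_rfl)
  have lXTX := C.tendsto_midX R C.contXTX hz
  have lXTX' := C.tendsto_midX R' C.contXTX hz'
  have la0 : Tendsto (fun i => partialT (partialX D) (0, s (y i), y i)) l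
      (𝓝 (partialT (partialX D) (0, s ybar, ybar))) :=
    C.tendsto_midT R C.contTX.continuous (τ₁ := fun _ => 0) (fun _ => by simp)
  have l2 := C.tendsto_midT R C.contTXX h2
  have l3 := C.tendsto_midT R C.contXXX.continuous (τ₁ := τ) (fun _ => le_rfl)
  have l4 := C.tendsto_mid R C.contXXXX (fun _ => le_rfl) hx
  have l4' := C.tendsto_mid R' C.contXXXX (fun _ => le_rfl) hx'
  have ld := C.X_div_lim R
  have ld' := C.X_div_lim R'
  have hd0 : -2 * partialT (partialX D) (0, s ybar, ybar) ≠ 0 := by simpa using hp.ne'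
  have lS : Tendsto (fun i => ((u i - s (y i)) + (v i - s (y i))) / τ i) l (𝓝 _) :=
    (((C.pair_lim R R').sub hω).div_const (partialT (partialX D) (0, s ybar, ybar))).congr' (by
      filter_upwards [C.τ_pos R] with i hi
      field_simp
      ring)
  have num : ∀ {x : ι → ℝ} {σ a : ℝ}, RootFamily D s A (α / β) e M l ybar σ τ w y x →
      Tendsto (fun i => (x i - s (y i)) / Real.sqrt (τ i)) l (𝓝 a) → ∃ c,
      Tendsto (fun i => (K i - partialT D (τ i, x i, y i)) / Real.sqrt (τ i)) l (𝓝 c) := by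
    intro x σ a R lx
    choose t z ht hz et using fun i => C.T_expansion (τ i) (x i) (y i)
    refine ⟨_, (((lr.mul hK).sub (lr.mul (C.tendsto_mid R C.contTT.continuous ht fun _ => le_rfl))).sub
      (la0.mul lx) |>.sub (lr.mul ((lx.pow 2).mul (C.tendsto_midX R C.contXTX hz)) |>.div_const
      2)).congr' ?_⟩
    filter_upwards [C.τ_pos R] with i hi
    have hr := Real.sqrt_pos.2 hi
    have hrτ := Real.sq_sqrt hi.le
    rw [et i]
    generalize Real.sqrt (τ i) = r at hr hrτ ⊢
    generalize τ i = T at hrτ ⊢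
    subst hrτ
    field_simp
    ring
  obtain ⟨c₁, ln⟩ := num R la
  obtain ⟨c₂, ln'⟩ := num R' lb
  have lsum : Tendsto (fun i => ((K i - partialT D (τ i, u i, y i)) +
      (K i - partialT D (τ i, v i, y i))) / τ i) l (𝓝 _) :=
    ((((hK.const_mul 2).sub (lTT.add lTT')).sub (la0.mul lS)).sub
      ((((la.pow 2).mul lXTX).add ((lb.pow 2).mul lXTX')).div_const 2)).congr' (by
      filter_upwards [C.sqrt_mul_ratio R R'] with i ⟨hr, hrτ, _⟩
      rw [et i, et' i]
      generalize Real.sqrt (τ i) = r at hr hrτ ⊢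
      generalize τ i = T at hrτ ⊢
      subst hrτ
      field_simp
      ring)
  have ldiff : Tendsto (fun i => (partialX D (τ i, u i, y i) - partialX D (τ i, v i, y i)) /
      (τ i * Real.sqrt (τ i))) l (𝓝 _) :=
    (((l2.mul (la.sub lb)).add ((l3.mul (lS.mul (la.sub lb))).div_const 2)).add
      (((l4.mul (la.pow 3)).sub (l4'.mul (lb.pow 3))).div_const 6)).congr' (by
      filter_upwards [C.sqrt_mul_ratio R R'] with i ⟨hr, hrτ, _⟩
      rw [ex i, ex' i, q2 i]
      generalize Real.sqrt (τ i) = r at hr hrτ ⊢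
      generalize τ i = T at hrτ ⊢
      subst hrτ
      field_simp
      ring)
  have hne : ∀ᶠ i in l, partialX D (τ i, u i, y i) ≠ 0 ∧ partialX D (τ i, v i, y i) ≠ 0 := by
    filter_upwards [ld.eventually_ne hd0, ld'.eventually_ne hd0] with i h1 h2
    exact ⟨fun h => h1 (by rw [h, zero_div]), fun h => h2 (by rw [h, zero_div])⟩
  refine ⟨⟨_, (ln.div ld hd0).congr' ?_⟩, ⟨_, (ln'.div ld' hd0).congr' ?_⟩,
    ⟨_, ((((lsum.mul (ld.add ld')).sub ((ln.sub ln').mul ldiff)).div_const 2).div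
      (ld.mul ld') (mul_ne_zero hd0 hd0)).congr' ?_⟩⟩
  all_goals
    filter_upwards [C.sqrt_mul_ratio R R', hne] with i ⟨hr, hrτ, _, _⟩ ⟨h1, h2⟩
    simp only [Pi.div_apply]
    generalize partialX D (τ i, u i, y i) = d at h1 ⊢
    generalize partialX D (τ i, v i, y i) = d' at h2 ⊢
    generalize K i - partialT D (τ i, u i, y i) = n
    generalize K i - partialT D (τ i, v i, y i) = n'
    generalize Real.sqrt (τ i) = r at hr hrτ ⊢
    generalize τ i = T at hrτ ⊢
    subst hrτ
    field_simp
  ring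

/-- The limit of `k_ττ`. -/
lemma exists_second_lim {K Ω Ω' : ι → ℝ} {ω κ₁ κ₂ κ₃ : ℝ}
    (hω : Tendsto (fun i => w i / τ i) l (𝓝 ω))
    (hK : Tendsto (fun i => (K i - A (y i)) / τ i) l (𝓝 κ₁))
    (hΩ : Tendsto (fun i => Ω i / τ i) l (𝓝 κ₂)) (hΩ' : Tendsto Ω' l (𝓝 κ₃)) :
    ∃ c, Tendsto (fun i =>
      let p := (K i - partialT D (τ i, u i, y i)) / partialX D (τ i, u i, y i)
      let q := (K i - partialT D (τ i, v i, y i)) / partialX D (τ i, v i, y i)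
      p * partialT Fh (u i, v i, y i) + q * partialX Fh (u i, v i, y i) -
        (p * partialT Gh (u i, v i, y i) + q * partialX Gh (u i, v i, y i)) * Ω i -
        Gh (u i, v i, y i) * Ω' i) l (𝓝 c) := by
  obtain ⟨⟨c1, lp⟩, ⟨c2, lq⟩, ⟨c3, lpq⟩⟩ := C.exists_rate_lims R R' hω hK
  obtain ⟨c4, lF⟩ := C.exists_Fdiff_lim R R'
  have lT := C.tendsto_pair R R' (C.Fh2.partialT (m := 1) (by norm_num)).continuous
  have lX := C.tendsto_pair R R' (C.Fh2.partialX (m := 1) (by norm_num)).continuous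
  have gT := C.tendsto_pair R R' (C.Gh2.partialT (m := 1) (by norm_num)).continuous
  have gX := C.tendsto_pair R R' (C.Gh2.partialX (m := 1) (by norm_num)).continuous
  have lG := C.tendsto_pair R R' C.Gh2.continuous
  refine ⟨_, ((((((lT.add lX).mul lpq).div_const 2).add ((lF.mul (lp.sub lq)).div_const 2)).sub
    (((lp.mul gT).add (lq.mul gX)).mul ((C.sqrt_lim R).mul hΩ))).sub (lG.mul hΩ')).congr' ?_⟩
  filter_upwards [C.sqrt_mul_ratio R R'] with i ⟨hr, hrτ, _, _⟩
  generalize (K i - partialT D (τ i, u i, y i)) / partialX D (τ i, u i, y i) = p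
  generalize (K i - partialT D (τ i, v i, y i)) / partialX D (τ i, v i, y i) = q
  have h1 : ∀ a : ℝ, a * Real.sqrt (τ i) * (Real.sqrt (τ i) * (Ω i / τ i)) = a * Ω i := by
    intro a
    nth_rewrite 3 [← hrτ]
    field_simp
  have h2 : (p * Real.sqrt (τ i) * partialT Gh (u i, v i, y i) +
      q * Real.sqrt (τ i) * partialX Gh (u i, v i, y i)) * (Real.sqrt (τ i) * (Ω i / τ i)) =
      (p * partialT Gh (u i, v i, y i) + q * partialX Gh (u i, v i, y i)) * Ω i := by
    rw [← h1]; ring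
  rw [h2]
  field_simp
  ring

end FlatCusp

/-- A function with limits at the points of `{0} × [-R,R]` is bounded near that segment. -/
lemma exists_bound_near_segment {g : ℝ × ℝ → ℝ} {R : ℝ}
    (hg : ∀ y, |y| ≤ R → ∃ c, Tendsto g (𝓝[{p | 0 < p.1 ∧ |p.2| ≤ R}] (0, y)) (𝓝 c)) :
    ∃ K τ₀ : ℝ, 0 ≤ K ∧ 0 < τ₀ ∧ ∀ τ y, 0 < τ → τ ≤ τ₀ → |y| ≤ R → |g (τ, y)| ≤ K := by
  suffices h : ∃ K τ₀ : ℝ, 0 ≤ K ∧ 0 < τ₀ ∧ ∀ τ y, 0 < τ → τ ≤ τ₀ → y ∈ Icc (-R) R →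
      |g (τ, y)| ≤ K by simpa only [mem_Icc, ← abs_le] using h
  refine isCompact_Icc.induction_on (p := fun S : Set ℝ => ∃ K τ₀ : ℝ, 0 ≤ K ∧ 0 < τ₀ ∧
    ∀ τ y, 0 < τ → τ ≤ τ₀ → y ∈ S → |g (τ, y)| ≤ K) ?_ ?_ ?_ ?_
  · exact ⟨0, 1, le_rfl, one_pos, fun _ _ _ _ h => h.elim⟩
  · rintro S S' h ⟨K, τ₀, h0, h1, h2⟩
    exact ⟨K, τ₀, h0, h1, fun τ y a b c => h2 τ y a b (h c)⟩
  · rintro S S' ⟨K, τ₀, h0, h1, h2⟩ ⟨K', τ₀', h0', h1', h2'⟩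
    refine ⟨max K K', min τ₀ τ₀', h0.trans (le_max_left _ _), lt_min h1 h1', ?_⟩
    rintro τ y a b (c | c)
    · exact (h2 τ y a (b.trans (min_le_left _ _)) c).trans (le_max_left _ _)
    · exact (h2' τ y a (b.trans (min_le_right _ _)) c).trans (le_max_right _ _)
  · intro y hy
    obtain ⟨c, hc⟩ := hg y (abs_le.2 hy)
    have h1 := hc.abs.eventually_lt_const (lt_add_one |c|)
    rw [eventually_nhdsWithin_iff, Metric.eventually_nhds_iff] at h1
    obtain ⟨δ, hδ, h1⟩ := h1
    refine ⟨Icc (-R) R ∩ Metric.ball y δ, inter_mem_nhdsWithin _ (Metric.ball_mem_nhds y hδ),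
      |c| + 1, δ / 2, by positivity, by positivity, ?_⟩
    rintro τ y' h2 h3 ⟨h4, h5⟩
    refine (h1 (y := (τ, y')) ?_ ⟨h2, (abs_le.2 h4 : |y'| ≤ R)⟩).le
    rw [Prod.dist_eq]
    refine max_lt ?_ h5
    rw [Real.dist_eq, sub_zero, abs_of_pos h2]
    linarith

/-- A strict bound at the tip of a cone persists for small times. -/
lemma exists_subcone {f : ℝ × PlaneState → ℝ} {τ₁ M R c : ℝ} (hτ₁ : 0 < τ₁)
    (hf : ContinuousOn f (stateCone τ₁ M R))
    (h : ∀ y, |y| ≤ R → f (0, (0, 0), y) < c) :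
    ∃ τ₂, 0 < τ₂ ∧ τ₂ ≤ τ₁ ∧ ∀ p ∈ stateCone τ₂ M R, f p < c := by
  set K := stateCone τ₁ M R ∩ f ⁻¹' Ici c with hK
  have hKc : IsCompact K := (isCompact_stateCone τ₁ M R).of_isClosed_subset
    (hf.preimage_isClosed_of_isClosed (isCompact_stateCone τ₁ M R).isClosed isClosed_Ici)
    inter_subset_left
  rcases K.eq_empty_or_nonempty with h0 | h0
  · refine ⟨τ₁, hτ₁, le_rfl, fun p hp => ?_⟩
    by_contra hcon
    exact (h0 ▸ (⟨hp, not_lt.1 hcon⟩ : p ∈ K) : p ∈ (∅ : Set _))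
  · obtain ⟨q, hq, hmin⟩ := hKc.exists_isMinOn h0 (continuous_fst.continuousOn)
    have hq0 : 0 < q.1 := by
      refine lt_of_le_of_ne hq.1.1.1 fun h1 => ?_
      obtain ⟨t, ⟨a, b⟩, y⟩ := q
      simp only at h1
      subst h1
      obtain ⟨⟨-, h2, h3, h4⟩, h5⟩ := hq
      simp only [mul_zero] at h2 h3
      have := h y h4
      rw [abs_nonpos_iff.1 h2, abs_nonpos_iff.1 h3] at h5
      exact absurd h5 (not_le.2 this)
    refine ⟨min τ₁ (q.1 / 2), by positivity, min_le_left _ _, fun p hp => ?_⟩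
    by_contra hcon
    have hpK : p ∈ K := ⟨⟨⟨hp.1.1, hp.1.2.trans (min_le_left _ _)⟩, hp.2⟩, not_lt.1 hcon⟩
    have h1 : q.1 ≤ p.1 := hmin hpK
    have h2 := hp.1.2.trans (min_le_right _ _)
    linarith

lemma ConeDiff.mono {E : Type*} [NormedAddCommGroup E] [NormedSpace ℝ E] {τ₁ τ₂ M R : ℝ}
    {q : ℝ × PlaneState → E} {q' : ℝ × PlaneState → PlaneState →L[ℝ] E}
    (hq : ConeDiff τ₁ M R q q') (h : τ₂ ≤ τ₁) : ConeDiff τ₂ M R q q' := by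
  have hs : stateCone τ₂ M R ⊆ stateCone τ₁ M R := fun p hp => ⟨⟨hp.1.1, hp.1.2.trans h⟩, hp.2⟩
  exact ⟨hq.cont.mono hs, hq.cont'.mono hs, fun p hp => hq.deriv p (hs hp)⟩

/-- Time, state, the two outer roots and their rates. -/
abbrev ShockJet := ℝ × PlaneState × (ℝ × ℝ) × (ℝ × ℝ)

/-- The right-hand side of the equation for `(w, Ω)`. -/
def shockRhs (A : ℝ → ℝ) (Fh Gh : ℝ × ℝ × ℝ → ℝ) (Q : ShockJet) : ℝ × ℝ :=
  let q : ℝ × ℝ × ℝ := (Q.2.2.1.1, Q.2.2.1.2, Q.2.1.2)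
  (Fh q - A Q.2.1.2 - Q.1 * deriv A Q.2.1.2 * Gh q,
    Q.2.1.1.2 + (partialT Fh q * Q.2.2.2.1 + partialX Fh q * Q.2.2.2.2 + Q.1 * partialY Fh q) -
    Q.2.1.1.2 * (partialT Gh q * Q.2.2.2.1 + partialX Gh q * Q.2.2.2.2 + Q.1 * partialY Gh q))

def shockDrift (Gh : ℝ × ℝ × ℝ → ℝ) (Q : ShockJet) : ℝ := Gh (Q.2.2.1.1, Q.2.2.1.2, Q.2.1.2)

section
variable (D : ℝ × ℝ × ℝ → ℝ) (s A : ℝ → ℝ) (γ e : ℝ)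

def shockJet (p : ℝ × PlaneState) : ShockJet :=
  (p.1, p.2, (stateRoot D s A γ e 1 p, stateRoot D s A γ e (-1) p),
    (stateRate D s A γ e 1 p, stateRate D s A γ e (-1) p))

def shockJet' (p : ℝ × PlaneState) : PlaneState →L[ℝ] ShockJet :=
  (0 : PlaneState →L[ℝ] ℝ).prod ((ContinuousLinearMap.id ℝ PlaneState).prod
    (((stateRoot' D s A γ e 1 p).prod (stateRoot' D s A γ e (-1) p)).prod
      ((stateRate' D s A γ e 1 p).prod (stateRate' D s A γ e (-1) p))))

end

namespace FlatCusp

variable {D : ℝ × ℝ × ℝ → ℝ} {s A : ℝ → ℝ} {Fh Gh : ℝ × ℝ × ℝ → ℝ} {α β e M R τ₁ : ℝ}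
  (C : FlatCusp D s A Fh Gh α β e)
include C

lemma contDiff_shockRhs : ContDiff ℝ 1 (shockRhs A Fh Gh) := by
  have h1 : ContDiff ℝ 1 Fh := C.Fh2.of_le (by norm_num)
  have h2 : ContDiff ℝ 1 Gh := C.Gh2.of_le (by norm_num)
  have h3 : ContDiff ℝ 1 A := C.A2.of_le (by norm_num)
  have h4 : ContDiff ℝ 1 (deriv A) := C.A2.deriv'
  have f1 : ContDiff ℝ 1 (partialT Fh) := C.Fh2.partialT (by norm_num)
  have f2 : ContDiff ℝ 1 (partialX Fh) := C.Fh2.partialX (by norm_num)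
  have f3 : ContDiff ℝ 1 (partialY Fh) := C.Fh2.partialY (by norm_num)
  have g1 : ContDiff ℝ 1 (partialT Gh) := C.Gh2.partialT (by norm_num)
  have g2 : ContDiff ℝ 1 (partialX Gh) := C.Gh2.partialX (by norm_num)
  have g3 : ContDiff ℝ 1 (partialY Gh) := C.Gh2.partialY (by norm_num)
  unfold shockRhs
  fun_prop

lemma contDiff_shockDrift : ContDiff ℝ 1 (shockDrift Gh) := by
  have h2 : ContDiff ℝ 1 Gh := C.Gh2.of_le (by norm_num)
  unfold shockDrift
  fun_prop

lemma coneDiff_shockJet (hτ₁ : 0 ≤ τ₁) (H : ConeRoots D s A (α / β) e M R τ₁) :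
    ConeDiff τ₁ M R (shockJet D s A (α / β) e) (shockJet' D s A (α / β) e) :=
  ConeDiff.time.prodMk (ConeDiff.state.prodMk
    (((C.coneDiff_stateRoot H (Or.inl rfl)).prodMk (C.coneDiff_stateRoot H (Or.inr rfl))).prodMk
    ((C.coneDiff_stateRate hτ₁ H (Or.inl rfl)).prodMk
      (C.coneDiff_stateRate hτ₁ H (Or.inr rfl)))))

lemma shockJet_zero (z : PlaneState) : shockJet D s A (α / β) e (0, z) =
    (0, z, (s z.2, s z.2), (0, 0)) := by
  simp only [shockJet]
  rw [C.stateRoot_of_nonpos le_rfl, C.stateRoot_of_nonpos le_rfl, C.stateRate_zero rfl,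
    C.stateRate_zero rfl]

/-- The linearisation at the tip is `(-1/2, 1/2)`, diagonal. -/
lemma fderiv_shockRhs_zero (y : ℝ) (v : PlaneState) :
    (fderiv ℝ (shockRhs A Fh Gh) (shockJet D s A (α / β) e (0, (0, 0), y)))
      (shockJet' D s A (α / β) e (0, (0, 0), y) v) = (-(v.1.1 / 2), v.1.2 / 2) := by
  have ha := (C.slopeX_pos y).ne'
  obtain ⟨⟨vw, vΩ⟩, vy⟩ := v
  set a₀ := partialT (partialX D) (0, s y, y) with ha₀
  set a := -(2 * a₀)⁻¹ * vw + deriv s y * vy with hadef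
  set n := -(2 * a₀)⁻¹ * vΩ with hn
  have e1 : shockJet' D s A (α / β) e (0, (0, 0), y) ((vw, vΩ), vy) =
      (0, ((vw, vΩ), vy), (a, a), (n, n)) := by
    simp [shockJet', stateRoot', stateRate', a, n, a₀]
  rw [e1, C.shockJet_zero]
  have hlin : ∀ c b : ℝ, HasDerivAt (fun t : ℝ => c + t * b) b 0 := fun c b => by
    simpa using ((hasDerivAt_id (0 : ℝ)).mul_const b).const_add c
  have hcurve : HasDerivAt (fun t : ℝ => ((t * 0, ((0 + t * vw, 0 + t * vΩ), y + t * vy),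
      (s y + t * a, s y + t * a), (0 + t * n, 0 + t * n)) : ShockJet))
      (0, ((vw, vΩ), vy), (a, a), (n, n)) 0 := by
    have h0 : HasDerivAt (fun t : ℝ => t * (0 : ℝ)) 0 0 := by simpa using hasDerivAt_const (0:ℝ) (0:ℝ)
    exact h0.prodMk ((((hlin _ _).prodMk (hlin _ _)).prodMk (hlin _ _)).prodMk
      (((hlin _ _).prodMk (hlin _ _)).prodMk ((hlin _ _).prodMk (hlin _ _))))
  have hΦ := (C.contDiff_shockRhs.differentiable one_ne_zero
    ((0, ((0, 0), y), (s y, s y), (0, 0)) : ShockJet)).hasFDerivAt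
  have h1 := HasFDerivAt.comp_hasDerivAt_of_eq (0 : ℝ) hΦ hcurve (by simp)
  refine h1.unique ?_
  have hp : ∀ {h : ℝ × ℝ × ℝ → ℝ}, Differentiable ℝ h →
      HasDerivAt (fun t : ℝ => h (s y + t * a, s y + t * a, y + t * vy))
        (a * partialT h (s y, s y, y) + a * partialX h (s y, s y, y) +
          vy * partialY h (s y, s y, y)) 0 := fun {h} hh => by
    have := HasFDerivAt.comp_curve (hh _) (hlin (s y) a) (hlin (s y) a) (hlin y vy)
    simpa using this
  have hA := (C.diffA (y + 0 * vy)).hasDerivAt.comp (0 : ℝ) (hlin y vy)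
  have f1 := (C.Fh2.partialT (m := 1) (by norm_num)).differentiable one_ne_zero
  have f2 := (C.Fh2.partialX (m := 1) (by norm_num)).differentiable one_ne_zero
  have g1 := (C.Gh2.partialT (m := 1) (by norm_num)).differentiable one_ne_zero
  have g2 := (C.Gh2.partialX (m := 1) (by norm_num)).differentiable one_ne_zero
  refine HasDerivAt.prodMk ?_ ?_
  · refine (((hp C.diffF).sub hA).congr_of_eventuallyEq (Eventually.of_forall fun t => ?_)).congr_deriv ?_
    · simp
    · rw [C.Fdiag_T, C.Fdiag_X, C.Fdiag_Y, ← ha₀, hadef]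
      simp only [zero_mul, add_zero]
      field_simp
      ring
  · have hn' := hlin 0 n
    have hΩ' := hlin 0 vΩ
    have := (hΩ'.add (((hp f1).mul hn').add ((hp f2).mul hn'))).sub
      (hΩ'.mul (((hp g1).mul hn').add ((hp g2).mul hn')))
    refine (this.congr_of_eventuallyEq (Eventually.of_forall fun t => ?_)).congr_deriv ?_
    · simp
    · simp only [Pi.add_apply, Pi.mul_apply, zero_mul, add_zero, mul_zero, zero_add, C.Fdiag_T, C.Fdiag_X, ← ha₀]
      rw [hn]
      field_simp
      ring

end FlatCusp

lemma stateCone_mono {τ₁ τ₂ M R : ℝ} (h : τ₂ ≤ τ₁) : stateCone τ₂ M R ⊆ stateCone τ₁ M R :=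
  fun _ hp => ⟨⟨hp.1.1, hp.1.2.trans h⟩, hp.2⟩

section
variable (D : ℝ × ℝ × ℝ → ℝ) (s A : ℝ → ℝ) (Fh Gh : ℝ × ℝ × ℝ → ℝ) (γ e : ℝ)

/-- Right-hand side of the singular system for `(w, Ω)`, and its derivative. -/
def coneRhs (p : ℝ × PlaneState) : ℝ × ℝ := shockRhs A Fh Gh (shockJet D s A γ e p)

def coneRhs' (p : ℝ × PlaneState) : PlaneState →L[ℝ] ℝ × ℝ :=
  (fderiv ℝ (shockRhs A Fh Gh) (shockJet D s A γ e p)).comp (shockJet' D s A γ e p)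

/-- Drift of the singular system, and its derivative. -/
def coneDrift (p : ℝ × PlaneState) : ℝ := shockDrift Gh (shockJet D s A γ e p)

def coneDrift' (p : ℝ × PlaneState) : PlaneState →L[ℝ] ℝ :=
  (fderiv ℝ (shockDrift Gh) (shockJet D s A γ e p)).comp (shockJet' D s A γ e p)

end

namespace FlatCusp

variable {D : ℝ × ℝ × ℝ → ℝ} {s A : ℝ → ℝ} {Fh Gh : ℝ × ℝ × ℝ → ℝ} {α β e M R τ₁ : ℝ}
  (C : FlatCusp D s A Fh Gh α β e)

lemma ConeRoots.mono {γ τ₂ : ℝ} (H : ConeRoots D s A γ e M R τ₁) (h : τ₂ ≤ τ₁) :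
    ConeRoots D s A γ e M R τ₂ :=
  ⟨h.trans_lt H.1, fun σ hσ τ w y h0 h1 => H.2 σ hσ τ w y h0 (h1.trans h)⟩

include C

lemma exists_coneRoots (R : ℝ) {M : ℝ} (hM : 0 ≤ M) :
    ∃ τ₁, 0 < τ₁ ∧ ConeRoots D s A (α / β) e M R τ₁ := by
  obtain ⟨τ₀, h0, h1, h2⟩ := C.exists_outer_roots R M hM
  have := C.e_pos
  exact ⟨min τ₀ (e / 2), by positivity, (min_le_right _ _).trans_lt (by linarith),
    fun σ hσ τ w y a b => h2 σ hσ τ w y a (b.trans (min_le_left _ _))⟩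

lemma zero_family (H : ConeRoots D s A (α / β) e 0 R τ₁) (hτ₁ : 0 < τ₁) {σ : ℝ}
    (hσ : σ = 1 ∨ σ = -1) (y : ℝ) : RootFamily D s A (α / β) e 0
      (𝓝[{p | 0 < p.1 ∧ |p.2| ≤ R}] ((0, y) : ℝ × ℝ)) y σ (fun p => p.1) (fun _ => 0)
      (fun p => p.2) (fun p => stateRoot D s A (α / β) e σ (p.1, (0, 0), p.2)) := by
  have h1 : ∀ᶠ p : ℝ × ℝ in 𝓝[{p | 0 < p.1 ∧ |p.2| ≤ R}] ((0, y) : ℝ × ℝ), 0 < p.1 ∧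
      ((p.1, (0, 0), p.2) : ℝ × PlaneState) ∈ stateCone τ₁ 0 R := by
    have : ∀ᶠ p : ℝ × ℝ in 𝓝 ((0, y) : ℝ × ℝ), p.1 < τ₁ :=
      continuousAt_fst.eventually (gt_mem_nhds hτ₁)
    filter_upwards [self_mem_nhdsWithin, this.filter_mono nhdsWithin_le_nhds] with p hp hp'
    exact ⟨hp.1, ⟨hp.1.le, hp'.le⟩, by simp, by simp, hp.2⟩
  have h2 := h1.mono fun p hp => C.stateRoot_spec H hσ hp.2 hp.1
  exact {
    τ_lim := tendsto_nhdsWithin_iff.2 ⟨(continuous_fst.tendsto' _ _ rfl).mono_left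
      nhdsWithin_le_nhds, h1.mono fun p hp => hp.1⟩
    y_lim := (continuous_snd.tendsto' _ _ rfl).mono_left nhdsWithin_le_nhds
    w_le := Eventually.of_forall fun p => by simp
    side := hσ
    outer := h2.mono fun p hp => hp.1
    eq := h2.mono fun p hp => hp.2.1
    upper := h2.mono fun p hp => hp.2.2 }

lemma exists_rhs_bound (R : ℝ) : ∃ K τ₀ : ℝ, 0 ≤ K ∧ 0 < τ₀ ∧ ∀ τ y, 0 < τ → τ ≤ τ₀ → |y| ≤ R →
    ‖coneRhs D s A Fh Gh (α / β) e (τ, (0, 0), y)‖ ≤ K * τ := by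
  obtain ⟨τ₁, hτ₁, H⟩ := C.exists_coneRoots R le_rfl
  obtain ⟨K, τ₀, hK, hτ₀, h⟩ := exists_bound_near_segment (R := R)
    (g := fun p => (coneRhs D s A Fh Gh (α / β) e (p.1, (0, 0), p.2)).1 / p.1) (fun y _ => by
      obtain ⟨c, hc⟩ := C.exists_speed_lim (C.zero_family H hτ₁ (Or.inl rfl) y)
        (C.zero_family H hτ₁ (Or.inr rfl) y)
      simp only [zero_div, add_zero] at hc
      exact ⟨c, hc⟩)
  obtain ⟨K', τ₀', hK', hτ₀', h'⟩ := exists_bound_near_segment (R := R)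
    (g := fun p => (coneRhs D s A Fh Gh (α / β) e (p.1, (0, 0), p.2)).2 / p.1) (fun y _ => by
      have R₁ := C.zero_family H hτ₁ (Or.inl rfl) y
      have R₂ := C.zero_family H hτ₁ (Or.inr rfl) y
      have r1 := C.rootY_lim R₁ (Ω := fun _ => 0) (a := 0)
        (by simpa only [zero_div] using tendsto_const_nhds)
      have r2 := C.rootY_lim R₂ (Ω := fun _ => 0) (a := 0)
        (by simpa only [zero_div] using tendsto_const_nhds)
      have lT := C.tendsto_pair R₁ R₂ (C.Fh2.partialT (m := 1) (by norm_num)).continuous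
      have lX := C.tendsto_pair R₁ R₂ (C.Fh2.partialX (m := 1) (by norm_num)).continuous
      have lY := C.tendsto_pair R₁ R₂ (C.Fh2.partialY (m := 1) (by norm_num)).continuous
      refine ⟨_, (((lT.mul r1).add (lX.mul r2)).add lY).congr' ?_⟩
      filter_upwards [C.τ_pos R₁] with p hp
      simp only [coneRhs, shockRhs, shockJet, stateRate]
      field_simp
      ring)
  refine ⟨max K K', min τ₀ τ₀', hK.trans (le_max_left _ _), lt_min hτ₀ hτ₀', ?_⟩
  intro τ y h0 h1 hy
  have e1 := h τ y h0 (h1.trans (min_le_left _ _)) hy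
  have e2 := h' τ y h0 (h1.trans (min_le_right _ _)) hy
  simp only [abs_div, abs_of_pos h0] at e1 e2
  rw [div_le_iff₀ h0] at e1 e2
  rw [Prod.norm_def]
  exact max_le (e1.trans (mul_le_mul_of_nonneg_right (le_max_left _ _) h0.le))
    (e2.trans (mul_le_mul_of_nonneg_right (le_max_right _ _) h0.le))

lemma coneRhs_zero (z : PlaneState) (hz : z.1 = 0) :
    coneRhs D s A Fh Gh (α / β) e (0, z) = 0 := by
  have h2 : z.1.2 = 0 := by rw [hz]; rfl
  rw [coneRhs, C.shockJet_zero, shockRhs]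
  simp [C.Fdiag, h2]

lemma exists_coneSystem (M₀ : ℝ) {R : ℝ} (hR : 0 ≤ R) : ∃ τ₁ M ℓ B, M₀ ≤ M ∧ τ₁ * B ≤ 1 / 8 ∧
    ConeRoots D s A (α / β) e M R τ₁ ∧
    ConeSystem (coneRhs D s A Fh Gh (α / β) e) (coneDrift D s A Gh (α / β) e)
      (coneRhs' D s A Fh Gh (α / β) e) (coneDrift' D s A Gh (α / β) e) τ₁ M R (3 / 5) ℓ B := by
  obtain ⟨K, τ₀, hK, hτ₀, hrhs⟩ := C.exists_rhs_bound R
  set M := max M₀ K with hM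
  have hM0 : 0 ≤ M := hK.trans (le_max_right _ _)
  obtain ⟨τ₁, hτ₁, H⟩ := C.exists_coneRoots R hM0
  have hQ := C.coneDiff_shockJet hτ₁.le H
  have hF : ConeDiff τ₁ M R (coneRhs D s A Fh Gh (α / β) e) (coneRhs' D s A Fh Gh (α / β) e) :=
    hQ.comp C.contDiff_shockRhs
  have hG : ConeDiff τ₁ M R (coneDrift D s A Gh (α / β) e) (coneDrift' D s A Gh (α / β) e) :=
    hQ.comp C.contDiff_shockDrift
  have htip : ∀ y, |y| ≤ R → ‖coneRhs' D s A Fh Gh (α / β) e (0, (0, 0), y)‖ < 3 / 5 := by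
    intro y _
    refine lt_of_le_of_lt (ContinuousLinearMap.opNorm_le_bound _ (by norm_num : (0:ℝ) ≤ 1 / 2)
      fun v => ?_) (by norm_num)
    have := C.fderiv_shockRhs_zero y v
    rw [coneRhs', ContinuousLinearMap.comp_apply, this, Prod.norm_def]
    have h1 : ‖v.1.1‖ ≤ ‖v‖ := (norm_fst_le v.1).trans (norm_fst_le v)
    have h2 : ‖v.1.2‖ ≤ ‖v‖ := (norm_snd_le v.1).trans (norm_fst_le v)
    refine max_le ?_ ?_
    · simp only [norm_neg, norm_div, Real.norm_two]; linarith
    · simp only [norm_div, Real.norm_two]; linarith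
  obtain ⟨τ₂, hτ₂, hτ₂₁, hnF⟩ := exists_subcone hτ₁ hF.cont'.norm htip
  obtain ⟨ℓ, hℓ⟩ := (isCompact_stateCone τ₁ M R).exists_bound_of_continuousOn hG.cont'
  obtain ⟨B, hB⟩ := (isCompact_stateCone τ₁ M R).exists_bound_of_continuousOn hG.cont
  set N := max (max ℓ B) 0 with hN
  have hN0 : 0 ≤ N := le_max_right _ _
  have hℓN : ℓ ≤ N := (le_max_left _ _).trans (le_max_left _ _)
  have hBN : B ≤ N := (le_max_right _ _).trans (le_max_left _ _)
  set τ₃ := min (min τ₂ τ₀) (1 / (8 * (N + 1))) with hτ₃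
  have hτ₃0 : 0 < τ₃ := by positivity
  have hτ₃₂ : τ₃ ≤ τ₂ := (min_le_left _ _).trans (min_le_left _ _)
  have hτ₃₁ : τ₃ ≤ τ₁ := hτ₃₂.trans hτ₂₁
  have hτN : τ₃ * N ≤ 1 / 8 := by
    have h1 : τ₃ ≤ 1 / (8 * (N + 1)) := min_le_right _ _
    rw [le_div_iff₀ (by positivity)] at h1
    nlinarith
  have hF' := hF.mono hτ₃₁
  have hG' := hG.mono hτ₃₁
  have hnF' : ∀ p ∈ stateCone τ₃ M R, ‖coneRhs' D s A Fh Gh (α / β) e p‖ ≤ 3 / 5 :=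
    fun p hp => (hnF p (stateCone_mono hτ₃₂ hp)).le
  refine ⟨τ₃, M, N, N, le_max_left _ _, hτN, ConeRoots.mono H hτ₃₁, ?_⟩
  exact {
    τ₁_pos := hτ₃0
    M_nonneg := hM0
    R_nonneg := hR
    κ_nonneg := by norm_num
    κ_lt := by norm_num
    ℓ_nonneg := hN0
    ℓ_le := by linarith
    ℓ_le' := by linarith
    contF := hF'.cont
    contG := hG'.cont
    contF' := hF'.cont'
    contG' := hG'.cont'
    derivF := hF'.deriv
    derivG := hG'.deriv
    normF' := hnF'
    normG' := fun p hp => (hℓ p (stateCone_mono hτ₃₁ hp)).trans hℓN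
    normF := by
      rintro ⟨τ, z⟩ hp
      rcases hp.1.1.eq_or_lt with h0 | h0
      · simp only at h0
        subst h0
        have hz : z.1 = 0 := by
          have h1 := hp.2.1
          have h2 := hp.2.2.1
          simp only [mul_zero] at h1 h2
          exact Prod.ext (abs_nonpos_iff.1 h1) (abs_nonpos_iff.1 h2)
        rw [C.coneRhs_zero z hz]
        simp
      · have hMτ : 0 ≤ M * τ := mul_nonneg hM0 hp.1.1
        have hz0 : (((0, 0), z.2) : PlaneState) ∈ coneSlice M R τ :=
          ⟨by simpa using hMτ, by simpa using hMτ, hp.2.2.2⟩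
        have h1 := (convex_coneSlice M R τ).norm_image_sub_le_of_norm_hasFDerivWithin_le
          (f := fun z => coneRhs D s A Fh Gh (α / β) e (τ, z)) (C := 3 / 5)
          (fun z' hz' => hF'.deriv (τ, z') ⟨hp.1, hz'⟩) (fun z' hz' => hnF' (τ, z') ⟨hp.1, hz'⟩)
          hz0 hp.2
        have h2 := hrhs τ z.2 h0 (hp.1.2.trans ((min_le_left _ _).trans (min_le_right _ _)))
          hp.2.2.2
        have h3 : ‖z - ((0, 0), z.2)‖ ≤ M * τ := by
          rw [Prod.norm_def, Prod.norm_def]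
          simp only [Prod.fst_sub, Prod.snd_sub, sub_zero, sub_self, norm_zero]
          exact max_le (max_le hp.2.1 hp.2.2.1) hMτ
        have h4 : K * τ ≤ M * τ := mul_le_mul_of_nonneg_right (le_max_right _ _) hp.1.1
        have h5 := norm_sub_norm_le (coneRhs D s A Fh Gh (α / β) e (τ, z))
          (coneRhs D s A Fh Gh (α / β) e (τ, (0, 0), z.2))
        simp only at h1 ⊢
        linarith
    normG := fun p hp => (hB p (stateCone_mono hτ₃₁ hp)).trans hBN }

lemma diffG : Differentiable ℝ Gh := C.Gh2.differentiable (by norm_num)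

lemma hasDerivAt_A' (y : ℝ) : HasDerivAt (deriv A) (deriv (deriv A) y) y := by
  have h4 : ContDiff ℝ 1 (deriv A) := C.A2.deriv'
  exact (h4.differentiable one_ne_zero y).hasDerivAt

lemma fderiv_shockRhs_fst (Q V : ShockJet) :
    let q : ℝ × ℝ × ℝ := (Q.2.2.1.1, Q.2.2.1.2, Q.2.1.2)
    (fderiv ℝ (shockRhs A Fh Gh) Q V).1 = (V.2.2.1.1 * partialT Fh q + V.2.2.1.2 * partialX Fh q +
      V.2.1.2 * partialY Fh q) - V.2.1.2 * deriv A Q.2.1.2 -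
      (V.1 * deriv A Q.2.1.2 + Q.1 * (V.2.1.2 * deriv (deriv A) Q.2.1.2)) * Gh q -
      Q.1 * deriv A Q.2.1.2 * (V.2.2.1.1 * partialT Gh q + V.2.2.1.2 * partialX Gh q +
      V.2.1.2 * partialY Gh q) := by
  intro q
  have hline : HasDerivAt (fun t : ℝ => Q + t • V) V 0 := by
    simpa using ((hasDerivAt_id (0 : ℝ)).smul_const V).const_add Q
  have hΦ := (C.contDiff_shockRhs.differentiable one_ne_zero Q).hasFDerivAt
  have h1 : HasDerivAt (fun t : ℝ => (shockRhs A Fh Gh (Q + t • V)).1)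
      (fderiv ℝ (shockRhs A Fh Gh) Q V).1 0 :=
    (ContinuousLinearMap.fst ℝ ℝ ℝ).hasFDerivAt.comp_hasDerivAt (0 : ℝ)
      (HasFDerivAt.comp_hasDerivAt_of_eq (0 : ℝ) hΦ hline (by simp))
  refine h1.unique ?_
  have hlin : ∀ c b : ℝ, HasDerivAt (fun t : ℝ => c + t * b) b 0 := fun c b => by
    simpa using ((hasDerivAt_id (0 : ℝ)).mul_const b).const_add c
  have hp : ∀ {h : ℝ × ℝ × ℝ → ℝ}, Differentiable ℝ h →
      HasDerivAt (fun t : ℝ => h (Q.2.2.1.1 + t * V.2.2.1.1, Q.2.2.1.2 + t * V.2.2.1.2,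
        Q.2.1.2 + t * V.2.1.2))
        (V.2.2.1.1 * partialT h q + V.2.2.1.2 * partialX h q + V.2.1.2 * partialY h q) 0 :=
    fun {h} hh => by
    have := HasFDerivAt.comp_curve (hh _) (hlin Q.2.2.1.1 V.2.2.1.1) (hlin Q.2.2.1.2 V.2.2.1.2)
      (hlin Q.2.1.2 V.2.1.2)
    simpa using this
  have hA := HasDerivAt.comp_of_eq (0 : ℝ) (C.diffA Q.2.1.2).hasDerivAt (hlin Q.2.1.2 V.2.1.2)
    (by simp)
  have hA' := HasDerivAt.comp_of_eq (0 : ℝ) (C.hasDerivAt_A' Q.2.1.2) (hlin Q.2.1.2 V.2.1.2)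
    (by simp)
  have := ((hp C.diffF).sub hA).sub (((hlin Q.1 V.1).mul hA').mul (hp C.diffG))
  refine (this.congr_of_eventuallyEq (Eventually.of_forall fun t => ?_)).congr_deriv ?_
  · simp [shockRhs]
  · simp [q]
    ring

lemma fderiv_shockDrift (Q V : ShockJet) :
    let q : ℝ × ℝ × ℝ := (Q.2.2.1.1, Q.2.2.1.2, Q.2.1.2)
    fderiv ℝ (shockDrift Gh) Q V = V.2.2.1.1 * partialT Gh q + V.2.2.1.2 * partialX Gh q +
      V.2.1.2 * partialY Gh q := by
  intro q
  have hline : HasDerivAt (fun t : ℝ => Q + t • V) V 0 := by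
    simpa using ((hasDerivAt_id (0 : ℝ)).smul_const V).const_add Q
  have hΦ := (C.contDiff_shockDrift.differentiable one_ne_zero Q).hasFDerivAt
  have h1 := HasFDerivAt.comp_hasDerivAt_of_eq (0 : ℝ) hΦ hline (by simp)
  refine h1.unique ?_
  have hlin : ∀ c b : ℝ, HasDerivAt (fun t : ℝ => c + t * b) b 0 := fun c b => by
    simpa using ((hasDerivAt_id (0 : ℝ)).mul_const b).const_add c
  have := HasFDerivAt.comp_curve (C.diffG _) (hlin Q.2.2.1.1 V.2.2.1.1)
    (hlin Q.2.2.1.2 V.2.2.1.2) (hlin Q.2.1.2 V.2.1.2)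
  refine (this.congr_of_eventuallyEq (Eventually.of_forall fun t => ?_)).congr_deriv ?_
  · simp [shockDrift]
  · simp [q]

variable {ℓ B : ℝ} (S : ConeSystem (coneRhs D s A Fh Gh (α / β) e) (coneDrift D s A Gh (α / β) e)
  (coneRhs' D s A Fh Gh (α / β) e) (coneDrift' D s A Gh (α / β) e) τ₁ M R (3 / 5) ℓ B)
  (H : ConeRoots D s A (α / β) e M R τ₁)
include H

/-- Along an orbit and its variation, `τ (A' + δw / δy)` satisfies the equation of `Ω`. -/
lemma slope_equation {τ y₀ : ℝ} (hτ : τ ∈ Ioo 0 τ₁) (hy : |y₀| + τ₁ * B ≤ R) :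
    let z := S.flow (τ, y₀)
    let δ := S.dflow (τ, y₀)
    let Ω := τ * deriv A z.2 + τ * δ.1.1 / δ.2
    HasDerivAt (fun σ => σ * (σ * deriv A (S.flow (σ, y₀)).2 +
        σ * (S.dflow (σ, y₀)).1.1 / (S.dflow (σ, y₀)).2))
      (coneRhs D s A Fh Gh (α / β) e (τ, (z.1.1, Ω), z.2)).2 τ := by
  intro z δ Ω
  have hτ0 : 0 < τ := hτ.1
  obtain ⟨-, hz2⟩ := S.hasDerivAt_flow_time hτ hy
  obtain ⟨hd1, hd2⟩ := S.hasDerivAt_dflow_time hτ hy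
  have hδ2 : (S.dflow (τ, y₀)).2 ≠ 0 := by
    have := S.half_le_dflow (τ, y₀); linarith
  have hX : HasDerivAt (fun σ => σ * (S.dflow (σ, y₀)).1.1) _ τ := hd1.fst
  have hA := (C.hasDerivAt_A' z.2).comp τ hz2
  have hmem : ((τ, z) : ℝ × PlaneState) ∈ stateCone τ₁ M R :=
    ⟨⟨hτ.1.le, hτ.2.le⟩, (S.flow_mem ⟨hτ.1.le, hτ.2.le⟩ hy).1⟩
  have hne1 := C.outer_X_ne H (Or.inl rfl) hmem hτ0
  have hne2 := C.outer_X_ne H (Or.inr rfl) hmem hτ0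
  have hmain := (hasDerivAt_id τ).mul (((hasDerivAt_id τ).mul hA).add (hX.div hd2 hδ2))
  refine hmain.congr_deriv ?_
  have hr : ∀ σ, stateRoot D s A (α / β) e σ (τ, (z.1.1, Ω), z.2) =
      stateRoot D s A (α / β) e σ (τ, z) := fun σ => rfl
  have e1 := C.fderiv_shockRhs_fst (shockJet D s A (α / β) e (τ, z))
    (shockJet' D s A (α / β) e (τ, z) δ)
  have e2 := C.fderiv_shockDrift (shockJet D s A (α / β) e (τ, z))
    (shockJet' D s A (α / β) e (τ, z) δ)
  have e1' : ((coneRhs' D s A Fh Gh (α / β) e (τ, z)) δ).1 = _ := e1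
  have e2' : (coneDrift' D s A Gh (α / β) e (τ, z)) δ = _ := e2
  have eδ : S.dflow (τ, y₀) = δ := rfl
  have ez : S.flow (τ, y₀) = z := rfl
  rw [eδ] at hδ2
  simp only [ez, eδ, e1', e2', id, Pi.mul_apply, Pi.add_apply, Pi.div_apply, Function.comp]
  clear e1 e2 e1' e2' hmain hA hX hd1 hd2 hz2
  simp only [coneRhs, coneDrift, shockRhs, shockDrift, shockJet, stateRate, hr]
  simp only [shockJet', stateRoot', if_pos hτ0, ContinuousLinearMap.prod_apply, zero_apply,
    ContinuousLinearMap.id_apply, add_apply, smul_apply, stateW_apply,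
    stateY_apply, smul_eq_mul]
  simp only [Ω]
  generalize stateRoot D s A (α / β) e 1 (τ, z) = u at *
  generalize stateRoot D s A (α / β) e (-1) (τ, z) = v at *
  generalize partialX D (τ, u, z.2) = a at *
  generalize partialX D (τ, v, z.2) = b at *
  field_simp
  ring

/-- The second unknown is the `y`-derivative of `τ (A + w)`. -/
lemma slope_flow (hM : ∀ y, |y| ≤ R → |deriv A y| + 5 ≤ M) {τ y₀ : ℝ} (hτ : τ ∈ Ioo 0 τ₁)
    (hy : |y₀| + τ₁ * B ≤ R) : (S.flow (τ, y₀)).1.2 = τ * deriv A (S.flow (τ, y₀)).2 +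
      τ * (S.dflow (τ, y₀)).1.1 / (S.dflow (τ, y₀)).2 := by
  set Ω' : ℝ → ℝ := fun σ => σ * deriv A (S.flow (σ, y₀)).2 +
    σ * (S.dflow (σ, y₀)).1.1 / (S.dflow (σ, y₀)).2 with hΩ'
  have hδ : ∀ σ, 1 / 2 ≤ (S.dflow (σ, y₀)).2 := fun σ => S.half_le_dflow _
  have hcf := S.continuous_flow
  have hcd := S.continuous_dflow
  have hcA := C.contA'
  have hδ' : ∀ σ, (S.dflow (σ, y₀)).2 ≠ 0 := fun σ => by have := hδ σ; linarith
  have hcont : Continuous fun σ => Ω' σ - (S.flow (σ, y₀)).1.2 := by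
    simp only [hΩ']
    fun_prop (disch := assumption)
  obtain ⟨σ, hσ, hmax⟩ := isCompact_Icc.exists_isMaxOn (nonempty_Icc.2 hτ.1.le)
    (hcont.abs.continuousOn (s := Icc 0 τ))
  set m := |Ω' σ - (S.flow (σ, y₀)).1.2| with hm
  have hm' : ∀ c ∈ Icc 0 τ, |Ω' c - (S.flow (c, y₀)).1.2| ≤ m := fun c hc => hmax hc
  suffices hm0 : m ≤ 0 by
    have := (hm' τ ⟨hτ.1.le, le_rfl⟩).trans hm0
    have := sub_eq_zero.1 (abs_nonpos_iff.1 this)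
    exact this.symm
  rcases hσ.1.eq_or_lt with h0 | h0
  · have := (S.flow_mem (τ := 0) ⟨le_rfl, hτ.1.le.trans hτ.2.le⟩ hy).1.2.1
    rw [mul_zero] at this
    rw [hm, ← h0, abs_nonpos_iff.1 this]
    simp [hΩ']
  have hder : ∀ c ∈ Ioo 0 τ₁, HasDerivAt (fun c => c * (Ω' c - (S.flow (c, y₀)).1.2))
      ((coneRhs D s A Fh Gh (α / β) e (c, ((S.flow (c, y₀)).1.1, Ω' c), (S.flow (c, y₀)).2)).2 -
        (coneRhs D s A Fh Gh (α / β) e (c, S.flow (c, y₀))).2) c := by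
    intro c hc
    have h1 := C.slope_equation S H hc hy
    have h2 : HasDerivAt (fun σ => σ * (S.flow (σ, y₀)).1.2) _ c :=
      (S.hasDerivAt_flow_time hc hy).1.snd
    refine (h1.sub h2).congr_of_eventuallyEq (Eventually.of_forall fun c => ?_)
    simp only [hΩ', Pi.sub_apply]
    ring
  have hlip : ∀ c ∈ Ioo 0 τ₁,
      |(coneRhs D s A Fh Gh (α / β) e (c, ((S.flow (c, y₀)).1.1, Ω' c), (S.flow (c, y₀)).2)).2 -
        (coneRhs D s A Fh Gh (α / β) e (c, S.flow (c, y₀))).2| ≤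
        3 / 5 * |Ω' c - (S.flow (c, y₀)).1.2| := by
    intro c hc
    have hc' : c ∈ Icc 0 τ₁ := ⟨hc.1.le, hc.2.le⟩
    have hz := (S.flow_mem hc' hy).1
    have hz' : (((S.flow (c, y₀)).1.1, Ω' c), (S.flow (c, y₀)).2) ∈ coneSlice M R c := by
      refine ⟨hz.1, ?_, hz.2.2⟩
      have hw : |(S.dflow (c, y₀)).1.1| ≤ 5 / 2 := by
        have h1 : ‖S.dflow (c, y₀)‖ ≤ 1 / (1 - 3 / 5) :=
          (ContinuousMap.norm_coe_le_norm _ _).trans (S.norm_vari_le y₀)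
        have h2 : ‖(S.dflow (c, y₀)).1.1‖ ≤ ‖S.dflow (c, y₀)‖ := (norm_fst_le _).trans (norm_fst_le _)
        rw [Real.norm_eq_abs] at h2
        norm_num at h1 ⊢
        linarith
      have hd := hδ c
      have hq : |(S.dflow (c, y₀)).1.1 / (S.dflow (c, y₀)).2| ≤ 5 := by
        rw [abs_div, abs_of_pos (a := (S.dflow (c, y₀)).2) (by linarith), div_le_iff₀ (by linarith)]
        linarith
      have e1 : Ω' c = c * (deriv A (S.flow (c, y₀)).2 +
          (S.dflow (c, y₀)).1.1 / (S.dflow (c, y₀)).2) := by simp only [hΩ']; ring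
      rw [e1, abs_mul, abs_of_pos hc.1, mul_comm]
      refine mul_le_mul_of_nonneg_right ?_ hc.1.le
      exact (abs_add_le _ _).trans ((by linarith : _ ≤ _).trans (hM _ hz.2.2))
    have h1 := (convex_coneSlice M R c).norm_image_sub_le_of_norm_hasFDerivWithin_le
      (f := fun z => coneRhs D s A Fh Gh (α / β) e (c, z)) (C := 3 / 5)
      (fun z' hz' => S.derivF (c, z') ⟨hc', hz'⟩) (fun z' hz' => S.normF' (c, z') ⟨hc', hz'⟩)
      hz hz'
    refine (norm_snd_le _).trans (h1.trans (mul_le_mul_of_nonneg_left ?_ (by norm_num)))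
    rw [Prod.norm_def, Prod.norm_def]
    simp
  have hg : Continuous fun c => c * (Ω' c - (S.flow (c, y₀)).1.2) := continuous_id.mul hcont
  obtain ⟨c, hc, hc1⟩ := exists_hasDerivAt_eq_slope _ _ h0 hg.continuousOn
    (fun c hc => hder c ⟨hc.1, hc.2.trans_le (hσ.2.trans hτ.2.le)⟩)
  have h1 := (hlip c ⟨hc.1, hc.2.trans_le (hσ.2.trans hτ.2.le)⟩).trans
    (mul_le_mul_of_nonneg_left (hm' c ⟨hc.1.le, hc.2.le.trans hσ.2⟩) (by norm_num))
  rw [hc1, sub_zero, zero_mul, sub_zero, mul_div_cancel_left₀ _ h0.ne', ← hm] at h1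
  linarith

lemma slope_field (hM : ∀ y, |y| ≤ R → |deriv A y| + 5 ≤ M) {p : ℝ × ℝ} (hτ : p.1 ∈ Ioo 0 τ₁)
    (h : |p.2| + 2 * τ₁ * B < R) :
    (S.field p).2 = p.1 * (deriv A p.2 + (S.fieldY p).1) := by
  obtain ⟨h1, h2⟩ := S.foot_spec h
  have := C.slope_flow S H hM hτ h1.le
  rw [h2] at this
  have e : (S.field p).2 = (S.flow (p.1, S.foot p)).1.2 := rfl
  rw [e, this, ConeSystem.fieldY]
  simp only [Prod.smul_fst, smul_eq_mul]
  ring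

end FlatCusp

namespace ConeSystem

variable {F : ℝ × PlaneState → ℝ × ℝ} {G : ℝ × PlaneState → ℝ}
  {F' : ℝ × PlaneState → PlaneState →L[ℝ] ℝ × ℝ} {G' : ℝ × PlaneState → PlaneState →L[ℝ] ℝ}
  {τ₁ M R κ ℓ B : ℝ} (S : ConeSystem F G F' G' τ₁ M R κ ℓ B)
include S

lemma flow_zero {y₀ : ℝ} (hy : |y₀| + τ₁ * B ≤ R) : S.flow (0, y₀) = ((0, 0), y₀) := by
  obtain ⟨⟨h1, h2, -⟩, h3⟩ := S.flow_mem (τ := 0) ⟨le_rfl, S.τ₁_pos.le⟩ hy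
  rw [mul_zero] at h1 h2
  rw [zero_mul] at h3
  exact Prod.ext (Prod.ext (abs_nonpos_iff.1 h1) (abs_nonpos_iff.1 h2))
    (sub_eq_zero.1 (abs_nonpos_iff.1 h3))

lemma dflow_zero {y₀ : ℝ} (hy : |y₀| + τ₁ * B < R) : S.dflow (0, y₀) = ((0, 0), 1) := by
  have h1 := S.hasDerivAt_flow_label (τ := 0) hy
  have h2 : HasDerivAt (fun y : ℝ => (((0, 0), y) : PlaneState)) ((0, 0), 1) y₀ :=
    (hasDerivAt_const y₀ ((0, 0) : ℝ × ℝ)).prodMk (hasDerivAt_id y₀)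
  refine h1.unique (h2.congr_of_eventuallyEq ?_)
  have : ∀ᶠ y in 𝓝 y₀, |y| + τ₁ * B < R :=
    (by fun_prop : Continuous fun y : ℝ => |y| + τ₁ * B).continuousAt.eventually (gt_mem_nhds hy)
  filter_upwards [this] with y hy using S.flow_zero hy.le

lemma field_zero {y : ℝ} (h : |y| + 2 * τ₁ * B < R) : S.field (0, y) = 0 := by
  rw [field, S.flow_zero (S.foot_spec (p := (0, y)) h).1.le]; rfl

lemma fieldY_zero {y : ℝ} (h : |y| + 2 * τ₁ * B < R) : S.fieldY (0, y) = 0 := by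
  rw [fieldY, S.dflow_zero (S.foot_spec (p := (0, y)) h).1]; simp

/-- If the first component satisfies `(τ w)' = -w/2 + c τ + o(τ)`, then `w / τ → 2c/5`. -/
lemma field_ratio_lim {ybar c : ℝ} (hy : |ybar| + 2 * τ₁ * B < R)
    (hF : Tendsto (fun p : ℝ × ℝ => ((F (p.1, S.field p, p.2)).1 + (S.field p).1 / 2) / p.1)
      (𝓝[{p | 0 < p.1}] (0, ybar)) (𝓝 c)) :
    Tendsto (fun p : ℝ × ℝ => (S.field p).1 / p.1) (𝓝[{p | 0 < p.1}] (0, ybar))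
      (𝓝 (2 / 5 * c)) := by
  have hB := S.B_nonneg
  have hτ₁ := S.τ₁_pos
  rw [Metric.tendsto_nhds]
  intro η hη
  have h1 := (Metric.tendsto_nhds.1 hF) (η / 2) (by positivity)
  rw [eventually_nhdsWithin_iff, Metric.eventually_nhds_iff] at h1
  obtain ⟨δ, hδ, h1⟩ := h1
  have hc1 : Continuous fun p : ℝ × ℝ => |p.2| + 2 * τ₁ * B + 2 * p.1 * B := by fun_prop
  have hc2 : Continuous fun p : ℝ × ℝ => p.1 := by fun_prop
  have hc3 : Continuous fun p : ℝ × ℝ => |p.2 - ybar| + 2 * p.1 * B := by fun_prop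
  have ev1 := (hc1.tendsto ((0, ybar) : ℝ × ℝ)).eventually_lt_const (u := R)
    (by simpa using hy)
  have ev2 := (hc2.tendsto ((0, ybar) : ℝ × ℝ)).eventually_lt_const (u := min τ₁ δ)
    (by simpa using ⟨hτ₁, hδ⟩)
  have ev3 := (hc3.tendsto ((0, ybar) : ℝ × ℝ)).eventually_lt_const (u := δ)
    (by simpa using hδ)
  filter_upwards [self_mem_nhdsWithin, ev1.filter_mono nhdsWithin_le_nhds,
    ev2.filter_mono nhdsWithin_le_nhds, ev3.filter_mono nhdsWithin_le_nhds] with p hp0 e1 e2 e3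
  have hp0 : 0 < p.1 := hp0
  have hpτ : p.1 < τ₁ := e2.trans_le (min_le_left _ _)
  have hband : |p.2| + 2 * τ₁ * B < R := by nlinarith
  obtain ⟨hf1, hf2⟩ := S.foot_spec hband
  set y₀ := S.foot p with hy₀
  have hYp := (S.flow_mem (τ := p.1) ⟨hp0.le, hpτ.le⟩ hf1.le).2
  rw [hf2] at hYp
  have hY : ∀ σ ∈ Icc 0 p.1, |(S.flow (σ, y₀)).2 - p.2| ≤ 2 * p.1 * B := by
    intro σ hσ
    have h2 := (S.flow_mem (τ := σ) ⟨hσ.1, hσ.2.trans hpτ.le⟩ hf1.le).2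
    have h3 : σ * B ≤ p.1 * B := mul_le_mul_of_nonneg_right hσ.2 hB
    calc |(S.flow (σ, y₀)).2 - p.2| ≤ |(S.flow (σ, y₀)).2 - y₀| + |y₀ - p.2| := abs_sub_le _ _ _
      _ ≤ 2 * p.1 * B := by rw [abs_sub_comm y₀]; linarith
  have hfield : ∀ σ ∈ Icc 0 p.1, S.field (σ, (S.flow (σ, y₀)).2) = (S.flow (σ, y₀)).1 := by
    intro σ hσ
    have h2 : |(S.flow (σ, y₀)).2| + 2 * τ₁ * B < R := by
      have := abs_sub_abs_le_abs_sub (S.flow (σ, y₀)).2 p.2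
      have := hY σ hσ
      linarith
    rw [field, S.foot_flow hf1 h2]
  have hest : ∀ σ ∈ Ioo 0 p.1, |(F (σ, S.flow (σ, y₀))).1 + (S.flow (σ, y₀)).1.1 / 2 - c * σ| ≤
      η / 2 * σ := by
    intro σ hσ
    have hσ' : σ ∈ Icc 0 p.1 := ⟨hσ.1.le, hσ.2.le⟩
    have h2 := h1 (y := (σ, (S.flow (σ, y₀)).2)) (by
      rw [Prod.dist_eq]
      refine max_lt ?_ ?_
      · rw [Real.dist_eq, sub_zero, abs_of_pos hσ.1]
        exact hσ.2.trans (e2.trans_le (min_le_right _ _))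
      · rw [Real.dist_eq]
        have := abs_sub_le (S.flow (σ, y₀)).2 p.2 ybar
        have := hY σ hσ'
        simp only
        linarith) hσ.1
    rw [hfield σ hσ', Real.dist_eq] at h2
    simp only at h2
    have h3 := hσ.1
    rw [div_sub' h3.ne', abs_div, abs_of_pos h3, div_lt_iff₀ h3] at h2
    rw [mul_comm c σ]
    exact h2.le
  set m : ℝ → ℝ := fun σ => Real.sqrt σ * (σ * (S.flow (σ, y₀)).1.1 - 2 / 5 * c * σ ^ 2) with hm
  have hder : ∀ σ ∈ Ioo 0 p.1, HasDerivAt m (Real.sqrt σ *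
      ((F (σ, S.flow (σ, y₀))).1 + (S.flow (σ, y₀)).1.1 / 2 - c * σ)) σ := by
    intro σ hσ
    have h2 : HasDerivAt (fun σ => σ * (S.flow (σ, y₀)).1.1) _ σ :=
      (S.hasDerivAt_flow_time ⟨hσ.1, hσ.2.trans hpτ⟩ hf1.le).1.fst
    have h3 := (Real.hasDerivAt_sqrt hσ.1.ne').mul
      (h2.sub (((hasDerivAt_id σ).pow 2).const_mul (2 / 5 * c)))
    refine h3.congr_deriv ?_
    have hs := Real.sqrt_pos.2 hσ.1
    have hss : σ = Real.sqrt σ ^ 2 := (Real.sq_sqrt hσ.1.le).symm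
    simp only [Pi.sub_apply, id, Pi.pow_apply]
    generalize (S.flow (σ, y₀)).1.1 = w
    generalize (F (σ, S.flow (σ, y₀))).1 = f
    generalize Real.sqrt σ = r at hs hss
    subst hss
    field_simp
    norm_num
    ring
  have hcont : Continuous m := by
    have := S.continuous_flow
    simp only [hm]
    fun_prop
  obtain ⟨σ, hσ, hσ1⟩ := exists_hasDerivAt_eq_slope _ _ hp0 hcont.continuousOn hder
  have hs := Real.sqrt_pos.2 hp0
  have h4 : |m p.1| ≤ Real.sqrt p.1 * (η / 2 * p.1) * p.1 := by
    have h5 : m p.1 = Real.sqrt σ * ((F (σ, S.flow (σ, y₀))).1 + (S.flow (σ, y₀)).1.1 / 2 -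
        c * σ) * p.1 := by
      rw [hσ1]
      have h6 : m 0 = 0 := by simp [hm]
      rw [h6, sub_zero, sub_zero, div_mul_cancel₀ _ hp0.ne']
    rw [h5, abs_mul, abs_mul, abs_of_pos hp0, abs_of_nonneg (Real.sqrt_nonneg σ)]
    refine mul_le_mul_of_nonneg_right ?_ hp0.le
    refine mul_le_mul (Real.sqrt_le_sqrt hσ.2.le) ((hest σ hσ).trans ?_) (abs_nonneg _) hs.le
    exact mul_le_mul_of_nonneg_left hσ.2.le (by positivity)
  have h7 : m p.1 = Real.sqrt p.1 * p.1 * p.1 * ((S.field p).1 / p.1 - 2 / 5 * c) := by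
    have : (S.field p).1 = (S.flow (p.1, y₀)).1.1 := rfl
    rw [this]
    simp only [hm]
    field_simp
  rw [h7, abs_mul, abs_of_pos (by positivity : 0 < Real.sqrt p.1 * p.1 * p.1)] at h4
  rw [Real.dist_eq]
  have h8 : Real.sqrt p.1 * p.1 * p.1 * |(S.field p).1 / p.1 - 2 / 5 * c| ≤
      Real.sqrt p.1 * p.1 * p.1 * (η / 2) := by linarith
  have := le_of_mul_le_mul_left h8 (by positivity)
  linarith

end ConeSystem

/-- The half-closed strip on which the shock is constructed. -/
def shockStrip (τ₁ : ℝ) : Set (ℝ × ℝ) := {p | 0 ≤ p.1 ∧ p.1 < τ₁ ∧ |p.2| < 1}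

lemma shockStrip_eq (τ₁ : ℝ) : shockStrip τ₁ = Ico 0 τ₁ ×ˢ Ioo (-1) 1 := by
  ext p
  simp [shockStrip, abs_lt, mem_prod, and_assoc]

lemma uniqueDiffOn_shockStrip {τ₁ : ℝ} : UniqueDiffOn ℝ (shockStrip τ₁) := by
  rw [shockStrip_eq]; exact (uniqueDiffOn_Ico _ _).prod (uniqueDiffOn_Ioo _ _)

/-- A function that is `C¹` for `τ > 0`, with limits of the derivative at `τ = 0`, is `C¹` up to
`τ = 0`. -/
lemma contDiffOn_one_of_limits {E : Type*} [NormedAddCommGroup E] [NormedSpace ℝ E] {f : ℝ × ℝ → E}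
    {f' : ℝ × ℝ → ℝ × ℝ →L[ℝ] E} [CompleteSpace E] {τ₁ : ℝ} (hτ₁ : 0 < τ₁)
    (h1 : ∀ p : ℝ × ℝ, 0 < p.1 → p.1 < τ₁ → |p.2| < 1 → HasFDerivAt f (f' p) p ∧ ContinuousAt f' p)
    (h2 : ∀ y, |y| < 1 → ∃ L, Tendsto f' (𝓝[{p | 0 < p.1}] (0, y)) (𝓝 L))
    (h3 : ∀ y, |y| < 1 → ContinuousWithinAt f {p | 0 ≤ p.1} (0, y)) :
    ContDiffOn ℝ 1 f (shockStrip τ₁) ∧ ∀ y L, |y| < 1 →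
      Tendsto f' (𝓝[{p | 0 < p.1}] (0, y)) (𝓝 L) → HasFDerivWithinAt f L (shockStrip τ₁) (0, y) := by
  set V : Set (ℝ × ℝ) := Ioo 0 τ₁ ×ˢ Ioo (-1) 1 with hV
  have hVmem : ∀ p ∈ V, 0 < p.1 ∧ p.1 < τ₁ ∧ |p.2| < 1 := fun p hp =>
    ⟨hp.1.1, hp.1.2, abs_lt.2 hp.2⟩
  have hbd : ∀ y L, |y| < 1 → Tendsto f' (𝓝[{p | 0 < p.1}] (0, y)) (𝓝 L) →
      HasFDerivWithinAt f L (shockStrip τ₁) (0, y) := by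
    intro y L hy hL
    obtain ⟨δ, hδ, hδ1⟩ : ∃ δ > 0, |y| + δ < 1 := ⟨(1 - |y|) / 2, by linarith, by linarith⟩
    have hyb : ∀ z ∈ Icc (y - δ) (y + δ), |z| < 1 := fun z hz => by
      have := le_abs_self y
      have := neg_abs_le y
      rw [abs_lt]; constructor <;> linarith [hz.1, hz.2]
    set W : Set (ℝ × ℝ) := Ioo 0 (τ₁ / 2) ×ˢ Ioo (y - δ) (y + δ) with hW
    have hWcl : closure W = Icc 0 (τ₁ / 2) ×ˢ Icc (y - δ) (y + δ) := by
      rw [hW, closure_prod_eq, closure_Ioo (by positivity : (0 : ℝ) ≠ τ₁ / 2),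
        closure_Ioo (fun h => by linarith)]
    have hWo : IsOpen W := isOpen_Ioo.prod isOpen_Ioo
    have hWd : ∀ p ∈ W, HasFDerivAt f (f' p) p := fun p hp =>
      (h1 p hp.1.1 (by linarith [hp.1.2]) (hyb _ ⟨hp.2.1.le, hp.2.2.le⟩)).1
    have key := hasFDerivWithinAt_closure_of_tendsto_fderiv (f := f) (s := W) (x := (0, y))
      (f' := L) (fun p hp => (hWd p hp).differentiableAt.differentiableWithinAt)
      ((convex_Ioo _ _).prod (convex_Ioo _ _)) hWo (fun p hp => by
        rw [hWcl] at hp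
        have hp2 := hyb _ hp.2
        rcases hp.1.1.eq_or_lt with h0 | h0
        · obtain ⟨a, b⟩ := p
          simp only at h0
          subst h0
          exact (h3 b hp2).mono fun q hq => hq.1.1.le
        · exact (h1 p h0 (by linarith [hp.1.2]) hp2).1.continuousAt.continuousWithinAt)
      ((hL.mono_left (nhdsWithin_mono _ fun q hq => hq.1.1)).congr' (by
        filter_upwards [self_mem_nhdsWithin] with q hq using (hWd q hq).fderiv.symm))
    refine key.mono_of_mem_nhdsWithin ?_
    rw [hWcl, mem_nhdsWithin_iff_eventually]
    have ev : ∀ᶠ q : ℝ × ℝ in 𝓝 (0, y), q ∈ Iio (τ₁ / 2) ×ˢ Ioo (y - δ) (y + δ) :=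
      (isOpen_Iio.prod isOpen_Ioo).mem_nhds ⟨by simpa using hτ₁, by simpa using hδ⟩
    filter_upwards [ev] with q hq hq'
    exact ⟨⟨hq'.1, hq.1.le⟩, hq.2.1.le, hq.2.2.le⟩
  refine ⟨?_, hbd⟩
  have hVlim : ∀ p ∈ shockStrip τ₁, ∃ L, Tendsto f' (𝓝[V] p) (𝓝 L) := by
    rintro ⟨t, y⟩ ⟨ht, ht', hy⟩
    rcases ht.eq_or_lt with h0 | h0
    · simp only at h0
      subst h0
      obtain ⟨L, hL⟩ := h2 y hy
      exact ⟨L, hL.mono_left (nhdsWithin_mono _ fun q hq => hq.1.1)⟩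
    · exact ⟨_, (h1 (t, y) h0 ht' hy).2.mono_left nhdsWithin_le_nhds⟩
  have hVcl : shockStrip τ₁ ⊆ closure V := by
    rw [hV, closure_prod_eq, closure_Ioo hτ₁.ne, closure_Ioo (by norm_num : (-1 : ℝ) ≠ 1)]
    exact fun p hp => ⟨⟨hp.1, hp.2.1.le⟩, (abs_lt.1 hp.2.2).1.le, (abs_lt.1 hp.2.2).2.le⟩
  have hcont : ContinuousOn (extendFrom V f') (shockStrip τ₁) := continuousOn_extendFrom hVcl hVlim
  have hext : ∀ p ∈ shockStrip τ₁, HasFDerivWithinAt f (extendFrom V f' p) (shockStrip τ₁) p := by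
    rintro ⟨t, y⟩ ⟨ht, ht', hy⟩
    rcases ht.eq_or_lt with h0 | h0
    · simp only at h0
      subst h0
      obtain ⟨L, hL⟩ := h2 y hy
      rw [extendFrom_eq (hVcl ⟨le_rfl, ht', hy⟩)
        (hL.mono_left (nhdsWithin_mono _ fun q hq => hq.1.1))]
      exact hbd y L hy hL
    · obtain ⟨a, b⟩ := h1 (t, y) h0 ht' hy
      rw [extendFrom_eq (hVcl ⟨ht, ht', hy⟩) (b.mono_left nhdsWithin_le_nhds)]
      exact a.hasFDerivWithinAt
  rw [show (1 : WithTop ℕ∞) = 0 + 1 by norm_num,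
    contDiffOn_succ_iff_hasFDerivWithinAt_of_uniqueDiffOn uniqueDiffOn_shockStrip]
  exact ⟨by simp, _, contDiffOn_zero.2 hcont, hext⟩

/-- A shock `k` of a flat cusp, with the states `up > s` and `um < s` on its two sides. -/
structure FlatShock (D : ℝ × ℝ × ℝ → ℝ) (s A : ℝ → ℝ) (Fh Gh : ℝ × ℝ × ℝ → ℝ) (γ e τ₁ : ℝ)
    (k up um : ℝ × ℝ → ℝ) : Prop where
  τ₁_pos : 0 < τ₁
  smooth : ContDiffOn ℝ 2 k (shockStrip τ₁)
  zero : ∀ y, |y| < 1 → k (0, y) = 0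
  slope : ∀ y, |y| < 1 → HasDerivWithinAt (fun τ => k (τ, y)) (A y) (Ici 0) 0
  deriv_lim : ∀ y, |y| < 1 → Tendsto (fun p => (partialFst k p, partialSnd k p))
    (𝓝[{p | 0 < p.1}] (0, y)) (𝓝 (A y, 0))
  diff : ∀ p : ℝ × ℝ, 0 < p.1 → p.1 < τ₁ → |p.2| < 1 → DifferentiableAt ℝ k p
  upper : ∀ p : ℝ × ℝ, 0 < p.1 → p.1 < τ₁ → |p.2| < 1 →
    IsOuter s γ e 1 p.1 p.2 (up p) ∧ D (p.1, up p, p.2) = k p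
  lower : ∀ p : ℝ × ℝ, 0 < p.1 → p.1 < τ₁ → |p.2| < 1 →
    IsOuter s γ e (-1) p.1 p.2 (um p) ∧ D (p.1, um p, p.2) = k p
  transport : ∀ p : ℝ × ℝ, 0 < p.1 → p.1 < τ₁ → |p.2| < 1 →
    partialFst k p + Gh (up p, um p, p.2) * partialSnd k p = Fh (up p, um p, p.2)

/-- The linear functional with components `a`, `b`. -/
def planeForm (a b : ℝ) : ℝ × ℝ →L[ℝ] ℝ :=
  a • ContinuousLinearMap.fst ℝ ℝ ℝ + b • ContinuousLinearMap.snd ℝ ℝ ℝ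

lemma planeForm_apply (a b : ℝ) (v : ℝ × ℝ) : planeForm a b v = a * v.1 + b * v.2 := rfl

namespace FlatCusp

variable {D : ℝ × ℝ × ℝ → ℝ} {s A : ℝ → ℝ} {Fh Gh : ℝ × ℝ × ℝ → ℝ} {α β e M R τ₁ : ℝ}
  (C : FlatCusp D s A Fh Gh α β e)
  {ℓ B : ℝ} (S : ConeSystem (coneRhs D s A Fh Gh (α / β) e) (coneDrift D s A Gh (α / β) e)
  (coneRhs' D s A Fh Gh (α / β) e) (coneDrift' D s A Gh (α / β) e) τ₁ M R (3 / 5) ℓ B)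
  (H : ConeRoots D s A (α / β) e M R τ₁)

/-- The position of the shock. -/
def shockPos (p : ℝ × ℝ) : ℝ := p.1 * (A p.2 + (S.field p).1)

/-- The states next to the shock. -/
def shockSide (σ : ℝ) (p : ℝ × ℝ) : ℝ := stateRoot D s A (α / β) e σ (p.1, S.field p, p.2)

/-- The time derivative of the position of the shock. -/
def shockSpeed (p : ℝ × ℝ) : ℝ :=
  Fh (shockSide S 1 p, shockSide S (-1) p, p.2) -
    Gh (shockSide S 1 p, shockSide S (-1) p, p.2) * (S.field p).2

/-- The time derivative of `Ω`. -/
def slopeRate (p : ℝ × ℝ) : ℝ :=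
  p.1⁻¹ * ((coneRhs D s A Fh Gh (α / β) e (p.1, S.field p, p.2)).2 - (S.field p).2) -
    Gh (shockSide S 1 p, shockSide S (-1) p, p.2) * (S.fieldY p).2

/-- Time and space derivatives of the states next to the shock. -/
def sideT (σ : ℝ) (p : ℝ × ℝ) : ℝ :=
  (shockSpeed S p - partialT D (p.1, shockSide S σ p, p.2)) /
    partialX D (p.1, shockSide S σ p, p.2)

def sideY (σ : ℝ) (p : ℝ × ℝ) : ℝ :=
  ((S.field p).2 - partialY D (p.1, shockSide S σ p, p.2)) /
    partialX D (p.1, shockSide S σ p, p.2)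

/-- Derivatives of `shockSpeed`. -/
def speedT (p : ℝ × ℝ) : ℝ :=
  let q : ℝ × ℝ × ℝ := (shockSide S 1 p, shockSide S (-1) p, p.2)
  sideT S 1 p * partialT Fh q + sideT S (-1) p * partialX Fh q -
    (sideT S 1 p * partialT Gh q + sideT S (-1) p * partialX Gh q) * (S.field p).2 -
    Gh q * slopeRate S p

def speedY (p : ℝ × ℝ) : ℝ :=
  let q : ℝ × ℝ × ℝ := (shockSide S 1 p, shockSide S (-1) p, p.2)
  sideY S 1 p * partialT Fh q + sideY S (-1) p * partialX Fh q + partialY Fh q -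
    (sideY S 1 p * partialT Gh q + sideY S (-1) p * partialX Gh q + partialY Gh q) * (S.field p).2 -
    Gh q * (S.fieldY p).2

section
include C H

lemma state_mem {p : ℝ × ℝ} (hτ : p.1 ∈ Ioo 0 τ₁) (h : |p.2| + 2 * τ₁ * B < R) :
    ((p.1, S.field p, p.2) : ℝ × PlaneState) ∈ stateCone τ₁ M R :=
  ⟨⟨hτ.1.le, hτ.2.le⟩, S.field_mem ⟨hτ.1.le, hτ.2.le⟩ h⟩

lemma shockSide_spec {σ : ℝ} (hσ : σ = 1 ∨ σ = -1) {p : ℝ × ℝ} (hτ : p.1 ∈ Ioo 0 τ₁)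
    (h : |p.2| + 2 * τ₁ * B < R) :
    IsOuter s (α / β) e σ p.1 p.2 (shockSide S σ p) ∧
    D (p.1, shockSide S σ p, p.2) = shockPos S p ∧
    (shockSide S σ p - s p.2) ^ 2 ≤ 9 * (α / β) * p.1 :=
  C.stateRoot_spec H hσ (C.state_mem S H hτ h) hτ.1

lemma shockSide_family {σ : ℝ} (hσ : σ = 1 ∨ σ = -1) {y : ℝ} (h : |y| + 2 * τ₁ * B < R) :
    RootFamily D s A (α / β) e M (𝓝[{p | 0 < p.1}] ((0, y) : ℝ × ℝ)) y σ (fun p => p.1)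
      (fun p => (S.field p).1) (fun p => p.2) (shockSide S σ) := by
  have hb : ∀ᶠ p : ℝ × ℝ in 𝓝 ((0, y) : ℝ × ℝ), |p.2| + 2 * τ₁ * B < R :=
    ConeSystem.isOpen_band.mem_nhds h
  have ht : ∀ᶠ p : ℝ × ℝ in 𝓝 ((0, y) : ℝ × ℝ), p.1 < τ₁ :=
    continuousAt_fst.eventually (gt_mem_nhds S.τ₁_pos)
  have h1 : ∀ᶠ p : ℝ × ℝ in 𝓝[{p | 0 < p.1}] ((0, y) : ℝ × ℝ), p.1 ∈ Ioo 0 τ₁ ∧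
      |p.2| + 2 * τ₁ * B < R := by
    filter_upwards [self_mem_nhdsWithin, hb.filter_mono nhdsWithin_le_nhds,
      ht.filter_mono nhdsWithin_le_nhds] with p a b c using ⟨⟨a, c⟩, b⟩
  have h2 := h1.mono fun p hp => C.shockSide_spec S H hσ hp.1 hp.2
  exact {
    τ_lim := tendsto_nhdsWithin_iff.2 ⟨(continuous_fst.tendsto' _ _ rfl).mono_left
      nhdsWithin_le_nhds, h1.mono fun p hp => hp.1.1⟩
    y_lim := (continuous_snd.tendsto' _ _ rfl).mono_left nhdsWithin_le_nhds
    w_le := h1.mono fun p hp => (C.state_mem S H hp.1 hp.2).2.1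
    side := hσ
    outer := h2.mono fun p hp => hp.1
    eq := h2.mono fun p hp => hp.2.1
    upper := h2.mono fun p hp => hp.2.2 }

lemma hasFDerivAt_slope {p : ℝ × ℝ} (hτ : p.1 ∈ Ioo 0 τ₁) (h : |p.2| + 2 * τ₁ * B < R) :
    HasFDerivAt (fun p => (S.field p).2) (planeForm (slopeRate S p) (S.fieldY p).2) p := by
  have h1 := (ContinuousLinearMap.snd ℝ ℝ ℝ).hasFDerivAt.comp p (S.hasFDerivAt_field hτ h)
  refine HasFDerivAt.congr_fderiv h1 (ContinuousLinearMap.ext fun v => ?_)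
  simp [planeForm_apply, slopeRate, coneDrift, shockDrift, shockJet, shockSide]
  ring

variable (hM : ∀ y, |y| ≤ R → |deriv A y| + 5 ≤ M)

include hM in
lemma hasFDerivAt_shockPos {p : ℝ × ℝ} (hτ : p.1 ∈ Ioo 0 τ₁) (h : |p.2| + 2 * τ₁ * B < R) :
    HasFDerivAt (shockPos S) (planeForm (shockSpeed S p) (S.field p).2) p := by
  have h1 : HasFDerivAt (fun p => (S.field p).1) _ p :=
    (ContinuousLinearMap.fst ℝ ℝ ℝ).hasFDerivAt.comp p (S.hasFDerivAt_field hτ h)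
  have hy : HasFDerivAt (fun p : ℝ × ℝ => p.2) (ContinuousLinearMap.snd ℝ ℝ ℝ) p := hasFDerivAt_snd
  have h2 : HasFDerivAt (fun p : ℝ × ℝ => A p.2) _ p :=
    ((C.diffA p.2).hasDerivAt.hasFDerivAt).comp p hy
  have h3 := (hasFDerivAt_fst (p := p)).mul (h2.add h1)
  refine HasFDerivAt.congr_fderiv h3 (ContinuousLinearMap.ext fun v => ?_)
  have h0 := hτ.1.ne'
  have hs := C.slope_field S H hM hτ h
  simp [planeForm_apply, shockSpeed, coneDrift, shockDrift, shockJet, shockSide, coneRhs, shockRhs]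
  rw [hs]
  field_simp
  ring

include hM in
lemma hasFDerivAt_shockSide {σ : ℝ} (hσ : σ = 1 ∨ σ = -1) {p : ℝ × ℝ} (hτ : p.1 ∈ Ioo 0 τ₁)
    (h : |p.2| + 2 * τ₁ * B < R) :
    HasFDerivAt (shockSide S σ) (planeForm (sideT S σ p) (sideY S σ p)) p := by
  obtain ⟨h1, h2, -⟩ := C.shockSide_spec S H hσ hτ h
  have h3 := (C.outerRoot_smooth hτ.1 (hτ.2.trans H.1) h1 h2).2
  have h4 := HasFDerivAt.comp p (f := fun p : ℝ × ℝ => ((p.1, shockPos S p, p.2) : ℝ × ℝ × ℝ)) h3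
    ((hasFDerivAt_fst (p := p)).prodMk ((C.hasFDerivAt_shockPos S H hM hτ h).prodMk
      (hasFDerivAt_snd (p := p))))
  refine HasFDerivAt.congr_fderiv h4 (ContinuousLinearMap.ext fun v => ?_)
  simp [planeForm_apply, sideT, sideY]
  ring

include hM in
lemma hasFDerivAt_shockSpeed {p : ℝ × ℝ} (hτ : p.1 ∈ Ioo 0 τ₁) (h : |p.2| + 2 * τ₁ * B < R) :
    HasFDerivAt (shockSpeed S) (planeForm (speedT S p) (speedY S p)) p := by
  have hq := (C.hasFDerivAt_shockSide S H hM (Or.inl rfl) hτ h).prodMk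
    ((C.hasFDerivAt_shockSide S H hM (Or.inr rfl) hτ h).prodMk (hasFDerivAt_snd (p := p)))
  have hF := HasFDerivAt.comp p (f := fun p : ℝ × ℝ =>
    ((shockSide S 1 p, shockSide S (-1) p, p.2) : ℝ × ℝ × ℝ)) (C.diffF _).hasFDerivAt hq
  have hG := HasFDerivAt.comp p (f := fun p : ℝ × ℝ =>
    ((shockSide S 1 p, shockSide S (-1) p, p.2) : ℝ × ℝ × ℝ)) (C.diffG _).hasFDerivAt hq
  have h3 := hF.sub (hG.mul (C.hasFDerivAt_slope S H hτ h))
  refine HasFDerivAt.congr_fderiv h3 (ContinuousLinearMap.ext fun v => ?_)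
  simp [planeForm_apply, speedT, speedY, fderiv_apply_eq_partials]
  ring

lemma side_X_ne {σ : ℝ} (hσ : σ = 1 ∨ σ = -1) {p : ℝ × ℝ} (hτ : p.1 ∈ Ioo 0 τ₁)
    (h : |p.2| + 2 * τ₁ * B < R) : partialX D (p.1, shockSide S σ p, p.2) ≠ 0 :=
  C.outer_X_ne H hσ (C.state_mem S H hτ h) hτ.1

end
end FlatCusp

lemma continuousAt_planeForm {a b : ℝ × ℝ → ℝ} {p : ℝ × ℝ} (ha : ContinuousAt a p)
    (hb : ContinuousAt b p) : ContinuousAt (fun p => planeForm (a p) (b p)) p :=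
  (ha.smul continuousAt_const).add (hb.smul continuousAt_const)

lemma tendsto_planeForm {ι : Type*} {l : Filter ι} {a b : ι → ℝ} {x y : ℝ}
    (ha : Tendsto a l (𝓝 x)) (hb : Tendsto b l (𝓝 y)) :
    Tendsto (fun p => planeForm (a p) (b p)) l (𝓝 (planeForm x y)) :=
  (ha.smul tendsto_const_nhds).add (hb.smul tendsto_const_nhds)

namespace FlatCusp

variable {D : ℝ × ℝ × ℝ → ℝ} {s A : ℝ → ℝ} {Fh Gh : ℝ × ℝ × ℝ → ℝ} {α β e M R τ₁ : ℝ}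
  (C : FlatCusp D s A Fh Gh α β e)
  {ℓ B : ℝ} (S : ConeSystem (coneRhs D s A Fh Gh (α / β) e) (coneDrift D s A Gh (α / β) e)
  (coneRhs' D s A Fh Gh (α / β) e) (coneDrift' D s A Gh (α / β) e) τ₁ M R (3 / 5) ℓ B)
  (H : ConeRoots D s A (α / β) e M R τ₁)
  (hM : ∀ y, |y| ≤ R → |deriv A y| + 5 ≤ M)

lemma slopeRate_eq {p : ℝ × ℝ} (h : p.1 ≠ 0) : slopeRate S p = speedY S p := by
  simp only [slopeRate, speedY, coneRhs, shockRhs, shockJet, stateRate, sideY]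
  have e1 : ∀ σ, stateRoot D s A (α / β) e σ (p.1, S.field p, p.2) = shockSide S σ p := fun _ => rfl
  simp only [e1]
  field_simp
  ring

include C H hM

lemma continuousAt_rates {p : ℝ × ℝ} (hτ : p.1 ∈ Ioo 0 τ₁) (h : |p.2| + 2 * τ₁ * B < R) :
    ContinuousAt (speedT S) p ∧ ContinuousAt (speedY S) p ∧ ContinuousAt (slopeRate S) p := by
  have hs : ∀ {σ : ℝ}, σ = 1 ∨ σ = -1 → ContinuousAt (shockSide S σ) p := fun hσ =>
    (C.hasFDerivAt_shockSide S H hM hσ hτ h).continuousAt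
  have hp := hs (Or.inl rfl)
  have hm := hs (Or.inr rfl)
  have hK : ContinuousAt (shockSpeed S) p := (C.hasFDerivAt_shockSpeed S H hM hτ h).continuousAt
  have hf := S.continuousAt_field h
  have hfY := S.continuousAt_fieldY h
  have hΩ : ContinuousAt (fun p => (S.field p).2) p := hf.snd
  have hΩ' : ContinuousAt (fun p => (S.fieldY p).2) p := hfY.snd
  have hD : ∀ {σ : ℝ} {g : ℝ × ℝ × ℝ → ℝ}, σ = 1 ∨ σ = -1 → Continuous g →
      ContinuousAt (fun p : ℝ × ℝ => g (p.1, shockSide S σ p, p.2)) p := fun {σ g} hσ hg =>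
    ContinuousAt.comp (f := fun p : ℝ × ℝ => ((p.1, shockSide S σ p, p.2) : ℝ × ℝ × ℝ)) (g := g)
      hg.continuousAt (continuousAt_fst.prodMk ((hs hσ).prodMk continuousAt_snd))
  have hT : ∀ {σ : ℝ}, σ = 1 ∨ σ = -1 → ContinuousAt (sideT S σ) p := fun hσ =>
    (hK.sub (hD hσ C.contT.continuous)).div (hD hσ C.Du3.continuous) (C.side_X_ne S H hσ hτ h)
  have hY : ∀ {σ : ℝ}, σ = 1 ∨ σ = -1 → ContinuousAt (sideY S σ) p := fun hσ =>
    (hΩ.sub (hD hσ C.contY.continuous)).div (hD hσ C.Du3.continuous) (C.side_X_ne S H hσ hτ h)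
  have hq : ∀ {g : ℝ × ℝ × ℝ → ℝ}, Continuous g → ContinuousAt (fun p : ℝ × ℝ =>
      g (shockSide S 1 p, shockSide S (-1) p, p.2)) p := fun {g} hg =>
    ContinuousAt.comp (f := fun p : ℝ × ℝ => ((shockSide S 1 p, shockSide S (-1) p, p.2) :
      ℝ × ℝ × ℝ)) (g := g) hg.continuousAt (hp.prodMk (hm.prodMk continuousAt_snd))
  have fT := hq (C.Fh2.partialT (m := 1) (by norm_num)).continuous
  have fX := hq (C.Fh2.partialX (m := 1) (by norm_num)).continuous
  have fY := hq (C.Fh2.partialY (m := 1) (by norm_num)).continuous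
  have gT := hq (C.Gh2.partialT (m := 1) (by norm_num)).continuous
  have gX := hq (C.Gh2.partialX (m := 1) (by norm_num)).continuous
  have gY := hq (C.Gh2.partialY (m := 1) (by norm_num)).continuous
  have g0 := hq C.Gh2.continuous
  have a1 := hT (Or.inl rfl)
  have a2 := hT (Or.inr rfl)
  have b1 := hY (Or.inl rfl)
  have b2 := hY (Or.inr rfl)
  have hYY : ContinuousAt (speedY S) p :=
    ((((b1.mul fT).add (b2.mul fX)).add fY).sub
      ((((b1.mul gT).add (b2.mul gX)).add gY).mul hΩ)).sub (g0.mul hΩ')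
  have hSR : ContinuousAt (slopeRate S) p := hYY.congr (by
    filter_upwards [continuousAt_fst.eventually (lt_mem_nhds hτ.1)] with q hq
    exact (slopeRate_eq S (ne_of_gt hq)).symm)
  exact ⟨(((a1.mul fT).add (a2.mul fX)).sub (((a1.mul gT).add (a2.mul gX)).mul hΩ)).sub
    (g0.mul hSR), hYY, hSR⟩

variable {y : ℝ} (h : |y| + 2 * τ₁ * B < R)
include h

lemma field_lim : Tendsto S.field (𝓝[{p | 0 < p.1}] ((0, y) : ℝ × ℝ)) (𝓝 0) := by
  have := (S.continuousAt_field (p := (0, y)) h).tendsto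
  rw [S.field_zero h] at this
  exact this.mono_left nhdsWithin_le_nhds

lemma fieldY_lim : Tendsto S.fieldY (𝓝[{p | 0 < p.1}] ((0, y) : ℝ × ℝ)) (𝓝 0) := by
  have := (S.continuousAt_fieldY (p := (0, y)) h).tendsto
  rw [S.fieldY_zero h] at this
  exact this.mono_left nhdsWithin_le_nhds

include S in
lemma eventually_band : ∀ᶠ p in 𝓝[{p | 0 < p.1}] ((0, y) : ℝ × ℝ), p.1 ∈ Ioo 0 τ₁ ∧
    |p.2| + 2 * τ₁ * B < R := by
  have hb : ∀ᶠ p : ℝ × ℝ in 𝓝 ((0, y) : ℝ × ℝ), |p.2| + 2 * τ₁ * B < R :=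
    ConeSystem.isOpen_band.mem_nhds h
  have ht : ∀ᶠ p : ℝ × ℝ in 𝓝 ((0, y) : ℝ × ℝ), p.1 < τ₁ :=
    continuousAt_fst.eventually (gt_mem_nhds S.τ₁_pos)
  filter_upwards [self_mem_nhdsWithin, hb.filter_mono nhdsWithin_le_nhds,
    ht.filter_mono nhdsWithin_le_nhds] with p a b c using ⟨⟨a, c⟩, b⟩

lemma slope_div_lim : Tendsto (fun p : ℝ × ℝ => (S.field p).2 / p.1)
    (𝓝[{p | 0 < p.1}] ((0, y) : ℝ × ℝ)) (𝓝 (deriv A y)) := by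
  have h1 : Tendsto (fun p : ℝ × ℝ => deriv A p.2) (𝓝[{p | 0 < p.1}] ((0, y) : ℝ × ℝ))
      (𝓝 (deriv A y)) := (C.contA'.comp continuous_snd).tendsto' _ _ rfl |>.mono_left
    nhdsWithin_le_nhds
  have h2 : Tendsto (fun p : ℝ × ℝ => (S.fieldY p).1) (𝓝[{p | 0 < p.1}] ((0, y) : ℝ × ℝ))
      (𝓝 0) := (continuous_fst.tendsto _).comp (C.fieldY_lim S H hM h)
  have h3 := h1.add h2
  rw [add_zero] at h3
  refine h3.congr' ?_
  filter_upwards [C.eventually_band S H hM h] with p hp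
  rw [C.slope_field S H hM hp.1 hp.2, mul_div_cancel_left₀ _ hp.1.1.ne']

lemma speedY_lim : Tendsto (speedY S) (𝓝[{p | 0 < p.1}] ((0, y) : ℝ × ℝ)) (𝓝 (deriv A y)) := by
  have R₁ := C.shockSide_family S H (Or.inl rfl) h
  have R₂ := C.shockSide_family S H (Or.inr rfl) h
  have hΩ := C.slope_div_lim S H hM h
  have r1 : Tendsto (sideY S 1) _ _ := C.rootY_lim R₁ hΩ
  have r2 : Tendsto (sideY S (-1)) _ _ := C.rootY_lim R₂ hΩ
  have fT := C.tendsto_pair R₁ R₂ (C.Fh2.partialT (m := 1) (by norm_num)).continuous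
  have fX := C.tendsto_pair R₁ R₂ (C.Fh2.partialX (m := 1) (by norm_num)).continuous
  have fY := C.tendsto_pair R₁ R₂ (C.Fh2.partialY (m := 1) (by norm_num)).continuous
  have gT := C.tendsto_pair R₁ R₂ (C.Gh2.partialT (m := 1) (by norm_num)).continuous
  have gX := C.tendsto_pair R₁ R₂ (C.Gh2.partialX (m := 1) (by norm_num)).continuous
  have gY := C.tendsto_pair R₁ R₂ (C.Gh2.partialY (m := 1) (by norm_num)).continuous
  have g0 := C.tendsto_pair R₁ R₂ C.Gh2.continuous
  have l1 : Tendsto (fun p => (S.field p).2) (𝓝[{p | 0 < p.1}] ((0, y) : ℝ × ℝ)) (𝓝 0) :=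
    (continuous_snd.tendsto _).comp (C.field_lim S H hM h)
  have l2 : Tendsto (fun p => (S.fieldY p).2) (𝓝[{p | 0 < p.1}] ((0, y) : ℝ × ℝ)) (𝓝 0) :=
    (continuous_snd.tendsto _).comp (C.fieldY_lim S H hM h)
  have := ((((r1.mul fT).add (r2.mul fX)).add fY).sub
      ((((r1.mul gT).add (r2.mul gX)).add gY).mul l1)).sub (g0.mul l2)
  rw [C.Fdiag_T, C.Fdiag_X, C.Fdiag_Y, sub_self, zero_div, zero_add, mul_zero, mul_zero] at this
  have e := this.congr (f₂ := speedY S) fun p => rfl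
  convert e using 2
  ring

lemma slopeRate_lim :
    Tendsto (slopeRate S) (𝓝[{p | 0 < p.1}] ((0, y) : ℝ × ℝ)) (𝓝 (deriv A y)) :=
  (C.speedY_lim S H hM h).congr' (by
    filter_upwards [C.eventually_band S H hM h] with p hp
    exact (slopeRate_eq S hp.1.1.ne').symm)

lemma ratio_speed_lim : ∃ ω κ : ℝ, Tendsto (fun p : ℝ × ℝ => (S.field p).1 / p.1)
    (𝓝[{p | 0 < p.1}] ((0, y) : ℝ × ℝ)) (𝓝 ω) ∧
    Tendsto (fun p : ℝ × ℝ => (shockSpeed S p - A p.2) / p.1)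
    (𝓝[{p | 0 < p.1}] ((0, y) : ℝ × ℝ)) (𝓝 κ) := by
  have R₁ := C.shockSide_family S H (Or.inl rfl) h
  have R₂ := C.shockSide_family S H (Or.inr rfl) h
  obtain ⟨c, hc⟩ := C.exists_speed_lim R₁ R₂
  have hω := S.field_ratio_lim h hc
  have hA : Tendsto (fun p : ℝ × ℝ => deriv A p.2) (𝓝[{p | 0 < p.1}] ((0, y) : ℝ × ℝ))
      (𝓝 (deriv A y)) := (C.contA'.comp continuous_snd).tendsto' _ _ rfl |>.mono_left
    nhdsWithin_le_nhds
  have g0 := C.tendsto_pair R₁ R₂ C.Gh2.continuous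
  refine ⟨_, _, hω, (((hc.sub (hω.div_const 2)).add (hA.mul g0)).sub
    (g0.mul (C.slope_div_lim S H hM h))).congr' ?_⟩
  filter_upwards [C.eventually_band S H hM h] with p hp
  have := hp.1.1.ne'
  simp only [shockSpeed]
  field_simp
  ring

lemma exists_speedT_lim : ∃ c, Tendsto (speedT S) (𝓝[{p | 0 < p.1}] ((0, y) : ℝ × ℝ)) (𝓝 c) := by
  obtain ⟨ω, κ, hω, hκ⟩ := C.ratio_speed_lim S H hM h
  exact C.exists_second_lim (C.shockSide_family S H (Or.inl rfl) h)
    (C.shockSide_family S H (Or.inr rfl) h) hω hκ (C.slope_div_lim S H hM h)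
    (C.slopeRate_lim S H hM h)

lemma shockSpeed_zero : shockSpeed S (0, y) = A y := by
  have e : ∀ σ, shockSide S σ (0, y) = s y := fun σ => C.stateRoot_of_nonpos le_rfl
  simp only [shockSpeed, e, C.Fdiag, S.field_zero h, Prod.snd_zero, mul_zero, sub_zero]

lemma shockSpeed_lim : Tendsto (shockSpeed S) (𝓝[{p | 0 < p.1}] ((0, y) : ℝ × ℝ)) (𝓝 (A y)) := by
  obtain ⟨ω, κ, -, hκ⟩ := C.ratio_speed_lim S H hM h
  have h1 : Tendsto (fun p : ℝ × ℝ => p.1) (𝓝[{p | 0 < p.1}] ((0, y) : ℝ × ℝ)) (𝓝 0) :=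
    (continuous_fst.tendsto' _ _ rfl).mono_left nhdsWithin_le_nhds
  have h2 : Tendsto (fun p : ℝ × ℝ => A p.2) (𝓝[{p | 0 < p.1}] ((0, y) : ℝ × ℝ)) (𝓝 (A y)) :=
    ((C.diffA.continuous.comp continuous_snd).tendsto' _ _ rfl).mono_left nhdsWithin_le_nhds
  have h3 := h2.add (h1.mul hκ)
  rw [zero_mul, add_zero] at h3
  refine h3.congr' ?_
  filter_upwards [C.eventually_band S H hM h] with p hp
  have := hp.1.1.ne'
  field_simp
  ring

lemma continuousWithinAt_shockSpeed :
    ContinuousWithinAt (shockSpeed S) {p | 0 ≤ p.1} ((0, y) : ℝ × ℝ) := by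
  have h1 : ContinuousWithinAt (shockSpeed S) {p | 0 < p.1} ((0, y) : ℝ × ℝ) := by
    have := C.shockSpeed_lim S H hM h
    rwa [← C.shockSpeed_zero S H hM h] at this
  have h2 : ContinuousWithinAt (shockSpeed S) {p | p.1 = 0} ((0, y) : ℝ × ℝ) := by
    have h3 : ContinuousWithinAt (fun p : ℝ × ℝ => A p.2) {p | p.1 = 0} ((0, y) : ℝ × ℝ) :=
      (C.diffA.continuous.comp continuous_snd).continuousWithinAt
    refine h3.congr_of_eventuallyEq ?_ (C.shockSpeed_zero S H hM h)
    have hb : ∀ᶠ p : ℝ × ℝ in 𝓝 ((0, y) : ℝ × ℝ), |p.2| + 2 * τ₁ * B < R :=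
      ConeSystem.isOpen_band.mem_nhds h
    filter_upwards [self_mem_nhdsWithin, hb.filter_mono nhdsWithin_le_nhds] with p hp hp'
    obtain ⟨a, b⟩ := p
    have hp : a = 0 := hp
    subst hp
    exact C.shockSpeed_zero S H hM hp'
  refine (h2.union h1).mono fun p hp => ?_
  exact (eq_or_lt_of_le (show 0 ≤ p.1 from hp)).imp Eq.symm id

omit h
variable (hR : ∀ y : ℝ, |y| < 1 → |y| + 2 * τ₁ * B < R)
include hR

lemma contDiffOn_shockPos : ContDiffOn ℝ 2 (shockPos S) (shockStrip τ₁) ∧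
    ∀ y : ℝ, |y| < 1 → HasFDerivWithinAt (shockPos S) (planeForm (A y) 0) (shockStrip τ₁) (0, y) := by
  have hK := (contDiffOn_one_of_limits (f := shockSpeed S) S.τ₁_pos
    (f' := fun p => planeForm (speedT S p) (speedY S p))
    (fun p h0 h1 h2 => ⟨C.hasFDerivAt_shockSpeed S H hM ⟨h0, h1⟩ (hR _ h2),
      continuousAt_planeForm (C.continuousAt_rates S H hM ⟨h0, h1⟩ (hR _ h2)).1
        (C.continuousAt_rates S H hM ⟨h0, h1⟩ (hR _ h2)).2.1⟩)
    (fun y hy => by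
      obtain ⟨c, hc⟩ := C.exists_speedT_lim S H hM (hR y hy)
      exact ⟨_, tendsto_planeForm hc (C.speedY_lim S H hM (hR y hy))⟩)
    (fun y hy => C.continuousWithinAt_shockSpeed S H hM (hR y hy))).1
  have hΩ := (contDiffOn_one_of_limits (f := fun p => (S.field p).2) S.τ₁_pos
    (f' := fun p => planeForm (slopeRate S p) (S.fieldY p).2)
    (fun p h0 h1 h2 => ⟨C.hasFDerivAt_slope S H ⟨h0, h1⟩ (hR _ h2),
      continuousAt_planeForm (C.continuousAt_rates S H hM ⟨h0, h1⟩ (hR _ h2)).2.2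
        (S.continuousAt_fieldY (hR _ h2)).snd⟩)
    (fun y hy => ⟨_, tendsto_planeForm (C.slopeRate_lim S H hM (hR y hy))
      ((continuous_snd.tendsto _).comp (C.fieldY_lim S H hM (hR y hy)))⟩)
    (fun y hy => (S.continuousAt_field (p := (0, y)) (hR y hy)).snd.continuousWithinAt)).1
  have hk := (contDiffOn_one_of_limits (f := shockPos S) S.τ₁_pos
    (f' := fun p => planeForm (shockSpeed S p) (S.field p).2)
    (fun p h0 h1 h2 => ⟨C.hasFDerivAt_shockPos S H hM ⟨h0, h1⟩ (hR _ h2),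
      continuousAt_planeForm (C.hasFDerivAt_shockSpeed S H hM ⟨h0, h1⟩ (hR _ h2)).continuousAt
        (S.continuousAt_field (hR _ h2)).snd⟩)
    (fun y hy => ⟨_, tendsto_planeForm (C.shockSpeed_lim S H hM (hR y hy))
      ((continuous_snd.tendsto _).comp (C.field_lim S H hM (hR y hy)))⟩)
    (fun y hy => ((continuousAt_fst.mul ((C.diffA.continuous.continuousAt.comp
      continuousAt_snd).add (S.continuousAt_field (p := (0, y)) (hR y hy)).fst))).continuousWithinAt)).2
  have hk0 : ∀ y : ℝ, |y| < 1 →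
      HasFDerivWithinAt (shockPos S) (planeForm (A y) 0) (shockStrip τ₁) (0, y) := fun y hy =>
    hk y _ hy (tendsto_planeForm (C.shockSpeed_lim S H hM (hR y hy))
      ((continuous_snd.tendsto _).comp (C.field_lim S H hM (hR y hy))))
  refine ⟨?_, hk0⟩
  rw [show (2 : WithTop ℕ∞) = 1 + 1 by norm_num,
    contDiffOn_succ_iff_hasFDerivWithinAt_of_uniqueDiffOn uniqueDiffOn_shockStrip]
  refine ⟨by simp, fun p => planeForm (shockSpeed S p) (S.field p).2,
    (hK.smul contDiffOn_const).add (hΩ.smul contDiffOn_const), ?_⟩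
  rintro ⟨t, y⟩ ⟨ht, ht', hy⟩
  rcases ht.eq_or_lt with h0 | h0
  · simp only at h0
    subst h0
    change HasFDerivWithinAt _ (planeForm (shockSpeed S (0, y)) (S.field (0, y)).2) _ _
    rw [C.shockSpeed_zero S H hM (hR y hy), S.field_zero (hR y hy)]
    exact hk0 y hy
  · exact (C.hasFDerivAt_shockPos S H hM ⟨h0, ht'⟩ (hR _ hy)).hasFDerivWithinAt

lemma flatShock_of_system : FlatShock D s A Fh Gh (α / β) e τ₁ (shockPos S) (shockSide S 1)
    (shockSide S (-1)) where
  τ₁_pos := S.τ₁_pos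
  smooth := (C.contDiffOn_shockPos S H hM hR).1
  zero y _ := by simp [shockPos]
  slope y hy := by
    have h1 := (C.contDiffOn_shockPos S H hM hR).2 y hy
    have h2 : HasDerivWithinAt (fun τ : ℝ => ((τ, y) : ℝ × ℝ)) (1, 0) (Ico 0 τ₁) 0 :=
      ((hasDerivAt_id (0 : ℝ)).prodMk (hasDerivAt_const (0 : ℝ) y)).hasDerivWithinAt
    have h3 := h1.comp_hasDerivWithinAt (0 : ℝ) h2 (show MapsTo (fun τ : ℝ => ((τ, y) : ℝ × ℝ))
      (Ico 0 τ₁) (shockStrip τ₁) from fun τ hτ => ⟨hτ.1, hτ.2, hy⟩)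
    have h4 : HasDerivWithinAt (fun τ => shockPos S (τ, y)) (A y) (Ico 0 τ₁) 0 := by
      refine h3.congr_deriv ?_
      simp [planeForm_apply]
    exact h4.mono_of_mem_nhdsWithin (Ico_mem_nhdsGE S.τ₁_pos)
  deriv_lim y hy := by
    refine ((C.shockSpeed_lim S H hM (hR y hy)).prodMk_nhds
      ((continuous_snd.tendsto _).comp (C.field_lim S H hM (hR y hy)))).congr' ?_
    filter_upwards [C.eventually_band S H hM (hR y hy)] with p hp
    have h := C.hasFDerivAt_shockPos S H hM hp.1 hp.2
    simp [partialFst, partialSnd, h.fderiv, planeForm_apply]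
  diff p h0 h1 h2 := (C.hasFDerivAt_shockPos S H hM ⟨h0, h1⟩ (hR _ h2)).differentiableAt
  upper p h0 h1 h2 :=
    have h := C.shockSide_spec S H (Or.inl rfl) ⟨h0, h1⟩ (hR _ h2)
    ⟨h.1, h.2.1⟩
  lower p h0 h1 h2 :=
    have h := C.shockSide_spec S H (Or.inr rfl) ⟨h0, h1⟩ (hR _ h2)
    ⟨h.1, h.2.1⟩
  transport p h0 h1 h2 := by
    have h := C.hasFDerivAt_shockPos S H hM ⟨h0, h1⟩ (hR _ h2)
    simp only [partialFst, partialSnd, h.fderiv, planeForm_apply, shockSpeed]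
    ring

omit S H hM hR

theorem exists_flatShock :
    ∃ τ₁ k up um, FlatShock D s A Fh Gh (α / β) e τ₁ k up um := by
  obtain ⟨K, hK⟩ := (isCompact_Icc (a := (-2 : ℝ)) (b := 2)).exists_bound_of_continuousOn
    C.contA'.continuousOn
  obtain ⟨τ₁, M, ℓ, B, h1, h2, H, S⟩ := C.exists_coneSystem (K + 5) (R := 2) (by norm_num)
  refine ⟨τ₁, _, _, _, C.flatShock_of_system S H (fun y hy => ?_) (fun y hy => ?_)⟩
  · have := hK y (abs_le.1 hy)
    rw [Real.norm_eq_abs] at this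
    linarith
  · linarith

end FlatCusp

/-- An integral over `[0,1]` depends as smoothly on parameters as its integrand. -/
lemma contDiff_integral_unit {W : Type} [NormedAddCommGroup W] [NormedSpace ℝ W]
    [FiniteDimensional ℝ W] {n : ℕ} : ∀ {E : Type} [NormedAddCommGroup E] [NormedSpace ℝ E]
    [CompleteSpace E] {h : W × ℝ → E}, ContDiff ℝ n h →
    ContDiff ℝ n (fun p => ∫ θ in (0 : ℝ)..1, h (p, θ)) := by
  induction n with
  | zero =>
    intro E _ _ _ h hh
    rw [Nat.cast_zero, contDiff_zero] at hh ⊢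
    exact intervalIntegral.continuous_parametric_intervalIntegral_of_continuous'
      (f := fun p θ => h (p, θ)) hh _ _
  | succ n ih =>
    intro E _ _ _ h hh
    have h1 : ContDiff ℝ n (fun q : W × ℝ => (fderiv ℝ h q).comp (ContinuousLinearMap.inl ℝ W ℝ)) :=
      (hh.fderiv_right (m := n) (by norm_cast)).clm_comp contDiff_const
    have hd : ∀ q, HasFDerivAt h (fderiv ℝ h q) q := fun q =>
      (hh.differentiable (by simp) q).hasFDerivAt
    rw [Nat.cast_succ, contDiff_succ_iff_hasFDerivAt]
    refine ⟨_, ih h1, fun p => ?_⟩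
    obtain ⟨K, hK⟩ := ((isCompact_closedBall p 1).prod (isCompact_Icc (a := (0 : ℝ)) (b := 1)))
      |>.exists_bound_of_continuousOn h1.continuous.continuousOn
    refine intervalIntegral.hasFDerivAt_integral_of_dominated_of_fderiv_le
      (F := fun p θ => h (p, θ))
      (F' := fun p θ => (fderiv ℝ h (p, θ)).comp (ContinuousLinearMap.inl ℝ W ℝ))
      (bound := fun _ => K) (Metric.closedBall_mem_nhds p one_pos)
      (Eventually.of_forall fun q => (hh.continuous.comp (by fun_prop)).aestronglyMeasurable)
      ((hh.continuous.comp (by fun_prop)).intervalIntegrable _ _)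
      (h1.continuous.comp (by fun_prop : Continuous fun θ : ℝ => (p, θ))).aestronglyMeasurable
      (Eventually.of_forall fun θ hθ q hq => hK (q, θ) ⟨hq, ?_⟩)
      (by simp) (Eventually.of_forall fun θ hθ q hq => ?_)
    · rw [uIoc_of_le zero_le_one] at hθ
      exact ⟨hθ.1.le, hθ.2⟩
    · exact (hd (q, θ)).comp q ((hasFDerivAt_id q).prodMk (hasFDerivAt_const θ q))

/-- The mean of `f'` between two points. -/
def meanDeriv (f : ℝ → ℝ) (p : ℝ × ℝ) : ℝ := ∫ θ in (0 : ℝ)..1, deriv f (p.2 + θ * (p.1 - p.2))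

lemma contDiff_meanDeriv {f : ℝ → ℝ} {n : ℕ} (hf : ContDiff ℝ (n + 1) f) :
    ContDiff ℝ n (meanDeriv f) := by
  have h1 : ContDiff ℝ n (deriv f) := hf.deriv'
  exact contDiff_integral_unit (h := fun q : (ℝ × ℝ) × ℝ =>
    deriv f (q.1.2 + q.2 * (q.1.1 - q.1.2))) (h1.comp (by fun_prop))

lemma meanDeriv_self (f : ℝ → ℝ) (a : ℝ) : meanDeriv f (a, a) = deriv f a := by
  simp [meanDeriv]

lemma meanDeriv_swap (f : ℝ → ℝ) (a b : ℝ) : meanDeriv f (a, b) = meanDeriv f (b, a) := by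
  have h := intervalIntegral.integral_comp_sub_left (a := 0) (b := 1)
    (fun θ => deriv f (b + θ * (a - b))) 1
  simp only [sub_self, sub_zero] at h
  simp only [meanDeriv]
  rw [← h]
  refine intervalIntegral.integral_congr fun θ _ => ?_
  congr 1
  ring

lemma meanDeriv_mul {f : ℝ → ℝ} (hf : ContDiff ℝ 1 f) (a b : ℝ) :
    meanDeriv f (a, b) * (a - b) = f a - f b := by
  have hd : ∀ θ ∈ uIcc (0 : ℝ) 1, HasDerivAt (fun θ => f (b + θ * (a - b)))
      (deriv f (b + θ * (a - b)) * (a - b)) θ := fun θ _ => by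
    have h1 : HasDerivAt (fun θ : ℝ => b + θ * (a - b)) (a - b) θ := by
      simpa using ((hasDerivAt_id θ).mul_const (a - b)).const_add b
    exact ((hf.differentiable one_ne_zero _).hasDerivAt).comp θ h1
  have hc : Continuous (deriv f) := hf.continuous_deriv le_rfl
  have := intervalIntegral.integral_eq_sub_of_hasDerivAt hd
    ((hc.comp (by fun_prop)).mul continuous_const |>.intervalIntegrable _ _)
  rw [intervalIntegral.integral_mul_const] at this
  simpa [meanDeriv] using this

/-- A smooth map of the line that is the identity near `0` and has small range. -/
lemma exists_squash {r : ℝ} (hr : 0 < r) : ∃ χ : ℝ → ℝ, ContDiff ℝ 5 χ ∧ (∀ x, |χ x| < r) ∧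
    ∀ x, |x| < r / 2 → χ x = x := by
  let b : ContDiffBump (0 : ℝ) := ⟨r / 2, r, by positivity, by linarith⟩
  refine ⟨fun x => x * b x, contDiff_id.mul b.contDiff, fun x => ?_, fun x hx => ?_⟩
  · rcases lt_or_ge |x| r with h | h
    · rw [abs_mul]
      have h1 : |b x| ≤ 1 := by rw [abs_of_nonneg b.nonneg]; exact b.le_one
      exact lt_of_le_of_lt (mul_le_of_le_one_right (abs_nonneg _) h1) h
    · have : b x = 0 := b.zero_of_le_dist (by simpa [Real.dist_eq] using h)
      simpa [this] using hr
  · have : b x = 1 := b.one_of_mem_closedBall (by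
      rw [mem_closedBall_zero_iff, Real.norm_eq_abs]; exact hx.le)
    simp [this]

/-- A germ extends to a global function of the same smoothness. -/
lemma exists_contDiff_eventuallyEq {E : Type*} [NormedAddCommGroup E] [NormedSpace ℝ E]
    [FiniteDimensional ℝ E] {f : E → ℝ} {x : E} {n : ℕ} (hf : ContDiffAt ℝ n f x) :
    ∃ g : E → ℝ, ContDiff ℝ n g ∧ g =ᶠ[𝓝 x] f := by
  have h1 := hf.eventually (by simp)
  obtain ⟨ε, hε, h2⟩ := Metric.eventually_nhds_iff.1 h1
  let b : ContDiffBump x := ⟨ε / 3, ε / 2, by positivity, by linarith⟩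
  refine ⟨fun y => b y * f y, ?_, ?_⟩
  · rw [contDiff_iff_contDiffAt]
    intro y
    rcases lt_or_ge (dist y x) ε with h | h
    · exact (b.contDiff.contDiffAt (x := y)).mul (h2 h)
    · have : (fun y => b y * f y) =ᶠ[𝓝 y] fun _ => 0 := by
        have h3 : ∀ᶠ z in 𝓝 y, ε / 2 < dist z x :=
          (continuous_id.dist continuous_const).continuousAt.eventually
            (lt_mem_nhds (by simpa using (by linarith : ε / 2 < dist y x)))
        filter_upwards [h3] with z hz
        rw [b.zero_of_le_dist hz.le, zero_mul]
      exact contDiffAt_const.congr_of_eventuallyEq this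
  · filter_upwards [b.eventuallyEq_one] with y hy
    rw [hy]; simp

lemma exists_smooth_localInverse {E : Type*} [NormedAddCommGroup E] [NormedSpace ℝ E]
    [FiniteDimensional ℝ E] [CompleteSpace E] {n : WithTop ℕ∞} (hn : n ≠ 0) {f : E → E} {a : E}
    (hf : ContDiffAt ℝ n f a) (hinj : ∀ v, fderiv ℝ f a v = 0 → v = 0) :
    ∃ g : E → E, ContDiffAt ℝ n g (f a) ∧ g (f a) = a ∧ (∀ᶠ x in 𝓝 a, g (f x) = x) ∧
      ∀ᶠ y in 𝓝 (f a), f (g y) = y := by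
  have hi : Function.Injective (fderiv ℝ f a : E →ₗ[ℝ] E) :=
    (injective_iff_map_eq_zero _).2 hinj
  set L := (LinearEquiv.ofInjectiveEndo _ hi).toContinuousLinearEquiv with hL
  have hd : HasFDerivAt f (L : E →L[ℝ] E) a := by
    refine (hf.differentiableAt hn).hasFDerivAt.congr_fderiv ?_
    ext v
    simp [hL]
  exact ⟨hf.localInverse hd hn, hf.to_localInverse hd hn, hf.localInverse_apply_image hd hn,
    (hf.hasStrictFDerivAt' hd hn).eventually_left_inverse,
    (hf.hasStrictFDerivAt' hd hn).eventually_right_inverse⟩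

section PlanePartials

variable {h : ℝ × ℝ → ℝ}

lemma fderiv_apply_eq_planePartials (h : ℝ × ℝ → ℝ) (p v : ℝ × ℝ) :
    fderiv ℝ h p v = v.1 * partialFst h p + v.2 * partialSnd h p := by
  obtain ⟨a, b⟩ := v
  have : ((a, b) : ℝ × ℝ) = a • (1, 0) + b • (0, 1) := by simp
  rw [this, map_add, map_smul, map_smul]
  simp [partialFst, partialSnd]

lemma ContDiff.partialFst {n m : WithTop ℕ∞} (hh : ContDiff ℝ n h) (hmn : m + 1 ≤ n) :
    ContDiff ℝ m (partialFst h) :=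
  (hh.fderiv_right hmn).clm_apply contDiff_const

lemma ContDiff.partialSnd {n m : WithTop ℕ∞} (hh : ContDiff ℝ n h) (hmn : m + 1 ≤ n) :
    ContDiff ℝ m (partialSnd h) :=
  (hh.fderiv_right hmn).clm_apply contDiff_const

lemma HasFDerivAt.comp_planeCurve {a b : ℝ → ℝ} {a' b' x : ℝ}
    (hh : DifferentiableAt ℝ h (a x, b x)) (ha : HasDerivAt a a' x) (hb : HasDerivAt b b' x) :
    HasDerivAt (fun x => h (a x, b x))
      (a' * _root_.partialFst h (a x, b x) + b' * _root_.partialSnd h (a x, b x)) x := by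
  have := hh.hasFDerivAt.comp_hasDerivAt x (f := fun x => (a x, b x)) (ha.prodMk hb)
  rwa [fderiv_apply_eq_planePartials] at this

lemma hasDerivAt_partialFst (hh : Differentiable ℝ h) (a b : ℝ) :
    HasDerivAt (fun a => h (a, b)) (partialFst h (a, b)) a := by
  simpa using HasFDerivAt.comp_planeCurve (hh _) (hasDerivAt_id a) (hasDerivAt_const a b)

lemma hasDerivAt_partialSnd (hh : Differentiable ℝ h) (a b : ℝ) :
    HasDerivAt (fun b => h (a, b)) (partialSnd h (a, b)) b := by
  simpa using HasFDerivAt.comp_planeCurve (hh _) (hasDerivAt_const b a) (hasDerivAt_id b)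

lemma partialSnd_partialFst (hh : ContDiff ℝ 2 h) (p : ℝ × ℝ) :
    partialSnd (partialFst h) p = partialFst (partialSnd h) p := by
  have hd : DifferentiableAt ℝ (fderiv ℝ h) p :=
    ((hh.fderiv_right (m := 1) (by norm_num)).differentiable one_ne_zero) p
  have hs := (hh.contDiffAt (x := p)).isSymmSndFDerivAt (by simp)
  have e : ∀ v w, fderiv ℝ (fun q => fderiv ℝ h q v) p w = fderiv ℝ (fderiv ℝ h) p w v := by
    intro v w
    rw [fderiv_clm_apply hd (differentiableAt_const _)]
    simp
  have := (e (1, 0) (0, 1)).trans ((hs _ _).trans (e (0, 1) (1, 0)).symm)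
  exact this

lemma partialFst_comp {f : ℝ → ℝ} {p : ℝ × ℝ} (hf : DifferentiableAt ℝ f (h p))
    (hh : DifferentiableAt ℝ h p) :
    partialFst (fun q => f (h q)) p = deriv f (h p) * partialFst h p ∧
    partialSnd (fun q => f (h q)) p = deriv f (h p) * partialSnd h p := by
  have := (hf.hasDerivAt.comp_hasFDerivAt p hh.hasFDerivAt).fderiv
  have e : fderiv ℝ (fun q => f (h q)) p = deriv f (h p) • fderiv ℝ h p := this
  simp [partialFst, partialSnd, e]

end PlanePartials

/-- Position of the characteristic with value `u` that is at ordinate `y` at time `t`, variables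
`(t, u, y)`; here `Z (u, η)` is the abscissa of the point on `{u₀ = u}` with ordinate `η`. -/
def charPos (F G : ℝ → ℝ) (Z : ℝ × ℝ → ℝ) (p : ℝ × ℝ × ℝ) : ℝ :=
  Z (p.2.1, p.2.2 - p.1 * deriv G p.2.1) + p.1 * deriv F p.2.1

section
variable {F G : ℝ → ℝ} {Z : ℝ × ℝ → ℝ} (hF : ContDiff ℝ 5 F) (hG : ContDiff ℝ 5 G)
  (hZ : ContDiff ℝ 4 Z)

lemma ContDiff.deriv_four {f : ℝ → ℝ} (hf : ContDiff ℝ 5 f) : ContDiff ℝ 4 (deriv f) :=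
  ContDiff.deriv' (n := 4) (by rwa [show (4 : WithTop ℕ∞) + 1 = 5 by norm_num])

lemma ContDiff.hasDerivAt_deriv {f : ℝ → ℝ} (hf : ContDiff ℝ 5 f) (x : ℝ) :
    HasDerivAt (deriv f) (deriv (deriv f) x) x :=
  (hf.deriv_four.differentiable (by norm_num) x).hasDerivAt

include hF hG hZ

lemma contDiff_charPos : ContDiff ℝ 4 (charPos F G Z) := by
  have h1 := hF.deriv_four
  have h2 := hG.deriv_four
  unfold charPos
  fun_prop

lemma charPos_partials (t u y : ℝ) :
    partialY (charPos F G Z) (t, u, y) = partialSnd Z (u, y - t * deriv G u) ∧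
    partialT (charPos F G Z) (t, u, y) =
      deriv F u - deriv G u * partialSnd Z (u, y - t * deriv G u) ∧
    partialX (charPos F G Z) (t, u, y) = partialFst Z (u, y - t * deriv G u) -
      t * deriv (deriv G) u * partialSnd Z (u, y - t * deriv G u) + t * deriv (deriv F) u := by
  have hX : Differentiable ℝ (charPos F G Z) :=
    (contDiff_charPos hF hG hZ).differentiable (by norm_num)
  have hZd : Differentiable ℝ Z := hZ.differentiable (by norm_num)
  refine ⟨?_, ?_, ?_⟩
  · have h1 := (HasFDerivAt.comp_planeCurve (hZd (u, y - t * deriv G u)) (hasDerivAt_const y u)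
      ((hasDerivAt_id y).sub_const (t * deriv G u))).add_const (t * deriv F u)
    have := (hasDerivAt_partialY hX t u y).unique h1
    simpa using this
  · have h1 := (HasFDerivAt.comp_planeCurve (hZd (u, y - t * deriv G u)) (hasDerivAt_const t u)
      (((hasDerivAt_id t).mul_const (deriv G u)).const_sub y)).add
      ((hasDerivAt_id t).mul_const (deriv F u))
    have := (hasDerivAt_partialT hX t u y).unique h1
    simp only [zero_mul, zero_add, one_mul, id] at this
    rw [this]; ring
  · have h1 := (HasFDerivAt.comp_planeCurve (hZd (u, y - t * deriv G u)) (hasDerivAt_id u)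
      (((hG.hasDerivAt_deriv u).const_mul t).const_sub y)).add
      ((hF.hasDerivAt_deriv u).const_mul t)
    have := (hasDerivAt_partialX hX t u y).unique h1
    simp only [id] at this
    rw [this]; ring

lemma charPos_T (t u y : ℝ) : partialT (charPos F G Z) (t, u, y) =
    deriv F u - deriv G u * partialY (charPos F G Z) (t, u, y) := by
  obtain ⟨h1, h2, -⟩ := charPos_partials hF hG hZ t u y
  rw [h1, h2]

end

/-- `Z` is the local inverse of `ξ ↦ u₀(ξ, η)` near a generic point with `∂_ξ u₀ < 0`. -/
structure CharGerm (F G : ℝ → ℝ) (u₀ Z : ℝ × ℝ → ℝ) (c : ℝ) : Prop where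
  F5 : ContDiff ℝ 5 F
  G5 : ContDiff ℝ 5 G
  u4 : ContDiff ℝ 4 u₀
  gnc : NormalizedGNC F G u₀
  neg : partialFst u₀ (0, 0) < 0
  base : u₀ (0, 0) = c
  Z4 : ContDiff ℝ 4 Z
  right : ∀ᶠ q in 𝓝 (c, 0), u₀ (Z q, q.2) = q.1
  left : ∀ᶠ p in 𝓝 (0, 0), Z (u₀ p, p.2) = p.1

lemma exists_charGerm {F G : ℝ → ℝ} {u₀ : ℝ × ℝ → ℝ} (hF : ContDiff ℝ 5 F) (hG : ContDiff ℝ 5 G)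
    (hu₀ : ContDiff ℝ 4 u₀) (hGNC : NormalizedGNC F G u₀) (hneg : partialFst u₀ (0, 0) < 0) :
    ∃ Z, CharGerm F G u₀ Z (u₀ (0, 0)) := by
  have hd : DifferentiableAt ℝ u₀ (0, 0) := hu₀.differentiable (by norm_num) _
  have hΨ : ContDiff ℝ 4 fun p : ℝ × ℝ => (u₀ p, p.2) := hu₀.prodMk contDiff_snd
  obtain ⟨g, hg, hga, hgl, hgr⟩ := exists_smooth_localInverse (n := 4) (by norm_num)
    (hΨ.contDiffAt (x := (0, 0))) (fun v hv => by
      have h1 : HasFDerivAt (fun p : ℝ × ℝ => (u₀ p, p.2)) _ (0, 0) :=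
        hd.hasFDerivAt.prodMk hasFDerivAt_snd
      rw [h1.fderiv] at hv
      have h2 : fderiv ℝ u₀ (0, 0) v = 0 := congrArg Prod.fst hv
      have h3 : v.2 = 0 := congrArg Prod.snd hv
      rw [fderiv_apply_eq_planePartials, h3, zero_mul, add_zero] at h2
      exact Prod.ext ((mul_eq_zero.1 h2).resolve_right hneg.ne) h3)
  obtain ⟨Z, hZ, hZg⟩ := exists_contDiff_eventuallyEq (n := 4) (f := fun q => (g q).1)
    (x := (u₀ (0, 0), (0 : ℝ))) hg.fst
  refine ⟨Z, hF, hG, hu₀, hGNC, hneg, rfl, hZ, ?_, ?_⟩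
  · filter_upwards [hZg, hgr] with q h1 h2
    have h3 : (g q).2 = q.2 := (Prod.ext_iff.1 h2).2
    have h4 : u₀ (g q) = q.1 := (Prod.ext_iff.1 h2).1
    rw [h1, ← h3]
    exact h4
  · have ht : Tendsto (fun p : ℝ × ℝ => (u₀ p, p.2)) (𝓝 (0, 0)) (𝓝 (u₀ (0, 0), 0)) :=
      hΨ.continuous.tendsto _
    filter_upwards [ht.eventually hZg, hgl] with p h1 h2
    rw [h1, h2]

namespace CharGerm

variable {F G : ℝ → ℝ} {u₀ Z : ℝ × ℝ → ℝ} {c : ℝ} (K : CharGerm F G u₀ Z c)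
include K

lemma F_zero : deriv F c = 0 := by have := K.gnc.speed_fst; rwa [speed, K.base] at this
lemma G_zero : deriv G c = 0 := by have := K.gnc.speed_snd; rwa [speed, K.base] at this

lemma Z_zero : Z (c, 0) = 0 := by
  have := K.left.self_of_nhds
  rwa [K.base] at this

lemma diffu : Differentiable ℝ u₀ := K.u4.differentiable (by norm_num)
lemma diffZ : Differentiable ℝ Z := K.Z4.differentiable (by norm_num)

lemma speed_partials (p : ℝ × ℝ) :
    (partialFst (speed F u₀) p = deriv (deriv F) (u₀ p) * partialFst u₀ p ∧
    partialSnd (speed F u₀) p = deriv (deriv F) (u₀ p) * partialSnd u₀ p) ∧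
    (partialFst (speed G u₀) p = deriv (deriv G) (u₀ p) * partialFst u₀ p ∧
    partialSnd (speed G u₀) p = deriv (deriv G) (u₀ p) * partialSnd u₀ p) :=
  ⟨partialFst_comp (K.F5.hasDerivAt_deriv _).differentiableAt (K.diffu p),
    partialFst_comp (K.G5.hasDerivAt_deriv _).differentiableAt (K.diffu p)⟩

lemma initDiv_eq (p : ℝ × ℝ) : initDiv F G u₀ p =
    deriv (deriv F) (u₀ p) * partialFst u₀ p + deriv (deriv G) (u₀ p) * partialSnd u₀ p := by
  rw [initDiv, (K.speed_partials p).1.1, (K.speed_partials p).2.2]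

lemma secondF_pos : 0 < deriv (deriv F) c := by
  have h := K.gnc.fst_le
  rw [(K.speed_partials _).1.1, K.base] at h
  have := K.neg
  by_contra hcon
  nlinarith

/-- Points `q = (u, η)` at which the chart and its first derivatives are valid. -/
lemma eventually_chart : ∀ᶠ q in 𝓝 (c, 0), u₀ (Z q, q.2) = q.1 ∧ partialFst u₀ (Z q, q.2) < 0 ∧
    partialFst Z q * partialFst u₀ (Z q, q.2) = 1 ∧
    partialSnd Z q * partialFst u₀ (Z q, q.2) + partialSnd u₀ (Z q, q.2) = 0 := by
  have hc : Continuous fun q : ℝ × ℝ => partialFst u₀ (Z q, q.2) :=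
    (K.u4.partialFst (m := 3) (by norm_num)).continuous.comp
      (K.Z4.continuous.prodMk continuous_snd)
  have h1 : ∀ᶠ q in 𝓝 (c, 0), partialFst u₀ (Z q, q.2) < 0 :=
    (hc.tendsto _).eventually_lt_const (by simpa [K.Z_zero] using K.neg)
  filter_upwards [K.right.eventually_nhds, h1] with q h2 h3
  refine ⟨h2.self_of_nhds, h3, ?_, ?_⟩
  · have e1 := HasFDerivAt.comp_planeCurve (K.diffu (Z (q.1, q.2), q.2))
      (hasDerivAt_partialFst K.diffZ q.1 q.2) (hasDerivAt_const q.1 q.2)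
    have ht : Tendsto (fun a : ℝ => (a, q.2)) (𝓝 q.1) (𝓝 q) :=
      (by fun_prop : Continuous fun a : ℝ => (a, q.2)).tendsto' _ _ rfl
    have e2 := (hasDerivAt_id q.1).congr_of_eventuallyEq (ht.eventually h2)
    simpa using e1.unique e2
  · have e1 := HasFDerivAt.comp_planeCurve (K.diffu (Z (q.1, q.2), q.2))
      (hasDerivAt_partialSnd K.diffZ q.1 q.2) (hasDerivAt_id q.2)
    have ht : Tendsto (fun a : ℝ => (q.1, a)) (𝓝 q.2) (𝓝 q) :=
      (by fun_prop : Continuous fun a : ℝ => (q.1, a)).tendsto' _ _ rfl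
    have e2 := (hasDerivAt_const q.2 q.1).congr_of_eventuallyEq (ht.eventually h2)
    simpa using e1.unique e2

end CharGerm

lemma contDiffAt_succ_of_hasDerivAt {f f' : ℝ → ℝ} {x : ℝ} {n : ℕ}
    (h : ∀ᶠ y in 𝓝 x, HasDerivAt f (f' y) y) (hf' : ContDiffAt ℝ n f' x) :
    ContDiffAt ℝ (n + 1) f x := by
  rw [contDiffAt_succ_iff_hasFDerivAt]
  exact ⟨fun y => ContinuousLinearMap.toSpanSingleton ℝ (f' y), ⟨_, h, fun y hy => hy.hasFDerivAt⟩,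
    (ContinuousLinearMap.toSpanSingletonCLE (𝕜 := ℝ) (E := ℝ)).contDiff.contDiffAt.comp x hf'⟩

/-- A product whose first factor has a double zero. -/
lemma deriv_mul_of_double_zero {h w : ℝ → ℝ} {c : ℝ} (hh : ContDiff ℝ 2 h) (hw : ContDiff ℝ 2 w)
    (h0 : h c = 0) (h1 : deriv h c = 0) : deriv (fun u => h u * w u) c = 0 ∧
    deriv (deriv fun u => h u * w u) c = deriv (deriv h) c * w c := by
  have dh : Differentiable ℝ h := hh.differentiable (by norm_num)
  have dw : Differentiable ℝ w := hw.differentiable (by norm_num)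
  have dh' : Differentiable ℝ (deriv h) := (hh.deriv' (n := 1)).differentiable one_ne_zero
  have dw' : Differentiable ℝ (deriv w) := (hw.deriv' (n := 1)).differentiable one_ne_zero
  have e : (deriv fun u => h u * w u) = fun u => deriv h u * w u + h u * deriv w u :=
    funext fun u => ((dh u).hasDerivAt.mul (dw u).hasDerivAt).deriv
  refine ⟨by simp [e, h0, h1], ?_⟩
  rw [e]
  have := ((dh' c).hasDerivAt.mul (dw c).hasDerivAt).add ((dh c).hasDerivAt.mul (dw' c).hasDerivAt)
  refine this.deriv.trans ?_
  rw [h0, h1]; ring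

namespace CharGerm

variable {F G : ℝ → ℝ} {u₀ Z : ℝ × ℝ → ℝ} {c : ℝ} (K : CharGerm F G u₀ Z c)
include K

lemma X4 : ContDiff ℝ 4 (charPos F G Z) := contDiff_charPos K.F5 K.G5 K.Z4
lemma diffX : Differentiable ℝ (charPos F G Z) := K.X4.differentiable (by norm_num)
lemma Xu3 : ContDiff ℝ 3 (partialX (charPos F G Z)) := K.X4.partialX (by norm_num)
lemma Xt3 : ContDiff ℝ 3 (partialT (charPos F G Z)) := K.X4.partialT (by norm_num)
lemma Xy3 : ContDiff ℝ 3 (partialY (charPos F G Z)) := K.X4.partialY (by norm_num)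
lemma diffXu : Differentiable ℝ (partialX (charPos F G Z)) := K.Xu3.differentiable (by norm_num)
lemma Xuu2 : ContDiff ℝ 2 (partialX (partialX (charPos F G Z))) := K.Xu3.partialX (by norm_num)
lemma diffXuu : Differentiable ℝ (partialX (partialX (charPos F G Z))) :=
  K.Xuu2.differentiable (by norm_num)

lemma initDiv3 : ContDiff ℝ 3 (initDiv F G u₀) :=
  ((K.F5.deriv_four.comp K.u4).partialFst (by norm_num)).add
    ((K.G5.deriv_four.comp K.u4).partialSnd (by norm_num))

lemma charPos_X {t u y : ℝ} (h : u₀ (Z (u, y - t * deriv G u), y - t * deriv G u) = u ∧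
    partialFst u₀ (Z (u, y - t * deriv G u), y - t * deriv G u) < 0 ∧
    partialFst Z (u, y - t * deriv G u) *
      partialFst u₀ (Z (u, y - t * deriv G u), y - t * deriv G u) = 1 ∧
    partialSnd Z (u, y - t * deriv G u) *
      partialFst u₀ (Z (u, y - t * deriv G u), y - t * deriv G u) +
      partialSnd u₀ (Z (u, y - t * deriv G u), y - t * deriv G u) = 0) :
    partialX (charPos F G Z) (t, u, y) =
      (1 + t * initDiv F G u₀ (Z (u, y - t * deriv G u), y - t * deriv G u)) *
        partialFst Z (u, y - t * deriv G u) := by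
  rw [(charPos_partials K.F5 K.G5 K.Z4 t u y).2.2, K.initDiv_eq]
  generalize y - t * deriv G u = η at *
  obtain ⟨h1, h2, h3, h4⟩ := h
  rw [h1]
  linear_combination (-t * deriv (deriv F) u) * h3 - t * deriv (deriv G) u * partialFst Z (u, η) * h4 +
    t * deriv (deriv G) u * partialSnd Z (u, η) * h3

lemma initDiv_grad : partialFst (initDiv F G u₀) (0, 0) = 0 ∧
    partialSnd (initDiv F G u₀) (0, 0) = 0 := by
  have h1 : IsLocalMin (initDiv F G u₀) (0, 0) := Eventually.of_forall fun p => by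
    rcases eq_or_ne p (0, 0) with h | h
    · rw [h]
    · rw [K.gnc.min_value]; exact (K.gnc.unique_min p h).le
  have := h1.fderiv_eq_zero
  simp [partialFst, partialSnd, this]

lemma initDiv_ge (p : ℝ × ℝ) : -1 ≤ initDiv F G u₀ p := by
  rcases eq_or_ne p (0, 0) with h | h
  · rw [h, K.gnc.min_value]
  · exact (K.gnc.unique_min p h).le

/-- Second order behaviour of `H` along a curve through the origin. -/
lemma initDiv_curve {a b : ℝ → ℝ} (ha : ContDiff ℝ 2 a) (hb : ContDiff ℝ 2 b) (ha0 : a c = 0)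
    (hb0 : b c = 0) : deriv (fun u => 1 + initDiv F G u₀ (a u, b u)) c = 0 ∧
    deriv (deriv fun u => 1 + initDiv F G u₀ (a u, b u)) c = 6 * (deriv a c ^ 2 + deriv b c ^ 2) := by
  have da : Differentiable ℝ a := ha.differentiable (by norm_num)
  have db : Differentiable ℝ b := hb.differentiable (by norm_num)
  have da' : Differentiable ℝ (deriv a) := (ha.deriv' (n := 1)).differentiable one_ne_zero
  have db' : Differentiable ℝ (deriv b) := (hb.deriv' (n := 1)).differentiable one_ne_zero
  have hH := K.initDiv3
  have dH : Differentiable ℝ (initDiv F G u₀) := hH.differentiable (by norm_num)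
  have d1 : Differentiable ℝ (partialFst (initDiv F G u₀)) :=
    (hH.partialFst (m := 2) (by norm_num)).differentiable (by norm_num)
  have d2 : Differentiable ℝ (partialSnd (initDiv F G u₀)) :=
    (hH.partialSnd (m := 2) (by norm_num)).differentiable (by norm_num)
  have e : (deriv fun u => 1 + initDiv F G u₀ (a u, b u)) = fun u =>
      deriv a u * partialFst (initDiv F G u₀) (a u, b u) +
        deriv b u * partialSnd (initDiv F G u₀) (a u, b u) := funext fun u =>
    ((HasFDerivAt.comp_planeCurve (dH _) (da u).hasDerivAt (db u).hasDerivAt).const_add 1).deriv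
  obtain ⟨g1, g2⟩ := K.initDiv_grad
  rw [e]
  refine ⟨by simp only [ha0, hb0, g1, g2]; ring, ?_⟩
  have := ((da' c).hasDerivAt.mul (HasFDerivAt.comp_planeCurve (d1 (a c, b c)) (da c).hasDerivAt
    (db c).hasDerivAt)).add ((db' c).hasDerivAt.mul (HasFDerivAt.comp_planeCurve (d2 (a c, b c))
    (da c).hasDerivAt (db c).hasDerivAt))
  refine this.deriv.trans ?_
  simp only [ha0, hb0, g1, g2]
  rw [partialSnd_partialFst (hH.of_le (by norm_num)), K.gnc.hess_fst_fst, K.gnc.hess_fst_snd,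
    K.gnc.hess_snd_snd]
  ring

lemma chart_base : partialFst Z (c, 0) * partialFst u₀ (0, 0) = 1 := by
  have := K.eventually_chart.self_of_nhds.2.2.1
  rwa [K.Z_zero] at this

lemma Z_fst_neg : partialFst Z (c, 0) < 0 := by
  have := K.chart_base
  have := K.neg
  by_contra hcon
  nlinarith

/-- The degenerate point `(1, c, 0)`. -/
lemma charPos_base : charPos F G Z (1, c, 0) = 0 ∧ partialX (charPos F G Z) (1, c, 0) = 0 ∧
    partialX (partialX (charPos F G Z)) (1, c, 0) = 0 ∧
    partialX (partialX (partialX (charPos F G Z))) (1, c, 0) < 0 ∧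
    0 < partialT (partialX (charPos F G Z)) (1, c, 0) := by
  set a : ℝ → ℝ := fun u => Z (u, 0 - 1 * deriv G u) with ha
  set b : ℝ → ℝ := fun u => 0 - 1 * deriv G u with hb
  have hb4 : ContDiff ℝ 4 b := by have := K.G5.deriv_four; fun_prop
  have ha4 : ContDiff ℝ 4 a := K.Z4.comp (contDiff_id.prodMk hb4)
  have hb0 : b c = 0 := by simp [hb, K.G_zero]
  have ha0 : a c = 0 := by simp [ha, K.G_zero, K.Z_zero]
  obtain ⟨e1, e2⟩ := K.initDiv_curve (ha4.of_le (by norm_num)) (hb4.of_le (by norm_num)) ha0 hb0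
  set h : ℝ → ℝ := fun u => 1 + initDiv F G u₀ (a u, b u) with hh
  set w : ℝ → ℝ := fun u => partialFst Z (u, b u) with hw
  have hh3 : ContDiff ℝ 2 h := contDiff_const.add ((K.initDiv3.of_le (by norm_num)).comp
    ((ha4.of_le (by norm_num)).prodMk (hb4.of_le (by norm_num))))
  have hw3 : ContDiff ℝ 2 w := (K.Z4.partialFst (m := 2) (by norm_num)).comp
    (contDiff_id.prodMk (hb4.of_le (by norm_num)))
  have hh0 : h c = 0 := by simp [hh, ha0, hb0, K.gnc.min_value]
  obtain ⟨f1, f2⟩ := deriv_mul_of_double_zero hh3 hw3 hh0 e1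
  have hev : (fun u => partialX (charPos F G Z) (1, u, 0)) =ᶠ[𝓝 c] fun u => h u * w u := by
    have ht : Tendsto (fun u => (u, b u)) (𝓝 c) (𝓝 (c, 0)) :=
      (continuous_id.prodMk hb4.continuous).tendsto' _ _ (by simp [hb0])
    filter_upwards [ht.eventually K.eventually_chart] with u hu
    have := K.charPos_X (t := 1) (u := u) (y := 0) hu
    rw [this, one_mul]
  have g1 : deriv (fun u => partialX (charPos F G Z) (1, u, 0)) =
      fun u => partialX (partialX (charPos F G Z)) (1, u, 0) :=
    funext fun u => (hasDerivAt_partialX K.diffXu 1 u 0).deriv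
  have g2 : deriv (deriv fun u => partialX (charPos F G Z) (1, u, 0)) c =
      partialX (partialX (partialX (charPos F G Z))) (1, c, 0) := by
    rw [g1]; exact (hasDerivAt_partialX K.diffXuu 1 c 0).deriv
  have hZ := K.Z_fst_neg
  have hwc : w c = partialFst Z (c, 0) := by simp [hw, hb0]
  refine ⟨by simp [charPos, K.G_zero, K.F_zero, K.Z_zero], ?_, ?_, ?_, ?_⟩
  · exact hev.self_of_nhds.trans (by simp only [hh0, zero_mul])
  · rw [← congrFun g1 c, hev.deriv_eq, f1]
  · rw [← g2, hev.deriv.deriv_eq, f2, e2, hwc]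
    refine mul_neg_of_pos_of_neg ?_ hZ
    have ha' : deriv a c = partialFst Z (c, 0) + deriv b c * partialSnd Z (c, 0) := by
      have := HasFDerivAt.comp_planeCurve (K.diffZ (c, b c)) (hasDerivAt_id c)
        (hb4.differentiable (by norm_num) c).hasDerivAt
      rw [hb0, one_mul] at this
      exact this.deriv
    rcases eq_or_ne (deriv b c) 0 with h0 | h0
    · rw [ha', h0]
      nlinarith
    · positivity
  · have h1 : (fun t => partialX (charPos F G Z) (t, c, 0)) = fun t =>
        (1 - t) * partialFst Z (c, 0) := funext fun t => by
      have h2 := K.charPos_X (t := t) (u := c) (y := 0) (by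
        simp only [K.G_zero, mul_zero, sub_zero]
        exact K.eventually_chart.self_of_nhds)
      simp only [K.G_zero, mul_zero, sub_zero, K.Z_zero, K.gnc.min_value] at h2
      rw [h2]; ring
    have h3 := hasDerivAt_partialT K.diffXu 1 c 0
    rw [h1] at h3
    have h4 := h3.unique (((hasDerivAt_id (1 : ℝ)).const_sub 1).mul_const (partialFst Z (c, 0)))
    rw [h4]
    linarith

end CharGerm

lemma ContDiffAt.comp_triple {h : ℝ × ℝ × ℝ → ℝ} {n : WithTop ℕ∞} (hh : ContDiff ℝ n h)
    {a b d : ℝ → ℝ} {y : ℝ} (ha : ContDiffAt ℝ n a y) (hb : ContDiffAt ℝ n b y)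
    (hd : ContDiffAt ℝ n d y) : ContDiffAt ℝ n (fun y => h (a y, b y, d y)) y :=
  hh.contDiffAt.comp y (ha.prodMk (hb.prodMk hd))

/-- `T`, `s` parametrise the cusps of `u ↦ X (t, u, y)` near `(1, c, 0)` at the ordinate `y`. -/
structure CuspAt (X : ℝ × ℝ × ℝ → ℝ) (T s : ℝ → ℝ) (y : ℝ) : Prop where
  T3 : ContDiffAt ℝ 3 T y
  s2 : ContDiffAt ℝ 2 s y
  pos3 : ContDiffAt ℝ 3 (fun y => X (T y, s y, y)) y
  X_zero : partialX X (T y, s y, y) = 0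
  XX_zero : partialX (partialX X) (T y, s y, y) = 0
  derivT : deriv T y * partialT (partialX X) (T y, s y, y) = -partialY (partialX X) (T y, s y, y)
  derivX : deriv (fun y => X (T y, s y, y)) y =
    deriv T y * partialT X (T y, s y, y) + partialY X (T y, s y, y)

lemma exists_cusps {X : ℝ × ℝ × ℝ → ℝ} {c : ℝ} (hX : ContDiff ℝ 4 X)
    (h1 : partialX X (1, c, 0) = 0) (h2 : partialX (partialX X) (1, c, 0) = 0)
    (h3 : partialX (partialX (partialX X)) (1, c, 0) ≠ 0)
    (h4 : partialT (partialX X) (1, c, 0) ≠ 0) :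
    ∃ T s : ℝ → ℝ, T 0 = 1 ∧ s 0 = c ∧ ∀ᶠ y in 𝓝 0, CuspAt X T s y := by
  have Xu3 : ContDiff ℝ 3 (partialX X) := hX.partialX (by norm_num)
  have Xuu2 : ContDiff ℝ 2 (partialX (partialX X)) := Xu3.partialX (by norm_num)
  have Xtu2 : ContDiff ℝ 2 (partialT (partialX X)) := Xu3.partialT (by norm_num)
  have Xyu2 : ContDiff ℝ 2 (partialY (partialX X)) := Xu3.partialY (by norm_num)
  have Xt2 : ContDiff ℝ 2 (partialT X) := hX.partialT (by norm_num)
  have Xy2 : ContDiff ℝ 2 (partialY X) := hX.partialY (by norm_num)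
  have dXu : Differentiable ℝ (partialX X) := Xu3.differentiable (by norm_num)
  have dXuu : Differentiable ℝ (partialX (partialX X)) := Xuu2.differentiable (by norm_num)
  have dX : Differentiable ℝ X := hX.differentiable (by norm_num)
  have hΨ : ContDiff ℝ 2 fun p : ℝ × ℝ × ℝ => (partialX X p, partialX (partialX X) p, p.2.2) :=
    (Xu3.of_le (by norm_num)).prodMk (Xuu2.prodMk (by fun_prop))
  obtain ⟨g, hg, hga, -, hgr⟩ := exists_smooth_localInverse (n := 2) (by norm_num)
    (hΨ.contDiffAt (x := (1, c, 0))) (fun v hv => by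
      have hd : HasFDerivAt (fun p : ℝ × ℝ × ℝ => (partialX X p, partialX (partialX X) p, p.2.2))
          _ (1, c, 0) := (dXu _).hasFDerivAt.prodMk ((dXuu _).hasFDerivAt.prodMk
          ((ContinuousLinearMap.snd ℝ ℝ ℝ).comp (ContinuousLinearMap.snd ℝ ℝ (ℝ × ℝ))).hasFDerivAt)
      rw [hd.fderiv] at hv
      have e1 : fderiv ℝ (partialX X) (1, c, 0) v = 0 := congrArg Prod.fst hv
      have e2 : fderiv ℝ (partialX (partialX X)) (1, c, 0) v = 0 :=
        congrArg (fun q : ℝ × ℝ × ℝ => q.2.1) hv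
      have e3 : v.2.2 = 0 := congrArg (fun q : ℝ × ℝ × ℝ => q.2.2) hv
      rw [fderiv_apply_eq_partials, e3, h2, mul_zero, zero_mul, add_zero, add_zero] at e1
      have e4 : v.1 = 0 := (mul_eq_zero.1 e1).resolve_right h4
      rw [fderiv_apply_eq_partials, e3, e4, zero_mul, zero_mul, zero_add, add_zero] at e2
      exact Prod.ext e4 (Prod.ext ((mul_eq_zero.1 e2).resolve_right h3) e3))
  rw [h1, h2] at hg hga hgr
  have hline : ContDiff ℝ 2 fun y : ℝ => ((0, 0, y) : ℝ × ℝ × ℝ) := by fun_prop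
  have hG : ContDiffAt ℝ 2 (fun y : ℝ => g (0, 0, y)) 0 := ContDiffAt.comp (0 : ℝ) hg hline.contDiffAt
  set T : ℝ → ℝ := fun y => (g (0, 0, y)).1 with hT
  set s : ℝ → ℝ := fun y => (g (0, 0, y)).2.1 with hs
  have T2 : ContDiffAt ℝ 2 T 0 := hG.fst
  have s2 : ContDiffAt ℝ 2 s 0 := hG.snd.fst
  have hT0 : T 0 = 1 := by simp [hT, hga]
  have hs0 : s 0 = c := by simp [hs, hga]
  have hroot : ∀ᶠ y in 𝓝 (0 : ℝ), partialX X (T y, s y, y) = 0 ∧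
      partialX (partialX X) (T y, s y, y) = 0 := by
    have ht : Tendsto (fun y : ℝ => ((0, 0, y) : ℝ × ℝ × ℝ)) (𝓝 0) (𝓝 (0, 0, 0)) :=
      hline.continuous.tendsto _
    filter_upwards [ht.eventually hgr] with y hy
    have e1 := (Prod.ext_iff.1 hy).1
    have e2 := (Prod.ext_iff.1 (Prod.ext_iff.1 hy).2).1
    have e3 := (Prod.ext_iff.1 (Prod.ext_iff.1 hy).2).2
    have e : ((T y, s y, y) : ℝ × ℝ × ℝ) = g (0, 0, y) :=
      Prod.ext rfl (Prod.ext rfl e3.symm)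
    rw [e]
    exact ⟨e1, e2⟩
  have hTd : ∀ᶠ y in 𝓝 (0 : ℝ), DifferentiableAt ℝ T y ∧ DifferentiableAt ℝ s y := by
    filter_upwards [T2.eventually (by simp), s2.eventually (by simp)] with y a b
    exact ⟨a.differentiableAt (by norm_num), b.differentiableAt (by norm_num)⟩
  have hTu : ∀ᶠ y in 𝓝 (0 : ℝ), partialT (partialX X) (T y, s y, y) ≠ 0 := by
    have hc : ContinuousAt (fun y => partialT (partialX X) (T y, s y, y)) 0 :=
      (ContDiffAt.comp_triple Xtu2 T2 s2 contDiffAt_id).continuousAt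
    exact hc.eventually_ne (by rw [hT0, hs0]; exact h4)
  have hT' : ∀ᶠ y in 𝓝 (0 : ℝ), deriv T y * partialT (partialX X) (T y, s y, y) =
      -partialY (partialX X) (T y, s y, y) := by
    filter_upwards [hroot.eventually_nhds, hTd] with y hy ⟨dT, ds⟩
    have e1 := HasFDerivAt.comp_curve (dXu (T y, s y, y)) dT.hasDerivAt ds.hasDerivAt
      (hasDerivAt_id y)
    have e2 := e1.unique ((hasDerivAt_const y (0 : ℝ)).congr_of_eventuallyEq
      (hy.mono fun z hz => hz.1))
    simp only [id] at e2
    rw [hy.self_of_nhds.2] at e2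
    linarith
  have T3 : ContDiffAt ℝ 3 T 0 := by
    rw [show (3 : WithTop ℕ∞) = ((2 : ℕ) : WithTop ℕ∞) + 1 by norm_num]
    refine contDiffAt_succ_of_hasDerivAt (f' := fun y => -partialY (partialX X) (T y, s y, y) /
      partialT (partialX X) (T y, s y, y)) ?_ ?_
    · filter_upwards [hT', hTu, hTd] with y a b d
      rw [← a, mul_div_cancel_right₀ _ b]
      exact d.1.hasDerivAt
    · exact (ContDiffAt.comp_triple Xyu2 T2 s2 contDiffAt_id).neg.div
        (ContDiffAt.comp_triple Xtu2 T2 s2 contDiffAt_id) (hTu.self_of_nhds)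
  have hX' : ∀ᶠ y in 𝓝 (0 : ℝ), HasDerivAt (fun y => X (T y, s y, y))
      (deriv T y * partialT X (T y, s y, y) + partialY X (T y, s y, y)) y := by
    filter_upwards [hroot, hTd] with y hy ⟨dT, ds⟩
    have e1 := HasFDerivAt.comp_curve (dX (T y, s y, y)) dT.hasDerivAt ds.hasDerivAt
      (hasDerivAt_id y)
    refine e1.congr_deriv ?_
    simp only [id]
    rw [hy.1]; ring
  have X3 : ContDiffAt ℝ 3 (fun y => X (T y, s y, y)) 0 := by
    rw [show (3 : WithTop ℕ∞) = ((2 : ℕ) : WithTop ℕ∞) + 1 by norm_num]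
    have T2' : ContDiffAt ℝ 2 (deriv T) 0 := 
      (T3.fderiv_right (m := 2) (by norm_num)).clm_apply contDiffAt_const
    exact contDiffAt_succ_of_hasDerivAt hX'
      ((T2'.mul (ContDiffAt.comp_triple Xt2 T2 s2 contDiffAt_id)).add
      (ContDiffAt.comp_triple Xy2 T2 s2 contDiffAt_id))
  refine ⟨T, s, hT0, hs0, ?_⟩
  filter_upwards [T3.eventually (by simp), s2.eventually (by simp), X3.eventually (by simp), hroot,
    hT', hX'] with y a1 a2 a3 a4 a5 a6
  exact ⟨a1, a2, a3, a4.1, a4.2, a5, a6.deriv⟩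

lemma partials_shift {h : ℝ × ℝ × ℝ → ℝ} {a b d : ℝ → ℝ} (hh : ContDiff ℝ 1 h) (ha : ContDiff ℝ 1 a)
    (hb : ContDiff ℝ 1 b) (hd : ContDiff ℝ 1 d) :
    partialX (fun p : ℝ × ℝ × ℝ => h (a p.2.2 + p.1, p.2.1, b p.2.2) - d p.2.2) =
      (fun p => partialX h (a p.2.2 + p.1, p.2.1, b p.2.2)) ∧
    partialT (fun p : ℝ × ℝ × ℝ => h (a p.2.2 + p.1, p.2.1, b p.2.2) - d p.2.2) =
      (fun p => partialT h (a p.2.2 + p.1, p.2.1, b p.2.2)) := by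
  have hD : Differentiable ℝ (fun p : ℝ × ℝ × ℝ => h (a p.2.2 + p.1, p.2.1, b p.2.2) - d p.2.2) := by
    have : ContDiff ℝ 1 (fun p : ℝ × ℝ × ℝ => h (a p.2.2 + p.1, p.2.1, b p.2.2) - d p.2.2) := by
      fun_prop
    exact this.differentiable one_ne_zero
  have hhd : Differentiable ℝ h := hh.differentiable one_ne_zero
  constructor
  · ext ⟨τ, u, y⟩
    exact (hasDerivAt_partialX hD τ u y).unique
      ((hasDerivAt_partialX hhd (a y + τ) u (b y)).sub_const (d y))
  · ext ⟨τ, u, y⟩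
    have h1 : HasDerivAt (fun τ => h (a y + τ, u, b y) - d y) _ τ :=
      ((hasDerivAt_partialT hhd (a y + τ) u (b y)).comp τ
        ((hasDerivAt_id τ).const_add (a y))).sub_const (d y)
    have h2 := (hasDerivAt_partialT hD τ u y).unique h1
    simpa using h2

lemma contDiff_comp_squash {f χ : ℝ → ℝ} {r : ℝ} {n : WithTop ℕ∞} (hχ : ContDiff ℝ n χ)
    (hr : ∀ x, |χ x| < r) (hf : ∀ y, |y| < r → ContDiffAt ℝ n f y) :
    ContDiff ℝ n fun y => f (χ y) :=
  contDiff_iff_contDiffAt.2 fun y => (hf _ (hr y)).comp y hχ.contDiffAt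

/-- The data of the flat cusp near `y = 0`. -/
structure FlatModel (F G : ℝ → ℝ) (X : ℝ × ℝ × ℝ → ℝ) (T s : ℝ → ℝ) (c r : ℝ)
    (D : ℝ × ℝ × ℝ → ℝ) (sh Ah : ℝ → ℝ) (Fh Gh : ℝ × ℝ × ℝ → ℝ) (y : ℝ) : Prop where
  cusp : CuspAt X T s y
  center : sh y = s y
  value : ∀ τ u, D (τ, u, y) = X (T y + τ, u, y) - X (T y, s y, y)
  valueX : ∀ τ u, partialX D (τ, u, y) = partialX X (T y + τ, u, y)
  speed : Ah y = partialT X (T y, s y, y)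
  denom : ∀ a b, |a - c| < r → |b - c| < r → 1 - deriv T y * meanDeriv G (a, b) ≠ 0
  valueF : ∀ a b, |a - c| < r → |b - c| < r → Fh (a, b, y) = (meanDeriv F (a, b) -
    deriv (fun y => X (T y, s y, y)) y * meanDeriv G (a, b)) / (1 - deriv T y * meanDeriv G (a, b))
  valueG : ∀ a b, |a - c| < r → |b - c| < r →
    Gh (a, b, y) = meanDeriv G (a, b) / (1 - deriv T y * meanDeriv G (a, b))

lemma partialT_partialX_of_speed {F G : ℝ → ℝ} {X : ℝ × ℝ × ℝ → ℝ} (hF : ContDiff ℝ 5 F)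
    (hG : ContDiff ℝ 5 G) (hX : ContDiff ℝ 4 X)
    (hXt : ∀ t u y, partialT X (t, u, y) = deriv F u - deriv G u * partialY X (t, u, y))
    (t u y : ℝ) : partialT (partialX X) (t, u, y) = deriv (deriv F) u -
      (deriv (deriv G) u * partialY X (t, u, y) + deriv G u * partialY (partialX X) (t, u, y)) := by
  rw [← partialX_partialT (hX.of_le (by norm_num)), partialY_partialX (hX.of_le (by norm_num))]
  refine (hasDerivAt_partialX ((hX.partialT (m := 3) (by norm_num)).differentiable (by norm_num))
    t u y).unique (((hF.hasDerivAt_deriv u).sub ((hG.hasDerivAt_deriv u).mul (hasDerivAt_partialX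
    ((hX.partialY (m := 3) (by norm_num)).differentiable (by norm_num)) t u y))
    ).congr_of_eventuallyEq (Eventually.of_forall fun u => hXt t u y))

lemma exists_flatCusp {F G : ℝ → ℝ} {X : ℝ × ℝ × ℝ → ℝ} {T s : ℝ → ℝ} {c : ℝ}
    (hF : ContDiff ℝ 5 F) (hG : ContDiff ℝ 5 G) (hX : ContDiff ℝ 4 X)
    (hXt : ∀ t u y, partialT X (t, u, y) = deriv F u - deriv G u * partialY X (t, u, y))
    (hα : 0 < partialT (partialX X) (1, c, 0))
    (hβ : partialX (partialX (partialX X)) (1, c, 0) < 0) (hGc : deriv G c = 0)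
    (hT0 : T 0 = 1) (hs0 : s 0 = c) (hcusp : ∀ᶠ y in 𝓝 0, CuspAt X T s y) :
    ∃ D sh Ah Fh Gh α β e r, FlatCusp D sh Ah Fh Gh α β e ∧ 0 < r ∧
      ∀ y, |y| < r → FlatModel F G X T s c r D sh Ah Fh Gh y := by
  have Xu3 : ContDiff ℝ 3 (partialX X) := hX.partialX (by norm_num)
  have Xt3 : ContDiff ℝ 3 (partialT X) := hX.partialT (by norm_num)
  have Xuu2 : ContDiff ℝ 2 (partialX (partialX X)) := Xu3.partialX (by norm_num)
  have Xtu2 : ContDiff ℝ 2 (partialT (partialX X)) := Xu3.partialT (by norm_num)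
  have Xuuu1 : ContDiff ℝ 1 (partialX (partialX (partialX X))) := Xuu2.partialX (by norm_num)
  have mF : ContDiff ℝ 4 (meanDeriv F) := contDiff_meanDeriv (n := 4) (by norm_num; exact hF)
  have mG : ContDiff ℝ 4 (meanDeriv G) := contDiff_meanDeriv (n := 4) (by norm_num; exact hG)
  set α := partialT (partialX X) (1, c, 0) with hαd
  set β := -partialX (partialX (partialX X)) (1, c, 0) with hβd
  have hβ' : 0 < β := by rw [hβd]; linarith
  have h0 := hcusp.self_of_nhds
  have Tc : ContinuousAt T 0 := h0.T3.continuousAt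
  have sc : ContinuousAt s 0 := h0.s2.continuousAt
  have T'c : ContinuousAt (deriv T) 0 :=
    ((h0.T3.fderiv_right (m := 2) (by norm_num)).clm_apply contDiffAt_const).continuousAt
  have hev : ∀ᶠ q : ℝ × ℝ × ℝ in 𝓝 0,
      |partialT (partialX X) (T q.2.2 + q.1, s q.2.2 + q.2.1, q.2.2) - α| < α / 100 ∧
      |partialX (partialX (partialX X)) (T q.2.2 + q.1, s q.2.2 + q.2.1, q.2.2) + β| < β / 100 ∧
      |deriv T q.2.2 * meanDeriv G (c + q.1, c + q.2.1)| < 1 / 2 ∧ CuspAt X T s q.2.2 := by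
    have c3 : Continuous fun q : ℝ × ℝ × ℝ => q.2.2 := by fun_prop
    have t3 : Tendsto (fun q : ℝ × ℝ × ℝ => q.2.2) (𝓝 0) (𝓝 0) := c3.tendsto' _ _ rfl
    have t1 : Tendsto (fun q : ℝ × ℝ × ℝ => q.1) (𝓝 0) (𝓝 0) := continuous_fst.tendsto' _ _ rfl
    have t2 : Tendsto (fun q : ℝ × ℝ × ℝ => q.2.1) (𝓝 0) (𝓝 0) :=
      (by fun_prop : Continuous fun q : ℝ × ℝ × ℝ => q.2.1).tendsto' _ _ rfl
    have tT := (Tc.tendsto.comp t3).add t1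
    have ts := (sc.tendsto.comp t3).add t2
    rw [hT0, add_zero] at tT
    rw [hs0, add_zero] at ts
    have tp := tT.prodMk_nhds (ts.prodMk_nhds t3)
    have l1 := ((Xtu2.continuous.tendsto _).comp tp).sub_const α |>.abs
    have l2 := ((Xuuu1.continuous.tendsto _).comp tp).add_const β |>.abs
    have l3 := ((T'c.tendsto.comp t3).mul ((mG.continuous.tendsto (c + 0, c + 0)).comp
      ((t1.const_add c).prodMk_nhds (t2.const_add c)))).abs
    rw [add_zero, meanDeriv_self, hGc, mul_zero, abs_zero] at l3
    rw [← hαd, sub_self, abs_zero] at l1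
    rw [hβd, add_neg_cancel, abs_zero] at l2
    filter_upwards [l1.eventually_lt_const (by positivity : 0 < α / 100),
      l2.eventually_lt_const (by positivity : 0 < β / 100),
      l3.eventually_lt_const (by norm_num : (0 : ℝ) < 1 / 2), t3.eventually hcusp] with q a1 a2 a3 a4
    exact ⟨a1, a2, a3, a4⟩
  obtain ⟨r, hr, hev⟩ := Metric.eventually_nhds_iff.1 hev
  have hball : ∀ a b y : ℝ, |a| < r → |b| < r → |y| < r → dist ((a, b, y) : ℝ × ℝ × ℝ) 0 < r :=
    fun a b y h1 h2 h3 => by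
    rw [dist_zero_right, Prod.norm_def, Prod.norm_def]
    exact max_lt h1 (max_lt h2 h3)
  have hcu : ∀ y, |y| < r → CuspAt X T s y := fun y hy =>
    (hev (hball 0 0 y (by simpa) (by simpa) hy)).2.2.2
  have hden : ∀ a b y : ℝ, |a - c| < r → |b - c| < r → |y| < r →
      1 - deriv T y * meanDeriv G (a, b) ≠ 0 := fun a b y h1 h2 h3 h => by
    have := (hev (hball _ _ y h1 h2 h3)).2.2.1
    simp only [add_sub_cancel] at this
    have := (abs_lt.1 this).2
    linarith
  obtain ⟨η, hη, hη1⟩ : ∃ η, 0 < η ∧ ∀ y, |y| < η → |s y - c| < r / 2 := by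
    have := Metric.continuousAt_iff.1 sc (r / 2) (by positivity)
    obtain ⟨η, h1, h2⟩ := this
    refine ⟨η, h1, fun y hy => ?_⟩
    have := h2 (x := y) (by simpa [Real.dist_eq] using hy)
    rwa [Real.dist_eq, hs0] at this
  obtain ⟨χ, χ5, χr, χid⟩ := exists_squash (r := min r η) (by positivity)
  have χ3 : ContDiff ℝ 3 χ := χ5.of_le (by norm_num)
  have χ2 : ContDiff ℝ 2 χ := χ5.of_le (by norm_num)
  have χr' : ∀ y, |χ y| < r := fun y => (χr y).trans_le (min_le_left _ _)
  obtain ⟨ζ₀, ζ5, ζr, ζid⟩ := exists_squash (r := r) hr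
  set ζ : ℝ → ℝ := fun u => c + ζ₀ (u - c) with hζ
  have ζ2 : ContDiff ℝ 2 ζ := by
    have : ContDiff ℝ 2 ζ₀ := ζ5.of_le (by norm_num)
    fun_prop
  have ζr' : ∀ u, |ζ u - c| < r := fun u => by simpa [hζ] using ζr (u - c)
  have ζid' : ∀ u, |u - c| < r / 2 → ζ u = u := fun u hu => by simp [hζ, ζid _ hu]
  have ζs : ∀ y, ζ (s (χ y)) = s (χ y) := fun y =>
    ζid' _ (hη1 _ ((χr y).trans_le (min_le_right _ _)))
  set Xs : ℝ → ℝ := fun y => X (T y, s y, y) with hXs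
  have Tχ3 : ContDiff ℝ 3 fun y => T (χ y) := contDiff_comp_squash χ3 χr' fun y hy => (hcu y hy).T3
  have sχ2 : ContDiff ℝ 2 fun y => s (χ y) := contDiff_comp_squash χ2 χr' fun y hy => (hcu y hy).s2
  have Xχ3 : ContDiff ℝ 3 fun y => Xs (χ y) :=
    contDiff_comp_squash χ3 χr' fun y hy => (hcu y hy).pos3
  have T'χ : ContDiff ℝ 2 fun y => deriv T (χ y) := contDiff_comp_squash χ2 χr' fun y hy =>
    ((hcu y hy).T3.fderiv_right (m := 2) (by norm_num)).clm_apply contDiffAt_const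
  have X'χ : ContDiff ℝ 2 fun y => deriv Xs (χ y) := contDiff_comp_squash χ2 χr' fun y hy =>
    ((hcu y hy).pos3.fderiv_right (m := 2) (by norm_num)).clm_apply contDiffAt_const
  set D : ℝ × ℝ × ℝ → ℝ := fun p => X (T (χ p.2.2) + p.1, p.2.1, χ p.2.2) - Xs (χ p.2.2) with hD
  have Tχ1 : ContDiff ℝ 1 fun y => T (χ y) := Tχ3.of_le (by norm_num)
  have χ1 : ContDiff ℝ 1 χ := χ3.of_le (by norm_num)
  have zero1 : ContDiff ℝ 1 fun _ : ℝ => (0 : ℝ) := contDiff_const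
  have eX : partialX D = fun p => partialX X (T (χ p.2.2) + p.1, p.2.1, χ p.2.2) :=
    (partials_shift (hX.of_le (by norm_num)) Tχ1 χ1 (Xχ3.of_le (by norm_num))).1
  have eT : partialT D = fun p => partialT X (T (χ p.2.2) + p.1, p.2.1, χ p.2.2) :=
    (partials_shift (hX.of_le (by norm_num)) Tχ1 χ1 (Xχ3.of_le (by norm_num))).2
  have shift : ∀ {h : ℝ × ℝ × ℝ → ℝ}, ContDiff ℝ 1 h →
      partialX (fun p : ℝ × ℝ × ℝ => h (T (χ p.2.2) + p.1, p.2.1, χ p.2.2)) =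
        (fun p => partialX h (T (χ p.2.2) + p.1, p.2.1, χ p.2.2)) ∧
      partialT (fun p : ℝ × ℝ × ℝ => h (T (χ p.2.2) + p.1, p.2.1, χ p.2.2)) =
        (fun p => partialT h (T (χ p.2.2) + p.1, p.2.1, χ p.2.2)) := fun {h} hh => by
    have := partials_shift hh Tχ1 χ1 zero1
    simpa only [sub_zero] using this
  have eXX : partialX (partialX D) = fun p =>
      partialX (partialX X) (T (χ p.2.2) + p.1, p.2.1, χ p.2.2) := by
    rw [eX, (shift (Xu3.of_le (by norm_num))).1]
  have eTX : partialT (partialX D) = fun p =>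
      partialT (partialX X) (T (χ p.2.2) + p.1, p.2.1, χ p.2.2) := by
    rw [eX, (shift (Xu3.of_le (by norm_num))).2]
  have eXXX : partialX (partialX (partialX D)) = fun p =>
      partialX (partialX (partialX X)) (T (χ p.2.2) + p.1, p.2.1, χ p.2.2) := by
    rw [eXX, (shift (Xuu2.of_le (by norm_num))).1]
  set Q : ℝ × ℝ × ℝ → ℝ := fun p => 1 - deriv T (χ p.2.2) * meanDeriv G (ζ p.1, ζ p.2.1) with hQ
  have hQ0 : ∀ p, Q p ≠ 0 := fun p => hden _ _ _ (ζr' _) (ζr' _) (χr' _)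
  have mF2 : ContDiff ℝ 2 (meanDeriv F) := mF.of_le (by norm_num)
  have mG2 : ContDiff ℝ 2 (meanDeriv G) := mG.of_le (by norm_num)
  have gζ : ContDiff ℝ 2 fun p : ℝ × ℝ × ℝ => meanDeriv G (ζ p.1, ζ p.2.1) :=
    mG2.comp ((ζ2.comp (by fun_prop)).prodMk (ζ2.comp (by fun_prop)))
  have fζ : ContDiff ℝ 2 fun p : ℝ × ℝ × ℝ => meanDeriv F (ζ p.1, ζ p.2.1) :=
    mF2.comp ((ζ2.comp (by fun_prop)).prodMk (ζ2.comp (by fun_prop)))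
  have hy2 : ∀ {n : WithTop ℕ∞}, ContDiff ℝ n fun p : ℝ × ℝ × ℝ => p.2.2 := by fun_prop
  have hQ2 : ContDiff ℝ 2 Q := contDiff_const.sub ((T'χ.comp hy2).mul gζ)
  have hE3 : ContDiff ℝ 3 fun p : ℝ × ℝ × ℝ =>
      ((T (χ p.2.2) + p.1, p.2.1, χ p.2.2) : ℝ × ℝ × ℝ) :=
    ((Tχ3.comp hy2).add contDiff_fst).prodMk (ContDiff.prodMk (by fun_prop) (χ3.comp hy2))
  set Fh : ℝ × ℝ × ℝ → ℝ := fun p => (meanDeriv F (ζ p.1, ζ p.2.1) -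
    deriv Xs (χ p.2.2) * meanDeriv G (ζ p.1, ζ p.2.1)) / Q p with hFh
  set Gh : ℝ × ℝ × ℝ → ℝ := fun p => meanDeriv G (ζ p.1, ζ p.2.1) / Q p with hGh
  have Fh2 : ContDiff ℝ 2 Fh := by
    exact ContDiff.div (fζ.sub ((X'χ.comp hy2).mul gζ)) hQ2 hQ0
  have Gh2 : ContDiff ℝ 2 Gh := by
    exact ContDiff.div gζ hQ2 hQ0
  have hdiag : ∀ y, Fh (s (χ y), s (χ y), y) = partialT X (T (χ y), s (χ y), χ y) := fun y => by
    have hy := hcu _ (χr' y)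
    have hq := hQ0 (s (χ y), s (χ y), y)
    simp only [hFh]
    rw [div_eq_iff hq]
    simp only [hQ, ζs, meanDeriv_self]
    rw [hy.derivX, hXt]
    ring
  refine ⟨D, fun y => s (χ y), fun y => partialT X (T (χ y), s (χ y), χ y), Fh, Gh, α, β, r / 2,
    min (r / 2) (η / 2), ?_, by positivity, fun y hy => ?_⟩
  · exact {
      D3 := (((hX.of_le (by norm_num) : ContDiff ℝ 3 X).comp hE3)).sub (Xχ3.comp hy2)
      Du3 := by rw [eX]; exact Xu3.comp hE3
      s1 := sχ2.of_le (by norm_num)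
      A2 := (Xt3.of_le (by norm_num) : ContDiff ℝ 2 (partialT X)).comp
        ((Tχ3.of_le (by norm_num)).prodMk (sχ2.prodMk χ2))
      Fh2 := Fh2
      Gh2 := Gh2
      Fsymm := fun a b y => by
        simp only [hFh, hQ]
        rw [meanDeriv_swap F, meanDeriv_swap G]
      zero := fun y => by simp [hD, hXs]
      zeroX := fun y => by rw [eX]; simpa using (hcu _ (χr' y)).X_zero
      zeroXX := fun y => by rw [eXX]; simpa using (hcu _ (χr' y)).XX_zero
      slope := fun y => by rw [eT]; simp
      Fdiag := hdiag
      Fdiag' := fun y => by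
        have hy := hcu _ (χr' y)
        have hFd : Differentiable ℝ Fh := Fh2.differentiable (by norm_num)
        have h1 := HasFDerivAt.comp_curve (hFd (s (χ y), s (χ y), y)) (hasDerivAt_id (s (χ y)))
          (hasDerivAt_id (s (χ y))) (hasDerivAt_const (s (χ y)) y)
        have hq := hQ0 (s (χ y), s (χ y), y)
        simp only [hQ, ζs, meanDeriv_self] at hq
        have h2 := ((hF.hasDerivAt_deriv (s (χ y))).sub
          ((hG.hasDerivAt_deriv (s (χ y))).const_mul (deriv Xs (χ y)))).div
          (((hG.hasDerivAt_deriv (s (χ y))).const_mul (deriv T (χ y))).const_sub 1) hq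
        have h3 := h1.unique (h2.congr_of_eventuallyEq (by
          have : ∀ᶠ u in 𝓝 (s (χ y)), |u - c| < r / 2 :=
            (by fun_prop : Continuous fun u => |u - c|).continuousAt.eventually
              (gt_mem_nhds (hη1 _ ((χr y).trans_le (min_le_right _ _))))
          filter_upwards [this] with u hu
          simp [hFh, hQ, ζid' _ hu, meanDeriv_self]))
        simp only [id, one_mul, zero_mul, add_zero, Pi.sub_apply] at h3
        rw [h3, eTX]
        simp only [add_zero]
        have k1 := partialT_partialX_of_speed hF hG hX hXt (T (χ y)) (s (χ y)) (χ y)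
        have k2 := hy.derivT
        have k3 : deriv Xs (χ y) = _ := hy.derivX
        have k4 := hXt (T (χ y)) (s (χ y)) (χ y)
        rw [div_eq_iff (pow_ne_zero 2 hq), k3]
        generalize partialT (partialX X) (T (χ y), s (χ y), χ y) = a at *
        generalize partialY (partialX X) (T (χ y), s (χ y), χ y) = b at *
        generalize partialT X (T (χ y), s (χ y), χ y) = A at *
        generalize partialY X (T (χ y), s (χ y), χ y) = B at *
        generalize deriv T (χ y) = T' at *
        generalize deriv G (s (χ y)) = g at *
        generalize deriv F (s (χ y)) = f at *
        generalize deriv (deriv G) (s (χ y)) = g' at *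
        generalize deriv (deriv F) (s (χ y)) = f' at *
        linear_combination (-T' * g') * k4 - (1 - T' * g) * k1 + (1 - T' * g) * g * k2
      α_pos := hα
      β_pos := hβ'
      e_pos := by positivity
      boundTX := fun τ u y hτ hu => by
        rw [eTX]
        have := (hev (hball τ (u - s (χ y)) (χ y) (by linarith) (by linarith) (χr' y))).1
        simp only [add_sub_cancel] at this
        exact this.le
      boundXXX := fun τ u y hτ hu => by
        rw [eXXX]
        have := (hev (hball τ (u - s (χ y)) (χ y) (by linarith) (by linarith) (χr' y))).2.1
        simp only [add_sub_cancel] at this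
        exact this.le }
  · have hy1 : |y| < r / 2 := hy.trans_le (min_le_left _ _)
    have hχ : χ y = y := χid y (hy.trans_le (by
      rw [min_div_div_right (by norm_num)]))
    have hζ' : ∀ a, |a - c| < min (r / 2) (η / 2) → ζ a = a := fun a ha =>
      ζid' a (ha.trans_le (min_le_left _ _))
    have hsz : ∀ a, |a - c| < min (r / 2) (η / 2) → |a - c| < r := fun a ha => by
      have := ha.trans_le (min_le_left _ _); linarith
    exact {
      cusp := hcu y (by linarith)
      center := by rw [hχ]
      value := fun τ u => by simp only [hD, hχ, hXs]
      valueX := fun τ u => by rw [eX]; simp only [hχ]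
      speed := by rw [hχ]
      denom := fun a b ha hb => hden a b y (hsz a ha) (hsz b hb) (by linarith)
      valueF := fun a b ha hb => by simp only [hFh, hQ, hχ, hζ' a ha, hζ' b hb, hXs]
      valueG := fun a b ha hb => by simp only [hGh, hQ, hχ, hζ' a ha, hζ' b hb] }

/-- The chart `(u, η) ↦ (Z (u, η), η)` and its first derivatives are valid at `q = (u, η)`. -/
def ChartValid (u₀ Z : ℝ × ℝ → ℝ) (q : ℝ × ℝ) : Prop :=
  u₀ (Z q, q.2) = q.1 ∧ partialFst u₀ (Z q, q.2) < 0 ∧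
    partialFst Z q * partialFst u₀ (Z q, q.2) = 1 ∧
    partialSnd Z q * partialFst u₀ (Z q, q.2) + partialSnd u₀ (Z q, q.2) = 0

/-- Charts, cusps and shock near a generic blowup point, with all sizes fixed. -/
structure ShockConfig (F G : ℝ → ℝ) (u₀ : ℝ × ℝ → ℝ) where
  (Z : ℝ × ℝ → ℝ) (c : ℝ) (T s : ℝ → ℝ) (D : ℝ × ℝ × ℝ → ℝ) (sh Ah : ℝ → ℝ)
  (Fh Gh : ℝ × ℝ × ℝ → ℝ) (α β e m τ₁ : ℝ) (k up um : ℝ × ℝ → ℝ) (ϱ ρ r δ₀ ε₀ : ℝ)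
  germ : CharGerm F G u₀ Z c
  flat : FlatCusp D sh Ah Fh Gh α β e
  shock : FlatShock D sh Ah Fh Gh (α / β) e τ₁ k up um
  model : ∀ y, |y| < δ₀ → FlatModel F G (charPos F G Z) T s c m D sh Ah Fh Gh y
  T_zero : T 0 = 1
  s_zero : s 0 = c
  ϱ_pos : 0 < ϱ
  ρ_pos : 0 < ρ
  r_pos : 0 < r
  δ₀_pos : 0 < δ₀
  ε₀_pos : 0 < ε₀
  δ₀_le_r : δ₀ ≤ r
  ϱ_le_m : ϱ ≤ m
  ϱ_le_e : 2 * ϱ ≤ e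
  δ₀_le_one : δ₀ ≤ 1
  ε₀_le_half : ε₀ ≤ 1 / 2
  ε₀_le_τ₁ : ε₀ ≤ τ₁
  ε₀_le_e : ε₀ ≤ e / 2
  ends : 4 * (α / β) * ε₀ ≤ (ϱ / 2) ^ 2
  T_close : ∀ y, |y| < δ₀ → |T y - 1| < 1 / 2 ∧ |T y - 1| < e / 2
  s_close : ∀ y, |y| < δ₀ → |s y - c| < ϱ / 2
  sides : ∀ t y, |y| < δ₀ → 0 ≤ t → t < T y + ε₀ →
    charPos F G Z (t, c + ϱ, y) < -r ∧ r < charPos F G Z (t, c - ϱ, y)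
  chart : ∀ t u y, 0 ≤ t → t ≤ 2 → |u - c| ≤ ϱ → |y| < δ₀ →
    ChartValid u₀ Z (u, y - t * deriv G u) ∧ |Z (u, y - t * deriv G u)| < ρ ∧
      |y - t * deriv G u| < ρ
  foot : ∀ ξ η, |ξ| < ρ → |η| < ρ → Z (u₀ (ξ, η), η) = ξ ∧ |u₀ (ξ, η) - c| < e / 2 ∧
    ChartValid u₀ Z (u₀ (ξ, η), η)
  init : ∀ x y, |x| < r → |y| < δ₀ → |u₀ (x, y) - c| < ϱ ∧ Z (u₀ (x, y), y) = x
  spacelike : ∀ y, |y| < δ₀ → deriv T y * deriv G (s y) < 1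
  secondF : ∀ u, |u - c| ≤ ϱ → 0 < deriv (deriv F) u
  phi_lt : ∀ t y, |y| < δ₀ → T y ≤ t → t < T y + ε₀ →
    |charPos F G Z (T y, s y, y) + k (t - T y, y)| < r
  convex : ∀ τ y u, |y| < δ₀ → 0 < τ → τ < ε₀ → |u - c| ≤ ϱ →
    0 < deriv (deriv F) u - (deriv (fun y => charPos F G Z (T y, s y, y)) y -
      deriv T y * partialFst k (τ, y) + partialSnd k (τ, y)) * deriv (deriv G) u

lemma ContDiffAt.continuousAt_deriv_one {f : ℝ → ℝ} {y : ℝ} {n : WithTop ℕ∞}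
    (hf : ContDiffAt ℝ n f y) (hn : n ≠ 0) : ContinuousAt (deriv f) y :=
  (hf.continuousAt_fderiv hn).clm_apply continuousAt_const

namespace ShockConfig

variable {F G : ℝ → ℝ} {u₀ : ℝ × ℝ → ℝ} (Q : ShockConfig F G u₀)

/-- Positions of characteristics, of the blowup curve and of the shock. -/
def X : ℝ × ℝ × ℝ → ℝ := charPos F G Q.Z

def pos (y : ℝ) : ℝ := Q.X (Q.T y, Q.s y, y)

def phi (q : ℝ × ℝ) : ℝ := Q.pos q.2 + Q.k (q.1 - Q.T q.2, q.2)

/-- The branch condition on the value `u` at the point `p = (t, x, y)`. -/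
def Adm (p : ℝ × ℝ × ℝ) (u : ℝ) : Prop :=
  |u - Q.c| < Q.ϱ ∧ (Q.T p.2.2 ≤ p.1 → ∀ σ : ℝ, σ = 1 ∨ σ = -1 →
    0 < σ * (Q.phi (p.1, p.2.2) - p.2.1) →
      IsOuter Q.sh (Q.α / Q.β) Q.e σ (p.1 - Q.T p.2.2) p.2.2 u)

/-- Points of the largest domain, off the shock. -/
def Reg (p : ℝ × ℝ × ℝ) : Prop :=
  0 ≤ p.1 ∧ p.1 < Q.T p.2.2 + Q.ε₀ ∧ |p.2.1| < Q.r ∧ |p.2.2| < Q.δ₀ ∧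
    (Q.T p.2.2 ≤ p.1 → p.2.1 ≠ Q.phi (p.1, p.2.2))

open Classical in
/-- The solution. -/
def val (p : ℝ × ℝ × ℝ) : ℝ :=
  if h : ∃ u, Q.Adm p u ∧ Q.X (p.1, u, p.2.2) = p.2.1 then h.choose else Q.c

lemma diffX : Differentiable ℝ Q.X := Q.germ.diffX

lemma contX : Continuous Q.X := Q.diffX.continuous

lemma X_eq {y : ℝ} (hy : |y| < Q.δ₀) (t u : ℝ) :
    Q.X (t, u, y) = Q.D (t - Q.T y, u, y) + Q.pos y := by
  rw [(Q.model y hy).value, add_sub_cancel]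
  exact (sub_add_cancel _ _).symm

lemma Xu_eq {y : ℝ} (hy : |y| < Q.δ₀) (t u : ℝ) :
    partialX Q.X (t, u, y) = partialX Q.D (t - Q.T y, u, y) := by
  rw [(Q.model y hy).valueX, add_sub_cancel]; rfl

lemma near {y u : ℝ} (hy : |y| < Q.δ₀) (hu : |u - Q.c| ≤ Q.ϱ) : |u - Q.sh y| < Q.e := by
  rw [(Q.model y hy).center]
  have h1 := Q.s_close y hy
  have h2 := abs_sub_le u Q.c (Q.s y)
  rw [abs_sub_comm Q.c] at h2
  have := Q.ϱ_le_e
  have := Q.ϱ_pos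
  linarith

lemma T_mem {y : ℝ} (hy : |y| < Q.δ₀) : 1 / 2 < Q.T y ∧ Q.T y < 3 / 2 := by
  have := abs_lt.1 (Q.T_close y hy).1
  constructor <;> linarith [this.1, this.2]

lemma phi_base {y : ℝ} (hy : |y| < Q.δ₀) : Q.phi (Q.T y, y) = Q.pos y := by
  simp [phi, Q.shock.zero y (hy.trans_le Q.δ₀_le_one)]

lemma Xu_neg_early {t y u : ℝ} (hy : |y| < Q.δ₀) (h0 : 0 ≤ t) (ht : t < Q.T y)
    (hu : |u - Q.c| ≤ Q.ϱ) : partialX Q.X (t, u, y) < 0 := by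
  obtain ⟨hT1, hT2⟩ := Q.T_mem hy
  rcases lt_or_ge t 1 with h1 | h1
  · obtain ⟨hc, -, -⟩ := Q.chart t u y h0 (by linarith) hu hy
    rw [X, Q.germ.charPos_X hc]
    have h2 := Q.germ.initDiv_ge (Q.Z (u, y - t * deriv G u), y - t * deriv G u)
    obtain ⟨-, h3, h4, -⟩ := hc
    refine mul_neg_of_pos_of_neg (by nlinarith) ?_
    by_contra hcon
    nlinarith
  · rw [Q.Xu_eq hy]
    have h2 := (abs_lt.1 (Q.T_close y hy).2).2
    have hγ := Q.flat.γ_pos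
    exact Q.flat.X_neg (by rw [abs_of_neg (by linarith)]; linarith) (Q.near hy hu).le
      (by nlinarith [sq_nonneg (u - Q.sh y)]) (Or.inl (by linarith))

lemma outer_X_neg {σ t y u : ℝ} (hy : |y| < Q.δ₀) (h0 : Q.T y ≤ t) (ht : t < Q.T y + Q.ε₀)
    (ho : IsOuter Q.sh (Q.α / Q.β) Q.e σ (t - Q.T y) y u) : partialX Q.X (t, u, y) < 0 := by
  rw [Q.Xu_eq hy]
  have := Q.ε₀_le_e
  have := Q.flat.e_pos
  exact Q.flat.outer_X_neg (by rw [abs_of_nonneg (by linarith)]; linarith) ho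

/-- Two outer points with the same position coincide. -/
lemma outer_inj {σ t y u u' : ℝ} (hy : |y| < Q.δ₀) (h0 : Q.T y ≤ t) (ht : t < Q.T y + Q.ε₀)
    (ho : IsOuter Q.sh (Q.α / Q.β) Q.e σ (t - Q.T y) y u)
    (ho' : IsOuter Q.sh (Q.α / Q.β) Q.e σ (t - Q.T y) y u')
    (h : u < u') : Q.X (t, u', y) < Q.X (t, u, y) := by
  obtain ⟨v, hv, e⟩ := exists_hasDerivAt_eq_slope (fun u => Q.X (t, u, y))
    (fun u => partialX Q.X (t, u, y)) h (by have := Q.contX; fun_prop)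
    (fun v _ => hasDerivAt_partialX Q.diffX t v y)
  have hneg := Q.outer_X_neg hy h0 ht (isOuter_between ho ho' (c := v)
    (by rw [uIcc_of_le h.le]; exact ⟨hv.1.le, hv.2.le⟩))
  rw [e, div_neg_iff] at hneg
  rcases hneg with h1 | h1 <;> linarith [h1.1, h1.2]

lemma end_outer {σ t y : ℝ} (hσ : σ = 1 ∨ σ = -1) (hy : |y| < Q.δ₀) (ht : t < Q.T y + Q.ε₀) :
    IsOuter Q.sh (Q.α / Q.β) Q.e σ (t - Q.T y) y (Q.c + σ * Q.ϱ) := by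
  have h1 := abs_lt.1 (Q.s_close y hy)
  have hϱ := Q.ϱ_pos
  have hσ2 : |σ| = 1 := by rcases hσ with rfl | rfl <;> simp
  have hσ3 : σ * σ = 1 := by rcases hσ with rfl | rfl <;> norm_num
  have h2 := Q.near hy (u := Q.c + σ * Q.ϱ) (by
    rw [add_sub_cancel_left, abs_mul, hσ2, one_mul, abs_of_pos hϱ])
  have h3 : Q.ϱ / 2 < σ * (Q.c + σ * Q.ϱ - Q.sh y) := by
    rw [(Q.model y hy).center]
    rcases hσ with rfl | rfl <;> linarith [h1.1, h1.2]
  refine ⟨by linarith, h2, ?_⟩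
  have h4 : (Q.c + σ * Q.ϱ - Q.sh y) ^ 2 = (σ * (Q.c + σ * Q.ϱ - Q.sh y)) ^ 2 := by
    rw [mul_pow, pow_two σ, hσ3, one_mul]
  have hγ := Q.flat.γ_pos
  have h5 := Q.ends
  rw [h4]
  have h6 : 4 * (Q.α / Q.β) * (t - Q.T y) < 4 * (Q.α / Q.β) * Q.ε₀ :=
    mul_lt_mul_of_pos_left (by linarith) (by positivity)
  nlinarith

/-- The state next to the shock on the side `σ`. -/
lemma exists_edge {σ t y : ℝ} (hσ : σ = 1 ∨ σ = -1) (hy : |y| < Q.δ₀) (h0 : Q.T y < t)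
    (ht : t < Q.T y + Q.ε₀) : ∃ a, IsOuter Q.sh (Q.α / Q.β) Q.e σ (t - Q.T y) y a ∧
      Q.X (t, a, y) = Q.phi (t, y) ∧ |a - Q.c| < Q.ϱ ∧
      (σ = 1 → a = Q.up (t - Q.T y, y)) ∧ (σ = -1 → a = Q.um (t - Q.T y, y)) := by
  have hτ : 0 < t - Q.T y := by linarith
  have hτ₁ : t - Q.T y < Q.τ₁ := by have := Q.ε₀_le_τ₁; linarith
  have hy1 := hy.trans_le Q.δ₀_le_one
  obtain ⟨a, ha, hk, h5, h6⟩ : ∃ a, IsOuter Q.sh (Q.α / Q.β) Q.e σ (t - Q.T y) y a ∧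
      Q.D (t - Q.T y, a, y) = Q.k (t - Q.T y, y) ∧ (σ = 1 → a = Q.up (t - Q.T y, y)) ∧
      (σ = -1 → a = Q.um (t - Q.T y, y)) := by
    rcases hσ with rfl | rfl
    · obtain ⟨h1, h2⟩ := Q.shock.upper (t - Q.T y, y) hτ hτ₁ hy1
      exact ⟨_, h1, h2, fun _ => rfl, fun h => by norm_num at h⟩
    · obtain ⟨h1, h2⟩ := Q.shock.lower (t - Q.T y, y) hτ hτ₁ hy1
      exact ⟨_, h1, h2, fun h => by norm_num at h, fun _ => rfl⟩
  have hX : Q.X (t, a, y) = Q.phi (t, y) := by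
    rw [Q.X_eq hy, hk, phi, add_comm]
  refine ⟨a, ha, hX, ?_, h5, h6⟩
  have hend := Q.end_outer hσ hy ht
  have hphi := abs_lt.1 (Q.phi_lt t y hy h0.le ht)
  have hs := abs_lt.1 (Q.s_close y hy)
  have ha1 := ha.1
  rw [(Q.model y hy).center] at ha1
  have hT := Q.T_mem hy
  have hsd := Q.sides t y hy (by linarith) ht
  have hϱ := Q.ϱ_pos
  have hXe : -Q.r < Q.X (t, a, y) ∧ Q.X (t, a, y) < Q.r := by rw [hX]; exact hphi
  rw [abs_lt]
  rcases hσ with rfl | rfl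
  · refine ⟨by linarith, ?_⟩
    by_contra hcon
    rcases (not_lt.1 hcon).eq_or_lt with h | h
    · have : a = Q.c + Q.ϱ := by linarith
      rw [this] at hXe
      exact absurd hsd.1 (not_lt.2 hXe.1.le)
    · have := Q.outer_inj hy h0.le ht hend ha (by linarith)
      rw [one_mul] at this
      have h7 : Q.X (t, Q.c + Q.ϱ, y) < -Q.r := hsd.1
      linarith
  · refine ⟨?_, by linarith⟩
    by_contra hcon
    rcases (not_lt.1 hcon).eq_or_lt with h | h
    · have : a = Q.c - Q.ϱ := by linarith
      rw [this] at hXe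
      exact absurd hsd.2 (not_lt.2 hXe.2.le)
    · have := Q.outer_inj hy h0.le ht ha hend (by linarith)
      rw [neg_one_mul, ← sub_eq_add_neg] at this
      have h7 : Q.r < Q.X (t, Q.c - Q.ϱ, y) := hsd.2
      linarith

lemma exists_root_late {σ t x y : ℝ} (hσ : σ = 1 ∨ σ = -1) (hy : |y| < Q.δ₀) (h0 : Q.T y ≤ t)
    (ht : t < Q.T y + Q.ε₀) (hx : |x| < Q.r) (hs : 0 < σ * (Q.phi (t, y) - x)) :
    ∃ u, |u - Q.c| < Q.ϱ ∧ IsOuter Q.sh (Q.α / Q.β) Q.e σ (t - Q.T y) y u ∧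
      Q.X (t, u, y) = x := by
  have hend := Q.end_outer hσ hy ht
  have hϱ := Q.ϱ_pos
  have hT := Q.T_mem hy
  have hsd := Q.sides t y hy (by linarith) ht
  obtain ⟨a, ha, haX, hout⟩ : ∃ a, |a - Q.c| < Q.ϱ ∧ Q.X (t, a, y) = Q.phi (t, y) ∧
      ∀ u ∈ uIcc a (Q.c + σ * Q.ϱ), u ≠ a → IsOuter Q.sh (Q.α / Q.β) Q.e σ (t - Q.T y) y u := by
    rcases h0.eq_or_lt with h | h
    · refine ⟨Q.s y, (Q.s_close y hy).trans (by linarith), ?_, fun u hu hne => ?_⟩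
      · rw [← h, Q.phi_base hy]; rfl
      · have hc := (Q.model y hy).center
        have h3 := Q.s_close y hy
        rw [abs_lt] at h3
        have h4 : |u - Q.c| ≤ Q.ϱ := by
          rw [abs_le]
          rcases hσ with rfl | rfl
          · rw [uIcc_of_le (by linarith)] at hu
            constructor <;> linarith [hu.1, hu.2]
          · rw [uIcc_of_ge (by linarith)] at hu
            constructor <;> linarith [hu.1, hu.2]
        have h5 : 0 < σ * (u - Q.sh y) := by
          rw [hc]
          rcases hσ with rfl | rfl
          · rw [uIcc_of_le (by linarith)] at hu
            have := lt_of_le_of_ne hu.1 (Ne.symm hne)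
            linarith
          · rw [uIcc_of_ge (by linarith)] at hu
            have := lt_of_le_of_ne hu.2 hne
            linarith
        refine ⟨h5, Q.near hy h4, ?_⟩
        rw [h, sub_self, mul_zero]
        have : u - Q.sh y ≠ 0 := fun h => by rw [h, mul_zero] at h5; exact lt_irrefl _ h5
        positivity
    · obtain ⟨a, h1, h2, h3, -⟩ := Q.exists_edge hσ hy h ht
      exact ⟨a, h3, h2, fun u hu _ => isOuter_between h1 hend hu⟩
  have hx' := abs_lt.1 hx
  have hmem : x ∈ uIcc (Q.X (t, a, y)) (Q.X (t, Q.c + σ * Q.ϱ, y)) := by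
    rw [haX]
    have h7 : Q.X (t, Q.c + Q.ϱ, y) < -Q.r := hsd.1
    have h8 : Q.r < Q.X (t, Q.c - Q.ϱ, y) := hsd.2
    rcases hσ with rfl | rfl
    · rw [one_mul, uIcc_of_ge (by linarith)]
      constructor <;> linarith
    · rw [neg_one_mul, ← sub_eq_add_neg, uIcc_of_le (by linarith)]
      constructor <;> linarith
  obtain ⟨u, hu, hux⟩ := intermediate_value_uIcc (f := fun u => Q.X (t, u, y))
    (by have := Q.contX; fun_prop) hmem
  simp only at hux
  have hne : u ≠ a := by
    rintro rfl
    rw [← hux, haX, sub_self, mul_zero] at hs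
    exact lt_irrefl _ hs
  refine ⟨u, ?_, hout u hu hne, hux⟩
  have h9 : u ≠ Q.c + σ * Q.ϱ := by
    rintro rfl
    have h7 : Q.X (t, Q.c + Q.ϱ, y) < -Q.r := hsd.1
    have h8 : Q.r < Q.X (t, Q.c - Q.ϱ, y) := hsd.2
    rcases hσ with rfl | rfl
    · rw [one_mul] at hux; linarith
    · rw [neg_one_mul, ← sub_eq_add_neg] at hux; linarith
  rw [abs_lt] at ha ⊢
  rcases hσ with rfl | rfl
  · rw [uIcc_of_le (by linarith)] at hu
    have := lt_of_le_of_ne hu.2 h9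
    constructor <;> linarith [hu.1]
  · rw [uIcc_of_ge (by linarith)] at hu
    have := lt_of_le_of_ne hu.1 (Ne.symm h9)
    constructor <;> linarith [hu.2]

lemma early_strictAnti {t y : ℝ} (hy : |y| < Q.δ₀) (h0 : 0 ≤ t) (ht : t < Q.T y) :
    StrictAntiOn (fun u => Q.X (t, u, y)) (Icc (Q.c - Q.ϱ) (Q.c + Q.ϱ)) := by
  refine strictAntiOn_of_deriv_neg (convex_Icc _ _) (by have := Q.contX; fun_prop) fun u hu => ?_
  rw [interior_Icc] at hu
  rw [(hasDerivAt_partialX Q.diffX t u y).deriv]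
  exact Q.Xu_neg_early hy h0 ht (abs_le.2 ⟨by linarith [hu.1], by linarith [hu.2]⟩)

lemma exists_root_early {t x y : ℝ} (hy : |y| < Q.δ₀) (h0 : 0 ≤ t) (ht : t < Q.T y)
    (hx : |x| < Q.r) : ∃ u, |u - Q.c| < Q.ϱ ∧ Q.X (t, u, y) = x := by
  have hϱ := Q.ϱ_pos
  have hε := Q.ε₀_pos
  obtain ⟨h7, h8⟩ := Q.sides t y hy h0 (by linarith)
  have h7 : Q.X (t, Q.c + Q.ϱ, y) < -Q.r := h7
  have h8 : Q.r < Q.X (t, Q.c - Q.ϱ, y) := h8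
  have hx' := abs_lt.1 hx
  obtain ⟨u, hu, hux⟩ := intermediate_value_Ioo' (f := fun u => Q.X (t, u, y))
    (by linarith : Q.c - Q.ϱ ≤ Q.c + Q.ϱ) (by have := Q.contX; fun_prop)
    (show x ∈ _ from ⟨by linarith, by linarith⟩)
  exact ⟨u, abs_lt.2 ⟨by linarith [hu.1], by linarith [hu.2]⟩, hux⟩

variable {Q} {p : ℝ × ℝ × ℝ}

lemma Reg.side (hp : Q.Reg p) (h : Q.T p.2.2 ≤ p.1) :
    ∃ σ : ℝ, (σ = 1 ∨ σ = -1) ∧ 0 < σ * (Q.phi (p.1, p.2.2) - p.2.1) := by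
  rcases lt_or_gt_of_ne (hp.2.2.2.2 h) with h1 | h1
  · exact ⟨1, Or.inl rfl, by linarith⟩
  · exact ⟨-1, Or.inr rfl, by linarith⟩

lemma Reg.exists_root (hp : Q.Reg p) : ∃ u, Q.Adm p u ∧ Q.X (p.1, u, p.2.2) = p.2.1 := by
  obtain ⟨h0, h1, h2, h3, h4⟩ := id hp
  rcases lt_or_ge p.1 (Q.T p.2.2) with h | h
  · obtain ⟨u, a, b⟩ := Q.exists_root_early h3 h0 h h2
    exact ⟨u, ⟨a, fun h' => absurd h (not_lt.2 h')⟩, b⟩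
  · obtain ⟨σ, hσ, hs⟩ := hp.side h
    obtain ⟨u, a, b, d⟩ := Q.exists_root_late hσ h3 h h1 h2 hs
    refine ⟨u, ⟨a, fun _ σ' hσ' hs' => ?_⟩, d⟩
    have : σ' = σ := by
      rcases hσ with rfl | rfl <;> rcases hσ' with rfl | rfl <;> first | rfl | (exfalso; linarith)
    rwa [this]

lemma Reg.val_spec (hp : Q.Reg p) : Q.Adm p (Q.val p) ∧ Q.X (p.1, Q.val p, p.2.2) = p.2.1 := by
  have h := hp.exists_root
  rw [val, dif_pos h]
  exact h.choose_spec

lemma Reg.unique (hp : Q.Reg p) {u u' : ℝ} (hu : Q.Adm p u) (hu' : Q.Adm p u')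
    (e : Q.X (p.1, u, p.2.2) = p.2.1) (e' : Q.X (p.1, u', p.2.2) = p.2.1) : u = u' := by
  obtain ⟨h0, h1, h2, h3, h4⟩ := id hp
  rcases lt_or_ge p.1 (Q.T p.2.2) with h | h
  · have a := abs_lt.1 hu.1
    have a' := abs_lt.1 hu'.1
    exact (Q.early_strictAnti h3 h0 h).injOn ⟨by linarith, by linarith⟩ ⟨by linarith, by linarith⟩
      (e.trans e'.symm)
  · obtain ⟨σ, hσ, hs⟩ := hp.side h
    have o := hu.2 h σ hσ hs
    have o' := hu'.2 h σ hσ hs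
    by_contra hne
    rcases lt_or_gt_of_ne hne with hl | hl
    · have := Q.outer_inj h3 h h1 o o' hl; linarith
    · have := Q.outer_inj h3 h h1 o' o hl; linarith

lemma Reg.gap (hp : Q.Reg p) {u : ℝ} (hu : Q.Adm p u) :
    4 * (Q.α / Q.β) * (p.1 - Q.T p.2.2) ≤ (u - Q.sh p.2.2) ^ 2 := by
  have hγ := Q.flat.γ_pos
  rcases lt_or_ge p.1 (Q.T p.2.2) with h | h
  · nlinarith [sq_nonneg (u - Q.sh p.2.2)]
  · obtain ⟨σ, hσ, hs⟩ := hp.side h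
    exact (hu.2 h σ hσ hs).2.2.le

lemma Reg.Xu_neg (hp : Q.Reg p) {u : ℝ} (hu : Q.Adm p u) : partialX Q.X (p.1, u, p.2.2) < 0 := by
  obtain ⟨h0, h1, h2, h3, h4⟩ := id hp
  rcases lt_or_ge p.1 (Q.T p.2.2) with h | h
  · exact Q.Xu_neg_early h3 h0 h hu.1.le
  · obtain ⟨σ, hσ, hs⟩ := hp.side h
    exact Q.outer_X_neg h3 h h1 (hu.2 h σ hσ hs)

variable (Q)

lemma diffT {y : ℝ} (hy : |y| < Q.δ₀) : DifferentiableAt ℝ Q.T y :=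
  (Q.model y hy).cusp.T3.differentiableAt (by norm_num)

lemma contT {y : ℝ} (hy : |y| < Q.δ₀) : ContinuousAt Q.T y := (Q.diffT hy).continuousAt

lemma contT_comp {E : Type*} [TopologicalSpace E] {f : E → ℝ} {x : E} (hy : |f x| < Q.δ₀)
    (hf : ContinuousAt f x) : ContinuousAt (fun z => Q.T (f z)) x := (Q.contT hy).comp hf

lemma eventually_early {p₀ : ℝ × ℝ × ℝ} {a : ℝ} (hy : |p₀.2.2| < Q.δ₀)
    (ht : p₀.1 < Q.T p₀.2.2 + a) :
    ∀ᶠ p in 𝓝 p₀, |p.2.2| < Q.δ₀ ∧ p.1 < Q.T p.2.2 + a :=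
  (ContinuousAt.eventually_lt (f := fun p : ℝ × ℝ × ℝ => |p.2.2|) (by fun_prop) continuousAt_const
    hy).and (ContinuousAt.eventually_lt (f := fun p : ℝ × ℝ × ℝ => p.1) (by fun_prop)
    ((Q.contT_comp (f := fun p : ℝ × ℝ × ℝ => p.2.2) hy (by fun_prop)).add continuousAt_const) ht)

lemma diff_pos {y : ℝ} (hy : |y| < Q.δ₀) : DifferentiableAt ℝ Q.pos y :=
  (Q.model y hy).cusp.pos3.differentiableAt (by norm_num)

lemma contDiffOn_phi : ContDiffOn ℝ 2 Q.phi (shockParam Q.T Q.ε₀ Q.δ₀) := by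
  intro q hq
  obtain ⟨h1, h2, h3⟩ := hq
  have hc := (Q.model q.2 h1).cusp
  have hpos : ContDiffAt ℝ 2 Q.pos q.2 := hc.pos3.of_le (by norm_num)
  have hT : ContDiffAt ℝ 2 Q.T q.2 := hc.T3.of_le (by norm_num)
  have hT' : ContDiffAt ℝ 2 (fun q : ℝ × ℝ => Q.T q.2) q := hT.comp q contDiffAt_snd
  refine (hpos.comp q contDiffAt_snd).contDiffWithinAt.add ?_
  refine ContDiffWithinAt.comp (t := shockStrip Q.τ₁) q
    (Q.shock.smooth (q.1 - Q.T q.2, q.2) ?_) ?_ ?_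
  · exact ⟨by simpa using h2, by have := Q.ε₀_le_τ₁; simp only; linarith,
      h1.trans_le Q.δ₀_le_one⟩
  · exact ((contDiffAt_fst.sub hT').prodMk contDiffAt_snd).contDiffWithinAt
  · rintro q' ⟨h1, h2, h3⟩
    exact ⟨by simpa using h2, by have := Q.ε₀_le_τ₁; simp only; linarith,
      h1.trans_le Q.δ₀_le_one⟩

lemma phi_slope {y : ℝ} (hy : |y| < Q.δ₀) :
    HasDerivWithinAt (fun t => Q.phi (t, y)) (Q.Ah y) (Ici (Q.T y)) (Q.T y) := by
  have h := Q.shock.slope y (hy.trans_le Q.δ₀_le_one)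
  have h2 : HasDerivWithinAt (fun t => t - Q.T y) 1 (Ici (Q.T y)) (Q.T y) :=
    ((hasDerivAt_id _).sub_const _).hasDerivWithinAt
  have h3 := HasDerivWithinAt.comp (h₂ := fun τ => Q.k (τ, y)) (h := fun t => t - Q.T y)
    (s' := Ici 0) (Q.T y) (by simpa using h) h2 (fun t ht => by simpa using ht)
  simpa [phi] using h3.const_add (Q.pos y)

lemma phi_partials {t y : ℝ} (hy : |y| < Q.δ₀) (h0 : Q.T y < t) (ht : t < Q.T y + Q.ε₀) :
    partialFst Q.phi (t, y) = partialFst Q.k (t - Q.T y, y) ∧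
    partialSnd Q.phi (t, y) = deriv Q.pos y - deriv Q.T y * partialFst Q.k (t - Q.T y, y) +
      partialSnd Q.k (t - Q.T y, y) := by
  have hk := Q.shock.diff (t - Q.T y, y) (by simp only; linarith)
    (by have := Q.ε₀_le_τ₁; simp only; linarith) (hy.trans_le Q.δ₀_le_one)
  have hT := (Q.diffT hy).hasDerivAt
  have hp := (Q.diff_pos hy).hasDerivAt
  have hd : DifferentiableAt ℝ Q.phi (t, y) := by
    refine DifferentiableAt.add (f := fun q : ℝ × ℝ => Q.pos q.2)
      (g := fun q : ℝ × ℝ => Q.k (q.1 - Q.T q.2, q.2)) ?_ ?_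
    · exact DifferentiableAt.comp (g := Q.pos) (t, y) (Q.diff_pos hy) differentiableAt_snd
    · refine DifferentiableAt.comp (t, y) hk ?_
      exact (differentiableAt_fst.sub (DifferentiableAt.comp (t, y) (Q.diffT hy)
        differentiableAt_snd)).prodMk differentiableAt_snd
  constructor
  · have h1 := HasFDerivAt.comp_planeCurve (a := fun t => t) (b := fun _ => y) hd (hasDerivAt_id t)
      (hasDerivAt_const t y)
    have h2 := (HasFDerivAt.comp_planeCurve (a := fun t => t - Q.T y) (b := fun _ => y) hk
      ((hasDerivAt_id t).sub_const _) (hasDerivAt_const t y)).const_add (Q.pos y)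
    have := h1.unique h2
    simpa using this
  · have h1 := HasFDerivAt.comp_planeCurve (a := fun _ => t) (b := fun y => y) hd
      (hasDerivAt_const y t) (hasDerivAt_id y)
    have h2 := hp.add (HasFDerivAt.comp_planeCurve (a := fun y => t - Q.T y) (b := fun y => y) hk
      (hT.const_sub t) (hasDerivAt_id y))
    have := h1.unique h2
    simp only [zero_mul, one_mul, zero_add] at this
    rw [this]; ring

/-- The set on which the position of a point relative to the shock makes sense. -/
lemma eventually_side {p₀ : ℝ × ℝ × ℝ} {σ : ℝ} (hy : |p₀.2.2| < Q.δ₀) (h0 : Q.T p₀.2.2 ≤ p₀.1)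
    (ht : p₀.1 < Q.T p₀.2.2 + Q.ε₀) (hs : 0 < σ * (Q.phi (p₀.1, p₀.2.2) - p₀.2.1)) :
    ∀ᶠ p in 𝓝 p₀, Q.T p.2.2 ≤ p.1 → 0 < σ * (Q.phi (p.1, p.2.2) - p.2.1) := by
  set W : Set (ℝ × ℝ × ℝ) := {p | (p.1, p.2.2) ∈ shockParam Q.T Q.ε₀ Q.δ₀} with hW
  have hφ : ContinuousWithinAt (fun p : ℝ × ℝ × ℝ => Q.phi (p.1, p.2.2)) W p₀ :=
    ContinuousWithinAt.comp (t := shockParam Q.T Q.ε₀ Q.δ₀) (f := fun p : ℝ × ℝ × ℝ => (p.1, p.2.2))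
      (Q.contDiffOn_phi.continuousOn (p₀.1, p₀.2.2) ⟨hy, h0, ht⟩)
      (by fun_prop) (fun p hp => hp)
  have hf : ContinuousWithinAt (fun p : ℝ × ℝ × ℝ => σ * (Q.phi (p.1, p.2.2) - p.2.1)) W p₀ := by
    refine continuousWithinAt_const.mul (hφ.sub ?_)
    fun_prop
  have hev := eventually_nhdsWithin_iff.1 (hf.tendsto.eventually_const_lt hs)
  filter_upwards [hev, Q.eventually_early hy ht] with p a ⟨b, d⟩ h
  exact a ⟨b, h, d⟩

lemma continuous_sh : Continuous Q.sh := Q.flat.s1.continuous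

lemma eventually_outer {p₀ : ℝ × ℝ × ℝ} {u σ : ℝ} (hy : |p₀.2.2| < Q.δ₀)
    (ho : IsOuter Q.sh (Q.α / Q.β) Q.e σ (p₀.1 - Q.T p₀.2.2) p₀.2.2 u) :
    ∀ᶠ q in 𝓝 (p₀, u), IsOuter Q.sh (Q.α / Q.β) Q.e σ (q.1.1 - Q.T q.1.2.2) q.1.2.2 q.2 := by
  have hTc : ContinuousAt (fun q : (ℝ × ℝ × ℝ) × ℝ => Q.T q.1.2.2) (p₀, u) :=
    Q.contT_comp (f := fun q : (ℝ × ℝ × ℝ) × ℝ => q.1.2.2) hy (by fun_prop)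
  have hc : ContinuousAt (fun q : (ℝ × ℝ × ℝ) × ℝ => (q.1.1 - Q.T q.1.2.2, q.1.2.2, q.2)) (p₀, u) := by
    refine ContinuousAt.prodMk (ContinuousAt.sub (by fun_prop) hTc) (by fun_prop)
  exact hc.eventually ((isOpen_isOuter Q.continuous_sh (Q.α / Q.β) Q.e σ).mem_nhds ho)

lemma eventually_near {E : Type*} [TopologicalSpace E] (p₀ : E) {u : ℝ} (hu : |u - Q.c| < Q.ϱ) :
    ∀ᶠ q in 𝓝 (p₀, u), |q.2 - Q.c| < Q.ϱ :=
  ContinuousAt.eventually_lt (f := fun q : E × ℝ => |q.2 - Q.c|) (by fun_prop) continuousAt_const hu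

lemma X1 : ContDiff ℝ 1 Q.X := Q.germ.X4.of_le (by norm_num)

variable {Q} {p₀ : ℝ × ℝ × ℝ}

lemma Reg.eventually_reg (hp : Q.Reg p₀) : ∀ᶠ p in 𝓝[{p | 0 ≤ p.1}] p₀, Q.Reg p := by
  obtain ⟨h0, h1, h2, h3, h4⟩ := id hp
  have e3 : ∀ᶠ p in 𝓝 p₀, |p.2.1| < Q.r :=
    ContinuousAt.eventually_lt (f := fun p : ℝ × ℝ × ℝ => |p.2.1|) (by fun_prop) continuousAt_const h2
  have e4 : ∀ᶠ p in 𝓝 p₀, Q.T p.2.2 ≤ p.1 → p.2.1 ≠ Q.phi (p.1, p.2.2) := by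
    rcases lt_or_ge p₀.1 (Q.T p₀.2.2) with h | h
    · filter_upwards [Q.eventually_early h3 (a := 0) (by linarith)] with p hp h'
      linarith [hp.2]
    · obtain ⟨σ, -, hs⟩ := hp.side h
      filter_upwards [Q.eventually_side h3 h h1 hs] with p hp h' e
      have := hp h'
      rw [e, sub_self, mul_zero] at this
      exact lt_irrefl _ this
  filter_upwards [self_mem_nhdsWithin, nhdsWithin_le_nhds (Q.eventually_early h3 h1),
    nhdsWithin_le_nhds e3, nhdsWithin_le_nhds e4] with p a1 ⟨a2, a3⟩ a4 a5
  exact ⟨a1, a3, a4, a2, a5⟩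

lemma Reg.eventually_adm (hp : Q.Reg p₀) {u : ℝ} (hu : Q.Adm p₀ u) :
    ∀ᶠ q in 𝓝 (p₀, u), Q.Adm q.1 q.2 := by
  obtain ⟨h0, h1, h2, h3, h4⟩ := id hp
  have hfst : Tendsto Prod.fst (𝓝 (p₀, u)) (𝓝 p₀) := continuousAt_fst
  rcases lt_or_ge p₀.1 (Q.T p₀.2.2) with h | h
  · filter_upwards [Q.eventually_near p₀ hu.1,
      hfst.eventually (Q.eventually_early h3 (a := 0) (by linarith))] with q a b
    exact ⟨a, fun h' => by linarith [b.2]⟩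
  · obtain ⟨σ, hσ, hs⟩ := hp.side h
    filter_upwards [Q.eventually_near p₀ hu.1, hfst.eventually (Q.eventually_side h3 h h1 hs),
      Q.eventually_outer h3 (hu.2 h σ hσ hs)] with q a b d
    refine ⟨a, fun h' σ' hσ' hs' => ?_⟩
    have hb := b h'
    have : σ' = σ := by
      rcases hσ with rfl | rfl <;> rcases hσ' with rfl | rfl <;> first | rfl | (exfalso; linarith)
    rwa [this]

lemma Reg.exists_smooth (hp : Q.Reg p₀) :
    ∃ ψ : ℝ × ℝ × ℝ → ℝ, ContDiffAt ℝ 1 ψ p₀ ∧ ψ p₀ = Q.val p₀ ∧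
      (∀ᶠ p in 𝓝[{p | 0 ≤ p.1}] p₀, Q.val p = ψ p) ∧
      ∀ v : ℝ × ℝ × ℝ, fderiv ℝ ψ p₀ v = -(partialX Q.X (p₀.1, Q.val p₀, p₀.2.2))⁻¹ *
        (v.1 * partialT Q.X (p₀.1, Q.val p₀, p₀.2.2) - v.2.1 +
          v.2.2 * partialY Q.X (p₀.1, Q.val p₀, p₀.2.2)) := by
  refine exists_smooth_branch Q.X1 (P := Q.Adm) (hp.Xu_neg hp.val_spec.1).ne hp.val_spec.2 ?_ ?_ ?_
  · filter_upwards [hp.eventually_reg] with p h _ _ _ using h.val_spec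
  · filter_upwards [hp.eventually_reg] with p h u u' a a' e e' using h.unique a a' e e'
  · filter_upwards [hp.eventually_adm hp.val_spec.1] with q h _ using h

lemma Reg.contDiffWithinAt (hp : Q.Reg p₀) : ContDiffWithinAt ℝ 1 Q.val {p | 0 ≤ p.1} p₀ := by
  obtain ⟨ψ, h1, h2, h3, -⟩ := hp.exists_smooth
  exact h1.contDiffWithinAt.congr_of_eventuallyEq h3 h2.symm

lemma Reg.fderiv_val (hp : Q.Reg p₀) (h0 : 0 < p₀.1) : DifferentiableAt ℝ Q.val p₀ ∧
    ∀ v : ℝ × ℝ × ℝ, fderiv ℝ Q.val p₀ v = -(partialX Q.X (p₀.1, Q.val p₀, p₀.2.2))⁻¹ *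
        (v.1 * partialT Q.X (p₀.1, Q.val p₀, p₀.2.2) - v.2.1 +
          v.2.2 * partialY Q.X (p₀.1, Q.val p₀, p₀.2.2)) := by
  obtain ⟨ψ, h1, h2, h3, h4⟩ := hp.exists_smooth
  have hn : {p : ℝ × ℝ × ℝ | 0 ≤ p.1} ∈ 𝓝 p₀ := by
    filter_upwards [(isOpen_lt (f := fun _ : ℝ × ℝ × ℝ => (0 : ℝ)) (g := fun p => p.1)
      (by fun_prop) (by fun_prop)).mem_nhds h0] with p hp using le_of_lt hp
  rw [nhdsWithin_eq_nhds.2 hn] at h3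
  have h3 : Q.val =ᶠ[𝓝 p₀] ψ := h3
  exact ⟨(h1.differentiableAt (by norm_num)).congr_of_eventuallyEq h3, fun v => by
    rw [h3.fderiv_eq, h4]⟩

lemma Reg.partials (hp : Q.Reg p₀) (h0 : 0 < p₀.1) :
    partialT Q.val p₀ = -(partialT Q.X (p₀.1, Q.val p₀, p₀.2.2) /
      partialX Q.X (p₀.1, Q.val p₀, p₀.2.2)) ∧
    partialX Q.val p₀ = (partialX Q.X (p₀.1, Q.val p₀, p₀.2.2))⁻¹ ∧
    partialY Q.val p₀ = -(partialY Q.X (p₀.1, Q.val p₀, p₀.2.2) /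
      partialX Q.X (p₀.1, Q.val p₀, p₀.2.2)) := by
  have h := (hp.fderiv_val h0).2
  refine ⟨?_, ?_, ?_⟩
  · rw [partialT, h]; simp; ring
  · rw [partialX, h]; simp
  · rw [partialY, h]; simp; ring

lemma partials_comp {f : ℝ → ℝ} {u : ℝ × ℝ × ℝ → ℝ} {p : ℝ × ℝ × ℝ}
    (hf : DifferentiableAt ℝ f (u p)) (hu : DifferentiableAt ℝ u p) :
    partialX (fun q => f (u q)) p = deriv f (u p) * partialX u p ∧
    partialY (fun q => f (u q)) p = deriv f (u p) * partialY u p := by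
  have h := (hf.hasDerivAt.comp_hasFDerivAt p hu.hasFDerivAt).fderiv
  simp only [Function.comp_def] at h
  constructor <;> simp only [partialX, partialY, h] <;> simp

lemma Reg.pde (hp : Q.Reg p₀) (h0 : 0 < p₀.1) : partialT Q.val p₀ +
    partialX (fun q => F (Q.val q)) p₀ + partialY (fun q => G (Q.val q)) p₀ = 0 := by
  obtain ⟨hd, -⟩ := hp.fderiv_val h0
  obtain ⟨e1, e2, e3⟩ := hp.partials h0
  have hF := Q.germ.F5.differentiable (by norm_num) (Q.val p₀)
  have hG := Q.germ.G5.differentiable (by norm_num) (Q.val p₀)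
  rw [(partials_comp hF hd).1, (partials_comp hG hd).2, e1, e2, e3]
  have := charPos_T Q.germ.F5 Q.germ.G5 Q.germ.Z4 p₀.1 (Q.val p₀) p₀.2.2
  have hne := (hp.Xu_neg hp.val_spec.1).ne
  change partialT Q.X _ = _ - _ * partialY Q.X _ at this
  rw [this]
  field_simp
  ring

lemma Reg.characteristic (hp : Q.Reg p₀) : ∃ ξ η : ℝ, |ξ| < Q.ρ ∧ |η| < Q.ρ ∧
    p₀.2.1 = ξ + p₀.1 * speed F u₀ (ξ, η) ∧ p₀.2.2 = η + p₀.1 * speed G u₀ (ξ, η) ∧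
    Q.val p₀ = u₀ (ξ, η) := by
  obtain ⟨ha, hX⟩ := hp.val_spec
  obtain ⟨h0, h1, h2, h3, -⟩ := hp
  have hT := Q.T_mem h3
  have := Q.ε₀_le_half
  obtain ⟨⟨c1, -⟩, c2, c3⟩ := Q.chart p₀.1 (Q.val p₀) p₀.2.2 h0 (by linarith) ha.1.le h3
  refine ⟨_, _, c2, c3, ?_, ?_, c1.symm⟩
  · rw [speed, c1]; exact hX.symm
  · simp only at c1
    rw [speed, c1]; ring

lemma val_initial {x y : ℝ} (hx : |x| < Q.r) (hy : |y| < Q.δ₀) : Q.val (0, x, y) = u₀ (x, y) := by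
  have hT := Q.T_mem hy
  have hε := Q.ε₀_pos
  have hp : Q.Reg (0, x, y) := ⟨le_rfl, by simp only; linarith, hx, hy, fun h => by
    simp only at h; linarith⟩
  obtain ⟨h1, h2⟩ := Q.init x y hx hy
  refine hp.unique hp.val_spec.1 ⟨h1, fun h => ?_⟩ hp.val_spec.2 ?_
  · simp only at h; linarith
  · simp [X, charPos, h2]

lemma reg_of_mem {δ ε : ℝ} (hδ : δ ≤ Q.δ₀) (hε : ε ≤ Q.ε₀) {p : ℝ × ℝ × ℝ}
    (hp : p ∈ solDomain Q.T ε δ Q.r \ shockSurface Q.T Q.phi ε δ) : Q.Reg p := by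
  obtain ⟨⟨h0, h1, h2, h3⟩, h4⟩ := hp
  exact ⟨h0, by linarith, h2, by linarith, fun h e => h4 ⟨⟨h3, h, h1⟩, e⟩⟩

lemma isSolutionOff {δ ε : ℝ} (hδ : δ ≤ Q.δ₀) (hε : ε ≤ Q.ε₀) :
    IsSolutionOff F G u₀ Q.ρ ε δ Q.r Q.T Q.phi Q.val where
  contDiffOn _ hp := (reg_of_mem hδ hε hp).contDiffWithinAt.mono fun _ hq => hq.1.1
  pde _ hp h0 := (reg_of_mem hδ hε hp).pde h0
  initial _ _ hx hy := val_initial hx (hy.trans_le hδ)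
  characteristic _ hp := (reg_of_mem hδ hε hp).characteristic

variable (Q)

/-- Foot of the characteristic through the blowup curve. -/
def footSnd (y : ℝ) : ℝ := y - Q.T y * deriv G (Q.s y)

def footFst (y : ℝ) : ℝ := Q.Z (Q.s y, Q.footSnd y)

lemma s_le {y : ℝ} (hy : |y| < Q.δ₀) : |Q.s y - Q.c| ≤ Q.ϱ := by
  have := Q.s_close y hy
  have := Q.ϱ_pos
  linarith

lemma foot_chart {y : ℝ} (hy : |y| < Q.δ₀) : ChartValid u₀ Q.Z (Q.s y, Q.footSnd y) ∧
    |Q.footFst y| < Q.ρ ∧ |Q.footSnd y| < Q.ρ := by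
  have hT := Q.T_mem hy
  exact Q.chart (Q.T y) (Q.s y) y (by linarith) (by linarith) (Q.s_le hy) hy

lemma foot_value {y : ℝ} (hy : |y| < Q.δ₀) : u₀ (Q.footFst y, Q.footSnd y) = Q.s y :=
  (Q.foot_chart hy).1.1

lemma foot_degenerate {y : ℝ} (hy : |y| < Q.δ₀) :
    1 + Q.T y * initDiv F G u₀ (Q.footFst y, Q.footSnd y) = 0 := by
  have h := (Q.foot_chart hy).1
  have h1 := Q.germ.charPos_X h
  have h2 : partialX Q.X (Q.T y, Q.s y, y) = 0 := (Q.model y hy).cusp.X_zero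
  have h3 := h2.symm.trans h1
  rcases mul_eq_zero.1 h3.symm with h4 | h4
  · exact h4
  · have := h.2.2.1
    rw [footSnd, h4, zero_mul] at this
    exact absurd this zero_ne_one

lemma footSnd_eq {y : ℝ} (hy : |y| < Q.δ₀) :
    y = Q.footSnd y + Q.T y * speed G u₀ (Q.footFst y, Q.footSnd y) := by
  rw [speed, Q.foot_value hy, footSnd]; ring

lemma footFst_eq {y : ℝ} (hy : |y| < Q.δ₀) :
    Q.pos y = Q.footFst y + Q.T y * speed F u₀ (Q.footFst y, Q.footSnd y) := by
  rw [speed, Q.foot_value hy]; rfl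

lemma first_time {y : ℝ} (hy : |y| < Q.δ₀) : IsLeast (degenerateTimes F G u₀ Q.ρ y) (Q.T y) := by
  have hT := Q.T_mem hy
  refine ⟨⟨by linarith, _, _, (Q.foot_chart hy).2.1, (Q.foot_chart hy).2.2, (Q.footSnd_eq hy).symm,
    Q.foot_degenerate hy⟩, ?_⟩
  rintro t ⟨ht, ξ, η, hξ, hη, hy', hd⟩
  by_contra hlt
  rw [not_le] at hlt
  have hH := Q.germ.initDiv_ge (ξ, η)
  have ht1 : 1 ≤ t := by nlinarith
  obtain ⟨h1, h2, h3⟩ := Q.foot ξ η hξ hη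
  set u := u₀ (ξ, η) with hu
  have hη' : η = y - t * deriv G u := by
    have : speed G u₀ (ξ, η) = deriv G u := rfl
    rw [this] at hy'; linarith
  rw [hη'] at h3
  have h4 := Q.germ.charPos_X h3
  rw [← hη', h1, hd, zero_mul] at h4
  have h5 : partialX Q.D (t - Q.T y, u, y) = 0 := by rw [← Q.Xu_eq hy]; exact h4
  have hTe := (abs_lt.1 (Q.T_close y hy).2).2
  have hs := Q.s_close y hy
  have h6 := abs_sub_le u Q.c (Q.s y)
  rw [abs_sub_comm Q.c] at h6
  have := Q.ϱ_le_e
  have hγ := Q.flat.γ_pos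
  exact (Q.flat.X_neg (by rw [abs_of_neg (by linarith)]; linarith)
    (by rw [(Q.model y hy).center]; linarith) (by nlinarith [sq_nonneg (u - Q.sh y)])
    (Or.inl (by linarith))).ne h5

lemma tangentSpeed_eq {y : ℝ} (hy : |y| < Q.δ₀) :
    tangentSpeed F G u₀ (Q.footFst y, Q.footSnd y) = Q.Ah y := by
  obtain ⟨h1, h2, h3, h4⟩ := (Q.foot_chart hy).1
  obtain ⟨⟨a1, a2⟩, -⟩ := Q.germ.speed_partials (Q.footFst y, Q.footSnd y)
  obtain ⟨-, b2, -⟩ := charPos_partials Q.germ.F5 Q.germ.G5 Q.germ.Z4 (Q.T y) (Q.s y) y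
  have hF := Q.secondF (Q.s y) (Q.s_le hy)
  rw [tangentSpeed, a1, a2, (Q.model y hy).speed, b2, speed, speed, Q.foot_value hy]
  change partialFst u₀ (Q.footFst y, Q.footSnd y) < 0 at h2
  change partialSnd Q.Z (Q.s y, Q.footSnd y) * partialFst u₀ (Q.footFst y, Q.footSnd y) +
    partialSnd u₀ (Q.footFst y, Q.footSnd y) = 0 at h4
  change _ = _ - _ * partialSnd Q.Z (Q.s y, Q.footSnd y)
  have h5 := h2.ne
  have h6 := hF.ne'
  have h7 : partialSnd u₀ (Q.footFst y, Q.footSnd y) =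
    -partialSnd Q.Z (Q.s y, Q.footSnd y) * partialFst u₀ (Q.footFst y, Q.footSnd y) := by linarith
  rw [h7]
  field_simp
  ring

lemma pos_zero : Q.pos 0 = 0 := by
  rw [pos, Q.T_zero, Q.s_zero]
  exact Q.germ.charPos_base.1

lemma isBlowupCurve {δ : ℝ} (hδ : δ ≤ Q.δ₀) :
    IsBlowupCurve F G u₀ Q.ρ δ Q.T Q.pos Q.footFst Q.footSnd where
  time_zero := Q.T_zero
  pos_zero := Q.pos_zero
  contDiffOn_time y hy := ((Q.model y ((abs_lt.2 hy).trans_le hδ)).cusp.T3.of_le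
    (by norm_num)).contDiffWithinAt
  contDiffOn_pos y hy := ((Q.model y ((abs_lt.2 hy).trans_le hδ)).cusp.pos3.of_le
    (by norm_num)).contDiffWithinAt
  foot_fst _ hy := (Q.foot_chart (hy.trans_le hδ)).2.1
  foot_snd _ hy := (Q.foot_chart (hy.trans_le hδ)).2.2
  degenerate _ hy := Q.foot_degenerate (hy.trans_le hδ)
  snd_eq _ hy := Q.footSnd_eq (hy.trans_le hδ)
  fst_eq _ hy := Q.footFst_eq (hy.trans_le hδ)
  first_time _ hy := Q.first_time (hy.trans_le hδ)
  spacelike y hy := by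
    have := Q.spacelike y (hy.trans_le hδ)
    rw [← Q.foot_value (hy.trans_le hδ)] at this
    simp only [speed]
    linarith

/-- On the blowup curve the solution is carried by the degenerate characteristic. -/
lemma val_curve {y : ℝ} (hy : |y| < Q.δ₀) : Q.val (Q.T y, Q.pos y, y) = Q.s y := by
  have hϱ := Q.ϱ_pos
  have hadm : ∀ u, |u - Q.c| < Q.ϱ → Q.Adm (Q.T y, Q.pos y, y) u := fun u hu =>
    ⟨hu, fun _ σ _ h => absurd h (by simp [Q.phi_base hy])⟩
  have hex : ∃ u, Q.Adm (Q.T y, Q.pos y, y) u ∧ Q.X (Q.T y, u, y) = Q.pos y :=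
    ⟨Q.s y, hadm _ ((Q.s_close y hy).trans (by linarith)), rfl⟩
  have hval : Q.val (Q.T y, Q.pos y, y) = hex.choose := dif_pos hex
  obtain ⟨⟨h1, -⟩, h2⟩ := hex.choose_spec
  rw [← hval] at h1 h2
  set u := Q.val (Q.T y, Q.pos y, y) with hu
  by_contra hne
  obtain ⟨v, hv, e⟩ := exists_mem_uIoo_mean_value
    (fun v => hasDerivAt_partialX Q.diffX (Q.T y) v y) hne
  rw [h2, show Q.X (Q.T y, Q.s y, y) = Q.pos y from rfl, sub_self] at e
  have h3 : partialX Q.X (Q.T y, v, y) = 0 := by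
    rcases mul_eq_zero.1 e.symm with h | h
    · exact h
    · exact absurd (sub_eq_zero.1 h).symm hne
  have hv' : |v - Q.c| ≤ Q.ϱ ∧ v ≠ Q.s y := by
    have ha := abs_lt.1 h1
    have hb := abs_le.1 (Q.s_le hy)
    rw [uIoo] at hv
    rcases lt_or_gt_of_ne hne with h | h
    · rw [min_eq_left h.le, max_eq_right h.le] at hv
      exact ⟨abs_le.2 ⟨by linarith [hv.1, hv.2], by linarith [hv.1, hv.2]⟩, hv.2.ne⟩
    · rw [min_eq_right h.le, max_eq_left h.le] at hv
      exact ⟨abs_le.2 ⟨by linarith [hv.1, hv.2], by linarith [hv.1, hv.2]⟩, hv.1.ne'⟩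
  rw [Q.Xu_eq hy] at h3
  exact (Q.flat.X_neg (by simpa using Q.flat.e_pos.le) (Q.near hy hv'.1).le
    (by rw [sub_self, mul_zero]; positivity) (Or.inr (by rw [(Q.model y hy).center]; exact hv'.2))).ne h3

/-- The one-sided limit of the solution at the shock is the state of the shock profile. -/
lemma tendsto_side {σ t y a : ℝ} (hσ : σ = 1 ∨ σ = -1) (hy : |y| < Q.δ₀) (h0 : Q.T y < t)
    (ht : t < Q.T y + Q.ε₀) (ho : IsOuter Q.sh (Q.α / Q.β) Q.e σ (t - Q.T y) y a)
    (hX : Q.X (t, a, y) = Q.phi (t, y)) (ha : |a - Q.c| < Q.ϱ) :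
    Tendsto Q.val (𝓝[{p | Q.Reg p ∧ Q.T p.2.2 ≤ p.1 ∧ 0 < σ * (Q.phi (p.1, p.2.2) - p.2.1)}]
      (t, Q.phi (t, y), y)) (𝓝 a) := by
  set S : Set (ℝ × ℝ × ℝ) :=
    {p | Q.Reg p ∧ Q.T p.2.2 ≤ p.1 ∧ 0 < σ * (Q.phi (p.1, p.2.2) - p.2.1)} with hS
  set p₀ : ℝ × ℝ × ℝ := (t, Q.phi (t, y), y) with hp₀
  have hnot : p₀ ∉ S := fun h => by have := h.2.2; simp [hp₀] at this
  have hev : ∀ᶠ p in 𝓝[S] p₀, p ∈ S ∧ Function.update Q.val p₀ a p = Q.val p := by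
    filter_upwards [self_mem_nhdsWithin] with p hp
    exact ⟨hp, Function.update_of_ne (by rintro rfl; exact hnot hp) _ _⟩
  obtain ⟨ψ, h1, h2, h3, -⟩ := exists_smooth_branch Q.X1 (p₀ := p₀) (U := Function.update Q.val p₀ a)
    (S := S) (P := fun p u => |u - Q.c| < Q.ϱ ∧
      IsOuter Q.sh (Q.α / Q.β) Q.e σ (p.1 - Q.T p.2.2) p.2.2 u)
    (by rw [Function.update_self]; exact (Q.outer_X_neg hy h0.le ht ho).ne)
    (by rw [Function.update_self]; exact hX)
    (by
      filter_upwards [hev] with p ⟨⟨hr, hT, hs⟩, e⟩ _ _ _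
      rw [e]
      have := hr.val_spec
      exact ⟨⟨this.1.1, this.1.2 hT σ hσ hs⟩, this.2⟩)
    (by
      filter_upwards [hev] with p ⟨⟨hr, hT, hs⟩, _⟩ u u' k k' e e'
      by_contra hne
      rcases lt_or_gt_of_ne hne with hl | hl
      · have := Q.outer_inj hr.2.2.2.1 hT hr.2.1 k.2 k'.2 hl; linarith
      · have := Q.outer_inj hr.2.2.2.1 hT hr.2.1 k'.2 k.2 hl; linarith)
    (by
      rw [Function.update_self]
      filter_upwards [Q.eventually_near p₀ ha, Q.eventually_outer (p₀ := p₀) hy ho] with q a b _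
      exact ⟨a, b⟩)
  rw [Function.update_self] at h2
  have h4 : Tendsto ψ (𝓝[S] p₀) (𝓝 a) := h2 ▸ h1.continuousAt.tendsto.mono_left nhdsWithin_le_nhds
  refine h4.congr' ?_
  filter_upwards [hev, h3] with p hp e
  rw [← e, hp.2]

/-- Two states satisfying the transport relation satisfy the Rankine–Hugoniot condition. -/
lemma rankineHugoniot {t y : ℝ} (hy : |y| < Q.δ₀) (h0 : Q.T y < t) (ht : t < Q.T y + Q.ε₀)
    (hu : |Q.up (t - Q.T y, y) - Q.c| < Q.ϱ) (hm : |Q.um (t - Q.T y, y) - Q.c| < Q.ϱ) :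
    partialFst Q.phi (t, y) * (Q.um (t - Q.T y, y) - Q.up (t - Q.T y, y)) -
      (F (Q.um (t - Q.T y, y)) - F (Q.up (t - Q.T y, y))) +
      partialSnd Q.phi (t, y) * (G (Q.um (t - Q.T y, y)) - G (Q.up (t - Q.T y, y))) = 0 := by
  obtain ⟨e1, e2⟩ := Q.phi_partials hy h0 ht
  have htr := Q.shock.transport (t - Q.T y, y) (by simp only; linarith)
    (by have := Q.ε₀_le_τ₁; simp only; linarith) (hy.trans_le Q.δ₀_le_one)
  rw [e1, e2]
  set a := Q.up (t - Q.T y, y)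
  set b := Q.um (t - Q.T y, y)
  simp only at htr
  have hM := Q.model y hy
  have ha := hu.trans_le Q.ϱ_le_m
  have hb := hm.trans_le Q.ϱ_le_m
  have hd := hM.denom a b ha hb
  have hpos : deriv (fun y => charPos F G Q.Z (Q.T y, Q.s y, y)) y = deriv Q.pos y := rfl
  rw [hM.valueF a b ha hb, hM.valueG a b ha hb, hpos] at htr
  have hF := meanDeriv_mul (Q.germ.F5.of_le (by norm_num)) a b
  have hG := meanDeriv_mul (Q.germ.G5.of_le (by norm_num)) a b
  obtain ⟨d, hd'⟩ : ∃ d, d = 1 - deriv Q.T y * meanDeriv G (a, b) := ⟨_, rfl⟩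
  rw [← hd'] at hd htr
  field_simp at htr
  rw [hd'] at htr
  have h1 : F b - F a = -(meanDeriv F (a, b) * (a - b)) := by linarith
  have h2 : G b - G a = -(meanDeriv G (a, b) * (a - b)) := by linarith
  rw [h1, h2]
  linear_combination (b - a) * htr

lemma entropy {t y a b : ℝ} (hy : |y| < Q.δ₀) (h0 : Q.T y < t) (ht : t < Q.T y + Q.ε₀)
    (ha : |a - Q.c| < Q.ϱ) (hb : |b - Q.c| < Q.ϱ) (hba : b < a)
    (hRH : partialFst Q.phi (t, y) * (b - a) - (F b - F a) +
      partialSnd Q.phi (t, y) * (G b - G a) = 0) :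
    -partialFst Q.phi (t, y) + deriv F b - partialSnd Q.phi (t, y) * deriv G b < 0 ∧
    0 < -partialFst Q.phi (t, y) + deriv F a - partialSnd Q.phi (t, y) * deriv G a := by
  set m := partialSnd Q.phi (t, y) with hm
  set l := partialFst Q.phi (t, y)
  have hq : ∀ u, HasDerivAt (fun u => F u - m * G u) (deriv F u - m * deriv G u) u := fun u =>
    (Q.germ.F5.differentiable (by norm_num) u).hasDerivAt.sub
      ((Q.germ.G5.differentiable (by norm_num) u).hasDerivAt.const_mul m)
  have hq2 : ∀ u, HasDerivAt (fun u => deriv F u - m * deriv G u)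
      (deriv (deriv F) u - m * deriv (deriv G) u) u := fun u =>
    (Q.germ.F5.hasDerivAt_deriv u).sub ((Q.germ.G5.hasDerivAt_deriv u).const_mul m)
  have hmono : StrictMonoOn (fun u => deriv F u - m * deriv G u)
      (Icc (Q.c - Q.ϱ) (Q.c + Q.ϱ)) := by
    refine strictMonoOn_of_deriv_pos (convex_Icc _ _)
      (fun u _ => (hq2 u).continuousAt.continuousWithinAt) fun u hu => ?_
    rw [interior_Icc] at hu
    rw [(hq2 u).deriv, hm, (Q.phi_partials hy h0 ht).2]
    exact Q.convex (t - Q.T y) y u hy (by linarith) (by linarith)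
      (abs_le.2 ⟨by linarith [hu.1], by linarith [hu.2]⟩)
  obtain ⟨v, hv, e⟩ := exists_hasDerivAt_eq_slope (fun u => F u - m * G u)
    (fun u => deriv F u - m * deriv G u) hba
    (fun u _ => (hq u).continuousAt.continuousWithinAt) (fun v _ => hq v)
  have hne : a - b ≠ 0 := by linarith
  have hl : deriv F v - m * deriv G v = l := by
    rw [e, div_eq_iff hne]; linarith
  have ha' := abs_lt.1 ha
  have hb' := abs_lt.1 hb
  have h1 := hmono ⟨by linarith, by linarith⟩ ⟨by linarith [hv.1], by linarith [hv.2]⟩ hv.1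
  have h2 := hmono ⟨by linarith [hv.1], by linarith [hv.2]⟩ ⟨by linarith, by linarith⟩ hv.2
  simp only at h1 h2
  constructor <;> linarith

lemma shockConditions {δ ε : ℝ} (hδ : δ ≤ Q.δ₀) (hε : ε ≤ Q.ε₀) :
    ShockConditions F G ε δ Q.r Q.T Q.phi Q.val := by
  intro t y hy h0 ht
  have hy' := hy.trans_le hδ
  have ht' : t < Q.T y + Q.ε₀ := by linarith
  obtain ⟨a, a1, a2, a3, a4, -⟩ := Q.exists_edge (Or.inl rfl) hy' h0 ht'
  obtain ⟨b, b1, b2, b3, -, b4⟩ := Q.exists_edge (Or.inr rfl) hy' h0 ht'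
  have hRH := Q.rankineHugoniot hy' h0 ht' (by rw [← a4 rfl]; exact a3) (by rw [← b4 rfl]; exact b3)
  rw [← a4 rfl, ← b4 rfl] at hRH
  have hba : b < a := by have := a1.1; have := b1.1; linarith
  refine ⟨a, b, ?_, ?_, hRH, Q.entropy hy' h0 ht' a3 b3 hba hRH⟩
  · refine (Q.tendsto_side (Or.inl rfl) hy' h0 ht' a1 a2 a3).mono_left
      (nhdsWithin_mono _ fun p hp => ?_)
    obtain ⟨h1, h2, h3⟩ := hp
    exact ⟨reg_of_mem hδ hε ⟨h1, fun h => h3.ne h.2⟩, h2.2.1, by linarith⟩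
  · refine (Q.tendsto_side (Or.inr rfl) hy' h0 ht' b1 b2 b3).mono_left
      (nhdsWithin_mono _ fun p hp => ?_)
    obtain ⟨h1, h2, h3⟩ := hp
    exact ⟨reg_of_mem hδ hε ⟨h1, fun h => h3.ne' h.2⟩, h2.2.1, by linarith⟩

end ShockConfig

lemma le_mul_of_cube_le {v d a b : ℝ} (hd : 0 ≤ d) (ha : 0 ≤ a) (hb : 0 ≤ b)
    (h : v ^ 3 ≤ a * d ^ 3 + b * d ^ 2 * v) : v ≤ (1 + a + b) * d := by
  by_contra hcon
  rw [not_le] at hcon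
  have h1 : d ≤ (1 + a + b) * d := by nlinarith [mul_nonneg ha hd, mul_nonneg hb hd]
  have hdv : d < v := by linarith
  have hv0 : 0 < v := by linarith
  have h2 : a * d ^ 3 ≤ a * d ^ 2 * v := by
    have : d ^ 3 ≤ d ^ 2 * v := by nlinarith [sq_nonneg d]
    nlinarith
  have h3 : v ^ 2 ≤ (a + b) * d ^ 2 := by
    have : v ^ 2 * v ≤ (a + b) * d ^ 2 * v := by nlinarith
    exact le_of_mul_le_mul_right this hv0
  have h4 : ((1 + a + b) * d) ^ 2 < v ^ 2 := by
    have : 0 ≤ (1 + a + b) * d := by positivity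
    nlinarith
  have h5 : (a + b) * d ^ 2 ≤ ((1 + a + b) * d) ^ 2 := by
    have : a + b ≤ (1 + a + b) ^ 2 := by nlinarith
    rw [mul_pow]
    exact mul_le_mul_of_nonneg_right this (sq_nonneg d)
  linarith

namespace FlatCusp

variable {D : ℝ × ℝ × ℝ → ℝ} {s A : ℝ → ℝ} {Fh Gh : ℝ × ℝ × ℝ → ℝ} {α β e : ℝ}
  (C : FlatCusp D s A Fh Gh α β e)

set_option maxHeartbeats 1000000 in
include C in
/-- Near the cusp, `d = |τ|^{1/2} + |D - A τ|^{1/3}` is comparable to `(|τ| + |u - s|²)^{1/2}`. -/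
lemma exists_dist_bounds (R : ℝ) : ∃ K, 0 ≤ K ∧ ∀ τ u y, |τ| ≤ e → |u - s y| ≤ e → |y| ≤ R →
    4 * (α / β) * τ ≤ (u - s y) ^ 2 → ∀ d r q, 0 ≤ r → r ^ 2 = |τ| → 0 ≤ q →
      q ^ 3 = |D (τ, u, y) - A y * τ| → d = r + q →
      |u - s y| ≤ K * d ∧ d ^ 2 ≤ K * -partialX D (τ, u, y) ∧
      d * |A y - partialT D (τ, u, y)| ≤ K * -partialX D (τ, u, y) := by
  have hα := C.α_pos
  have hβ := C.β_pos
  have he := C.e_pos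
  obtain ⟨M, hM0, hM⟩ := C.exists_bound C.contTT.continuous R
  set N := M * Real.sqrt e with hN
  have hN0 : 0 ≤ N := by positivity
  set a := (1 + N / 2) / (33 / 200 * β) with ha
  set b := 101 / 100 * α / (33 / 200 * β) with hb
  have ha0 : 0 ≤ a := by positivity
  have hb0 : 0 ≤ b := by positivity
  set C₁ := N / 2 + 101 / 100 * α + 101 / 600 * β with hC₁
  have hC₁0 : 0 ≤ C₁ := by positivity
  set κ := min (α / 2) (β / 10) with hκ
  have hκ0 : 0 < κ := lt_min (by positivity) (by positivity)
  set C₃ := N + 101 / 100 * α with hC₃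
  have hC₃0 : 0 ≤ C₃ := by positivity
  refine ⟨(1 + a + b) + (2 + C₁) ^ 2 / κ + (2 + C₁) * C₃ / κ, by positivity, ?_⟩
  intro τ u y hτ hu hy hgap d r q hr hrτ hq hqw hd
  set v := u - s y with hv
  obtain ⟨τ₁, u₂, u₃, h1, h2, h3, e1⟩ := C.taylorD τ u y
  have b1 := hM τ₁ u y (h1.trans hτ) hu hy
  have b2 := C.le_TX (τ := 0) (u := u₂) (y := y) (by simpa using he.le) (h2.trans hu)
  have b3 := C.le_XXX (τ := 0) (u := u₃) (y := y) (by simpa using he.le) (h3.trans hu)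
  have hXu := C.X_le hτ hu hgap
  have hr' : r ≤ Real.sqrt e := Real.le_sqrt_of_sq_le (by rw [hrτ]; exact hτ)
  have hτ2 : τ ^ 2 = r ^ 4 := by rw [← sq_abs, ← hrτ]; ring
  have hr4 : M * r ^ 4 ≤ N * r ^ 3 := by
    have : M * r ^ 3 * r ≤ M * r ^ 3 * Real.sqrt e := mul_le_mul_of_nonneg_left hr' (by positivity)
    rw [hN]; linarith
  set w := D (τ, u, y) - A y * τ with hw
  set P := partialT (partialT D) (τ₁, u, y)
  set B := partialT (partialX D) (0, u₂, y)
  set E := partialX (partialX (partialX D)) (0, u₃, y)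
  have e2 : w = P * τ ^ 2 / 2 + τ * v * B + E * v ^ 3 / 6 := by rw [hw, e1]; ring
  have t1 : |P * τ ^ 2 / 2| ≤ N / 2 * r ^ 3 := by
    rw [abs_div, abs_mul, abs_of_nonneg (sq_nonneg τ), hτ2, abs_two]
    have : |P| * r ^ 4 ≤ M * r ^ 4 := mul_le_mul_of_nonneg_right b1 (by positivity)
    linarith
  have t2 : |τ * v * B| ≤ 101 / 100 * α * r ^ 2 * |v| := by
    rw [abs_mul, abs_mul, ← hrτ, abs_of_pos (by linarith [b2.1] : 0 < B)]
    have : r ^ 2 * |v| * B ≤ r ^ 2 * |v| * (101 / 100 * α) :=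
      mul_le_mul_of_nonneg_left b2.2 (by positivity)
    linarith
  have t3 : |E * v ^ 3 / 6| = -E * |v| ^ 3 / 6 := by
    rw [abs_div, abs_mul, abs_pow, abs_of_neg (by linarith [b3.1] : E < 0)]
    norm_num
  have hv3 : 0 ≤ |v| ^ 3 := by positivity
  have hrd : r ≤ d := by linarith
  have hqd : q ≤ d := by linarith
  have hd0 : 0 ≤ d := by linarith
  have hv0 := abs_nonneg v
  have c1 : |v| ≤ (1 + a + b) * d := by
    refine le_mul_of_cube_le hd0 ha0 hb0 ?_
    have h5 : 33 / 200 * β * |v| ^ 3 ≤ |E * v ^ 3 / 6| := by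
      have := mul_le_mul_of_nonneg_right b3.1 hv3
      rw [t3]; linarith
    have h6 : |E * v ^ 3 / 6| ≤ |w| + |P * τ ^ 2 / 2| + |τ * v * B| := by
      have : E * v ^ 3 / 6 = w - P * τ ^ 2 / 2 - τ * v * B := by rw [e2]; ring
      rw [this]
      exact (abs_sub _ _).trans (add_le_add_left (abs_sub _ _) _)
    have h7 : |w| ≤ d ^ 3 := by rw [← hqw]; exact pow_le_pow_left₀ hq hqd 3
    have h8 : r ^ 3 ≤ d ^ 3 := pow_le_pow_left₀ hr hrd 3
    have h9 : r ^ 2 ≤ d ^ 2 := pow_le_pow_left₀ hr hrd 2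
    have h10 : 101 / 100 * α * r ^ 2 * |v| ≤ 101 / 100 * α * d ^ 2 * |v| := by gcongr
    have h11 : N / 2 * r ^ 3 ≤ N / 2 * d ^ 3 := by gcongr
    have h12 : 33 / 200 * β * |v| ^ 3 ≤ (1 + N / 2) * d ^ 3 + 101 / 100 * α * d ^ 2 * |v| := by
      linarith
    have h13 : a * d ^ 3 + b * d ^ 2 * |v| =
        ((1 + N / 2) * d ^ 3 + 101 / 100 * α * d ^ 2 * |v|) / (33 / 200 * β) := by
      rw [ha, hb]; ring
    rw [h13, le_div_iff₀ (by positivity)]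
    linarith
  set m := Real.sqrt (r ^ 2 + v ^ 2) with hm
  have hm0 : 0 ≤ m := Real.sqrt_nonneg _
  have hm2 : m ^ 2 = r ^ 2 + v ^ 2 := Real.sq_sqrt (by positivity)
  have hrm : r ≤ m := Real.le_sqrt_of_sq_le (by linarith [sq_nonneg v])
  have hvm : |v| ≤ m := Real.le_sqrt_of_sq_le (by rw [sq_abs]; linarith [sq_nonneg r])
  have hXm : κ * m ^ 2 ≤ -partialX D (τ, u, y) := by
    have k1 : κ * r ^ 2 ≤ α / 2 * |τ| := by
      rw [← hrτ]; exact mul_le_mul_of_nonneg_right (min_le_left _ _) (sq_nonneg _)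
    have k2 : κ * v ^ 2 ≤ β / 10 * v ^ 2 :=
      mul_le_mul_of_nonneg_right (min_le_right _ _) (sq_nonneg _)
    rw [hm2]; linarith
  have hqm : q ≤ (1 + C₁) * m := by
    have h5 : |w| ≤ C₁ * m ^ 3 := by
      have h6 : |w| ≤ |P * τ ^ 2 / 2| + |τ * v * B| + |E * v ^ 3 / 6| := by
        rw [e2]
        exact (abs_add_le _ _).trans (add_le_add_left (abs_add_le _ _) _)
      have h7 : r ^ 3 ≤ m ^ 3 := pow_le_pow_left₀ hr hrm 3
      have h8 : |v| ^ 3 ≤ m ^ 3 := pow_le_pow_left₀ hv0 hvm 3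
      have h9 : r ^ 2 * |v| ≤ m ^ 3 := by
        have := mul_le_mul (pow_le_pow_left₀ hr hrm 2) hvm hv0 (by positivity)
        calc r ^ 2 * |v| ≤ m ^ 2 * m := this
          _ = m ^ 3 := by ring
      have h10 : -E * |v| ^ 3 / 6 ≤ 101 / 600 * β * m ^ 3 := by
        have : -E * |v| ^ 3 ≤ 101 / 100 * β * m ^ 3 := mul_le_mul b3.2 h8 hv3 (by positivity)
        linarith
      have h11 : N / 2 * r ^ 3 ≤ N / 2 * m ^ 3 := by gcongr
      have h12 : 101 / 100 * α * (r ^ 2 * |v|) ≤ 101 / 100 * α * m ^ 3 := by gcongr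
      rw [hC₁]; linarith
    rw [← hqw] at h5
    have := le_mul_of_cube_le (b := 0) hm0 hC₁0 le_rfl (by simpa using h5)
    linarith
  have hdm : d ≤ (2 + C₁) * m := by rw [hd]; linarith
  have hXu0 : 0 ≤ -partialX D (τ, u, y) := le_trans (by positivity) hXm
  have hm2X : m ^ 2 ≤ -partialX D (τ, u, y) / κ := by
    rw [le_div_iff₀ hκ0]; linarith
  have c2 : d ^ 2 ≤ (2 + C₁) ^ 2 / κ * -partialX D (τ, u, y) := by
    calc d ^ 2 ≤ ((2 + C₁) * m) ^ 2 := pow_le_pow_left₀ hd0 hdm 2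
      _ = (2 + C₁) ^ 2 * m ^ 2 := by ring
      _ ≤ (2 + C₁) ^ 2 * (-partialX D (τ, u, y) / κ) := by gcongr
      _ = _ := by ring
  have c3 : |A y - partialT D (τ, u, y)| ≤ C₃ * m := by
    obtain ⟨τ₂, k1, f1⟩ := exists_taylor_one (fun t => hasDerivAt_partialT C.diffT t u y) 0 τ
    obtain ⟨u₄, k2, f2⟩ := exists_taylor_one (fun u => hasDerivAt_partialX C.diffT 0 u y) (s y) u
    rw [C.slope, C.partialX_partialT] at f2
    have l1 := hM τ₂ u y ((by simpa using k1 : |τ₂| ≤ |τ|).trans hτ) hu hy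
    have l2 := C.le_TX (τ := 0) (u := u₄) (y := y) (by simpa using he.le) (k2.trans hu)
    rw [f1, f2, show A y - (A y + partialT (partialX D) (0, u₄, y) * (u - s y) +
      partialT (partialT D) (τ₂, u, y) * (τ - 0)) = -(partialT (partialX D) (0, u₄, y) * v +
      partialT (partialT D) (τ₂, u, y) * τ) by ring, abs_neg]
    refine (abs_add_le _ _).trans ?_
    rw [abs_mul, abs_mul, abs_of_pos (by linarith [l2.1] :
      0 < partialT (partialX D) (0, u₄, y)), ← hrτ]
    have g1 : partialT (partialX D) (0, u₄, y) * |v| ≤ 101 / 100 * α * m :=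
      mul_le_mul l2.2 hvm hv0 (by positivity)
    have g2 : |partialT (partialT D) (τ₂, u, y)| * r ^ 2 ≤ N * m := by
      have g3 : |partialT (partialT D) (τ₂, u, y)| * r ^ 2 ≤ M * r ^ 2 :=
        mul_le_mul_of_nonneg_right l1 (sq_nonneg r)
      have g4 : r * r ≤ Real.sqrt e * m := mul_le_mul hr' hrm hr (Real.sqrt_nonneg _)
      have g5 : M * (r * r) ≤ M * (Real.sqrt e * m) := mul_le_mul_of_nonneg_left g4 hM0
      rw [hN]; linarith
    rw [hC₃]; linarith
  have c4 : d * |A y - partialT D (τ, u, y)| ≤ (2 + C₁) * C₃ / κ * -partialX D (τ, u, y) := by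
    calc d * |A y - partialT D (τ, u, y)| ≤ ((2 + C₁) * m) * (C₃ * m) :=
          mul_le_mul hdm c3 (abs_nonneg _) (by positivity)
      _ = (2 + C₁) * C₃ * m ^ 2 := by ring
      _ ≤ (2 + C₁) * C₃ * (-partialX D (τ, u, y) / κ) := by gcongr
      _ = _ := by ring
  have n1 : 0 ≤ (2 + C₁) ^ 2 / κ := by positivity
  have n2 : 0 ≤ (2 + C₁) * C₃ / κ := by positivity
  refine ⟨c1.trans (mul_le_mul_of_nonneg_right (by linarith) hd0),
    c2.trans (mul_le_mul_of_nonneg_right (by linarith) hXu0),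
    c4.trans (mul_le_mul_of_nonneg_right (by linarith) hXu0)⟩

end FlatCusp

namespace ShockConfig

variable {F G : ℝ → ℝ} {u₀ : ℝ × ℝ → ℝ} (Q : ShockConfig F G u₀)

lemma Xt_eq {y : ℝ} (hy : |y| < Q.δ₀) (t u : ℝ) :
    partialT Q.X (t, u, y) = partialT Q.D (t - Q.T y, u, y) := by
  have h1 := hasDerivAt_partialT Q.diffX t u y
  have h2 := (HasFDerivAt.comp_curve (h := Q.D) (t := fun t => t - Q.T y) (u := fun _ => u)
    (y := fun _ => y) (x := t) (Q.flat.diffD _) ((hasDerivAt_id t).sub_const _)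
    (hasDerivAt_const _ _) (hasDerivAt_const _ _)).add_const (Q.pos y)
  have h3 : (fun t => Q.X (t, u, y)) = fun t => Q.D (t - Q.T y, u, y) + Q.pos y :=
    funext fun t => Q.X_eq hy t u
  rw [h3] at h1
  simpa using h1.unique h2

/-- The estimates of the solution and its gradient near the blowup curve, before division. -/
lemma exists_estimates : ∃ K, 0 ≤ K ∧ ∀ p, Q.Reg p → |p.1 - Q.T p.2.2| ≤ Q.e →
    0 < cuspDist Q.T Q.pos Q.Ah p ∧
    |Q.val p - Q.s p.2.2| ≤ K * cuspDist Q.T Q.pos Q.Ah p ∧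
    cuspDist Q.T Q.pos Q.Ah p ^ 2 ≤ K * -partialX Q.X (p.1, Q.val p, p.2.2) ∧
    cuspDist Q.T Q.pos Q.Ah p * |Q.Ah p.2.2 - partialT Q.X (p.1, Q.val p, p.2.2)| ≤
      K * -partialX Q.X (p.1, Q.val p, p.2.2) := by
  obtain ⟨K, hK0, hK⟩ := Q.flat.exists_dist_bounds Q.δ₀
  refine ⟨K, hK0, fun p hp hτ => ?_⟩
  obtain ⟨ha, hX⟩ := hp.val_spec
  have hXu := hp.Xu_neg ha
  have hgap := hp.gap ha
  have hy := hp.2.2.2.1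
  rw [Q.X_eq hy] at hX
  have h := hK (p.1 - Q.T p.2.2) (Q.val p) p.2.2 hτ (Q.near hy ha.1.le).le hy.le hgap
    (cuspDist Q.T Q.pos Q.Ah p) (|p.1 - Q.T p.2.2| ^ (1 / 2 : ℝ))
    (|p.2.1 - Q.pos p.2.2 - Q.Ah p.2.2 * (p.1 - Q.T p.2.2)| ^ (1 / 3 : ℝ)) (by positivity)
    (by rw [← Real.rpow_natCast, ← Real.rpow_mul (abs_nonneg _)]; norm_num) (by positivity)
    (by rw [← Real.rpow_natCast, ← Real.rpow_mul (abs_nonneg _), ← hX]; norm_num)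
    rfl
  rw [← Q.Xu_eq hy, ← Q.Xt_eq hy, (Q.model _ hy).center] at h
  refine ⟨?_, h⟩
  have hd : 0 ≤ cuspDist Q.T Q.pos Q.Ah p := by unfold cuspDist; positivity
  refine lt_of_le_of_ne hd fun h0 => hXu.ne ?_
  have h1 : Q.val p = Q.s p.2.2 := by
    have := h.1
    rw [← h0, mul_zero] at this
    exact sub_eq_zero.1 (abs_nonpos_iff.1 this)
  have h2 : p.1 = Q.T p.2.2 := by
    have h3 : |p.1 - Q.T p.2.2| ^ (1 / 2 : ℝ) ≤ 0 := by
      rw [h0]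
      exact le_add_of_nonneg_right (by positivity)
    have h4 := (Real.rpow_eq_zero (abs_nonneg _) (by norm_num)).1 (le_antisymm h3 (by positivity))
    exact sub_eq_zero.1 (abs_eq_zero.1 h4)
  rw [h1, h2]
  exact (Q.model _ hy).cusp.X_zero

lemma gradNorm_le (u : ℝ × ℝ × ℝ → ℝ) (p : ℝ × ℝ × ℝ) :
    gradNorm u p ≤ |partialT u p| + |partialX u p| + |partialY u p| := by
  rw [gradNorm, Real.sqrt_le_left (by positivity)]
  nlinarith [sq_abs (partialT u p), sq_abs (partialX u p), sq_abs (partialY u p),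
    abs_nonneg (partialT u p), abs_nonneg (partialX u p), abs_nonneg (partialY u p),
    mul_nonneg (abs_nonneg (partialT u p)) (abs_nonneg (partialX u p)),
    mul_nonneg (abs_nonneg (partialT u p)) (abs_nonneg (partialY u p)),
    mul_nonneg (abs_nonneg (partialX u p)) (abs_nonneg (partialY u p))]

lemma time_close {ε t y : ℝ} (hε : ε ≤ Q.ε₀) (hy : |y| < Q.δ₀) (h : |t - 1| < ε) :
    |t - Q.T y| ≤ Q.e := by
  have h1 := (Q.T_close y hy).2
  have h2 := abs_sub_le t 1 (Q.T y)
  rw [abs_sub_comm 1] at h2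
  have := Q.ε₀_le_e
  linarith

lemma behaviour {δ ε : ℝ} (hδ : δ ≤ Q.δ₀) (hε : ε ≤ Q.ε₀) : ∃ C : ℝ,
    ∀ p ∈ solDomain Q.T ε δ Q.r \ shockSurface Q.T Q.phi ε δ, |p.1 - 1| < ε →
      |Q.val p - Q.val (Q.T p.2.2, Q.pos p.2.2, p.2.2)| ≤ C * cuspDist Q.T Q.pos Q.Ah p ∧
      gradNorm Q.val p ≤ C * (cuspDist Q.T Q.pos Q.Ah p ^ 2)⁻¹ ∧
      |partialT Q.val p + Q.Ah p.2.2 * partialX Q.val p| ≤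
        C * (cuspDist Q.T Q.pos Q.Ah p)⁻¹ := by
  obtain ⟨K, hK0, hK⟩ := Q.exists_estimates
  have hXt : Continuous (partialT Q.X) := Q.germ.Xt3.continuous
  have hXy : Continuous (partialY Q.X) := Q.germ.Xy3.continuous
  have hbox : IsCompact (Icc (0 : ℝ) 2 ×ˢ (Icc (Q.c - Q.ϱ) (Q.c + Q.ϱ) ×ˢ Icc (-Q.δ₀) Q.δ₀)) :=
    isCompact_Icc.prod (isCompact_Icc.prod isCompact_Icc)
  obtain ⟨M, hM⟩ := hbox.exists_bound_of_continuousOn hXt.continuousOn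
  obtain ⟨N, hN⟩ := hbox.exists_bound_of_continuousOn hXy.continuousOn
  have hM0 : 0 ≤ |M| := abs_nonneg M
  have hN0 : 0 ≤ |N| := abs_nonneg N
  refine ⟨K * (|M| + 1 + |N|), fun p hp ht => ?_⟩
  have hr := reg_of_mem hδ hε hp
  have hy := hr.2.2.2.1
  have ht0 : 0 < p.1 := by
    have := Q.ε₀_le_half
    linarith [(abs_lt.1 ht).1]
  obtain ⟨h1, h2, h3, h4⟩ := hK p hr (Q.time_close hε hy ht)
  obtain ⟨e1, e2, e3⟩ := hr.partials ht0
  set d := cuspDist Q.T Q.pos Q.Ah p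
  have hXu := hr.Xu_neg hr.val_spec.1
  have hmem : (p.1, Q.val p, p.2.2) ∈
      (Icc (0 : ℝ) 2 ×ˢ (Icc (Q.c - Q.ϱ) (Q.c + Q.ϱ) ×ˢ Icc (-Q.δ₀) Q.δ₀)) := by
    have a1 := abs_lt.1 hr.val_spec.1.1
    have a2 := abs_lt.1 hy
    have a3 := Q.T_mem hy
    have a4 := Q.ε₀_le_half
    have a5 := hr.2.1
    exact ⟨⟨ht0.le, by simp only; linarith⟩, ⟨by simp only; linarith, by simp only; linarith⟩,
      ⟨a2.1.le, a2.2.le⟩⟩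
  have bM := (hM _ hmem).trans (le_abs_self M)
  have bN := (hN _ hmem).trans (le_abs_self N)
  rw [Real.norm_eq_abs] at bM bN
  set Xt := partialT Q.X (p.1, Q.val p, p.2.2)
  set Xu := partialX Q.X (p.1, Q.val p, p.2.2)
  set Xy := partialY Q.X (p.1, Q.val p, p.2.2)
  have hXu' : 0 < -Xu := by linarith
  have habs : |Xu| = -Xu := abs_of_neg hXu
  have hinv : (-Xu)⁻¹ ≤ K * (d ^ 2)⁻¹ := by
    rw [inv_eq_one_div, div_le_iff₀ hXu', ← div_eq_mul_inv, div_mul_eq_mul_div,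
      le_div_iff₀ (by positivity)]
    linarith
  refine ⟨?_, ?_, ?_⟩
  · rw [Q.val_curve hy]
    refine h2.trans (mul_le_mul_of_nonneg_right ?_ h1.le)
    nlinarith
  · refine (gradNorm_le _ _).trans ?_
    rw [e1, e2, e3, abs_neg, abs_neg, abs_div, abs_div, abs_inv, habs]
    calc |Xt| / -Xu + (-Xu)⁻¹ + |Xy| / -Xu = (|Xt| + 1 + |Xy|) * (-Xu)⁻¹ := by ring
      _ ≤ (|M| + 1 + |N|) * (K * (d ^ 2)⁻¹) :=
        mul_le_mul (by linarith) hinv (by positivity) (by positivity)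
      _ = _ := by ring
  · have h5 : -(Xt / Xu) + Q.Ah p.2.2 * Xu⁻¹ = (Q.Ah p.2.2 - Xt) / Xu := by ring
    rw [e1, e2, h5, abs_div, habs, div_le_iff₀ hXu', ← div_eq_mul_inv, div_mul_eq_mul_div,
      le_div_iff₀ h1]
    have h6 : K * -Xu ≤ K * (|M| + 1 + |N|) * -Xu :=
      mul_le_mul_of_nonneg_right (by nlinarith) hXu'.le
    linarith

lemma tendsto_gradNorm {δ ε y : ℝ} (hδ : δ ≤ Q.δ₀) (hε : ε ≤ Q.ε₀) (hy : |y| < δ) :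
    Tendsto (gradNorm Q.val) (𝓝[solDomain Q.T ε δ Q.r \ shockSurface Q.T Q.phi ε δ]
      (Q.T y, Q.pos y, y)) atTop := by
  have hy' := hy.trans_le hδ
  obtain ⟨K, hK0, hK⟩ := Q.exists_estimates
  set S := solDomain Q.T ε δ Q.r \ shockSurface Q.T Q.phi ε δ with hS
  set p₀ : ℝ × ℝ × ℝ := (Q.T y, Q.pos y, y) with hp₀
  have hy2 : ContinuousAt (fun p : ℝ × ℝ × ℝ => p.2.2) p₀ := by fun_prop
  have cT : ContinuousAt (fun p : ℝ × ℝ × ℝ => Q.T p.2.2) p₀ := Q.contT_comp hy' hy2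
  have cpos : ContinuousAt (fun p : ℝ × ℝ × ℝ => Q.pos p.2.2) p₀ :=
    ContinuousAt.comp (f := fun p : ℝ × ℝ × ℝ => p.2.2) (g := Q.pos) (Q.diff_pos hy').continuousAt hy2
  have cs : ContinuousAt (fun p : ℝ × ℝ × ℝ => Q.s p.2.2) p₀ :=
    ContinuousAt.comp (f := fun p : ℝ × ℝ × ℝ => p.2.2)
      (Q.model y hy').cusp.s2.continuousAt hy2
  have cA : ContinuousAt (fun p : ℝ × ℝ × ℝ => Q.Ah p.2.2) p₀ := by
    have := Q.flat.A2.continuous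
    fun_prop
  have c1 : ContinuousAt (fun p : ℝ × ℝ × ℝ => p.1 - Q.T p.2.2) p₀ := by
    refine ContinuousAt.sub (by fun_prop) cT
  have c2 : ContinuousAt (fun p : ℝ × ℝ × ℝ => p.2.1 - Q.pos p.2.2 -
      Q.Ah p.2.2 * (p.1 - Q.T p.2.2)) p₀ := by
    refine ContinuousAt.sub (ContinuousAt.sub (by fun_prop) cpos) (cA.mul c1)
  have cd : Tendsto (cuspDist Q.T Q.pos Q.Ah) (𝓝 p₀) (𝓝 0) := by
    have h := (c1.abs.rpow_const (p := 1 / 2) (Or.inr (by norm_num))).add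
      (c2.abs.rpow_const (p := 1 / 3) (Or.inr (by norm_num)))
    have h0 : cuspDist Q.T Q.pos Q.Ah p₀ = 0 := by simp [cuspDist, hp₀]
    rw [← h0]
    exact h
  have hev : ∀ᶠ p in 𝓝[S] p₀, Q.Reg p ∧ |p.1 - Q.T p.2.2| ≤ Q.e ∧ 0 < p.1 := by
    have h1 : ∀ᶠ p in 𝓝 p₀, |p.1 - Q.T p.2.2| < Q.e :=
      c1.abs.eventually_lt continuousAt_const (by simpa [hp₀] using Q.flat.e_pos)
    have h2 : ∀ᶠ p in 𝓝 p₀, 0 < p.1 :=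
      ContinuousAt.eventually_lt (g := fun p : ℝ × ℝ × ℝ => p.1) continuousAt_const (by fun_prop)
        (by have := Q.T_mem hy'; simp only [hp₀]; linarith)
    filter_upwards [self_mem_nhdsWithin, h1.filter_mono nhdsWithin_le_nhds,
      h2.filter_mono nhdsWithin_le_nhds] with p a b d
    exact ⟨reg_of_mem hδ hε a, b.le, d⟩
  have hle : 𝓝[S] p₀ ≤ 𝓝 p₀ := nhdsWithin_le_nhds
  have hv : Tendsto Q.val (𝓝[S] p₀) (𝓝 (Q.s y)) := by
    have h1 : Tendsto (fun p => Q.val p - Q.s p.2.2) (𝓝[S] p₀) (𝓝 0) := by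
      refine squeeze_zero_norm' (a := fun p => K * cuspDist Q.T Q.pos Q.Ah p) ?_ ?_
      · filter_upwards [hev] with p hp using (hK p hp.1 hp.2.1).2.1
      · simpa using (cd.mono_left hle).const_mul K
    have h2 : Tendsto (fun p : ℝ × ℝ × ℝ => Q.s p.2.2) (𝓝[S] p₀) (𝓝 (Q.s y)) :=
      cs.tendsto.mono_left hle
    simpa using h1.add h2
  have hXu : Tendsto (fun p : ℝ × ℝ × ℝ => |partialX Q.X (p.1, Q.val p, p.2.2)|) (𝓝[S] p₀)
      (𝓝[>] 0) := by
    refine tendsto_nhdsWithin_iff.2 ⟨?_, ?_⟩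
    · have h1 : Tendsto (fun p : ℝ × ℝ × ℝ => (p.1, Q.val p, p.2.2)) (𝓝[S] p₀)
          (𝓝 (Q.T y, Q.s y, y)) := by
        refine Tendsto.prodMk_nhds ?_ (Tendsto.prodMk_nhds hv ?_)
        · exact (continuousAt_fst (p := p₀)).tendsto.mono_left hle
        · exact hy2.tendsto.mono_left hle
      have h2 := ((Q.germ.Xu3.continuous.tendsto (Q.T y, Q.s y, y)).comp h1).abs
      have h3 : partialX (charPos F G Q.Z) (Q.T y, Q.s y, y) = 0 := (Q.model y hy').cusp.X_zero
      rw [h3, abs_zero] at h2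
      exact h2
    · filter_upwards [hev] with p hp
      exact abs_pos.2 (hp.1.Xu_neg hp.1.val_spec.1).ne
  refine tendsto_atTop_mono' _ ?_ (tendsto_inv_nhdsGT_zero.comp hXu)
  filter_upwards [hev] with p hp
  have h := (hp.1.partials hp.2.2).2.1
  simp only [Function.comp_apply]
  rw [← abs_inv, ← h]
  refine Real.abs_le_sqrt ?_
  nlinarith [sq_nonneg (partialT Q.val p), sq_nonneg (partialY Q.val p)]

end ShockConfig

lemma exists_neg_near {f : ℝ × ℝ → ℝ} (hf : Continuous f) (h : ∀ t ∈ Icc (0 : ℝ) 1, f (t, 0) < 0) :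
    ∃ κ, 0 < κ ∧ ∀ t y, 0 ≤ t → t < 1 + κ → |y| < κ → f (t, y) < -κ := by
  have hK : IsCompact (Icc (0 : ℝ) 1 ×ˢ ({0} : Set ℝ)) := isCompact_Icc.prod isCompact_singleton
  obtain ⟨q, hq, hmax⟩ := hK.exists_isMaxOn ⟨(0, 0), by simp⟩ hf.continuousOn
  have hq0 : f q < 0 := by
    have : q = (q.1, 0) := Prod.ext rfl hq.2
    rw [this]; exact h _ hq.1
  obtain ⟨κ, hκ, hsub⟩ := hK.exists_thickening_subset_open
    (isOpen_lt hf (continuous_const (y := f q / 2))) (fun p hp => by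
      have : f p ≤ f q := hmax hp
      show f p < f q / 2
      linarith)
  refine ⟨min κ (-f q / 2), lt_min hκ (by linarith), fun t y h0 h1 h2 => ?_⟩
  have h3 : f (t, y) < f q / 2 := by
    refine hsub (Metric.mem_thickening_iff.2 ⟨(min t 1, 0), ⟨⟨le_min h0 zero_le_one,
      min_le_right _ _⟩, rfl⟩, ?_⟩)
    rw [Prod.dist_eq, max_lt_iff, Real.dist_eq, Real.dist_eq, sub_zero]
    refine ⟨?_, h2.trans_le (min_le_left _ _)⟩
    have h4 := h1.trans_le (add_le_add_right (min_le_left κ (-f q / 2)) 1)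
    rcases le_total t 1 with h | h
    · rw [min_eq_left h]; simpa using hκ
    · rw [min_eq_right h, abs_of_nonneg (by linarith)]; linarith
  have := min_le_right κ (-f q / 2)
  linarith

lemma CharGerm.side_sign {F G : ℝ → ℝ} {u₀ Z : ℝ × ℝ → ℝ} {c m ϱ : ℝ} {T s sh Ah : ℝ → ℝ}
    {D Fh Gh : ℝ × ℝ × ℝ → ℝ} {α β e : ℝ} (K : CharGerm F G u₀ Z c)
    (C : FlatCusp D sh Ah Fh Gh α β e)
    (hM : FlatModel F G (charPos F G Z) T s c m D sh Ah Fh Gh 0) (hT : T 0 = 1) (hs : s 0 = c)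
    (hϱ : 0 < ϱ) (hϱe : 2 * ϱ ≤ e)
    (hch : ∀ t u, 0 ≤ t → t ≤ 2 → |u - c| ≤ ϱ → ChartValid u₀ Z (u, 0 - t * deriv G u)) :
    ∀ t ∈ Icc (0 : ℝ) 1, charPos F G Z (t, c + ϱ, 0) < 0 ∧ 0 < charPos F G Z (t, c - ϱ, 0) := by
  intro t ht
  have h0 : charPos F G Z (t, c, 0) = 0 := by
    simp [charPos, K.G_zero, K.F_zero, K.Z_zero]
  have hneg : ∀ v, |v - c| ≤ ϱ → v ≠ c → partialX (charPos F G Z) (t, v, 0) < 0 := by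
    intro v hv hne
    rcases ht.2.lt_or_eq with h1 | h1
    · obtain hc := hch t v ht.1 (by linarith) hv
      rw [K.charPos_X hc]
      have h2 := K.initDiv_ge (Z (v, 0 - t * deriv G v), 0 - t * deriv G v)
      obtain ⟨-, h3, h4, -⟩ := hc
      have := ht.1
      refine mul_neg_of_pos_of_neg (by nlinarith) ?_
      by_contra hcon
      nlinarith
    · have h2 := hM.valueX 0 v
      rw [hT, add_zero, ← h1] at h2
      rw [← h2]
      have hc : sh 0 = c := hM.center.trans hs
      exact C.X_neg (by simpa using C.e_pos.le) (by rw [hc]; linarith)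
        (by rw [mul_zero]; positivity) (Or.inr (by rwa [hc]))
  have hX : ∀ v, HasDerivAt (fun v => charPos F G Z (t, v, 0))
      (partialX (charPos F G Z) (t, v, 0)) v :=
    fun v => hasDerivAt_partialX K.diffX t v 0
  have hcont : Continuous fun v => charPos F G Z (t, v, 0) :=
    continuous_iff_continuousAt.2 fun v => (hX v).continuousAt
  constructor
  · obtain ⟨v, hv, e⟩ := exists_hasDerivAt_eq_slope _ _ (by linarith : c < c + ϱ)
      hcont.continuousOn fun v _ => hX v
    have := hneg v (abs_le.2 ⟨by linarith [hv.1], by linarith [hv.2]⟩) hv.1.ne'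
    rw [e, h0, sub_zero, add_sub_cancel_left] at this
    rw [div_neg_iff] at this
    rcases this with h | h <;> linarith [h.1, h.2]
  · obtain ⟨v, hv, e⟩ := exists_hasDerivAt_eq_slope _ _ (by linarith : c - ϱ < c)
      hcont.continuousOn fun v _ => hX v
    have := hneg v (abs_le.2 ⟨by linarith [hv.1], by linarith [hv.2]⟩) hv.2.ne
    rw [e, h0, zero_sub, sub_sub_cancel] at this
    rw [div_neg_iff] at this
    rcases this with h | h <;> linarith [h.1, h.2]

lemma exists_radius_plane {P : ℝ × ℝ → Prop} {a b : ℝ} (h : ∀ᶠ q in 𝓝 (a, b), P q) :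
    ∃ κ, 0 < κ ∧ ∀ x y, |x - a| < κ → |y - b| < κ → P (x, y) := by
  obtain ⟨κ, hκ, hP⟩ := Metric.eventually_nhds_iff.1 h
  exact ⟨κ, hκ, fun x y hx hy => hP (by rw [Prod.dist_eq]; exact max_lt hx hy)⟩

lemma exists_radius_line {P : ℝ → Prop} {a : ℝ} (h : ∀ᶠ x in 𝓝 a, P x) :
    ∃ κ, 0 < κ ∧ ∀ x, |x - a| < κ → P x := by
  obtain ⟨κ, hκ, hP⟩ := Metric.eventually_nhds_iff.1 h
  exact ⟨κ, hκ, fun x hx => hP hx⟩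

theorem exists_shockConfig {F G : ℝ → ℝ} {u₀ : ℝ × ℝ → ℝ} (hF : ContDiff ℝ 5 F)
    (hG : ContDiff ℝ 5 G) (hu₀ : ContDiff ℝ 4 u₀) (hGNC : NormalizedGNC F G u₀)
    (hneg : partialFst u₀ (0, 0) < 0) : Nonempty (ShockConfig F G u₀) := by
  obtain ⟨Z, K⟩ := exists_charGerm hF hG hu₀ hGNC hneg
  set c := u₀ (0, 0) with hc
  obtain ⟨b0, b1, b2, b3, b4⟩ := K.charPos_base
  obtain ⟨T, s, hT0, hs0, hcusp⟩ := exists_cusps K.X4 b1 b2 b3.ne b4.ne'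
  obtain ⟨D, sh, Ah, Fh, Gh, α, β, e, m, C, hm, hmodel⟩ := exists_flatCusp hF hG K.X4
    (charPos_T hF hG K.Z4) b4 b3 K.G_zero hT0 hs0 hcusp
  obtain ⟨τ₁, k, up, um, S⟩ := C.exists_flatShock
  have he := C.e_pos
  have hγ := C.γ_pos
  have hu₀c : Continuous u₀ := hu₀.continuous
  have hZc : Continuous Z := K.Z4.continuous
  have hM0 := hmodel 0 (by simpa using hm)
  have c0 := hM0.cusp
  obtain ⟨ρ, hρ, foot⟩ : ∃ ρ, 0 < ρ ∧ ∀ ξ η, |ξ| < ρ → |η| < ρ → Z (u₀ (ξ, η), η) = ξ ∧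
      |u₀ (ξ, η) - c| < e / 2 ∧ ChartValid u₀ Z (u₀ (ξ, η), η) := by
    have h1 : ∀ᶠ p in 𝓝 ((0 : ℝ), (0 : ℝ)), |u₀ p - c| < e / 2 :=
      ContinuousAt.eventually_lt (f := fun p => |u₀ p - c|) (by fun_prop) continuousAt_const
        (by simpa [hc] using he)
    have h2 : Tendsto (fun p : ℝ × ℝ => (u₀ p, p.2)) (𝓝 (0, 0)) (𝓝 (c, 0)) := by
      have : Continuous fun p : ℝ × ℝ => (u₀ p, p.2) := by fun_prop
      exact this.tendsto (0, 0)
    obtain ⟨κ, hκ, h⟩ := exists_radius_plane ((K.left.and h1).and (h2.eventually K.eventually_chart))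
    refine ⟨κ, hκ, fun ξ η h3 h4 => ?_⟩
    have := h ξ η (by simpa using h3) (by simpa using h4)
    exact ⟨this.1.1, this.1.2, this.2⟩
  obtain ⟨κ₁, hκ₁, hchart⟩ : ∃ κ, 0 < κ ∧ ∀ u η, |u - c| < κ → |η| < κ →
      ChartValid u₀ Z (u, η) ∧ |Z (u, η)| < ρ ∧ |η| < ρ := by
    have h1 : ∀ᶠ q in 𝓝 (c, (0 : ℝ)), |Z q| < ρ :=
      ContinuousAt.eventually_lt (f := fun q => |Z q|) (by fun_prop) continuousAt_const
        (by simpa [K.Z_zero] using hρ)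
    obtain ⟨κ, hκ, h⟩ := exists_radius_plane (K.eventually_chart.and h1)
    refine ⟨min κ ρ, lt_min hκ hρ, fun u η h3 h4 => ?_⟩
    have := h u η (h3.trans_le (min_le_left _ _)) (by simpa using h4.trans_le (min_le_left _ _))
    exact ⟨this.1, this.2, h4.trans_le (min_le_right _ _)⟩
  have dF2 := hF.deriv_four.continuous_deriv (by norm_num)
  have dG2 := hG.deriv_four.continuous_deriv (by norm_num)
  have dG1 : Continuous (deriv G) := hG.deriv_four.continuous
  set ω₀ := partialY (charPos F G Z) (1, c, 0) with hω₀
  have hconv0 : 0 < deriv (deriv F) c - ω₀ * deriv (deriv G) c := by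
    rw [partialT_partialX_of_speed hF hG K.X4 (charPos_T hF hG K.Z4), K.G_zero] at b4
    linarith
  obtain ⟨κ₂, hκ₂, hconv⟩ := exists_radius_plane (a := c) (b := ω₀)
    (P := fun q => 0 < deriv (deriv F) q.1 - q.2 * deriv (deriv G) q.1)
    (ContinuousAt.eventually_lt (g := fun q : ℝ × ℝ => deriv (deriv F) q.1 -
      q.2 * deriv (deriv G) q.1) continuousAt_const (by fun_prop) hconv0)
  obtain ⟨κ₃, hκ₃, hF2⟩ := exists_radius_line (ContinuousAt.eventually_lt
    (f := fun _ => (0 : ℝ)) (g := deriv (deriv F)) continuousAt_const dF2.continuousAt K.secondF_pos)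
  obtain ⟨κ₄, hκ₄, hG1⟩ := exists_radius_line (a := c) (P := fun u => |deriv G u| < κ₁ / 4)
    (ContinuousAt.eventually_lt (f := fun u => |deriv G u|) (by fun_prop) continuousAt_const
      (by simpa [K.G_zero] using hκ₁))
  obtain ⟨ϱ, hϱ, r1, r2, r3, r4, r5, r6⟩ : ∃ ϱ, 0 < ϱ ∧ ϱ ≤ m ∧ ϱ ≤ e / 2 ∧ ϱ ≤ κ₁ / 2 ∧
      ϱ ≤ κ₂ / 2 ∧ ϱ ≤ κ₃ / 2 ∧ ϱ ≤ κ₄ / 2 := by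
    refine ⟨min (min m (e / 2)) (min (min (κ₁ / 2) (κ₂ / 2)) (min (κ₃ / 2) (κ₄ / 2))),
      by positivity, ?_⟩
    simp only [min_le_iff, le_refl, true_or, or_true, and_self]
  have chart : ∀ t u y, 0 ≤ t → t ≤ 2 → |u - c| ≤ ϱ → |y| < κ₁ / 2 →
      ChartValid u₀ Z (u, y - t * deriv G u) ∧ |Z (u, y - t * deriv G u)| < ρ ∧
        |y - t * deriv G u| < ρ := by
    intro t u y h0 h2 hu hy
    refine hchart _ _ (by linarith) ?_
    have h3 := hG1 u (by linarith)
    have h4 : |t * deriv G u| ≤ 2 * |deriv G u| := by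
      rw [abs_mul, abs_of_nonneg h0]
      exact mul_le_mul_of_nonneg_right h2 (abs_nonneg _)
    have := abs_sub y (t * deriv G u)
    linarith
  have hsign := K.side_sign C hM0 hT0 hs0 hϱ (by linarith) fun t u h0 h2 hu =>
    (chart t u 0 h0 h2 hu (by simpa using hκ₁)).1
  have hXc : Continuous (charPos F G Z) := K.diffX.continuous
  obtain ⟨κ₅, hκ₅, hs5⟩ := exists_neg_near (f := fun q => charPos F G Z (q.1, c + ϱ, q.2))
    (by fun_prop) fun t ht => (hsign t ht).1
  obtain ⟨κ₆, hκ₆, hs6⟩ := exists_neg_near (f := fun q => -charPos F G Z (q.1, c - ϱ, q.2))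
    (by fun_prop) fun t ht => neg_lt_zero.2 (hsign t ht).2
  obtain ⟨κ₇, hκ₇, hinit⟩ := exists_radius_plane (K.left.and
    (ContinuousAt.eventually_lt (f := fun p => |u₀ p - c|) (g := fun _ => ϱ) (x₀ := (0, 0))
      (by fun_prop) continuousAt_const (by simpa [hc] using hϱ)))
  obtain ⟨r, hr, q1, q2, q3⟩ : ∃ r, 0 < r ∧ r ≤ κ₅ ∧ r ≤ κ₆ ∧ r ≤ κ₇ :=
    ⟨min κ₅ (min κ₆ κ₇), by positivity, min_le_left _ _, (min_le_right _ _).trans (min_le_left _ _),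
      (min_le_right _ _).trans (min_le_right _ _)⟩
  set pos : ℝ → ℝ := fun y => charPos F G Z (T y, s y, y) with hpos
  have hpos0 : pos 0 = 0 := by rw [hpos]; simp only; rw [hT0, hs0, b0]
  have hposc : ContinuousAt pos 0 := c0.pos3.continuousAt
  have hpos' : deriv pos 0 = ω₀ := by
    have h1 := c0.derivX
    have h2 := charPos_T hF hG K.Z4 1 c 0
    rw [K.F_zero, K.G_zero, zero_mul, sub_zero] at h2
    rw [hT0, hs0, h2, mul_zero, zero_add] at h1
    exact h1
  have hA0 : Ah 0 = 0 := by
    have h2 := charPos_T hF hG K.Z4 1 c 0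
    rw [K.F_zero, K.G_zero, zero_mul, sub_zero] at h2
    rw [hM0.speed, hT0, hs0, h2]
  have hstrip : ∀ᶠ p in 𝓝 ((0 : ℝ), (0 : ℝ)), p.1 < τ₁ ∧ |p.2| < 1 := by
    refine Eventually.and ?_ ?_
    · exact ContinuousAt.eventually_lt (f := fun p : ℝ × ℝ => p.1) (by fun_prop)
        continuousAt_const S.τ₁_pos
    · exact ContinuousAt.eventually_lt (f := fun p : ℝ × ℝ => |p.2|) (by fun_prop)
        continuousAt_const (by simp)
  have hphi : ∀ᶠ p in 𝓝 ((0 : ℝ), (0 : ℝ)), 0 ≤ p.1 → |pos p.2 + k p| < r := by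
    have h1 : ContinuousWithinAt k (shockStrip τ₁) (0, 0) :=
      S.smooth.continuousOn (0, 0) ⟨le_rfl, S.τ₁_pos, by simp⟩
    have h2 : ContinuousAt (fun p : ℝ × ℝ => pos p.2) (0, 0) :=
      ContinuousAt.comp (f := fun p : ℝ × ℝ => p.2) (g := pos) hposc (by fun_prop)
    have h3 := (h2.continuousWithinAt.add h1).abs
    have h4 := eventually_nhdsWithin_iff.1 (h3.tendsto.eventually_lt_const (u := r)
      (by simp [hpos0, S.zero 0 (by simp), hr]))
    filter_upwards [h4, hstrip] with p h5 h6 h7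
    exact h5 ⟨h7, h6.1, h6.2⟩
  have hslope : ∀ᶠ p in 𝓝 ((0 : ℝ), (0 : ℝ)), 0 < p.1 →
      |deriv pos p.2 - deriv T p.2 * partialFst k p + partialSnd k p - ω₀| < κ₂ := by
    have h1 := S.deriv_lim 0 (by simp)
    have h2 : Tendsto (partialFst k) (𝓝[{p : ℝ × ℝ | 0 < p.1}] (0, 0)) (𝓝 (Ah 0)) :=
      (continuous_fst.tendsto _).comp h1
    have h3 : Tendsto (partialSnd k) (𝓝[{p : ℝ × ℝ | 0 < p.1}] (0, 0)) (𝓝 0) :=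
      (continuous_snd.tendsto _).comp h1
    have h4 : Tendsto (fun p : ℝ × ℝ => p.2) (𝓝[{p : ℝ × ℝ | 0 < p.1}] (0, 0)) (𝓝 0) :=
      (continuous_snd.tendsto (0, 0)).mono_left nhdsWithin_le_nhds
    have h5 : Tendsto (fun p : ℝ × ℝ => deriv pos p.2) (𝓝[{p : ℝ × ℝ | 0 < p.1}] (0, 0))
        (𝓝 ω₀) := hpos' ▸ ((c0.pos3.continuousAt_deriv_one (by norm_num)).tendsto).comp h4
    have h6 : Tendsto (fun p : ℝ × ℝ => deriv T p.2) (𝓝[{p : ℝ × ℝ | 0 < p.1}] (0, 0))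
        (𝓝 (deriv T 0)) := ((c0.T3.continuousAt_deriv_one (by norm_num)).tendsto).comp h4
    have h7 := (((h5.sub (h6.mul h2)).add h3).sub_const ω₀).abs
    rw [hA0] at h7
    exact eventually_nhdsWithin_iff.1 (h7.eventually_lt_const (u := κ₂) (by simpa using hκ₂))
  obtain ⟨κ₈, hκ₈, h8⟩ := exists_radius_plane (hphi.and hslope)
  obtain ⟨κ₉, hκ₉, h9⟩ : ∃ κ, 0 < κ ∧ ∀ y, |y - 0| < κ → |T y - 1| < 1 / 2 ∧ |T y - 1| < e / 2 ∧
      |T y - 1| < κ₅ / 2 ∧ |T y - 1| < κ₆ / 2 ∧ |s y - c| < ϱ / 2 ∧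
      deriv T y * deriv G (s y) < 1 := by
    have hTc : ContinuousAt (fun y => |T y - 1|) 0 := (c0.T3.continuousAt.sub_const 1).abs
    have hsc : ContinuousAt s 0 := c0.s2.continuousAt
    have hT' : ∀ κ, 0 < κ → ∀ᶠ y in 𝓝 0, |T y - 1| < κ := fun κ hκ =>
      hTc.eventually_lt continuousAt_const (by simpa [hT0] using hκ)
    refine exists_radius_line ((hT' _ (by norm_num)).and <| (hT' _ (by linarith)).and <|
      (hT' _ (by linarith)).and <| (hT' _ (by linarith)).and <| Eventually.and ?_ ?_)
    · exact ContinuousAt.eventually_lt (f := fun y => |s y - c|) (hsc.sub_const c).abs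
        continuousAt_const (by simpa [hs0] using hϱ)
    · refine ContinuousAt.eventually_lt (f := fun y => deriv T y * deriv G (s y))
        ((c0.T3.continuousAt_deriv_one (by norm_num)).mul
          (ContinuousAt.comp dG1.continuousAt hsc)) continuousAt_const ?_
      rw [hs0, K.G_zero, mul_zero]
      exact one_pos
  obtain ⟨δ₀, hδ₀, d1, d2, d3, d4, d5, d6, d7, d8⟩ : ∃ δ₀, 0 < δ₀ ∧ δ₀ ≤ r ∧ δ₀ ≤ 1 ∧ δ₀ ≤ m ∧
      δ₀ ≤ κ₁ / 2 ∧ δ₀ ≤ κ₅ ∧ δ₀ ≤ κ₆ ∧ δ₀ ≤ κ₈ ∧ δ₀ ≤ κ₉ := by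
    refine ⟨min (min (min r 1) (min m (κ₁ / 2))) (min (min κ₅ κ₆) (min κ₈ κ₉)), by positivity, ?_⟩
    simp only [min_le_iff, le_refl, true_or, or_true, and_self]
  obtain ⟨ε₀, hε₀, i1, i2, i3, i4, i5, i6, i7⟩ : ∃ ε₀, 0 < ε₀ ∧ ε₀ ≤ 1 / 2 ∧ ε₀ ≤ τ₁ ∧ ε₀ ≤ e / 2 ∧
      ε₀ ≤ κ₅ / 2 ∧ ε₀ ≤ κ₆ / 2 ∧ ε₀ ≤ κ₈ ∧ ε₀ ≤ (ϱ / 2) ^ 2 / (4 * (α / β)) := by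
    have := S.τ₁_pos
    refine ⟨min (min (min (1 / 2) τ₁) (min (e / 2) (κ₅ / 2)))
      (min (min (κ₆ / 2) κ₈) ((ϱ / 2) ^ 2 / (4 * (α / β)))), by positivity, ?_⟩
    simp only [min_le_iff, le_refl, true_or, or_true, and_self]
  have g9 : ∀ y, |y| < δ₀ → _ := fun y hy => h9 y (by rw [sub_zero]; linarith)
  refine ⟨{
    Z := Z, c := c, T := T, s := s, D := D, sh := sh, Ah := Ah, Fh := Fh, Gh := Gh, α := α, β := β,
    e := e, m := m, τ₁ := τ₁, k := k, up := up, um := um, ϱ := ϱ, ρ := ρ, r := r, δ₀ := δ₀,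
    ε₀ := ε₀, germ := K, flat := C, shock := S, model := fun y hy => hmodel y (by linarith)
    T_zero := hT0, s_zero := hs0, ϱ_pos := hϱ, ρ_pos := hρ, r_pos := hr, δ₀_pos := hδ₀,
    ε₀_pos := hε₀, δ₀_le_r := d1, ϱ_le_m := r1, ϱ_le_e := by linarith, δ₀_le_one := d2, ε₀_le_half := i1,
    ε₀_le_τ₁ := i2, ε₀_le_e := i3, ends := ?_
    T_close := fun y hy => ⟨(g9 y hy).1, (g9 y hy).2.1⟩
    s_close := fun y hy => (g9 y hy).2.2.2.2.1
    sides := ?_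
    chart := fun t u y h0 h2 hu hy => chart t u y h0 h2 hu (by linarith)
    foot := foot, init := ?_
    spacelike := fun y hy => (g9 y hy).2.2.2.2.2
    secondF := fun u hu => hF2 u (by linarith)
    phi_lt := ?_, convex := ?_ }⟩
  · have := (le_div_iff₀ (by positivity)).1 i7
    linarith
  · intro t y hy h0 ht
    obtain ⟨-, -, g1, g2, -⟩ := g9 y hy
    have g1 := (abs_lt.1 g1).2
    have g2 := (abs_lt.1 g2).2
    have j1 := hs5 t y h0 (by linarith) (by linarith)
    have j2 := hs6 t y h0 (by linarith) (by linarith)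
    simp only at j1 j2
    constructor <;> linarith
  · intro x y hx hy
    have := hinit x y (by rw [sub_zero]; linarith) (by rw [sub_zero]; linarith)
    exact ⟨this.2, this.1⟩
  · intro t y hy h0 ht
    exact (h8 (t - T y) y (by rw [sub_zero, abs_of_nonneg (by linarith)]; linarith)
      (by rw [sub_zero]; linarith)).1 (by simpa using h0)
  · intro τ y u hy h0 hτ hu
    have := (h8 τ y (by rw [sub_zero, abs_of_pos h0]; linarith) (by rw [sub_zero]; linarith)).2 h0
    exact hconv u _ (by linarith) this

/-- A shock forms at the origin of the blowup curve, with the regularity and bounds claimed. -/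
def FormsShock (F G : ℝ → ℝ) (u₀ : ℝ × ℝ → ℝ) : Prop :=
    ∃ ρ r δ₀ ε₀ : ℝ, 0 < ρ ∧ 0 < r ∧ 0 < δ₀ ∧ δ₀ ≤ r ∧ 0 < ε₀ ∧
      ∀ δ : ℝ, 0 < δ → δ ≤ δ₀ → ∀ ε : ℝ, 0 < ε → ε ≤ ε₀ →
        ∃ (T X Ξ Y : ℝ → ℝ) (φ : ℝ × ℝ → ℝ) (u : ℝ × ℝ × ℝ → ℝ) (A : ℝ → ℝ),
          (∀ y, A y = tangentSpeed F G u₀ (Ξ y, Y y)) ∧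
          IsBlowupCurve F G u₀ ρ δ T X Ξ Y ∧
          (∀ y, |y| < δ → u (T y, X y, y) = u₀ (Ξ y, Y y)) ∧
          (∀ y, |y| < δ → Tendsto (gradNorm u)
            (𝓝[solDomain T ε δ r \ shockSurface T φ ε δ] (T y, X y, y)) atTop) ∧
          (∀ y, |y| < δ → φ (T y, y) = X y) ∧
          (∀ q ∈ shockParam T ε δ, |φ q| < r) ∧
          ContDiffOn ℝ 2 φ (shockParam T ε δ) ∧
          (∀ y, |y| < δ → HasDerivWithinAt (fun t => φ (t, y)) (A y) (Ici (T y)) (T y)) ∧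
          IsSolutionOff F G u₀ ρ ε δ r T φ u ∧
          ShockConditions F G ε δ r T φ u ∧
          ∃ C : ℝ, ∀ p ∈ solDomain T ε δ r \ shockSurface T φ ε δ, |p.1 - 1| < ε →
            |u p - u (T p.2.2, X p.2.2, p.2.2)| ≤ C * cuspDist T X A p ∧
            gradNorm u p ≤ C * (cuspDist T X A p ^ 2)⁻¹ ∧
            |partialT u p + A p.2.2 * partialX u p| ≤ C * (cuspDist T X A p)⁻¹

lemma cuspDist_congr {T X A B : ℝ → ℝ} {p : ℝ × ℝ × ℝ} (h : A p.2.2 = B p.2.2) :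
    cuspDist T X A p = cuspDist T X B p := by
  rw [cuspDist, cuspDist, h]

lemma ShockConfig.formsShock {F G : ℝ → ℝ} {u₀ : ℝ × ℝ → ℝ} (Q : ShockConfig F G u₀) :
    FormsShock F G u₀ := by
  refine ⟨Q.ρ, Q.r, Q.δ₀, Q.ε₀, Q.ρ_pos, Q.r_pos, Q.δ₀_pos, Q.δ₀_le_r, Q.ε₀_pos,
    fun δ _ hδ ε _ hε => ⟨Q.T, Q.pos, Q.footFst, Q.footSnd, Q.phi, Q.val, _, fun _ => rfl,
      Q.isBlowupCurve hδ, fun y hy => ?_, fun y hy => Q.tendsto_gradNorm hδ hε hy,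
      fun y hy => Q.phi_base (hy.trans_le hδ), fun q hq => ?_, ?_, fun y hy => ?_,
      ShockConfig.isSolutionOff hδ hε, Q.shockConditions hδ hε, ?_⟩⟩
  · rw [Q.val_curve (hy.trans_le hδ), Q.foot_value (hy.trans_le hδ)]
  · exact Q.phi_lt q.1 q.2 (hq.1.trans_le hδ) hq.2.1 (by linarith [hq.2.2])
  · exact Q.contDiffOn_phi.mono fun q hq => ⟨hq.1.trans_le hδ, hq.2.1, by linarith [hq.2.2]⟩
  · rw [Q.tangentSpeed_eq (hy.trans_le hδ)]
    exact Q.phi_slope (hy.trans_le hδ)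
  · obtain ⟨C, hC⟩ := Q.behaviour hδ hε
    refine ⟨C, fun p hp ht => ?_⟩
    have hA := Q.tangentSpeed_eq (hp.1.2.2.2.trans_le hδ)
    rw [hA, cuspDist_congr (B := Q.Ah) hA]
    exact hC p hp ht

section Reflection

variable (F G : ℝ → ℝ) (u₀ : ℝ × ℝ → ℝ)

lemma deriv_reflect (F : ℝ → ℝ) : deriv (fun v => -F (-v)) = fun v => deriv F (-v) := by
  funext v
  rw [deriv.fun_neg, deriv_comp_neg, neg_neg]

lemma speed_reflect : speed (fun v => -F (-v)) (fun p => -u₀ p) = speed F u₀ := by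
  funext p
  simp only [speed, deriv_reflect, neg_neg]

lemma initDiv_reflect : initDiv (fun v => -F (-v)) (fun v => -G (-v)) (fun p => -u₀ p) =
    initDiv F G u₀ := by
  funext p
  rw [initDiv, initDiv, speed_reflect, speed_reflect]

lemma tangentSpeed_reflect : tangentSpeed (fun v => -F (-v)) (fun v => -G (-v)) (fun p => -u₀ p) =
    tangentSpeed F G u₀ := by
  funext p
  rw [tangentSpeed, tangentSpeed, speed_reflect, speed_reflect]

lemma degenerateTimes_reflect : degenerateTimes (fun v => -F (-v)) (fun v => -G (-v))
    (fun p => -u₀ p) = degenerateTimes F G u₀ := by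
  funext ρ y
  rw [degenerateTimes, degenerateTimes, speed_reflect, initDiv_reflect]

variable {F G u₀}

lemma NormalizedGNC.reflect (h : NormalizedGNC F G u₀) :
    NormalizedGNC (fun v => -F (-v)) (fun v => -G (-v)) (fun p => -u₀ p) where
  speed_fst := by rw [speed_reflect]; exact h.speed_fst
  speed_snd := by rw [speed_reflect]; exact h.speed_snd
  min_value := by rw [initDiv_reflect]; exact h.min_value
  unique_min := by rw [initDiv_reflect]; exact h.unique_min
  hess_fst_fst := by rw [initDiv_reflect]; exact h.hess_fst_fst
  hess_fst_snd := by rw [initDiv_reflect]; exact h.hess_fst_snd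
  hess_snd_snd := by rw [initDiv_reflect]; exact h.hess_snd_snd
  snd_ge := by rw [speed_reflect]; exact h.snd_ge
  fst_le := by rw [speed_reflect]; exact h.fst_le

lemma partials_neg (u : ℝ × ℝ × ℝ → ℝ) (p : ℝ × ℝ × ℝ) : partialT (fun q => -u q) p =
    -partialT u p ∧ partialX (fun q => -u q) p = -partialX u p ∧
    partialY (fun q => -u q) p = -partialY u p := by
  simp [partialT, partialX, partialY, fderiv_fun_neg]

lemma gradNorm_neg (u : ℝ × ℝ × ℝ → ℝ) : gradNorm (fun q => -u q) = gradNorm u := by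
  funext p
  obtain ⟨h1, h2, h3⟩ := partials_neg u p
  rw [gradNorm, gradNorm, h1, h2, h3, neg_sq, neg_sq, neg_sq]

lemma FormsShock.of_reflect
    (h : FormsShock (fun v => -F (-v)) (fun v => -G (-v)) (fun p => -u₀ p)) :
    FormsShock F G u₀ := by
  obtain ⟨ρ, r, δ₀, ε₀, hρ, hr, hδ₀, hδr, hε₀, H⟩ := h
  refine ⟨ρ, r, δ₀, ε₀, hρ, hr, hδ₀, hδr, hε₀, fun δ hδ hδ' ε hε hε' => ?_⟩
  obtain ⟨T, X, Ξ, Y, φ, u, A, hA, hB, hΓ, hgrad, hφ, hφr, hφ2, hφA, hu, hS, C, hC⟩ :=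
    H δ hδ hδ' ε hε hε'
  refine ⟨T, X, Ξ, Y, φ, fun p => -u p, A, ?_, ?_, ?_, ?_, hφ, hφr, hφ2, hφA, ?_, ?_, C, ?_⟩
  · rwa [tangentSpeed_reflect] at hA
  · exact
      { time_zero := hB.time_zero
        pos_zero := hB.pos_zero
        contDiffOn_time := hB.contDiffOn_time
        contDiffOn_pos := hB.contDiffOn_pos
        foot_fst := hB.foot_fst
        foot_snd := hB.foot_snd
        degenerate := by simpa only [initDiv_reflect] using hB.degenerate
        snd_eq := by simpa only [speed_reflect] using hB.snd_eq
        fst_eq := by simpa only [speed_reflect] using hB.fst_eq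
        first_time := by simpa only [degenerateTimes_reflect] using hB.first_time
        spacelike := by simpa only [speed_reflect] using hB.spacelike }
  · intro y hy
    simp only [hΓ y hy, neg_neg]
  · rwa [gradNorm_neg]
  · exact
      { contDiffOn := hu.contDiffOn.neg
        pde := fun p hp h0 => by
          have h := hu.pde p hp h0
          obtain ⟨e1, -, -⟩ := partials_neg u p
          obtain ⟨-, e2, -⟩ := partials_neg (fun q => F (-u q)) p
          obtain ⟨-, -, e3⟩ := partials_neg (fun q => G (-u q)) p
          rw [e2, e3] at h
          rw [e1]
          linarith
        initial := fun x y hx hy => by rw [hu.initial x y hx hy, neg_neg]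
        characteristic := fun p hp => by
          obtain ⟨ξ, η, h1, h2, h3, h4, h5⟩ := hu.characteristic p hp
          rw [speed_reflect] at h3 h4
          exact ⟨ξ, η, h1, h2, h3, h4, by rw [h5, neg_neg]⟩ }
  · intro t y hy h0 ht
    obtain ⟨um, up, h1, h2, h3, h4, h5⟩ := hS t y hy h0 ht
    rw [deriv_reflect, deriv_reflect] at h4 h5
    exact ⟨-um, -up, h1.neg, h2.neg, by linarith, h4, h5⟩
  · intro p hp ht
    obtain ⟨h1, h2, h3⟩ := hC p hp ht
    obtain ⟨e1, e2, -⟩ := partials_neg u p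
    refine ⟨?_, by rwa [gradNorm_neg], ?_⟩
    · rwa [← neg_sub', abs_neg]
    · rwa [e1, e2, mul_neg, ← neg_add, abs_neg]

end Reflection

lemma NormalizedGNC.partialFst_ne_zero {F G : ℝ → ℝ} {u₀ : ℝ × ℝ → ℝ} (hF : ContDiff ℝ 5 F)
    (hu₀ : ContDiff ℝ 4 u₀) (h : NormalizedGNC F G u₀) : partialFst u₀ (0, 0) ≠ 0 := by
  intro h0
  have h1 := h.fst_le
  have h2 := (partialFst_comp (f := deriv F) (p := (0, 0))
    (hF.hasDerivAt_deriv _).differentiableAt (hu₀.differentiable (by norm_num) (0, 0))).1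
  rw [h0, mul_zero] at h2
  have h3 : partialFst (speed F u₀) (0, 0) = 0 := h2
  rw [h3] at h1
  norm_num at h1

end

theorem theorem1p1 (F G : ℝ → ℝ) (u₀ : ℝ × ℝ → ℝ)
    (hF : ContDiff ℝ 5 F) (hG : ContDiff ℝ 5 G) (hu₀ : ContDiff ℝ 4 u₀)
    (hGNC : NormalizedGNC F G u₀) :
    ∃ ρ r δ₀ ε₀ : ℝ, 0 < ρ ∧ 0 < r ∧ 0 < δ₀ ∧ δ₀ ≤ r ∧ 0 < ε₀ ∧
      ∀ δ : ℝ, 0 < δ → δ ≤ δ₀ → ∀ ε : ℝ, 0 < ε → ε ≤ ε₀ →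
        ∃ (T X Ξ Y : ℝ → ℝ) (φ : ℝ × ℝ → ℝ) (u : ℝ × ℝ × ℝ → ℝ) (A : ℝ → ℝ),
          (∀ y, A y = tangentSpeed F G u₀ (Ξ y, Y y)) ∧
          -- the space-like blowup curve
          IsBlowupCurve F G u₀ ρ δ T X Ξ Y ∧
          (∀ y, |y| < δ → u (T y, X y, y) = u₀ (Ξ y, Y y)) ∧
          (∀ y, |y| < δ → Tendsto (gradNorm u)
            (𝓝[solDomain T ε δ r \ shockSurface T φ ε δ] (T y, X y, y)) atTop) ∧
          -- the shock surface, starting from the blowup curve, and its tangent direction there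
          (∀ y, |y| < δ → φ (T y, y) = X y) ∧
          (∀ q ∈ shockParam T ε δ, |φ q| < r) ∧
          ContDiffOn ℝ 2 φ (shockParam T ε δ) ∧
          (∀ y, |y| < δ → HasDerivWithinAt (fun t => φ (t, y)) (A y) (Ici (T y)) (T y)) ∧
          -- the solution, with the Rankine–Hugoniot and entropy conditions
          IsSolutionOff F G u₀ ρ ε δ r T φ u ∧
          ShockConditions F G ε δ r T φ u ∧
          -- the behaviour near the blowup curve
          ∃ C : ℝ, ∀ p ∈ solDomain T ε δ r \ shockSurface T φ ε δ, |p.1 - 1| < ε →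
            |u p - u (T p.2.2, X p.2.2, p.2.2)| ≤ C * cuspDist T X A p ∧
            gradNorm u p ≤ C * (cuspDist T X A p ^ 2)⁻¹ ∧
            |partialT u p + A p.2.2 * partialX u p| ≤ C * (cuspDist T X A p)⁻¹ := by
  rcases lt_or_gt_of_ne (hGNC.partialFst_ne_zero hF hu₀) with h | h
  · obtain ⟨Q⟩ := exists_shockConfig hF hG hu₀ hGNC h
    exact Q.formsShock
  · have hn : partialFst (fun p => -u₀ p) (0, 0) < 0 := by
      simpa [partialFst, fderiv_fun_neg] using h
    obtain ⟨Q⟩ := exists_shockConfig (hF.comp contDiff_neg).neg (hG.comp contDiff_neg).neg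
      hu₀.neg hGNC.reflect hn
    exact Q.formsShock.of_reflect
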